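/- Let $d, r \ge 1$ and $n, m \ge 0$ be integers. The spider with $d$ legs consists of $d$ half-lines $l_1,\dots,l_d$ glued at their common endpoint, the center; $(l,x)$ with $x \ge 0$ denotes the point on leg $l$ at distance $x$ from the center, and the distance of $(l,x)$ and $(l',x')$ is $|x-x'|$ if $l=l'$ and $x+x'$ if $l\neq l'$. An instance of \emph{min-max $r$-gather clustering} on the spider consists of $d$, $r$ and $n$ users $u_1,\dots,u_n$ located on the spider (several users may share a location); the task is to partition the users into clusters with at least $r$ users each so that the maximum diameter of a cluster is as small as possible. In \emph{min-max $r$-gathering} one is also given $m$ facilities located on the spider; the task is to open a subset of the facilities and to assign every user to an opened facility so that every opened facility receives at least $r$ users and the maximum distance from a user to its facility is as small as possible. An algorithm \emph{solves} such a problem if it outputs an optimal solution together with its value, or reports that no feasible solution exists. The users, and in the second problem also the facilities, are given in order of non-decreasing distance from the center. Running time is the number of elementary steps of a random access machine with natural number and real number registers and arrays, whose arithmetic operations are addition, subtraction and comparison. Then there is an algorithm that solves min-max $r$-gather clustering on spiders in $O(2^d r^4 d^5 + n)$ time, and there is an algorithm that solves min-max $r$-gathering on spiders in $O(2^d r^4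 d^5 + n + m)$ time; the algorithms and the constants in the $O$-notation do not depend on the instance. In particular, both problems are fixed-parameter tractable when parameterized by the number $d$ of legs alone: for some computable function $f$ and some constant $k$ they can be solved in time $f(d)\,(n+1)^k$ and $f(d)\,(n+m+1)^k$, respectively, for all $r \ge 1$. -/

import Mathlib

open scoped NNReal

/-! ### Spiders, clusterings and gatherings -/

/-- A point `(l, x)` of the spider with `d` legs: the point on leg `l` at distance `x` from the
center.  The pairs `(l, 0)` are all names of the center. -/
structure SpiderPoint (d : ℕ) where
  leg : Fin d
  pos : ℝ≥0

/-- The metric of the spider (`nndist` is the distance `|x - x'|`). -/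
noncomputable def SpiderPoint.distance {d : ℕ} (p q : SpiderPoint d) : ℝ≥0 :=
  if p.leg = q.leg then nndist p.pos q.pos else p.pos + q.pos

/-- The diameter of a cluster: the distance between two farthest users in it. -/
noncomputable def clusterDiameter {d n : ℕ} (U : Fin n → SpiderPoint d) (C : Finset (Fin n)) :
    ℝ≥0 :=
  C.sup fun u => C.sup fun v => (U u).distance (U v)

/-- A partition of the users all of whose clusters contain at least `r` users. -/
def IsRGather {n : ℕ} (r : ℕ) (P : Finpartition (Finset.univ : Finset (Fin n))) : Prop :=
  ∀ C ∈ P.parts, r ≤ C.card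

/-- The objective of `r`-gather clustering: the maximum diameter of the clusters. -/
noncomputable def clusteringCost {d n : ℕ} (U : Fin n → SpiderPoint d)
    (P : Finpartition (Finset.univ : Finset (Fin n))) : ℝ≥0 :=
  P.parts.sup (clusterDiameter U)

/-- A feasible solution of `r`-gathering: a set of opened facilities and an assignment of the users
to opened facilities that gives every opened facility at least `r` users. -/
structure RGathering (n m r : ℕ) where
  opened : Finset (Fin m)
  assign : Fin n → Fin m
  assign_mem : ∀ u, assign u ∈ opened
  le_card : ∀ f ∈ opened, r ≤ (Finset.univ.filter fun u => assign u = f).card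

/-- The objective of `r`-gathering: the maximum distance from a user to its facility. -/
noncomputable def RGathering.cost {d n m r : ℕ} (U : Fin n → SpiderPoint d)
    (F : Fin m → SpiderPoint d) (G : RGathering n m r) : ℝ≥0 :=
  Finset.univ.sup fun u => (U u).distance (F (G.assign u))

/-! ### A random access machine over natural and real numbers

The machine has natural number registers, real registers, and memory arrays of either kind that are
addressed by natural numbers.  Its operations are constants, reading, writing, addition,
subtraction, and comparison, each at unit cost.  There is no multiplication, no rounding or other
passage between real and natural numbers, and no real constant besides `0`. -/

namespace RAM

/-- A memory state. -/
structure State where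
  natReg : ℕ → ℕ
  realReg : ℕ → ℝ
  natArr : ℕ → ℕ → ℕ
  realArr : ℕ → ℕ → ℝ

/-- Natural number expressions; `read a e` is the cell of array `a` at address `e`. -/
inductive NatExpr where
  | const (c : ℕ)
  | reg (x : ℕ)
  | read (a : ℕ) (e : NatExpr)
  | add (e₁ e₂ : NatExpr)
  | sub (e₁ e₂ : NatExpr)

/-- The value of an expression (subtraction on natural numbers is truncated). -/
def NatExpr.eval (s : State) : NatExpr → ℕ
  | const c => c
  | reg x => s.natReg x
  | read a e => s.natArr a (e.eval s)
  | add e₁ e₂ => e₁.eval s + e₂.eval s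
  | sub e₁ e₂ => e₁.eval s - e₂.eval s

/-- The number of elementary operations in an expression. -/
def NatExpr.cost : NatExpr → ℕ
  | const _ => 1
  | reg _ => 1
  | read _ e => e.cost + 1
  | add e₁ e₂ => e₁.cost + e₂.cost + 1
  | sub e₁ e₂ => e₁.cost + e₂.cost + 1

/-- Real expressions. -/
inductive RealExpr where
  | zero
  | reg (x : ℕ)
  | read (a : ℕ) (e : NatExpr)
  | add (e₁ e₂ : RealExpr)
  | sub (e₁ e₂ : RealExpr)

/-- The value of a real expression. -/
noncomputable def RealExpr.eval (s : State) : RealExpr → ℝ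
  | zero => 0
  | reg x => s.realReg x
  | read a e => s.realArr a (e.eval s)
  | add e₁ e₂ => e₁.eval s + e₂.eval s
  | sub e₁ e₂ => e₁.eval s - e₂.eval s

/-- The number of elementary operations in a real expression. -/
def RealExpr.cost : RealExpr → ℕ
  | zero => 1
  | reg _ => 1
  | read _ e => e.cost + 1
  | add e₁ e₂ => e₁.cost + e₂.cost + 1
  | sub e₁ e₂ => e₁.cost + e₂.cost + 1

/-- Tests. -/
inductive Test where
  | natLe (e₁ e₂ : NatExpr)
  | natEq (e₁ e₂ : NatExpr)
  | realLe (e₁ e₂ : RealExpr)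
  | neg (b : Test)
  | and (b₁ b₂ : Test)

/-- The truth of a test. -/
def Test.Holds (s : State) : Test → Prop
  | natLe e₁ e₂ => e₁.eval s ≤ e₂.eval s
  | natEq e₁ e₂ => e₁.eval s = e₂.eval s
  | realLe e₁ e₂ => e₁.eval s ≤ e₂.eval s
  | neg b => ¬ b.Holds s
  | and b₁ b₂ => b₁.Holds s ∧ b₂.Holds s

/-- The number of elementary operations in a test. -/
def Test.cost : Test → ℕ
  | natLe e₁ e₂ => e₁.cost + e₂.cost + 1
  | natEq e₁ e₂ => e₁.cost + e₂.cost + 1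
  | realLe e₁ e₂ => e₁.cost + e₂.cost + 1
  | neg b => b.cost + 1
  | and b₁ b₂ => b₁.cost + b₂.cost + 1

/-- Programs. -/
inductive Program where
  | skip
  | setNat (x : ℕ) (e : NatExpr)
  | setReal (x : ℕ) (e : RealExpr)
  | writeNat (a : ℕ) (i : NatExpr) (e : NatExpr)
  | writeReal (a : ℕ) (i : NatExpr) (e : RealExpr)
  | seq (c₁ c₂ : Program)
  | ite (b : Test) (c₁ c₂ : Program)
  | loop (b : Test) (c : Program)

/-- `Exec c s t s'`: started in state `s`, the program `c` halts in state `s'` after exactly `t`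
elementary steps.  (`loop b c` is the loop "while `b` do `c`".) -/
inductive Exec : Program → State → ℕ → State → Prop where
  | skip (s : State) : Exec .skip s 1 s
  | setNat (s : State) (x : ℕ) (e : NatExpr) :
      Exec (.setNat x e) s (e.cost + 1)
        { s with natReg := Function.update s.natReg x (e.eval s) }
  | setReal (s : State) (x : ℕ) (e : RealExpr) :
      Exec (.setReal x e) s (e.cost + 1)
        { s with realReg := Function.update s.realReg x (e.eval s) }
  | writeNat (s : State) (a : ℕ) (i e : NatExpr) :
      Exec (.writeNat a i e) s (i.cost + e.cost + 1)
        { s with natArr :=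
            Function.update s.natArr a (Function.update (s.natArr a) (i.eval s) (e.eval s)) }
  | writeReal (s : State) (a : ℕ) (i : NatExpr) (e : RealExpr) :
      Exec (.writeReal a i e) s (i.cost + e.cost + 1)
        { s with realArr :=
            Function.update s.realArr a (Function.update (s.realArr a) (i.eval s) (e.eval s)) }
  | seq {c₁ c₂ : Program} {s s' s'' : State} {t₁ t₂ : ℕ} :
      Exec c₁ s t₁ s' → Exec c₂ s' t₂ s'' → Exec (.seq c₁ c₂) s (t₁ + t₂) s''
  | iteTrue {b : Test} {c₁ c₂ : Program} {s s' : State} {t : ℕ} :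
      b.Holds s → Exec c₁ s t s' → Exec (.ite b c₁ c₂) s (b.cost + 1 + t) s'
  | iteFalse {b : Test} {c₁ c₂ : Program} {s s' : State} {t : ℕ} :
      ¬ b.Holds s → Exec c₂ s t s' → Exec (.ite b c₁ c₂) s (b.cost + 1 + t) s'
  | loopTrue {b : Test} {c : Program} {s s' s'' : State} {t₁ t₂ : ℕ} :
      b.Holds s → Exec c s t₁ s' → Exec (.loop b c) s' t₂ s'' →
        Exec (.loop b c) s (b.cost + 1 + t₁ + t₂) s''
  | loopFalse {b : Test} {c : Program} {s : State} :
      ¬ b.Holds s → Exec (.loop b c) s (b.cost + 1) s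

end RAM

/-! ### Inputs, outputs and running times -/

/-- The initial state.  Natural registers `0, 1, 2, 3` hold the number of legs, `r`, the number of
users and the number of facilities; natural and real array `0` hold the legs and the positions of
the users, natural and real array `1` those of the facilities; everything else is `0`. -/
noncomputable def inputState {d n m : ℕ} (r : ℕ) (U : Fin n → SpiderPoint d)
    (F : Fin m → SpiderPoint d) : RAM.State where
  natReg x := if x = 0 then d else if x = 1 then r else if x = 2 then n else if x = 3 then m else 0
  realReg _ := 0
  natArr a i :=
    if a = 0 then (if h : i < n then ((U ⟨i, h⟩).leg : ℕ) else 0)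
    else if a = 1 then (if h : i < m then ((F ⟨i, h⟩).leg : ℕ) else 0)
    else 0
  realArr a i :=
    if a = 0 then (if h : i < n then ((U ⟨i, h⟩).pos : ℝ) else 0)
    else if a = 1 then (if h : i < m then ((F ⟨i, h⟩).pos : ℝ) else 0)
    else 0

/-- The state `s` shows a correct answer to the `r`-gather clustering problem.  Either natural
register `0` holds `1`, natural array `2` gives every user a cluster label, the clusters form an
optimal solution, and real register `0` holds its value; or natural register `0` holds `0` and there
is no feasible solution. -/
def ClusteringAnswer {d n : ℕ} (r : ℕ) (U : Fin n → SpiderPoint d) (s : RAM.State) : Prop :=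
  (s.natReg 0 = 1 ∧
    ∃ P : Finpartition (Finset.univ : Finset (Fin n)),
      IsRGather r P ∧
      (∀ Q : Finpartition (Finset.univ : Finset (Fin n)),
        IsRGather r Q → clusteringCost U P ≤ clusteringCost U Q) ∧
      (∀ u v : Fin n, P.part u = P.part v ↔ s.natArr 2 u = s.natArr 2 v) ∧
      s.realReg 0 = clusteringCost U P) ∨
  (s.natReg 0 = 0 ∧ ¬ ∃ P : Finpartition (Finset.univ : Finset (Fin n)), IsRGather r P)

/-- The state `s` shows a correct answer to the `r`-gathering problem; natural array `2` gives every
user the index of its facility. -/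
def GatheringAnswer {d n m : ℕ} (r : ℕ) (U : Fin n → SpiderPoint d) (F : Fin m → SpiderPoint d)
    (s : RAM.State) : Prop :=
  (s.natReg 0 = 1 ∧
    ∃ G : RGathering n m r,
      (∀ H : RGathering n m r, G.cost U F ≤ H.cost U F) ∧
      (∀ u : Fin n, s.natArr 2 u = (G.assign u : ℕ)) ∧
      s.realReg 0 = G.cost U F) ∨
  (s.natReg 0 = 0 ∧ IsEmpty (RGathering n m r))

/-- The program solves `r`-gather clustering on spiders in at most `T d r n` steps, the users being
listed in the order of their distance from the center. -/
def SolvesClustering (c : RAM.Program) (T : ℕ → ℕ → ℕ → ℕ) : Prop :=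
  ∀ (d r n : ℕ) (U : Fin n → SpiderPoint d), 1 ≤ d → 1 ≤ r →
    Monotone (fun i => (U i).pos) →
    ∃ (t : ℕ) (s : RAM.State),
      RAM.Exec c (inputState r U (Fin.elim0 : Fin 0 → SpiderPoint d)) t s ∧
      t ≤ T d r n ∧ ClusteringAnswer r U s

/-- The program solves `r`-gathering on spiders in at most `T d r n m` steps, the users and the
facilities being listed in the order of their distance from the center. -/
def SolvesGathering (c : RAM.Program) (T : ℕ → ℕ → ℕ → ℕ → ℕ) : Prop :=
  ∀ (d r n m : ℕ) (U : Fin n → SpiderPoint d) (F : Fin m → SpiderPoint d), 1 ≤ d → 1 ≤ r →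
    Monotone (fun i => (U i).pos) → Monotone (fun i => (F i).pos) →
    ∃ (t : ℕ) (s : RAM.State),
      RAM.Exec c (inputState r U F) t s ∧
      t ≤ T d r n m ∧ GatheringAnswer r U F s

set_option linter.unusedSimpArgs false

/-! The core is a decision procedure for gathering with a bound `D`; the program evaluates it with
minima and maxima in place of tests. Number the facilities by their distance from the center and
call a user a filler if its facility is on another leg. Among all gatherings of value at most `D`,
take one that minimizes the potential `pot`. Exchanging the facilities of two users then yields a
strong order. On each leg the fillers are the nearest users (`MinValid.filler_lt_local`), the other
users are served in order (`MinValid.local_mono`), and all users of a lower facility lie after every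
filler of a higher one and off its leg (`MinValid.lower_after`). Facility `0`, nearest to the
center, could take over any group of at least `r` users that contains a filler as its last user, if
what is left of the cluster is empty or still large enough (`MinValid.not_move`). In a minimal
solution every other facility with fillers therefore has a user after each of them and at most `2 *
r` users up to its last filler. There is at most one such facility per leg, so together they concern
at most `2 * r * d` swept users (`MinValid.card_swept`).

Consequently one sweep outward from the center rebuilds the solution, as formalized by
`Users.Reach`. The central clusters are completed in decreasing order of their facilities. The sweep
collects users for the current cluster; at its last filler the cluster takes the next block of its
own leg, the rest of that leg splits into intervals (`Users.Line`), and the leg is closed. When the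
sweep meets a user of a cluster that stays on one leg, that leg is closed at once. When the cluster
of facility `0` has `r` users, the open legs become independent: each gives some of its nearest
users to this cluster and splits the others into intervals (`Users.StarLine`). The induction is
`Inv.stage`, its result `reach_of_valid`. A state consists of the number of steps done, the set of
closed legs and the number of waiting users capped at `r`. Since only `B` users per leg can matter,
there are only polynomially many steps in `d` and `r`.

The optimal interval partitions of all final stretches of a leg satisfy a min-max recurrence, solved
in linear time by a monotone queue of cuts (`Deque`, `Deque.front_le`) with a pointer to the best
facility. The table over the states is filled backwards. `cell_of_best` shows that an entry is at
most every reachable `D` and that the recorded transition attains it; `pass_spec` follows the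
recorded transitions and labels the users. Values are capped at `big`, a bound for the cost of one
single cluster.

Clustering uses the same sweep. A cluster of diameter `2 * R` lies within `R` of the point at
distance `R` toward the center from its last user, or of the center if that user is closer than `R`
(`dd_mid`). Placing a facility at each such point turns a clustering into a gathering of half its
value (`valid_midFacs`), while the program computes diameters directly.

In the running time, the only superlinear dependence on `m` comes from binary search and is absorbed
by `time_le`. For the parameterized bounds, an instance with more than `r - 1` users has `r ≤ n`,
and all others are answered at once. -/

namespace Gather

/-! ### Users listed leg by leg -/

/-- The number of indices below `p` on leg `l`. -/
def cb (leg : ℕ → ℕ) (l p : ℕ) : ℕ := Nat.count (fun u => leg u = l) p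

/-- The number of users after `u` on the leg of `u`. -/
def fe (n : ℕ) (leg : ℕ → ℕ) (u : ℕ) : ℕ := cb leg (leg u) n - cb leg (leg u) (u + 1)

/-- The user on leg `l` with `k` users after it. -/
noncomputable def usr (n : ℕ) (leg : ℕ → ℕ) (l k : ℕ) : ℕ :=
  Nat.nth (fun u => leg u = l) (cb leg l n - 1 - k)

section legs
variable {n : ℕ} {leg : ℕ → ℕ}

@[simp] theorem cb_zero (l : ℕ) : cb leg l 0 = 0 := by simp [cb]

theorem cb_succ (l p : ℕ) : cb leg l (p + 1) = cb leg l p + if leg p = l then 1 else 0 := by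
  simp [cb, Nat.count_succ]

theorem cb_mono (l : ℕ) {p q : ℕ} (h : p ≤ q) : cb leg l p ≤ cb leg l q :=
  Nat.count_monotone _ h

theorem cb_lt {u v : ℕ} (h : u < v) : cb leg (leg u) u < cb leg (leg u) v := by
  have h1 := cb_mono (leg := leg) (leg u) (show u + 1 ≤ v from h)
  rw [cb_succ] at h1
  simp at h1
  omega

theorem fe_add {u : ℕ} (h : u < n) : fe n leg u + 1 + cb leg (leg u) u = cb leg (leg u) n := by
  have h1 := cb_mono (leg := leg) (leg u) (show u + 1 ≤ n from h)
  have h2 := cb_succ (leg := leg) (leg u) u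
  simp at h2
  unfold fe
  omega

theorem fe_lt_cb {u : ℕ} (h : u < n) : fe n leg u < cb leg (leg u) n := by
  have := fe_add (leg := leg) h; omega

theorem usr_fe {u : ℕ} (h : u < n) : usr n leg (leg u) (fe n leg u) = u := by
  have h1 := fe_add (leg := leg) h
  have h2 : cb leg (leg u) n - 1 - fe n leg u = cb leg (leg u) u := by omega
  unfold usr
  rw [h2]
  exact Nat.nth_count (p := fun v => leg v = leg u) rfl

theorem exists_fe {l k : ℕ} (h : k < cb leg l n) : ∃ u < n, leg u = l ∧ fe n leg u = k := by
  induction n generalizing k with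
  | zero => simp at h
  | succ n ih =>
    have e3 := cb_succ (leg := leg) l n
    by_cases hl : leg n = l
    · simp only [hl, if_true] at e3
      rcases Nat.eq_zero_or_pos k with h0 | h0
      · exact ⟨n, by omega, hl, by simp [fe, h0]⟩
      · obtain ⟨u, hu, hul, hf⟩ := ih (k := k - 1) (by omega)
        refine ⟨u, by omega, hul, ?_⟩
        have e1 := fe_add (leg := leg) hu
        have e2 := fe_add (leg := leg) (show u < n + 1 by omega)
        rw [hul] at e1 e2
        omega
    · simp only [hl, if_false] at e3
      obtain ⟨u, hu, hul, hf⟩ := ih (k := k) (by omega)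
      refine ⟨u, by omega, hul, ?_⟩
      have e1 := fe_add (leg := leg) hu
      have e2 := fe_add (leg := leg) (show u < n + 1 by omega)
      rw [hul] at e1 e2
      omega

theorem usr_lt {l k : ℕ} (h : k < cb leg l n) : usr n leg l k < n := by
  obtain ⟨u, hu, rfl, rfl⟩ := exists_fe h
  rwa [usr_fe hu]

theorem leg_usr {l k : ℕ} (h : k < cb leg l n) : leg (usr n leg l k) = l := by
  obtain ⟨u, hu, rfl, rfl⟩ := exists_fe h
  rw [usr_fe hu]

theorem fe_usr {l k : ℕ} (h : k < cb leg l n) : fe n leg (usr n leg l k) = k := by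
  obtain ⟨u, hu, rfl, rfl⟩ := exists_fe h
  rw [usr_fe hu]

theorem fe_lt_fe {u v : ℕ} (hv : v < n) (h : leg u = leg v) (huv : u < v) :
    fe n leg v < fe n leg u := by
  have e1 := fe_add (leg := leg) hv
  have e2 := fe_add (leg := leg) (huv.trans hv)
  have := cb_lt (leg := leg) huv
  rw [h] at *
  omega

theorem fe_lt_iff {u v : ℕ} (hu : u < n) (hv : v < n) (h : leg u = leg v) :
    fe n leg v < fe n leg u ↔ u < v := by
  constructor
  · intro h1
    by_contra h2
    rcases Nat.lt_or_ge v u with h3 | h3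
    · have := fe_lt_fe hu h.symm h3; omega
    · have : u = v := by omega
      subst this; omega
  · exact fe_lt_fe hv h

theorem usr_lt_usr {l j k : ℕ} (hk : k < cb leg l n) (h : j < k) :
    usr n leg l k < usr n leg l j := by
  have hj := h.trans hk
  rw [← fe_lt_iff (leg := leg) (usr_lt hk) (usr_lt hj) (by rw [leg_usr hk, leg_usr hj]), fe_usr hj,
    fe_usr hk]
  exact h

theorem cb_eq_card (l p : ℕ) : cb leg l p = ((Finset.range p).filter fun u => leg u = l).card := by
  simp [cb, Nat.count_eq_card_filter_range]

end legs

/-! ### The residual problem of the sweep -/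

/-- Users on the legs of a spider, and the number of users that a cluster needs. -/
structure Users where
  n : ℕ
  d : ℕ
  r : ℕ
  leg : ℕ → ℕ
  pos : ℕ → ℝ

structure Users.WF (U : Users) : Prop where
  leg_lt : ∀ u < U.n, U.leg u < U.d
  pos_nonneg : ∀ u, 0 ≤ U.pos u
  pos_mono : ∀ u v, u ≤ v → v < U.n → U.pos u ≤ U.pos v
  one_le_r : 1 ≤ U.r
  one_le_d : 1 ≤ U.d

namespace Users
variable (U : Users)

/-- The number of users of a leg that the sweep may use. -/
def B : ℕ := U.d * (2 * U.r) + U.r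

/-- Indices on a leg are counted from its far end. A final stretch of a leg is then described by one
number, its length `κ`, and `κ - 1` is the index of its nearest user. Positions do not increase with
the index. -/
noncomputable def X (l k : ℕ) : ℝ := U.pos (usr U.n U.leg l k)

def cnt (l : ℕ) : ℕ := cb U.leg l U.n

/-- Only the first `B` users of each leg enter the sweep. By `Inv.cb_le` an open leg loses at most
`d * (2 * r)` users to central clusters other than that of facility `0`, and at most `r` to that
one. This bounds the number of steps independently of `n`. -/
def near (u : ℕ) : Prop := u < U.n ∧ cb U.leg (U.leg u) u < U.B

instance : DecidablePred U.near := fun u => by unfold near; infer_instance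

noncomputable def nu (q : ℕ) : ℕ := Nat.nth U.near q

def P : ℕ := Nat.count U.near U.n

/-- The number of users on leg `l` that are left after the first `q` steps of the sweep. -/
noncomputable def kap : ℕ → ℕ → ℕ
  | 0, l => U.cnt l
  | q + 1, l => if U.leg (U.nu q) = l then kap q l - 1 else kap q l

/-- Distance of the last swept user, hence a bound for all users waiting in the current cluster; `0`
serves before the first step. -/
noncomputable def prev : ℕ → ℝ
  | 0 => 0
  | q + 1 => U.pos (U.nu q)

/-- The last `κ` users of leg `l` can be partitioned into clusters of their own. -/
inductive Line (G : ℕ → ℝ → ℝ → Prop) (l : ℕ) : ℕ → Prop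
  | zero : Line G l 0
  -- The split-off cluster has the indices `κ'` to `κ - 1`: its near end is at `κ - 1`, its far end
  -- at `κ'`.
  | step {κ κ' : ℕ} : κ' + U.r ≤ κ → κ ≤ U.cnt l → G l (U.X l (κ - 1)) (U.X l κ') → Line G l κ' →
      Line G l κ

/-- As `Line`, but nearest users may also join a central cluster. -/
inductive StarLine (G : ℕ → ℝ → ℝ → Prop) (St : ℕ → Prop) (l : ℕ) : ℕ → Prop
  | line {κ : ℕ} : U.Line G l κ → StarLine G St l κ
  | step {κ : ℕ} : κ < U.cnt l → St (usr U.n U.leg l κ) → StarLine G St l κ →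
      StarLine G St l (κ + 1)

/-- The residual problem: the legs in `S` are closed, `q` steps of the sweep are done, and `c` swept
users are not yet in a cluster. -/
inductive Reach (G : ℕ → ℝ → ℝ → Prop) (St : ℕ → Prop) (Tk : ℝ → Prop) : ℕ → ℕ → ℕ → Prop
  | done {q : ℕ} : Reach G St Tk q (2 ^ U.d - 1) 0
  | skip {q S c : ℕ} : q < U.P → S.testBit (U.leg (U.nu q)) = true → Reach G St Tk (q + 1) S c →
      Reach G St Tk q S c
  -- The count saturates at `r`; beyond that only the fact that the cluster is full matters.
  | fill {q S c : ℕ} : q < U.P → S.testBit (U.leg (U.nu q)) = false →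
      Reach G St Tk (q + 1) S (min U.r (c + 1)) → Reach G St Tk q S c
  | close {q S c l : ℕ} : l < U.d → S.testBit l = false → U.Line G l (U.kap q l) →
      Reach G St Tk q (S + 2 ^ l) c → Reach G St Tk q S c
  -- The waiting users act as points with coordinates at least `- U.prev q` on the line through leg
  -- `l`. The bound `2 * U.r` loses nothing, because `reach_top` splits off clusters of `r` users
  -- from a longer block.
  | top {q S c l a : ℕ} : l < U.d → S.testBit l = false → 1 ≤ a → a ≤ 2 * U.r → a ≤ U.kap q l →
      U.r ≤ c + a → G l (- U.prev q) (U.X l (U.kap q l - a)) → U.Line G l (U.kap q l - a) →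
      Reach G St Tk q (S + 2 ^ l) 0 → Reach G St Tk q S c
  -- The cluster around the facility nearest to the center is full, so its further users need no
  -- counting and the open legs no longer interact.
  | star {q S : ℕ} : Tk (U.prev q) →
      (∀ l < U.d, S.testBit l = false → U.StarLine G St l (U.kap q l)) → Reach G St Tk q S U.r

variable {U}

theorem Line.mono {G G' : ℕ → ℝ → ℝ → Prop} (h : ∀ l a b, G l a b → G' l a b) {l κ : ℕ}
    (H : U.Line G l κ) : U.Line G' l κ := by
  induction H with
  | zero => exact .zero
  | step h1 h2 h3 _ ih => exact .step h1 h2 (h _ _ _ h3) ih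

theorem StarLine.mono {G G' : ℕ → ℝ → ℝ → Prop} {St St' : ℕ → Prop}
    (h : ∀ l a b, G l a b → G' l a b) (h' : ∀ u < U.n, St u → St' u) {l κ : ℕ}
    (H : U.StarLine G St l κ) : U.StarLine G' St' l κ := by
  induction H with
  | line h1 => exact .line (h1.mono h)
  | step h1 h2 _ ih => exact .step h1 (h' _ (usr_lt h1) h2) ih

theorem Reach.mono {G G' : ℕ → ℝ → ℝ → Prop} {St St' : ℕ → Prop} {Tk Tk' : ℝ → Prop}
    (h : ∀ l a b, G l a b → G' l a b) (h' : ∀ u < U.n, St u → St' u) (h'' : ∀ x, Tk x → Tk' x)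
    {q S c : ℕ} (H : U.Reach G St Tk q S c) : U.Reach G' St' Tk' q S c := by
  induction H with
  | done => exact .done
  | skip h1 h2 _ ih => exact .skip h1 h2 ih
  | fill h1 h2 _ ih => exact .fill h1 h2 ih
  | close h1 h2 h3 _ ih => exact .close h1 h2 (h3.mono h) ih
  | top h1 h2 h3 h4 h5 h6 h7 h8 _ ih => exact .top h1 h2 h3 h4 h5 h6 (h _ _ _ h7) (h8.mono h) ih
  | star h1 h2 => exact .star (h'' _ h1) fun l hl hS => (h2 l hl hS).mono h h'

/-! ### The sweep -/

/-- Translates positions in the list of users into steps of the sweep: up to position `p` each leg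
has lost the users that lie there, but at most `B` of them. -/
theorem count_near_cb (l p : ℕ) (hp : p ≤ U.n) :
    U.kap (Nat.count U.near p) l = U.cnt l - min U.B (cb U.leg l p) := by
  induction p with
  | zero => simp [kap]
  | succ p ih =>
    have ih := ih (by omega)
    rw [Nat.count_succ, cb_succ]
    by_cases hn : U.near p
    · have e : U.nu (Nat.count U.near p) = p := Nat.nth_count hn
      simp only [hn, if_true, kap, e]
      by_cases hl : U.leg p = l
      · have := hn.2
        rw [hl] at this
        simp only [hl, if_true, ih]
        omega
      · simp [hl, ih]
    · simp only [hn, if_false, add_zero, ih]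
      by_cases hl : U.leg p = l
      · have : ¬ cb U.leg (U.leg p) p < U.B := fun h => hn ⟨by omega, h⟩
        rw [hl] at this
        simp only [hl, if_true]
        omega
      · simp [hl]

theorem nu_spec {q : ℕ} (hq : q < U.P) : U.nu q < U.n ∧ U.near (U.nu q) ∧
    Nat.count U.near (U.nu q) = q := by
  have hc : ∀ hf : (Set.ofPred U.near).Finite, q < hf.toFinset.card := by
    intro hf
    refine lt_of_lt_of_le hq ?_
    unfold P
    rw [Nat.count_eq_card_filter_range]
    apply Finset.card_le_card
    intro x hx
    simp at hx
    simpa using hx.2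
  exact ⟨Nat.nth_lt_of_lt_count hq, Nat.nth_mem q hc, Nat.count_nth hc⟩

theorem fe_nu {q : ℕ} (hq : q < U.P) :
    fe U.n U.leg (U.nu q) + 1 = U.kap q (U.leg (U.nu q)) := by
  obtain ⟨h1, h2, h3⟩ := nu_spec hq
  have := count_near_cb (U := U) (U.leg (U.nu q)) (U.nu q) h1.le
  rw [h3] at this
  rw [this]
  have h4 := fe_add (leg := U.leg) h1
  have h5 := h2.2
  unfold cnt
  omega

theorem nu_lt_of_count {q p : ℕ} (hq : q < Nat.count U.near p) : U.nu q < p :=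
  Nat.nth_lt_of_lt_count hq

end Users
end Gather

/-! ### Minimal gatherings and exchange arguments -/

namespace Gather

/-- The distance of `(l, x)` and `(l', x')`. -/
noncomputable def dd (l : ℕ) (x : ℝ) (l' : ℕ) (x' : ℝ) : ℝ := if l = l' then |x - x'| else x + x'

theorem dd_le_add {l l' : ℕ} {x x' : ℝ} (h : 0 ≤ x) (h' : 0 ≤ x') : dd l x l' x' ≤ x + x' := by
  unfold dd
  split_ifs
  · rw [abs_le]; constructor <;> linarith
  · exact le_rfl

/-- Facilities on the legs of a spider. -/
structure Facs where
  m : ℕ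
  fl : ℕ → ℕ
  fp : ℕ → ℝ

structure Facs.WF (F : Facs) : Prop where
  fp_nonneg : ∀ j, 0 ≤ F.fp j
  fp_mono : ∀ i j, i ≤ j → j < F.m → F.fp i ≤ F.fp j

/-- The assignment `σ` is an `r`-gathering of value at most `D`. -/
structure Valid (U : Users) (F : Facs) (D : ℝ) (σ : ℕ → ℕ) : Prop where
  lt : ∀ u < U.n, σ u < F.m
  dist : ∀ u < U.n, dd (U.leg u) (U.pos u) (F.fl (σ u)) (F.fp (σ u)) ≤ D
  card : ∀ u < U.n, U.r ≤ ((Finset.range U.n).filter fun v => σ v = σ u).card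

section
variable (U : Users) (F : Facs)

/-- Price of serving a user from another leg; it favours fillers near the center. The `+ 1` makes
user `0` as a filler dearer than any user of the facility's own leg. -/
def key (φ u : ℕ) : ℕ := if U.leg u = F.fl φ then 0 else u + 1

/-- Exceeds the sum of any `n` keys, each of which is at most `n`. -/
def bigM : ℕ := (U.n + 1) * (U.n + 1)

/-- The powers give priority to the farther facilities: lowering a key there outweighs a key that
newly appears at a nearer facility. -/
def w1 (u φ : ℕ) : ℕ := key U F φ u * bigM U ^ φ

/-- Breaks ties. By rearrangement the sum is smallest when later users have facilities of larger
index, which sorts the users served on their own leg. -/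
def w2 (u φ : ℕ) : ℕ := u * (F.m - φ)

def pot (σ : ℕ → ℕ) : ℕ ×ₗ ℕ :=
  toLex (∑ u ∈ Finset.range U.n, w1 U F u (σ u), ∑ u ∈ Finset.range U.n, w2 F u (σ u))

/-- Valid assignments that are minimal with respect to `pot`. -/
structure MinValid (D : ℝ) (σ : ℕ → ℕ) : Prop extends Valid U F D σ where
  min : ∀ τ, Valid U F D τ → ¬ pot U F τ < pot U F σ

theorem exists_minValid {D : ℝ} {σ : ℕ → ℕ} (h : Valid U F D σ) : ∃ τ, MinValid U F D τ := by
  obtain ⟨τ, h1, h2⟩ := WellFounded.has_min (InvImage.wf (pot U F) wellFounded_lt)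
    {σ | Valid U F D σ} ⟨σ, h⟩
  exact ⟨τ, h1, fun τ' h' => h2 τ' h'⟩

end

/-- The users `a` and `b` exchange their facilities. -/
def exch (σ : ℕ → ℕ) (a b : ℕ) : ℕ → ℕ := fun u => σ (Equiv.swap a b u)

section
variable {U : Users} {F : Facs} {D : ℝ} {σ : ℕ → ℕ}

theorem swap_lt {n a b u : ℕ} (ha : a < n) (hb : b < n) (hu : u < n) : Equiv.swap a b u < n := by
  rcases eq_or_ne u a with rfl | h1
  · simpa
  rcases eq_or_ne u b with rfl | h2
  · simpa
  rwa [Equiv.swap_apply_of_ne_of_ne h1 h2]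

/-- An exchange only permutes the users, so all cluster sizes persist and just the two new distances
have to be checked. -/
theorem Valid.exch (h : Valid U F D σ) {a b : ℕ} (ha : a < U.n) (hb : b < U.n)
    (h1 : dd (U.leg a) (U.pos a) (F.fl (σ b)) (F.fp (σ b)) ≤ D)
    (h2 : dd (U.leg b) (U.pos b) (F.fl (σ a)) (F.fp (σ a)) ≤ D) : Valid U F D (exch σ a b) where
  lt u hu := h.lt _ (swap_lt ha hb hu)
  dist u hu := by
    unfold Gather.exch
    rcases eq_or_ne u a with rfl | h3
    · simpa using h1
    rcases eq_or_ne u b with rfl | h4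
    · simpa using h2
    rw [Equiv.swap_apply_of_ne_of_ne h3 h4]
    exact h.dist u hu
  card u hu := by
    refine (h.card _ (swap_lt ha hb hu)).trans (le_of_eq ?_)
    refine Finset.card_bij' (fun v _ => Equiv.swap a b v) (fun v _ => Equiv.swap a b v)
      ?_ ?_ (by simp) (by simp)
    · intro v hv
      simp only [Finset.mem_filter, Finset.mem_range] at hv ⊢
      exact ⟨swap_lt ha hb hv.1, by simpa [Gather.exch] using hv.2⟩
    · intro v hv
      simp only [Finset.mem_filter, Finset.mem_range] at hv ⊢
      exact ⟨swap_lt ha hb hv.1, hv.2⟩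

theorem sum_exch (w : ℕ → ℕ → ℕ) {n a b : ℕ} (ha : a < n) (hb : b < n) (hab : a ≠ b) :
    ∑ u ∈ Finset.range n, w u (exch σ a b u) + (w a (σ a) + w b (σ b)) =
      ∑ u ∈ Finset.range n, w u (σ u) + (w a (σ b) + w b (σ a)) := by
  have ha' : a ∈ Finset.range n := by simpa
  have hb' : b ∈ (Finset.range n).erase a := by simp [hb, hab.symm]
  rw [← Finset.add_sum_erase _ _ ha', ← Finset.add_sum_erase _ _ hb',
    ← Finset.add_sum_erase _ (fun u => w u (σ u)) ha',
    ← Finset.add_sum_erase _ (fun u => w u (σ u)) hb']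
  have : ∑ x ∈ ((Finset.range n).erase a).erase b, w x (exch σ a b x) =
      ∑ x ∈ ((Finset.range n).erase a).erase b, w x (σ x) := by
    refine Finset.sum_congr rfl fun x hx => ?_
    simp only [Finset.mem_erase] at hx
    rw [exch, Equiv.swap_apply_of_ne_of_ne hx.2.1 hx.1]
  rw [this]
  simp only [exch, Equiv.swap_apply_left, Equiv.swap_apply_right]
  ring

theorem key_le {φ u : ℕ} (h : u < U.n) : key U F φ u ≤ U.n := by
  unfold key; split_ifs <;> omega

theorem MinValid.exch_w1 (h : MinValid U F D σ) {a b : ℕ} (ha : a < U.n) (hb : b < U.n)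
    (hab : a ≠ b) (h1 : dd (U.leg a) (U.pos a) (F.fl (σ b)) (F.fp (σ b)) ≤ D)
    (h2 : dd (U.leg b) (U.pos b) (F.fl (σ a)) (F.fp (σ a)) ≤ D) :
    w1 U F a (σ a) + w1 U F b (σ b) ≤ w1 U F a (σ b) + w1 U F b (σ a) := by
  by_contra hlt
  refine h.min _ (h.toValid.exch ha hb h1 h2) ?_
  have := sum_exch (σ := σ) (w1 U F) ha hb hab
  refine Prod.Lex.toLex_lt_toLex.2 (Or.inl ?_)
  simp only
  omega

theorem MinValid.exch_w2 (h : MinValid U F D σ) {a b : ℕ} (ha : a < U.n) (hb : b < U.n)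
    (hab : a ≠ b) (h1 : dd (U.leg a) (U.pos a) (F.fl (σ b)) (F.fp (σ b)) ≤ D)
    (h2 : dd (U.leg b) (U.pos b) (F.fl (σ a)) (F.fp (σ a)) ≤ D)
    (h3 : w1 U F a (σ a) + w1 U F b (σ b) = w1 U F a (σ b) + w1 U F b (σ a)) :
    w2 F a (σ a) + w2 F b (σ b) ≤ w2 F a (σ b) + w2 F b (σ a) := by
  by_contra hlt
  refine h.min _ (h.toValid.exch ha hb h1 h2) ?_
  have := sum_exch (σ := σ) (w1 U F) ha hb hab
  have := sum_exch (σ := σ) (w2 F) ha hb hab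
  refine Prod.Lex.toLex_lt_toLex.2 (Or.inr ⟨?_, ?_⟩) <;> simp only <;> omega

/-- `w` is served by a facility on another leg. -/
def Filler (U : Users) (F : Facs) (σ : ℕ → ℕ) (w : ℕ) : Prop := U.leg w ≠ F.fl (σ w)

/-- Some user of the cluster of the facility `φ` is on another leg. -/
def Multi (U : Users) (F : Facs) (σ : ℕ → ℕ) (φ : ℕ) : Prop :=
  ∃ w < U.n, Filler U F σ w ∧ σ w = φ

theorem Valid.filler_dist (h : Valid U F D σ) {w : ℕ} (hw : w < U.n) (hf : Filler U F σ w) :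
    U.pos w + F.fp (σ w) ≤ D := by
  have := h.dist w hw
  rwa [dd, if_neg hf] at this

theorem Valid.local_dist (h : Valid U F D σ) {w : ℕ} (hw : w < U.n)
    (hf : U.leg w = F.fl (σ w)) : |U.pos w - F.fp (σ w)| ≤ D := by
  have := h.dist w hw
  rwa [dd, if_pos hf] at this

variable (hU : U.WF) (hF : F.WF)
include hU hF

/-- Otherwise exchange the two facilities. The new filler `a` is nearer to the center than `b`, and
`b` stays within `D` of `σ a` because `U.pos a ≤ U.pos b ≤ D`. The key at `σ b` falls from `b + 1`
to `a + 1`, and those at `σ a` are zero. -/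
theorem MinValid.filler_lt_local (h : MinValid U F D σ) {a b : ℕ} (hb : b < U.n) (hab : a < b)
    (hl : U.leg a = U.leg b) (hfb : Filler U F σ b) : Filler U F σ a := by
  by_contra hfa
  have ha := hab.trans hb
  unfold Filler at hfa; push Not at hfa
  have e1 := h.filler_dist hb hfb
  have e2 := h.local_dist ha hfa
  have e3 := hU.pos_mono a b hab.le hb
  have p1 := hU.pos_nonneg a
  have p2 := hF.fp_nonneg (σ a)
  have p3 := hF.fp_nonneg (σ b)
  rw [abs_le] at e2
  have := h.exch_w1 ha hb hab.ne ?_ ?_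
  · unfold w1 key at this
    rw [if_pos hfa, if_neg hfb, if_neg (by rw [hl]; exact hfb), if_pos (by rw [← hl]; exact hfa)] at this
    have hpos : 0 < bigM U ^ σ b := by unfold bigM; positivity
    have := Nat.mul_lt_mul_of_pos_right (show a + 1 < b + 1 by omega) hpos
    omega
  · refine (dd_le_add p1 p3).trans (by linarith)
  · rw [← hl, hfa, dd, if_pos rfl, abs_le]
    constructor <;> linarith

/-- Uncrossing two users served on their own leg respects `D` and keeps all four keys at zero, so
the tie-breaker `w2` would fall. -/
theorem MinValid.local_mono (h : MinValid U F D σ) {a b : ℕ} (hb : b < U.n) (hab : a < b)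
    (hl : U.leg a = U.leg b) (hfa : U.leg a = F.fl (σ a)) (hfb : U.leg b = F.fl (σ b)) :
    σ a ≤ σ b := by
  by_contra hlt
  have ha := hab.trans hb
  have e1 := h.local_dist hb hfb
  have e2 := h.local_dist ha hfa
  have e3 := hU.pos_mono a b hab.le hb
  have e4 := hF.fp_mono (σ b) (σ a) (by omega) (h.lt a ha)
  rw [abs_le] at e1 e2
  have := h.exch_w2 ha hb hab.ne ?_ ?_ ?_
  · unfold w2 at this
    have q1 := h.lt a ha
    have q2 := h.lt b hb
    obtain ⟨x, hx⟩ : ∃ x, F.m - σ a = x := ⟨_, rfl⟩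
    obtain ⟨y, hy⟩ : ∃ y, F.m - σ b = y := ⟨_, rfl⟩
    have hxy : x < y := by omega
    rw [hx, hy] at this
    nlinarith
  · rw [hl, hfb, dd, if_pos rfl, abs_le]
    constructor <;> linarith
  · rw [← hl, hfa, dd, if_pos rfl, abs_le]
    constructor <;> linarith
  · unfold w1 key
    rw [if_pos hfa, if_pos hfb, if_pos (by rw [hl]; exact hfb), if_pos (by rw [← hl]; exact hfa)]
    simp

/-- If `v` were on the leg of `σ w` or came before `w`, exchanging the two would lower the key at `σ
w`. The user `w` may get a key at `σ v`, but the weight there is smaller by at least the factor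
`bigM`. The nearer facility `σ v` is admissible for `w` since its sum of distances only drops. -/
theorem MinValid.lower_after (h : MinValid U F D σ) {w v : ℕ} (hw : w < U.n) (hv : v < U.n)
    (hf : Filler U F σ w) (hr : σ v < σ w) : U.leg v ≠ F.fl (σ w) ∧ w < v := by
  by_contra hcon
  have hne : v ≠ w := by rintro rfl; omega
  have e1 := h.filler_dist hw hf
  have e4 := hF.fp_mono (σ v) (σ w) hr.le (h.lt w hw)
  have p1 := hU.pos_nonneg v
  have p1' := hU.pos_nonneg w
  have p2 := hF.fp_nonneg (σ w)
  have p3 := hF.fp_nonneg (σ v)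
  have hkey : key U F (σ w) v < key U F (σ w) w := by
    unfold key
    rw [if_neg hf]
    split_ifs with hl
    · omega
    · have : v < w := by
        by_contra h2
        exact hcon ⟨hl, by omega⟩
      omega
  have := h.exch_w1 hw hv hne.symm ?_ ?_
  · unfold w1 at this
    have hM : 1 ≤ bigM U := by unfold bigM; exact Nat.mul_pos (by omega) (by omega)
    have k1 := key_le (U := U) (F := F) (φ := σ v) hw
    have k2 : bigM U ^ σ v * bigM U ≤ bigM U ^ σ w := by
      rw [← pow_succ]; exact Nat.pow_le_pow_right hM hr
    have k3 : (U.n + 1) ≤ bigM U := by unfold bigM; nlinarith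
    have k4 : 0 < bigM U ^ σ v := by positivity
    have k5 : key U F (σ v) w * bigM U ^ σ v < bigM U ^ σ w := by nlinarith
    have k6 := Nat.mul_le_mul_right (bigM U ^ σ w) hkey
    rw [Nat.succ_mul] at k6
    omega
  · refine (dd_le_add p1' p3).trans (by linarith)
  -- On the leg of `σ w`, the filler `w` gives `F.fp (σ w) ≤ D`, which settles the side toward the
  -- center; on the other side `v` is no farther from `σ w` than from `σ v`, which is nearer to the
  -- center.
  · by_cases hl : U.leg v = F.fl (σ w)
    · rw [hl, dd, if_pos rfl, abs_le]
      by_cases hfv : Filler U F σ v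
      · have := h.filler_dist hv hfv
        constructor <;> linarith
      · unfold Filler at hfv; push Not at hfv
        have := h.local_dist hv hfv
        rw [abs_le] at this
        constructor <;> linarith
    · have : v < w := by
        by_contra h2
        exact hcon ⟨hl, by omega⟩
      have := hU.pos_mono v w this.le hw
      exact (dd_le_add p1 p2).trans (by linarith)

/-- In a minimal solution, no set of users moves to facility `0`. -/
theorem MinValid.not_move (h : MinValid U F D σ) {w : ℕ} (hw : w < U.n) (hf : Filler U F σ w)
    (h0 : 0 < σ w) {X : Finset ℕ} (hX : ∀ u ∈ X, u < U.n ∧ σ u = σ w ∧ u ≤ w) (hwX : w ∈ X)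
    (hc : U.r ≤ X.card)
    (hrest : (∀ u < U.n, σ u = σ w → u ∈ X) ∨
      U.r ≤ (((Finset.range U.n).filter fun u => σ u = σ w) \ X).card) : False := by
  classical
  set τ : ℕ → ℕ := fun u => if u ∈ X then 0 else σ u with hτ
  have e1 := h.filler_dist hw hf
  have hval : Valid U F D τ := by
    refine ⟨fun u hu => ?_, fun u hu => ?_, fun u hu => ?_⟩
    · simp only [hτ]; split_ifs
      · have := h.lt w hw; omega
      · exact h.lt u hu
    · simp only [hτ]; split_ifs with hx
      · have h1 := hU.pos_mono u w (hX u hx).2.2 hw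
        have h2 := hF.fp_mono 0 (σ w) (by omega) (h.lt w hw)
        exact (dd_le_add (hU.pos_nonneg _) (hF.fp_nonneg _)).trans (by linarith)
      · exact h.dist u hu
    -- Facility `0` now has at least the users in `X`. Every other facility keeps its users, except
    -- `σ w`, which by `hrest` either loses all of them or keeps at least `r`.
    · by_cases hx : τ u = 0
      · refine hc.trans (Finset.card_le_card fun v hv => ?_)
        simp only [Finset.mem_filter, Finset.mem_range]
        refine ⟨(hX v hv).1, ?_⟩
        rw [hx]; simp [hτ, hv]
      · have hu' : u ∉ X := fun h' => hx (by simp [hτ, h'])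
        have htu : τ u = σ u := by simp [hτ, hu']
        rw [htu] at hx ⊢
        by_cases hs : σ u = σ w
        · rcases hrest with hr | hr
          · exact absurd (hr u hu hs) hu'
          · refine hr.trans (Finset.card_le_card fun v hv => ?_)
            simp only [Finset.mem_sdiff, Finset.mem_filter, Finset.mem_range] at hv ⊢
            refine ⟨hv.1.1, ?_⟩
            simp [hτ, hv.2, hs, hv.1.2]
        · refine (h.card u hu).trans (Finset.card_le_card fun v hv => ?_)
          simp only [Finset.mem_filter, Finset.mem_range] at hv ⊢
          refine ⟨hv.1, ?_⟩
          have : v ∉ X := fun hvX => hs (by rw [← hv.2]; exact (hX v hvX).2.1)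
          simp [hτ, this, hv.2]
  refine h.min τ hval (Prod.Lex.toLex_lt_toLex.2 (Or.inl ?_))
  simp only
  have hXs : X ⊆ Finset.range U.n := fun u hu => by simpa using (hX u hu).1
  rw [← Finset.sum_sdiff hXs, ← Finset.sum_sdiff (f := fun u => w1 U F u (σ u)) hXs]
  have s1 : ∑ u ∈ Finset.range U.n \ X, w1 U F u (τ u) =
      ∑ u ∈ Finset.range U.n \ X, w1 U F u (σ u) := by
    refine Finset.sum_congr rfl fun u hu => ?_
    simp only [Finset.mem_sdiff] at hu
    simp [hτ, hu.2]
  -- Facility `0` has weight `1`, so after the move `X` costs at most `U.n` per user; before it `w`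
  -- alone cost at least `bigM U`, its facility having a positive index.
  have s2 : ∑ u ∈ X, w1 U F u (τ u) ≤ ∑ u ∈ X, U.n := by
    refine Finset.sum_le_sum fun u hu => ?_
    simp only [hτ, hu, if_true, w1, pow_zero, mul_one]
    exact key_le (hX u hu).1
  have s3 : w1 U F w (σ w) ≤ ∑ u ∈ X, w1 U F u (σ u) :=
    Finset.single_le_sum (f := fun u => w1 U F u (σ u)) (fun _ _ => Nat.zero_le _) hwX
  have s4 : X.card ≤ U.n := by simpa using Finset.card_le_card hXs
  have hM : 1 ≤ bigM U := by unfold bigM; exact Nat.mul_pos (by omega) (by omega)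
  have s5 : bigM U ≤ w1 U F w (σ w) := by
    unfold w1 key
    rw [if_neg hf]
    calc bigM U = 1 * bigM U ^ 1 := by simp
      _ ≤ _ := Nat.mul_le_mul (by omega) (Nat.pow_le_pow_right hM h0)
  have s6 : X.card * U.n < bigM U := by unfold bigM; nlinarith
  rw [Finset.sum_const, smul_eq_mul] at s2
  rw [s1]
  omega

/-- Otherwise no user of the cluster comes after `w`, and the whole cluster could move to facility
`0`. -/
theorem MinValid.exists_after (h : MinValid U F D σ) {w : ℕ} (hw : w < U.n)
    (hf : Filler U F σ w) (h0 : 0 < σ w) : ∃ u < U.n, w < u ∧ σ u = σ w := by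
  by_contra hcon
  push Not at hcon
  refine h.not_move hU hF hw hf h0 (X := (Finset.range U.n).filter fun u => σ u = σ w) ?_ ?_
    (h.card w hw) (Or.inl ?_)
  · intro u hu
    simp only [Finset.mem_filter, Finset.mem_range] at hu
    exact ⟨hu.1, hu.2, not_lt.1 fun h' => hcon u hu.1 h' hu.2⟩
  · simpa using hw
  · intro u hu hs
    simpa using ⟨hu, hs⟩

/-- Otherwise `r` of these users, `w` among them, could move to facility `0` while more than `r`
stay behind. -/
theorem MinValid.card_le_filler (h : MinValid U F D σ) {w : ℕ} (hw : w < U.n)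
    (hf : Filler U F σ w) (h0 : 0 < σ w) :
    ((Finset.range (w + 1)).filter fun u => σ u = σ w).card ≤ 2 * U.r := by
  classical
  by_contra hcon
  have hr := hU.one_le_r
  set Y := (Finset.range (w + 1)).filter fun u => σ u = σ w with hY
  have hwY : w ∈ Y := by simp [hY]
  obtain ⟨X, h1, h2, h3⟩ := Finset.exists_subsuperset_card_eq (s := {w}) (t := Y) (n := U.r)
    (by simpa using hwY) (by simpa using hr) (by omega)
  refine h.not_move hU hF hw hf h0 (X := X) ?_ (h1 (by simp)) h3.ge (Or.inr ?_)
  · intro u hu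
    have := h2 hu
    simp only [hY, Finset.mem_filter, Finset.mem_range] at this
    exact ⟨by omega, this.2, by omega⟩
  · have e1 : Y \ X ⊆ ((Finset.range U.n).filter fun u => σ u = σ w) \ X := by
      refine Finset.sdiff_subset_sdiff (fun u hu => ?_) le_rfl
      simp only [hY, Finset.mem_filter, Finset.mem_range] at hu ⊢
      exact ⟨by omega, hu.2⟩
    have e2 := Finset.card_le_card e1
    rw [Finset.card_sdiff_of_subset h2] at e2
    omega

/-- The users that a sweep consumes for the central clusters other than that of facility `0`. -/
noncomputable def swept (U : Users) (F : Facs) (σ : ℕ → ℕ) : Finset ℕ :=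
  open Classical in
  (Finset.range U.n).filter fun u =>
    0 < σ u ∧ ∃ w < U.n, Filler U F σ w ∧ σ w = σ u ∧ u ≤ w

/-- There is at most one facility with fillers per leg apart from facility `0`, and
`card_le_filler`, applied at its last filler, bounds its share. -/
theorem MinValid.card_swept (h : MinValid U F D σ) (hfl : ∀ j < F.m, F.fl j < U.d) :
    (swept U F σ).card ≤ U.d * (2 * U.r) := by
  classical
  set T : Finset ℕ := (Finset.range F.m).filter fun φ => 0 < φ ∧ Multi U F σ φ with hT
  have hmax : ∀ φ ∈ T, ∃ w < U.n, Filler U F σ w ∧ σ w = φ ∧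
      ∀ v < U.n, Filler U F σ v → σ v = φ → v ≤ w := by
    intro φ hφ
    simp only [hT, Finset.mem_filter] at hφ
    obtain ⟨w, hw, hf, hs⟩ := hφ.2.2
    set Z := (Finset.range U.n).filter fun v => Filler U F σ v ∧ σ v = φ
    have hZ : Z.Nonempty := ⟨w, by simp [Z, hw, hf, hs]⟩
    have := Z.max'_mem hZ
    simp only [Z, Finset.mem_filter, Finset.mem_range] at this
    refine ⟨Z.max' hZ, this.1, this.2.1, this.2.2, fun v hv hfv hsv => Z.le_max' _ ?_⟩
    simp [Z, hv, hfv, hsv]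
  have hTd : T.card ≤ U.d := by
    rw [← Finset.card_range U.d]
    refine Finset.card_le_card_of_injOn F.fl ?_ ?_
    · intro φ hφ
      simp only [hT, Finset.coe_filter, Finset.mem_range, Set.mem_ofPred_eq] at hφ
      simpa using hfl φ hφ.1
    -- Of two such facilities on one leg, the lower one has a user after its last filler. That user
    -- is served on its own leg, which is the leg of the higher facility too, against `lower_after`
    -- for a filler of the latter.
    · have key : ∀ φ ∈ T, ∀ ψ ∈ T, F.fl φ = F.fl ψ → ¬ ψ < φ := by
        intro φ hφ ψ hψ he hlt
        obtain ⟨w, hw, hf, hs, -⟩ := hmax φ hφ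
        obtain ⟨w', hw', hf', hs', hm⟩ := hmax ψ hψ
        simp only [hT, Finset.mem_filter] at hψ
        obtain ⟨u, hu, hlt', hsu⟩ := h.exists_after hU hF hw' hf' (by omega)
        have hloc : ¬ Filler U F σ u := fun hfu => by
          have := hm u hu hfu (by omega); omega
        unfold Filler at hloc; push Not at hloc
        refine (h.lower_after hU hF hw hu hf (by omega)).1 ?_
        rw [hloc, hs, he, hsu, hs']
      intro φ hφ ψ hψ he
      have h1 := key φ hφ ψ hψ he
      have h2 := key ψ hψ φ hφ he.symm
      omega
  choose! W hW using hmax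
  have hsub : swept U F σ ⊆ T.biUnion fun φ =>
      (Finset.range (W φ + 1)).filter fun u => σ u = σ (W φ) := by
    intro u hu
    simp only [swept, Finset.mem_filter, Finset.mem_range] at hu
    obtain ⟨hu, h0, w, hw, hf, hs, hle⟩ := hu
    have huT : σ u ∈ T := by
      simp only [hT, Finset.mem_filter, Finset.mem_range]
      exact ⟨h.lt u hu, h0, w, hw, hf, hs⟩
    obtain ⟨q1, q2, q3, q4⟩ := hW _ huT
    simp only [Finset.mem_biUnion, Finset.mem_filter, Finset.mem_range]
    exact ⟨σ u, huT, by have := q4 w hw hf hs; omega, q3.symm⟩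
  calc _ ≤ _ := Finset.card_le_card hsub
    _ ≤ T.card * (2 * U.r) := by
      refine Finset.card_biUnion_le_card_mul _ _ _ fun φ hφ => ?_
      obtain ⟨q1, q2, q3, q4⟩ := hW _ hφ
      simp only [hT, Finset.mem_filter] at hφ
      exact h.card_le_filler hU hF q1 q2 (by omega)
    _ ≤ _ := Nat.mul_le_mul_right _ hTd

end
end Gather

/-! ### Closed legs as bit sets, and the invariant of the sweep -/

namespace Gather

/-- A set of closed legs is stored as a number and closing a leg is an addition, since the machine
has no bit operations. As the bit is clear, no carry occurs. -/
theorem testBit_add_two_pow {S l : ℕ} (h : S.testBit l = false) (j : ℕ) :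
    (S + 2 ^ l).testBit j = (S.testBit j || decide (j = l)) := by
  have e : S + 2 ^ l = S ||| 2 ^ l := by
    have h1 : S &&& 2 ^ l = 0 := by
      apply Nat.eq_of_testBit_eq
      intro i
      rw [Nat.testBit_and, Nat.testBit_two_pow]
      by_cases hi : l = i
      · subst hi; simp [h]
      · simp [hi]
    have h2 := Nat.two_pow_add_eq_or_of_lt (i := l) (b := S % 2 ^ l) (Nat.mod_lt _ (by positivity))
    apply Nat.eq_of_testBit_eq
    intro i
    have hS : S = 2 ^ (l + 1) * (S / 2 ^ (l + 1)) + S % 2 ^ l := by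
      have a1 := Nat.div_add_mod S (2 ^ (l + 1))
      have a2 : S % 2 ^ (l + 1) = S % 2 ^ l := by
        rw [Nat.mod_pow_succ, ← Nat.toNat_testBit, h]; simp
      omega
    have hlt : S % 2 ^ l < 2 ^ l := Nat.mod_lt _ (by positivity)
    have hS2 : S + 2 ^ l = 2 ^ (l + 1) * (S / 2 ^ (l + 1)) + (2 ^ l + S % 2 ^ l) := by omega
    have hb : 2 ^ l + S % 2 ^ l < 2 ^ (l + 1) := by rw [pow_succ]; omega
    rw [hS2, Nat.testBit_two_pow_mul_add _ hb, Nat.testBit_or, Nat.testBit_two_pow]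
    by_cases hi : i < l + 1
    · rw [if_pos hi]
      by_cases hil : i = l
      · subst hil; rw [Nat.testBit_two_pow_add_eq]; simp
      · rw [Nat.testBit_two_pow_add_gt (by omega)]
        simp [Nat.testBit_mod_two_pow, show i < l by omega, show l ≠ i by omega]
    · rw [if_neg hi]
      conv_rhs => rw [hS]
      rw [Nat.testBit_two_pow_mul_add _ (hlt.trans (by rw [pow_succ]; omega)), if_neg hi]
      simp [show l ≠ i by omega]
  rw [e, Nat.testBit_or, Nat.testBit_two_pow]
  congr 1
  simp [eq_comm]

theorem add_two_pow_lt {S l d : ℕ} (hS : S < 2 ^ d) (hl : l < d) (h : S.testBit l = false) :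
    S + 2 ^ l < 2 ^ d := by
  apply Nat.lt_pow_two_of_testBit
  intro i hi
  rw [testBit_add_two_pow h, Nat.testBit_lt_two_pow (hS.trans_le (Nat.pow_le_pow_right (by omega) hi))]
  simp; omega

theorem exists_testBit_false {S d : ℕ} (hS : S < 2 ^ d) (h : S ≠ 2 ^ d - 1) :
    ∃ l < d, S.testBit l = false := by
  by_contra hcon
  push Not at hcon
  apply h
  apply Nat.eq_of_testBit_eq
  intro i
  rw [Nat.testBit_two_pow_sub_one]
  by_cases hi : i < d
  · simpa [hi] using hcon i hi
  · rw [Nat.testBit_lt_two_pow (hS.trans_le (Nat.pow_le_pow_right (by omega) (by omega)))]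
    simp [hi]

/-- One facility reaches both ends and hence everything between them. A negative `a` stands for
users of other legs at distance up to `-a`, for which `F.fp j - a` is the sum of the two distances.
-/
def segOK (F : Facs) (D : ℝ) (l : ℕ) (a b : ℝ) : Prop :=
  ∃ j < F.m, F.fl j = l ∧ b - F.fp j ≤ D ∧ F.fp j - a ≤ D

/-- On its own leg only the side away from the center is tested: a user between the center and
facility `0` is within `F.fp 0`, which the condition `Tk` of `Reach.star` bounds. -/
noncomputable def starDist (U : Users) (F : Facs) (u : ℕ) : ℝ :=
  if U.leg u = F.fl 0 then U.pos u - F.fp 0 else U.pos u + F.fp 0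

/-- Position `p` in the list of all users replaces the step number, so that inductions can pass
users that are not near. -/
def ReachAt (U : Users) (F : Facs) (D : ℝ) (p S c : ℕ) : Prop :=
  U.Reach (segOK F D) (fun u => starDist U F u ≤ D) (fun x => F.fp 0 + x ≤ D)
    (Nat.count U.near p) S c

section
variable {U : Users} {F : Facs} {D : ℝ} {σ : ℕ → ℕ}

theorem segOK.mono {l : ℕ} {a b a' b' : ℝ} (h : segOK F D l a b) (ha : a ≤ a') (hb : b' ≤ b) :
    segOK F D l a' b' := by
  obtain ⟨j, h1, h2, h3, h4⟩ := h
  exact ⟨j, h1, h2, by linarith, by linarith⟩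

theorem Users.WF.X_anti (hU : U.WF) {l j k : ℕ} (hk : k < U.cnt l) (h : j ≤ k) :
    U.X l k ≤ U.X l j := by
  rcases h.eq_or_lt with rfl | h
  · exact le_rfl
  · exact hU.pos_mono _ _ (usr_lt_usr hk h).le (usr_lt (h.trans hk))

theorem ReachAt.skip {p S c : ℕ} (hp : p < U.n) (hS : S.testBit (U.leg p) = true)
    (h : ReachAt U F D (p + 1) S c) : ReachAt U F D p S c := by
  unfold ReachAt at *
  rw [Nat.count_succ] at h
  by_cases hn : U.near p
  · have e : U.nu (Nat.count U.near p) = p := Nat.nth_count hn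
    rw [if_pos hn] at h
    exact .skip (Nat.count_strict_mono hn hp) (by rwa [e]) h
  · rwa [if_neg hn] at h

theorem ReachAt.fill {p S c : ℕ} (hp : p < U.n) (hn : U.near p) (hS : S.testBit (U.leg p) = false)
    (h : ReachAt U F D (p + 1) S (min U.r (c + 1))) : ReachAt U F D p S c := by
  unfold ReachAt at *
  rw [Nat.count_succ, if_pos hn] at h
  have e : U.nu (Nat.count U.near p) = p := Nat.nth_count hn
  exact .fill (Nat.count_strict_mono hn hp) (by rwa [e]) h

/-- The number of users of leg `l` from `p` on. -/
def ge (U : Users) (l p : ℕ) : ℕ := U.cnt l - cb U.leg l p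

theorem ge_le (l p : ℕ) : ge U l p ≤ U.cnt l := Nat.sub_le _ _

/-- What is known of a minimal gathering when the users before `p` are passed and the facilities
from `R` on with fillers are dealt with. Users ahead belong to such facilities if their leg is
closed; if the leg is open and they belong to such a facility, their cluster has no fillers. A
passed user of an open leg is not after the last filler of its cluster. `zero` limits what the
cluster of facility `0` has taken so far. -/
structure Inv (U : Users) (F : Facs) (σ : ℕ → ℕ) (R p S : ℕ) : Prop where
  le : p ≤ U.n
  lt : S < 2 ^ U.d
  closed : ∀ u < U.n, p ≤ u → S.testBit (U.leg u) = true → R ≤ σ u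
  single : ∀ u < U.n, S.testBit (U.leg u) = false → p ≤ u → R ≤ σ u → ¬ Multi U F σ (σ u)
  filled : ∀ u < U.n, S.testBit (U.leg u) = false → u < p →
    ∃ w < U.n, Filler U F σ w ∧ σ w = σ u ∧ u ≤ w
  zero : ((Finset.range p).filter fun u => σ u = 0).card ≤ U.r

variable (hU : U.WF) (hF : F.WF) (hfl : ∀ j < F.m, F.fl j < U.d)
include hU hF hfl

/-- By `filled`, a passed user of an open leg is in `swept` unless its facility is `0`. -/
theorem Inv.cb_le (h : MinValid U F D σ) {R p S l : ℕ} (H : Inv U F σ R p S)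
    (hl : S.testBit l = false) :
    cb U.leg l p ≤ U.d * (2 * U.r) + ((Finset.range p).filter fun u => σ u = 0).card := by
  classical
  rw [cb_eq_card]
  calc _ ≤ (swept U F σ ∪ (Finset.range p).filter fun u => σ u = 0).card := by
        refine Finset.card_le_card fun u hu => ?_
        simp only [Finset.mem_filter, Finset.mem_range, Finset.mem_union, swept] at hu ⊢
        have hun : u < U.n := hu.1.trans_le H.le
        obtain ⟨w, h1, h2, h3, h4⟩ := H.filled u hun (by rw [hu.2]; exact hl) hu.1
        rcases Nat.eq_zero_or_pos (σ u) with h0 | h0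
        · exact Or.inr ⟨hu.1, h0⟩
        · exact Or.inl ⟨hun, h0, w, h1, h2, h3, h4⟩
    _ ≤ _ := Finset.card_union_le _ _
    _ ≤ _ := Nat.add_le_add_right (h.card_swept hU hF hfl) _

/-- On an open leg the restriction of the sweep to `B` users is never felt, by `Inv.cb_le` and
`Inv.zero`. -/
theorem Inv.kap_eq (h : MinValid U F D σ) {R p S l : ℕ} (H : Inv U F σ R p S)
    (hl : S.testBit l = false) : U.kap (Nat.count U.near p) l = ge U l p := by
  have h1 := H.cb_le hU hF hfl h hl
  have h2 := H.zero
  rw [Users.count_near_cb l p H.le, ge, min_eq_right]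
  unfold Users.B
  omega

omit hU hF hfl in
theorem local_of_not_multi {u : ℕ} (hu : u < U.n) (h : ¬ Multi U F σ (σ u)) :
    U.leg u = F.fl (σ u) := by
  by_contra h1
  exact h ⟨u, hu, h1, rfl⟩

omit hU hF hfl in
theorem leg_eq_of_not_multi {u v : ℕ} (hu : u < U.n) (hv : v < U.n) (h : ¬ Multi U F σ (σ u))
    (e : σ v = σ u) : U.leg v = U.leg u := by
  rw [local_of_not_multi (σ := σ) (F := F) hu h, local_of_not_multi (σ := σ) (F := F) hv (by rwa [e]), e]

omit hU hF hfl in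
theorem ge_succ {p l : ℕ} (hp : p < U.n) :
    ge U l p = ge U l (p + 1) + if U.leg p = l then 1 else 0 := by
  have h1 := cb_succ (leg := U.leg) l p
  have h2 := cb_mono (leg := U.leg) l (show p + 1 ≤ U.n from hp)
  unfold ge Users.cnt
  split_ifs at * <;> omega

omit hU hF hfl in
theorem ge_eq_card {l p : ℕ} (hp : p ≤ U.n) :
    ge U l p = ((Finset.Ico p U.n).filter fun u => U.leg u = l).card := by
  obtain ⟨k, hk⟩ : ∃ k, U.n - p = k := ⟨_, rfl⟩
  induction k generalizing p with
  | zero =>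
    have : p = U.n := by omega
    subst this
    simp [ge, Users.cnt]
  | succ k ih =>
    rw [ge_succ (by omega), ih (by omega) (by omega), ← Finset.insert_Ico_add_one_left_eq_Ico
      (show p < U.n by omega), Finset.filter_insert]
    split_ifs with h
    · rw [Finset.card_insert_of_notMem (by simp)]
    · rfl

omit hU hF hfl in
theorem X_ge_of_leg {u l : ℕ} (hu : u < U.n) (hl : U.leg u = l) :
    U.X l (ge U l (u + 1)) = U.pos u := by
  subst hl
  have := usr_fe (leg := U.leg) hu
  unfold Users.X ge Users.cnt
  unfold fe at this
  rw [this]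

omit hfl in
-- Clusters that stay on one leg are intervals of it by `local_mono`. The first one is split off,
-- and the stretch behind it satisfies the hypotheses again.
theorem MinValid.line_suffix (h : MinValid U F D σ) {l p : ℕ} (hp : p ≤ U.n)
    (h1 : ∀ u < U.n, p ≤ u → U.leg u = l → ¬ Multi U F σ (σ u) ∧
      ∀ v < U.n, σ v = σ u → p ≤ v) :
    U.Line (segOK F D) l (ge U l p) := by
  obtain ⟨k, hk⟩ : ∃ k, U.n - p = k := ⟨_, rfl⟩
  induction k using Nat.strong_induction_on generalizing p with
  | _ k ih =>
    by_cases hex : ∃ u < U.n, p ≤ u ∧ U.leg u = l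
    swap
    · push Not at hex
      have : ge U l p = 0 := by
        rw [ge_eq_card hp, Finset.card_eq_zero, Finset.filter_eq_empty_iff]
        intro u hu
        rw [Finset.mem_Ico] at hu
        exact hex u hu.2 hu.1
      rw [this]
      exact .zero
    · classical
      obtain ⟨u0, ⟨hu0, hp0, hl0⟩, hmin⟩ : ∃ u0, (u0 < U.n ∧ p ≤ u0 ∧ U.leg u0 = l) ∧
          ∀ {u}, u < u0 → ¬ (u < U.n ∧ p ≤ u ∧ U.leg u = l) :=
        ⟨Nat.find hex, Nat.find_spec hex, fun {_} h => Nat.find_min hex h⟩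
      obtain ⟨hm0, hc0⟩ := h1 u0 hu0 hp0 hl0
      obtain ⟨e, ⟨hen, hes⟩, hle⟩ : ∃ e, (e < U.n ∧ σ e = σ u0) ∧
          ∀ v, v < U.n ∧ σ v = σ u0 → v ≤ e := by
        have hZn : ((Finset.range U.n).filter fun v => σ v = σ u0).Nonempty :=
          ⟨u0, by simp [hu0]⟩
        refine ⟨Finset.max' _ hZn, ?_, fun v hv => Finset.le_max' _ v ?_⟩
        · simpa using Finset.max'_mem _ hZn
        · simpa using hv
      have hel : U.leg e = l := by rw [leg_eq_of_not_multi hu0 hen hm0 hes, hl0]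
      have hu0e : u0 ≤ e := hle u0 ⟨hu0, rfl⟩
      -- Monotonicity squeezes `σ u` between its values at the first and the last user of the
      -- cluster.
      have hbetween : ∀ u < U.n, p ≤ u → U.leg u = l → u ≤ e → σ u = σ u0 := by
        intro u hu hpu hlu hue
        have hu0u : u0 ≤ u := by
          by_contra hlt
          exact hmin (not_le.1 hlt) ⟨hu, hpu, hlu⟩
        have g1 : σ u0 ≤ σ u := by
          rcases hu0u.eq_or_lt with h2 | h2
          · rw [h2]
          · exact h.local_mono hU hF hu h2 (by rw [hl0, hlu]) (local_of_not_multi hu0 hm0)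
              (local_of_not_multi hu (h1 u hu hpu hlu).1)
        have g2 : σ u ≤ σ e := by
          rcases hue.eq_or_lt with h2 | h2
          · rw [h2]
          · exact h.local_mono hU hF hen h2 (by rw [hel, hlu])
              (local_of_not_multi hu (h1 u hu hpu hlu).1)
              (local_of_not_multi hen (by rw [hes]; exact hm0))
        omega
      have hrec : U.Line (segOK F D) l (ge U l (e + 1)) := by
        refine ih _ ?_ (p := e + 1) (by omega) (fun u hu hpu hlu => ⟨?_, fun v hv hvs => ?_⟩) rfl
        · omega
        · exact (h1 u hu (by omega) hlu).1
        · by_contra hlt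
          have hpv := (h1 u hu (by omega) hlu).2 v hv hvs
          have hlv : U.leg v = l := by
            rw [leg_eq_of_not_multi hu hv (h1 u hu (by omega) hlu).1 hvs, hlu]
          have := hbetween v hv hpv hlv (by omega)
          have := hle u ⟨hu, by omega⟩
          omega
      -- The cluster of `u0` lies entirely from `p` on and not beyond `e`, so its `r` users come on
      -- top of those after `e`.
      have hcard : ge U l (e + 1) + U.r ≤ ge U l p := by
        have e1 := h.card u0 hu0
        rw [ge_eq_card hp, ge_eq_card (show e + 1 ≤ U.n by omega)]
        have : ((Finset.range U.n).filter fun v => σ v = σ u0) ∪ ((Finset.Ico (e + 1) U.n).filter fun u => U.leg u = l) ⊆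
            ((Finset.Ico p U.n).filter fun u => U.leg u = l) := by
          intro v hv
          simp only [Finset.mem_union, Finset.mem_filter, Finset.mem_range,
            Finset.mem_Ico] at hv ⊢
          rcases hv with hv | hv
          · refine ⟨⟨hc0 v hv.1 hv.2, hv.1⟩, ?_⟩
            rw [leg_eq_of_not_multi hu0 hv.1 hm0 hv.2, hl0]
          · exact ⟨⟨by omega, hv.1.2⟩, hv.2⟩
        have e2 := Finset.card_le_card this
        rw [Finset.card_union_of_disjoint] at e2
        · omega
        · rw [Finset.disjoint_left]
          intro v hv hv2
          simp only [Finset.mem_filter, Finset.mem_range, Finset.mem_Ico] at hv hv2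
          have := hle v hv
          omega
      refine .step hcard (ge_le _ _) ?_ hrec
      rw [X_ge_of_leg hen hel]
      have hstart : ge U l p = ge U l (u0 + 1) + 1 := by
        have e1 := ge_succ (U := U) (l := l) hu0
        rw [if_pos hl0] at e1
        rw [← e1, ge_eq_card hp, ge_eq_card hu0.le]
        congr 1
        ext v
        simp only [Finset.mem_filter, Finset.mem_Ico]
        constructor
        · rintro ⟨⟨a, b⟩, c⟩
          refine ⟨⟨?_, b⟩, c⟩
          by_contra hlt
          exact hmin (not_le.1 hlt) ⟨b, a, c⟩
        · rintro ⟨⟨a, b⟩, c⟩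
          exact ⟨⟨by omega, b⟩, c⟩
      rw [hstart, Nat.add_sub_cancel, X_ge_of_leg hu0 hl0]
      have d1 := h.local_dist hu0 (local_of_not_multi hu0 hm0)
      have d2 := h.local_dist hen (local_of_not_multi hen (by rw [hes]; exact hm0))
      rw [hes] at d2
      rw [abs_le] at d1 d2
      exact ⟨σ u0, h.lt _ hu0, by rw [← local_of_not_multi hu0 hm0, hl0], by linarith, by linarith⟩

omit hfl in
/-- All users of the leg from `u` on are in clusters of their own leg. -/
theorem Inv.line_of_single (h : MinValid U F D σ) {R p S u : ℕ} (H : Inv U F σ R p S)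
    (hu : u < U.n) (hpu : p ≤ u) (hS : S.testBit (U.leg u) = false) (hR : R ≤ σ u)
    (hno : ∀ v < U.n, p ≤ v → v < u → U.leg v = U.leg u → σ v < R) :
    (∀ v < U.n, u ≤ v → U.leg v = U.leg u → R ≤ σ v) ∧
      U.Line (segOK F D) (U.leg u) (ge U (U.leg u) u) := by
  have hm := H.single u hu hS hpu hR
  have hloc := local_of_not_multi hu hm
  -- Behind a user served on its own leg there is no filler, so the assignment is monotone from `u`
  -- on.
  have key : ∀ v < U.n, u ≤ v → U.leg v = U.leg u → R ≤ σ v := by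
    intro v hv huv hl
    rcases huv.eq_or_lt with rfl | huv
    · exact hR
    by_cases hfv : Filler U F σ v
    · exact absurd hloc (h.filler_lt_local hU hF hv huv hl.symm hfv)
    · unfold Filler at hfv; push Not at hfv
      exact hR.trans (h.local_mono hU hF hv huv hl.symm hloc hfv)
  refine ⟨key, h.line_suffix hU hF hu.le fun v hv huv hl => ?_⟩
  have hmv := H.single v hv (by rwa [hl]) (hpu.trans huv) (key v hv huv hl)
  refine ⟨hmv, fun x hx hxs => ?_⟩
  have hlx : U.leg x = U.leg u := by rw [leg_eq_of_not_multi hv hx hmv hxs, hl]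
  by_contra hlt
  rcases Nat.lt_or_ge x p with hxp | hxp
  · obtain ⟨w, h1, h2, h3, -⟩ := H.filled x hx (by rwa [hlx]) hxp
    exact hmv ⟨w, h1, h2, by omega⟩
  · have := hno x hx hxp (by omega) hlx
    have := key v hv huv hl
    omega

omit hfl in
-- Only the cluster of facility `0` is still undecided here, and on an open leg its remaining users
-- come first: as soon as a user has another facility, `Inv.line_of_single` covers everything behind
-- it. The position `p'` moves outward over the users of facility `0`.
theorem Inv.starLine (h : MinValid U F D σ) {p S l : ℕ} (H : Inv U F σ 1 p S)
    (hl : S.testBit l = false) {p' : ℕ} (hpp : p ≤ p') (hp' : p' ≤ U.n)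
    (hz : ∀ v < U.n, p ≤ v → v < p' → U.leg v = l → σ v = 0) :
    U.StarLine (segOK F D) (fun u => starDist U F u ≤ D) l (ge U l p') := by
  obtain ⟨k, hk⟩ : ∃ k, U.n - p' = k := ⟨_, rfl⟩
  induction k generalizing p' with
  | zero =>
    have : p' = U.n := by omega
    subst this
    have : ge U l U.n = 0 := by simp [ge, Users.cnt]
    rw [this]
    exact .line .zero
  | succ k ih =>
    have hlt : p' < U.n := by omega
    by_cases hlp : U.leg p' = l
    · by_cases hs : σ p' = 0
      · have e := ge_succ (U := U) (l := l) hlt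
        rw [if_pos hlp] at e
        rw [e]
        refine .step ?_ ?_ (ih (by omega) (by omega) ?_ (by omega))
        · have := ge_le (U := U) l p'; omega
        · have := usr_fe (leg := U.leg) hlt
          unfold fe at this
          rw [hlp] at this
          unfold ge Users.cnt
          rw [this]
          unfold starDist
          split_ifs with h0
          · have := h.local_dist hlt (by rw [h0, hs])
            rw [abs_le, hs] at this
            exact this.2
          · have := h.filler_dist hlt (by unfold Filler; rwa [hs])
            rwa [hs] at this
        · intro v hv hpv hvp hlv
          rcases Nat.lt_or_ge v p' with h1 | h1
          · exact hz v hv hpv h1 hlv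
          · have : v = p' := by omega
            rwa [this]
      · refine .line ?_
        have := H.line_of_single hU hF h hlt hpp (by rwa [hlp]) (by omega)
          (fun v hv h1 h2 h3 => by rw [hz v hv h1 h2 (by rw [h3, hlp])]; omega)
        rw [hlp] at this
        exact this.2
    · have e := ge_succ (U := U) (l := l) hlt
      rw [if_neg hlp] at e
      rw [e, add_zero]
      refine ih (by omega) (by omega) ?_ (by omega)
      intro v hv hpv hvp hlv
      rcases Nat.lt_or_ge v p' with h1 | h1
      · exact hz v hv hpv h1 hlv
      · have : v = p' := by omega
        rw [this] at hlv
        exact absurd hlv hlp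

end
end Gather

/-! ### The sweep finds every gathering of value at most `D` -/

namespace Gather
section
variable {U : Users} {F : Facs} {D : ℝ} {σ : ℕ → ℕ}

theorem prev_count_le (hU : U.WF) {p w : ℕ} (hp : p ≤ w + 1) (hw : w < U.n) :
    U.prev (Nat.count U.near p) ≤ U.pos w := by
  obtain ⟨k, hk⟩ : ∃ k, Nat.count U.near p = k := ⟨_, rfl⟩
  rw [hk]
  cases k with
  | zero => exact hU.pos_nonneg w
  | succ k =>
    have := Users.nu_lt_of_count (U := U) (q := k) (p := p) (by omega)
    exact hU.pos_mono _ _ (by omega) hw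

theorem prev_nonneg (hU : U.WF) (q : ℕ) : 0 ≤ U.prev q := by
  cases q with
  | zero => exact le_rfl
  | succ q => exact hU.pos_nonneg _

variable (hU : U.WF) (hF : F.WF) (hfl : ∀ j < F.m, F.fl j < U.d)

theorem card_filter_succ {p : ℕ} (Q : ℕ → Prop) [DecidablePred Q] :
    ((Finset.range (p + 1)).filter Q).card =
      ((Finset.range p).filter Q).card + if Q p then 1 else 0 := by
  rw [Finset.range_add_one, Finset.filter_insert]
  split_ifs with h
  · rw [Finset.card_insert_of_notMem (by simp)]
  · rfl

include hU hF hfl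

/-- If no open leg has a user in a central cluster left, all open legs are closed. -/
theorem Inv.close_all (h : MinValid U F D σ) {p S : ℕ} (H : Inv U F σ 0 p S) :
    ReachAt U F D p S 0 := by
  obtain ⟨k, hk⟩ : ∃ k, 2 ^ U.d - S = k := ⟨_, rfl⟩
  induction k using Nat.strong_induction_on generalizing S with
  | _ k ih =>
    by_cases hS : S = 2 ^ U.d - 1
    · subst hS; exact .done
    · obtain ⟨l, hl, hSl⟩ := exists_testBit_false H.lt hS
      have hlt := add_two_pow_lt H.lt hl hSl
      have h2l : 0 < 2 ^ l := by positivity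
      have hnm : ∀ u < U.n, p ≤ u → U.leg u = l → ¬ Multi U F σ (σ u) := fun u hu hpu hlu =>
        H.single u hu (by rwa [hlu]) hpu (Nat.zero_le _)
      refine .close hl hSl ?_ (ih (2 ^ U.d - (S + 2 ^ l)) (by omega) (S := S + 2 ^ l) ?_ rfl)
      · rw [H.kap_eq hU hF hfl h hSl]
        refine h.line_suffix hU hF H.le fun u hu hpu hlu => ⟨hnm u hu hpu hlu, fun v hv hvs => ?_⟩
        by_contra hvp
        have hlv := leg_eq_of_not_multi hu hv (hnm u hu hpu hlu) hvs
        obtain ⟨w, h1, h2, h3, -⟩ := H.filled v hv (by rwa [hlv, hlu]) (not_le.1 hvp)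
        exact hnm u hu hpu hlu ⟨w, h1, h2, by omega⟩
      · refine ⟨H.le, hlt, fun _ _ _ _ => Nat.zero_le _, ?_, ?_, H.zero⟩
        · intro u hu hS'
          rw [testBit_add_two_pow hSl] at hS'
          simp only [Bool.or_eq_false_iff] at hS'
          exact H.single u hu hS'.1
        · intro u hu hS'
          rw [testBit_add_two_pow hSl] at hS'
          simp only [Bool.or_eq_false_iff] at hS'
          exact H.filled u hu hS'.1

omit hF hfl in
/-- A large enough block at the top may be cut down to at most `2 r` users. -/
theorem reach_top {q S c l : ℕ} (hl : l < U.d) (hS : S.testBit l = false)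
    (hk : U.kap q l ≤ U.cnt l)
    (h : ∃ a, 1 ≤ a ∧ a ≤ U.kap q l ∧ U.r ≤ c + a ∧
      segOK F D l (- U.prev q) (U.X l (U.kap q l - a)) ∧
        U.Line (segOK F D) l (U.kap q l - a))
    {St : ℕ → Prop} {Tk : ℝ → Prop}
    (hR : U.Reach (segOK F D) St Tk q (S + 2 ^ l) 0) : U.Reach (segOK F D) St Tk q S c := by
  classical
  -- Take the shortest feasible block. If it had more than `2 * r` users, its farthest `r` users
  -- would form a cluster of their own with the same facility, and the others would still complete
  -- the current cluster.
  obtain ⟨h1, h2, h3, h4, h5⟩ := Nat.find_spec h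
  have hmin := fun {a} => Nat.find_min h (m := a)
  generalize Nat.find h = a at *
  have hr := hU.one_le_r
  refine .top hl hS h1 ?_ h2 h3 h4 h5 hR
  by_contra hlt
  refine hmin (a := a - U.r) (by omega) ⟨by omega, by omega, by omega, ?_, ?_⟩
  · exact h4.mono le_rfl (hU.X_anti (by omega) (by omega))
  · refine .step (κ' := U.kap q l - a) (by omega) (by omega) ?_ h5
    refine h4.mono ?_ le_rfl
    have := prev_nonneg hU q
    have := hU.pos_nonneg (usr U.n U.leg l (U.kap q l - (a - U.r) - 1))
    unfold Users.X
    linarith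

/-- Close the leg of the central cluster all of whose fillers are swept. -/
theorem Inv.top_close (h : MinValid U F D σ) {φ w S : ℕ} (H : Inv U F σ (φ + 1) (w + 1) S)
    (hw : w < U.n) (hf : Filler U F σ w) (hs : σ w = φ)
    (hmax : ∀ v < U.n, Filler U F σ v → σ v = φ → v ≤ w)
    (hex : ∃ u < U.n, w < u ∧ σ u = φ)
    (ih : ∀ S', S' < 2 ^ U.d → (∀ u < U.n, w + 1 ≤ u → S'.testBit (U.leg u) = true → φ ≤ σ u) →
      (∀ u < U.n, S'.testBit (U.leg u) = false → w + 1 ≤ u → φ ≤ σ u → ¬ Multi U F σ (σ u)) →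
      (∀ u < U.n, S'.testBit (U.leg u) = false → u < w + 1 →
        ∃ w < U.n, Filler U F σ w ∧ σ w = σ u ∧ u ≤ w) → ReachAt U F D (w + 1) S' 0) :
    ReachAt U F D (w + 1) S
      (min U.r ((Finset.range (w + 1)).filter fun u => σ u = φ).card) := by
  have hmulti : Multi U F σ φ := ⟨w, hw, hf, hs⟩
  have hloc : ∀ u < U.n, w < u → σ u = φ → U.leg u = F.fl φ := by
    intro u hu hwu hsu
    by_contra hcon
    have := hmax u hu (by unfold Filler; rwa [hsu]) hsu
    omega
  have hφm : φ < F.m := hs ▸ h.lt w hw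
  have hl : F.fl φ < U.d := hfl _ hφm
  obtain ⟨u1, hu1, hwu1, hsu1⟩ := hex
  -- On a closed leg, `closed` would give the user `u1` of `φ` a facility beyond `φ`.
  have hSl : S.testBit (F.fl φ) = false := by
    by_contra hcon
    have := H.closed u1 hu1 hwu1 (by rw [hloc u1 hu1 hwu1 hsu1]; simpa using hcon)
    omega
  have hk := H.kap_eq hU hF hfl h hSl
  obtain ⟨e, ⟨hen, hes⟩, hle⟩ : ∃ e, (e < U.n ∧ σ e = φ) ∧ ∀ v, v < U.n ∧ σ v = φ → v ≤ e := by
    have hZn : ((Finset.range U.n).filter fun v => σ v = φ).Nonempty := ⟨u1, by simp [hu1, hsu1]⟩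
    refine ⟨Finset.max' _ hZn, ?_, fun v hv => Finset.le_max' _ v ?_⟩
    · simpa using Finset.max'_mem _ hZn
    · simpa using hv
  have hwe : w < e := hwu1.trans_le (hle u1 ⟨hu1, hsu1⟩)
  have hel := hloc e hen hwe hes
  -- On the leg of `φ` no user belongs to a lower facility, by `lower_after`; so closing this leg
  -- takes nothing away from later clusters.
  have hup : ∀ u < U.n, w < u → U.leg u = F.fl φ → φ ≤ σ u := by
    intro u hu hwu hlu
    by_contra hlt
    exact (h.lower_after hU hF hw hu hf (by omega)).1 (by rw [hs, hlu])
  have hnm : ∀ u < U.n, w < u → U.leg u = F.fl φ → φ < σ u → ¬ Multi U F σ (σ u) :=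
    fun u hu hwu hlu hlt => H.single u hu (by rwa [hlu]) hwu hlt
  have hbetween : ∀ u < U.n, w < u → U.leg u = F.fl φ → u ≤ e → σ u = φ := by
    intro u hu hwu hlu hue
    rcases (hup u hu hwu hlu).eq_or_lt with h1 | h1
    · exact h1.symm
    have h2 := local_of_not_multi hu (hnm u hu hwu hlu h1)
    rcases hue.eq_or_lt with h3 | h3
    · rw [h3, hes]
    · have := h.local_mono hU hF hen h3 (by rw [hlu, hel]) h2 (by rw [hes, hel])
      omega
  have hlast : ∀ u < U.n, e < u → U.leg u = F.fl φ → φ < σ u := by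
    intro u hu heu hlu
    have h1 := hup u hu (by omega) hlu
    rcases h1.eq_or_lt with h2 | h2
    · have := hle u ⟨hu, h2.symm⟩; omega
    · exact h2
  -- Beyond `w`, the leg consists of the remaining users of `φ`, all up to `e`, and then of users of
  -- higher facilities. The former are the block that completes the cluster.
  have hcard : ge U (F.fl φ) (w + 1) = ge U (F.fl φ) (e + 1) +
      ((Finset.Ico (w + 1) U.n).filter fun u => σ u = φ).card := by
    rw [ge_eq_card hw, ge_eq_card hen, ← Finset.card_union_of_disjoint]
    · congr 1
      ext v
      simp only [Finset.mem_union, Finset.mem_filter, Finset.mem_Ico]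
      constructor
      · rintro ⟨⟨h1, h2⟩, h3⟩
        by_cases hve : v ≤ e
        · exact Or.inr ⟨⟨h1, h2⟩, hbetween v h2 h1 h3 hve⟩
        · exact Or.inl ⟨⟨by omega, h2⟩, h3⟩
      · rintro (⟨⟨h1, h2⟩, h3⟩ | ⟨⟨h1, h2⟩, h3⟩)
        · exact ⟨⟨by omega, h2⟩, h3⟩
        · exact ⟨⟨h1, h2⟩, hloc v h2 h1 h3⟩
    · rw [Finset.disjoint_left]
      intro v hv hv2
      simp only [Finset.mem_filter, Finset.mem_Ico] at hv hv2
      have := hle v ⟨hv2.1.2, hv2.2⟩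
      omega
  have htot : U.r ≤ ((Finset.range (w + 1)).filter fun u => σ u = φ).card +
      ((Finset.Ico (w + 1) U.n).filter fun u => σ u = φ).card := by
    have e1 := h.card w hw
    rw [hs] at e1
    refine e1.trans (le_trans (Finset.card_le_card ?_) (Finset.card_union_le _ _))
    intro v hv
    simp only [Finset.mem_union, Finset.mem_filter, Finset.mem_Ico, Finset.mem_range] at hv ⊢
    by_cases hvw : v < w + 1
    · exact Or.inl ⟨hvw, hv.2⟩
    · exact Or.inr ⟨⟨by omega, hv.1⟩, hv.2⟩
  have hpos : 1 ≤ ((Finset.Ico (w + 1) U.n).filter fun u => σ u = φ).card :=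
    Finset.card_pos.2 ⟨u1, by simp [hu1, hsu1]; omega⟩
  refine reach_top hU hl hSl (by rw [hk]; exact ge_le _ _)
    ⟨((Finset.Ico (w + 1) U.n).filter fun u => σ u = φ).card, hpos, by omega, by omega, ?_, ?_⟩
    (ih (S + 2 ^ F.fl φ) (add_two_pow_lt H.lt hl hSl) ?_ ?_ ?_)
  · rw [hk, hcard, Nat.add_sub_cancel, X_ge_of_leg hen hel]
    have d1 := h.local_dist hen (by rw [hes, hel])
    have d2 := h.filler_dist hw hf
    have d3 := prev_count_le hU (le_refl (w + 1)) hw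
    rw [hes, abs_le] at d1
    rw [hs] at d2
    exact ⟨φ, hφm, rfl, d1.2, by linarith⟩
  · rw [hk, hcard, Nat.add_sub_cancel]
    refine h.line_suffix hU hF hen fun u hu heu hlu => ?_
    have hm := hnm u hu (by omega) hlu (hlast u hu heu hlu)
    refine ⟨hm, fun v hv hvs => ?_⟩
    by_contra hve
    have hlv := leg_eq_of_not_multi hu hv hm hvs
    by_cases hvw : v < w + 1
    · obtain ⟨x, h1, h2, h3, -⟩ := H.filled v hv (by rwa [hlv, hlu]) hvw
      exact hm ⟨x, h1, h2, by omega⟩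
    · have := hbetween v hv (by omega) (by rw [hlv, hlu]) (by omega)
      have := hlast u hu heu hlu
      omega
  · intro u hu hwu hS'
    rw [testBit_add_two_pow hSl] at hS'
    simp only [Bool.or_eq_true, decide_eq_true_eq] at hS'
    rcases hS' with h1 | h1
    · exact (Nat.le_succ _).trans (H.closed u hu hwu h1)
    · exact hup u hu hwu h1
  · intro u hu hS' hwu hle'
    rw [testBit_add_two_pow hSl] at hS'
    simp only [Bool.or_eq_false_iff, decide_eq_false_iff_not] at hS'
    rcases hle'.eq_or_lt with h1 | h1
    · exact absurd (hloc u hu hwu h1.symm) hS'.2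
    · exact H.single u hu hS'.1 hwu h1
  · intro u hu hS'
    rw [testBit_add_two_pow hSl] at hS'
    simp only [Bool.or_eq_false_iff] at hS'
    exact H.filled u hu hS'.1

/-- Sweep the fillers of the cluster of `φ`. -/
theorem Inv.sweep (h : MinValid U F D σ) {φ w : ℕ}
    (hw : w < U.n) (hf : Filler U F σ w) (hs : σ w = φ)
    (hmax : ∀ v < U.n, Filler U F σ v → σ v = φ → v ≤ w)
    (ih : ∀ S, Inv U F σ φ (w + 1) S → (∀ u < w + 1, φ ≤ σ u) → ReachAt U F D (w + 1) S 0)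
    {p S : ℕ} (hp : p ≤ w + 1) (H : Inv U F σ (φ + 1) p S) (hb : ∀ u < p, φ ≤ σ u) :
    ReachAt U F D p S (min U.r ((Finset.range p).filter fun u => σ u = φ).card) := by
  obtain ⟨k, hk⟩ : ∃ k, w + 1 - p = k := ⟨_, rfl⟩
  -- As soon as `r` users of facility `0` are passed, the star alternative ends the sweep. This
  -- early end is what keeps `Inv.zero` true.
  by_cases hstar : φ = 0 ∧ U.r ≤ ((Finset.range p).filter fun u => σ u = φ).card
  · obtain ⟨h0, hr⟩ := hstar
    rw [min_eq_left hr]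
    refine .star ?_ fun l hl hSl => ?_
    · have d2 := h.filler_dist hw hf
      have d3 := prev_count_le hU hp hw
      rw [hs, h0] at d2
      linarith
    · rw [H.kap_eq hU hF hfl h hSl]
      subst h0
      exact H.starLine hU hF h hSl le_rfl H.le (fun v _ h1 h2 => by omega)
  have hzero : ((Finset.range p).filter fun u => σ u = 0).card < U.r := by
    rcases Nat.eq_zero_or_pos φ with h0 | h0
    · subst h0
      by_contra h1
      exact hstar ⟨rfl, not_lt.1 h1⟩
    · have : ((Finset.range p).filter fun u => σ u = 0) = ∅ := by
        rw [Finset.filter_eq_empty_iff]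
        intro u hu
        have := hb u (by simpa using hu)
        omega
      rw [this]
      exact hU.one_le_r
  have hzero' : ((Finset.range (p + 1)).filter fun u => σ u = 0).card ≤ U.r := by
    rw [card_filter_succ]; split_ifs <;> omega
  induction k generalizing p S with
  | zero =>
    obtain rfl : p = w + 1 := by omega
    -- For facility `0`, fewer than `r` of its users are passed, so some are left behind `w`; for
    -- all others this is `exists_after`.
    have hex : ∃ u < U.n, w < u ∧ σ u = φ := by
      rcases Nat.eq_zero_or_pos φ with h0 | h0
      · subst h0
        by_contra hcon
        push Not at hcon
        have e1 := h.card w hw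
        rw [hs] at e1
        refine hstar ⟨rfl, e1.trans (Finset.card_le_card fun v hv => ?_)⟩
        simp only [Finset.mem_filter, Finset.mem_range] at hv ⊢
        refine ⟨?_, hv.2⟩
        by_contra hvw
        exact hcon v hv.1 (by omega) hv.2
      · have := h.exists_after hU hF hw hf (by omega)
        rwa [hs] at this
    refine H.top_close hU hF hfl h hw hf hs hmax hex fun S' h1 h2 h3 h4 => ih S' ?_ hb
    exact ⟨H.le, h1, h2, h3, h4, H.zero⟩
  | succ k IH =>
    have hpw : p ≤ w := by omega
    have hpn : p < U.n := by omega
    -- A user of a lower facility would come after the filler `w`.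
    have hge : φ ≤ σ p := by
      by_contra hlt
      have := (h.lower_after hU hF hw hpn hf (by omega)).2
      omega
    have hb' : ∀ u < p + 1, φ ≤ σ u := by
      intro u hu
      rcases Nat.lt_succ_iff_lt_or_eq.1 hu with h1 | rfl
      · exact hb u h1
      · exact hge
    have IH' : ∀ S', Inv U F σ (φ + 1) (p + 1) S' → ReachAt U F D (p + 1) S'
        (min U.r ((Finset.range (p + 1)).filter fun u => σ u = φ).card) := by
      intro S' H'
      by_cases hstar' : φ = 0 ∧ U.r ≤ ((Finset.range (p + 1)).filter fun u => σ u = φ).card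
      · obtain ⟨h0, hr⟩ := hstar'
        rw [min_eq_left hr]
        refine .star ?_ fun l hl hSl => ?_
        · have d2 := h.filler_dist hw hf
          have d3 := prev_count_le hU (show p + 1 ≤ w + 1 by omega) hw
          rw [hs, h0] at d2
          linarith
        · rw [H'.kap_eq hU hF hfl h hSl]
          subst h0
          exact H'.starLine hU hF h hSl le_rfl H'.le (fun v _ h1 h2 => by omega)
      · have hz : ((Finset.range (p + 1)).filter fun u => σ u = 0).card < U.r := by
          rcases Nat.eq_zero_or_pos φ with h0 | h0
          · subst h0
            by_contra h1
            exact hstar' ⟨rfl, not_lt.1 h1⟩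
          · have : ((Finset.range (p + 1)).filter fun u => σ u = 0) = ∅ := by
              rw [Finset.filter_eq_empty_iff]
              intro u hu
              have := hb' u (by simpa using hu)
              omega
            rw [this]
            exact hU.one_le_r
        refine IH (by omega) H' hb' (by omega) hstar' hz ?_
        rw [card_filter_succ]; split_ifs <;> omega
    have e1 := card_filter_succ (p := p) (fun u => σ u = φ)
    cases hSp : S.testBit (U.leg p) with
    | true =>
      have h1 := H.closed p hpn le_rfl hSp
      rw [if_neg (by omega), add_zero] at e1
      rw [← e1]
      refine ReachAt.skip hpn hSp (IH' S ⟨hpn, H.lt, fun u hu h2 => H.closed u hu (by omega),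
        fun u hu h2 h3 => H.single u hu h2 (by omega), fun u hu h2 h3 => ?_, hzero'⟩)
      rcases Nat.lt_succ_iff_lt_or_eq.1 h3 with h4 | rfl
      · exact H.filled u hu h2 h4
      · rw [hSp] at h2; cases h2
    | false =>
      -- A user of `φ` is counted for the current cluster. A user of a higher facility begins a
      -- stretch of its leg that splits into clusters of that leg, so the leg is closed before the
      -- user is passed.
      rcases hge.eq_or_lt with h1 | h1
      · rw [if_pos h1.symm] at e1
        have hnear : U.near p := by
          refine ⟨hpn, ?_⟩
          have := H.cb_le hU hF hfl h hSp
          unfold Users.B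
          omega
        refine ReachAt.fill hpn hnear hSp ?_
        have e2 : min U.r (min U.r ((Finset.range p).filter fun u => σ u = φ).card + 1) =
            min U.r ((Finset.range (p + 1)).filter fun u => σ u = φ).card := by omega
        rw [e2]
        refine IH' S ⟨hpn, H.lt, fun u hu h2 => H.closed u hu (by omega),
          fun u hu h2 h3 => H.single u hu h2 (by omega), fun u hu h2 h3 => ?_, hzero'⟩
        rcases Nat.lt_succ_iff_lt_or_eq.1 h3 with h4 | rfl
        · exact H.filled u hu h2 h4
        · exact ⟨w, hw, hf, by omega, hpw⟩
      · rw [if_neg (by omega), add_zero] at e1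
        rw [← e1]
        obtain ⟨g1, g2⟩ := H.line_of_single hU hF h hpn le_rfl hSp h1 (fun v _ h2 h3 => by omega)
        have hl := hU.leg_lt p hpn
        refine .close hl hSp ?_ (ReachAt.skip hpn ?_ (IH' (S + 2 ^ U.leg p) ⟨hpn,
          add_two_pow_lt H.lt hl hSp, fun u hu h2 h3 => ?_, fun u hu h2 h3 => ?_,
          fun u hu h2 h3 => ?_, hzero'⟩))
        · rwa [H.kap_eq hU hF hfl h hSp]
        · rw [testBit_add_two_pow hSp]; simp
        · rw [testBit_add_two_pow hSp] at h3
          simp only [Bool.or_eq_true, decide_eq_true_eq] at h3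
          rcases h3 with h3 | h3
          · exact H.closed u hu (by omega) h3
          · exact g1 u hu (by omega) h3
        · rw [testBit_add_two_pow hSp] at h2
          simp only [Bool.or_eq_false_iff] at h2
          exact H.single u hu h2.1 (by omega)
        · rw [testBit_add_two_pow hSp] at h2
          simp only [Bool.or_eq_false_iff, decide_eq_false_iff_not] at h2
          rcases Nat.lt_succ_iff_lt_or_eq.1 h3 with h4 | rfl
          · exact H.filled u hu h2.1 h4
          · exact absurd rfl h2.2

/-- Induction on `R`. The next cluster is that of the highest facility below `R` with a filler, and
the sweep runs to its last filler. Only users of this or of higher facilities are passed on the way,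
so the lower clusters find all their users ahead. If no such facility is left, `close_all` finishes.
-/
theorem Inv.stage (h : MinValid U F D σ) {R p S : ℕ} (H : Inv U F σ R p S)
    (hb : ∀ u < p, R ≤ σ u) : ReachAt U F D p S 0 := by
  classical
  induction R using Nat.strong_induction_on generalizing p S with
  | _ R ih =>
    by_cases hR : ∃ φ < R, Multi U F σ φ
    · obtain ⟨φ, ⟨hφ, w0, hw0, hf0, hs0⟩, hφmax⟩ : ∃ φ, (φ < R ∧ Multi U F σ φ) ∧
          ∀ ψ, ψ < R ∧ Multi U F σ ψ → ψ ≤ φ := by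
        have hZn : ((Finset.range R).filter fun φ => Multi U F σ φ).Nonempty := by
          obtain ⟨φ, h1, h2⟩ := hR
          exact ⟨φ, by simp [h1, h2]⟩
        refine ⟨Finset.max' _ hZn, ?_, fun v hv => Finset.le_max' _ v ?_⟩
        · simpa using Finset.max'_mem _ hZn
        · simpa using hv
      obtain ⟨w, ⟨hw, hf, hs⟩, hmax⟩ : ∃ w, (w < U.n ∧ Filler U F σ w ∧ σ w = φ) ∧
          ∀ v, v < U.n ∧ Filler U F σ v ∧ σ v = φ → v ≤ w := by
        have hZn : ((Finset.range U.n).filter fun w => Filler U F σ w ∧ σ w = φ).Nonempty :=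
          ⟨w0, by simp [hw0, hf0, hs0]⟩
        refine ⟨Finset.max' _ hZn, ?_, fun v hv => Finset.le_max' _ v ?_⟩
        · simpa using Finset.max'_mem _ hZn
        · simpa using hv
      have hpw : p ≤ w := by
        by_contra hlt
        have := hb w (by omega)
        omega
      have hc : ((Finset.range p).filter fun u => σ u = φ).card = 0 := by
        rw [Finset.card_eq_zero, Finset.filter_eq_empty_iff]
        intro u hu
        have := hb u (by simpa using hu)
        omega
      have := Inv.sweep hU hF hfl h hw hf hs (fun v h1 h2 h3 => hmax v ⟨h1, h2, h3⟩)
        (fun S' H' hb' => ih φ hφ H' hb') (p := p) (S := S) (by omega)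
        ⟨H.le, H.lt, fun u h1 h2 h3 => hφ.trans_le (H.closed u h1 h2 h3),
          fun u h1 h2 h3 h4 => ?_, H.filled, H.zero⟩ (fun u hu => hφ.le.trans (hb u hu))
      · rwa [hc, Nat.min_zero] at this
      · by_cases h5 : R ≤ σ u
        · exact H.single u h1 h2 h3 h5
        · intro h6
          have := hφmax _ ⟨not_le.1 h5, h6⟩
          omega
    · push Not at hR
      refine Inv.close_all hU hF hfl h ⟨H.le, H.lt, fun _ _ _ _ => Nat.zero_le _,
        fun u h1 h2 h3 _ => ?_, H.filled, H.zero⟩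
      by_cases h5 : R ≤ σ u
      · exact H.single u h1 h2 h3 h5
      · exact hR _ (not_le.1 h5)

/-- If there is a gathering of value at most `D`, the sweep finds one. -/
theorem reach_of_valid (h : Valid U F D σ) :
    U.Reach (segOK F D) (fun u => starDist U F u ≤ D) (fun x => F.fp 0 + x ≤ D) 0 0 0 := by
  obtain ⟨τ, hτ⟩ := exists_minValid U F h
  have := Inv.stage hU hF hfl hτ (R := F.m) (p := 0) (S := 0)
    ⟨Nat.zero_le _, by positivity, fun u _ _ h1 => by simp at h1,
      fun u hu _ _ h1 => absurd (hτ.lt u hu) (not_lt.2 h1), fun u _ _ h1 => by omega, by simp⟩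
    (fun u hu => by omega)
  simpa [ReachAt] using this

end
end Gather

/-! ### Costs and certificates of clusters for both problems -/

namespace Gather

/-- An instance of clustering (`mode = true`) or gathering (`mode = false`). -/
structure Inst extends Users where
  mode : Bool
  m : ℕ
  fl : ℕ → ℕ
  fp : ℕ → ℝ

structure Inst.WF (I : Inst) : Prop extends I.toUsers.WF where
  fl_lt : ∀ j < I.m, I.fl j < I.d
  fp_nonneg : ∀ j, 0 ≤ I.fp j
  fp_mono : ∀ i j, i ≤ j → j < I.m → I.fp i ≤ I.fp j
  one_le_n : 1 ≤ I.n
  one_le_m : I.mode = false → 1 ≤ I.m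

namespace Inst
variable (I : Inst)

/-- The cost of a user at distance `x` from the center in a central star cluster. -/
noncomputable def tok (x : ℝ) : ℝ := if I.mode then x + x else I.fp 0 + x

noncomputable def star (u : ℕ) : ℝ :=
  if I.mode then I.pos u + I.pos u
  else if I.leg u = I.fl 0 then I.pos u - I.fp 0 else I.pos u + I.fp 0

/-- A bound for the cost of one cluster containing all users. It serves as infinity: the tables are
exact only below it, and an optimum that is not below it is attained by the single cluster. -/
noncomputable def big : ℝ := I.tok (I.pos (I.n - 1))

/-- The cost of a cluster that is centered on leg `l` and reaches from `lo` to `hi`, where points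
on other legs have negative coordinates. -/
noncomputable def g (l : ℕ) (lo hi : ℝ) : ℝ :=
  if I.mode then max (hi - lo) (-lo - lo)
  else if h : ((Finset.range I.m).filter fun j => I.fl j = l).Nonempty then
    Finset.inf' _ h fun j => max (hi - I.fp j) (I.fp j - lo)
  else I.big

/-- Evidence that a segment costs at most `v`. In gathering it names a facility, which is recorded
for the output; in clustering, twice `-lo` bounds the distance of two users on other legs. -/
def cert (φ l : ℕ) (lo hi v : ℝ) : Prop :=
  if I.mode then hi - lo ≤ v ∧ -lo - lo ≤ v
  else φ < I.m ∧ I.fl φ = l ∧ hi - I.fp φ ≤ v ∧ I.fp φ - lo ≤ v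

/-- The users in `C` form a cluster of cost at most `D`. -/
def fits (φ : ℕ) (D : ℝ) (C : ℕ → Prop) : Prop :=
  if I.mode then ∀ u < I.n, ∀ v < I.n, C u → C v → dd (I.leg u) (I.pos u) (I.leg v) (I.pos v) ≤ D
  else φ < I.m ∧ ∀ u < I.n, C u → dd (I.leg u) (I.pos u) (I.fl φ) (I.fp φ) ≤ D

/-- The distance of the facility `k` positions before the end of leg `l`. -/
noncomputable def Y (l k : ℕ) : ℝ := I.fp (usr I.m I.fl l k)

def cntF (l : ℕ) : ℕ := cb I.fl l I.m

def segLe (D : ℝ) (l : ℕ) (a b : ℝ) : Prop := I.g l a b ≤ D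

abbrev LineLe (D : ℝ) (l κ : ℕ) : Prop := I.toUsers.Line (I.segLe D) l κ

abbrev StarLe (D : ℝ) (l κ : ℕ) : Prop :=
  I.toUsers.StarLine (I.segLe D) (fun u => I.star u ≤ D) l κ

abbrev ReachLe (D : ℝ) (q S c : ℕ) : Prop :=
  I.toUsers.Reach (I.segLe D) (fun u => I.star u ≤ D) (fun x => I.tok x ≤ D) q S c

variable {I}

/-- Widening a segment never makes it cheaper; the queue of cuts rests on this monotonicity in both
ends. -/
theorem g_mono {l : ℕ} {lo hi lo' hi' : ℝ} (h : lo' ≤ lo) (h' : hi ≤ hi') :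
    I.g l lo hi ≤ I.g l lo' hi' := by
  unfold g
  split_ifs with h1 h2
  · exact max_le_max (by linarith) (by linarith)
  · refine Finset.inf'_mono_fun fun j _ => max_le_max (by linarith) (by linarith)
  · exact le_rfl

theorem g_le (hm : I.mode = false) {l j : ℕ} (hj : j < I.m) (hl : I.fl j = l) (lo hi : ℝ) :
    I.g l lo hi ≤ max (hi - I.fp j) (I.fp j - lo) := by
  unfold g
  have hj' : j ∈ (Finset.range I.m).filter fun j => I.fl j = l := by simp [hj, hl]
  rw [if_neg (by simp [hm]), dif_pos ⟨j, hj'⟩]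
  exact Finset.inf'_le _ hj'

theorem g_eq_big (hm : I.mode = false) {l : ℕ} (hl : I.cntF l = 0) (lo hi : ℝ) :
    I.g l lo hi = I.big := by
  unfold g
  rw [if_neg (by simp [hm]), dif_neg]
  rw [Finset.not_nonempty_iff_eq_empty, ← Finset.card_eq_zero, ← cb_eq_card]
  exact hl

theorem WF.Y_anti (hI : I.WF) {l j k : ℕ} (hk : k < I.cntF l) (h : j ≤ k) : I.Y l k ≤ I.Y l j := by
  rcases h.eq_or_lt with rfl | h
  · exact le_rfl
  · exact hI.fp_mono _ _ (usr_lt_usr hk h).le (usr_lt (h.trans hk))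

/-- The condition under which the facility `k` is best for the segment from `lo` to `hi`. -/
theorem WF.g_eq (hI : I.WF) (hm : I.mode = false) {l k : ℕ} {lo hi : ℝ} (hk : k < I.cntF l)
    (h1 : k = 0 ∨ lo + hi ≤ I.Y l (k - 1) + I.Y l k)
    (h2 : k + 1 = I.cntF l ∨ I.Y l k + I.Y l (k + 1) < lo + hi) :
    I.g l lo hi = max (hi - I.Y l k) (I.Y l k - lo) := by
  refine le_antisymm (g_le hm (usr_lt hk) (leg_usr hk) lo hi) ?_
  conv_rhs => unfold g
  rw [if_neg (by simp [hm]), dif_pos ⟨usr I.m I.fl l k, by simp [usr_lt hk, leg_usr hk]⟩]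
  refine Finset.le_inf' _ _ fun j hj => ?_
  simp only [Finset.mem_filter, Finset.mem_range] at hj
  obtain ⟨hj, rfl⟩ := hj
  have hf := fe_lt_cb (leg := I.fl) hj
  have hfp : I.fp j = I.Y (I.fl j) (fe I.m I.fl j) := by unfold Y; rw [usr_fe hj]
  rw [hfp]
  rcases Nat.lt_trichotomy (fe I.m I.fl j) k with h | h | h
  -- A facility farther out than `k` is at least as far out as its neighbour `k - 1`, whose distance
  -- to `lo` is by `h1` at least that of `k` to either end.
  · have e1 := hI.Y_anti (show k - 1 < I.cntF (I.fl j) by omega) (show fe I.m I.fl j ≤ k - 1 by omega)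
    have e2 := hI.Y_anti hk (show k - 1 ≤ k by omega)
    rcases h1 with h1 | h1
    · omega
    · refine le_max_of_le_right (max_le ?_ ?_) <;> linarith
  · rw [h]
  · have e1 := hI.Y_anti hf (show k + 1 ≤ fe I.m I.fl j by omega)
    rcases h2 with h2 | h2
    · have : fe I.m I.fl j < I.cntF (I.fl j) := hf
      omega
    · have e2 := hI.Y_anti (show k + 1 < I.cntF (I.fl j) from lt_of_le_of_lt h hf) (show k ≤ k + 1 by omega)
      refine le_max_of_le_left (max_le ?_ ?_) <;> linarith

theorem cert_facility (hm : I.mode = false) {l k : ℕ} (hk : k < I.cntF l) (lo hi : ℝ) :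
    I.cert (usr I.m I.fl l k) l lo hi (max (hi - I.Y l k) (I.Y l k - lo)) := by
  unfold cert
  rw [if_neg (by simp [hm])]
  exact ⟨usr_lt hk, leg_usr hk, le_max_left _ _, le_max_right _ _⟩

theorem cert_mode (hm : I.mode = true) (φ l : ℕ) (lo hi : ℝ) :
    I.cert φ l lo hi (I.g l lo hi) := by
  unfold cert g
  simp only [hm, if_true]
  exact ⟨le_max_left _ _, le_max_right _ _⟩

/-- A user of another leg is at most `-lo` from the center, so it is served at least as well as a
point with coordinate `lo` on the line through `l`. -/
theorem WF.fits_seg (hI : I.WF) {φ l : ℕ} {lo hi v D : ℝ} (h : I.cert φ l lo hi v) (hv : v ≤ D)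
    {C : ℕ → Prop} (hC : ∀ u < I.n, C u → I.pos u ≤ -lo ∨
      (I.leg u = l ∧ lo ≤ I.pos u ∧ I.pos u ≤ hi)) : I.fits φ D C := by
  unfold cert at h
  unfold fits
  split_ifs at * with hm
  · intro u hu w hw hCu hCw
    have p1 := hI.pos_nonneg u
    have p2 := hI.pos_nonneg w
    rcases hC u hu hCu with h1 | ⟨h1, h2, h3⟩ <;> rcases hC w hw hCw with h4 | ⟨h4, h5, h6⟩
    · exact (dd_le_add p1 p2).trans (by linarith)
    · exact (dd_le_add p1 p2).trans (by linarith)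
    · exact (dd_le_add p1 p2).trans (by linarith)
    · rw [dd, if_pos (by rw [h1, h4]), abs_le]
      constructor <;> linarith
  · obtain ⟨h1, h2, h3, h4⟩ := h
    refine ⟨h1, fun u hu hCu => ?_⟩
    rcases hC u hu hCu with h5 | ⟨h5, h6, h7⟩
    · exact (dd_le_add (hI.pos_nonneg u) (hI.fp_nonneg φ)).trans (by linarith)
    · rw [dd, if_pos (by rw [h5, h2]), abs_le]
      constructor <;> linarith

/-- For users on the leg of facility `0` and closer to the center than it, `I.fp 0 ≤ D` is needed;
it follows from `h₀` and `hx₀`. -/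
theorem WF.fits_star (hI : I.WF) {D x₀ : ℝ} (hx₀ : 0 ≤ x₀) (h₀ : I.tok x₀ ≤ D) {C : ℕ → Prop}
    (hC : ∀ u < I.n, C u → I.tok (I.pos u) ≤ D ∨ I.star u ≤ D) : I.fits 0 D C := by
  unfold fits
  unfold tok at *
  unfold star at *
  split_ifs at * with hm
  · intro u hu w hw hCu hCw
    have h1 : I.pos u + I.pos u ≤ D := (hC u hu hCu).elim id id
    have h2 : I.pos w + I.pos w ≤ D := (hC w hw hCw).elim id id
    exact (dd_le_add (hI.pos_nonneg u) (hI.pos_nonneg w)).trans (by linarith)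
  · refine ⟨hI.one_le_m (by simpa using hm), fun u hu hCu => ?_⟩
    have p1 := hI.pos_nonneg u
    have p2 := hI.fp_nonneg 0
    rcases hC u hu hCu with h1 | h1
    · exact (dd_le_add p1 p2).trans (by linarith)
    · by_cases hl : I.leg u = I.fl 0
      · rw [if_pos hl] at h1
        rw [dd, if_pos hl, abs_le]
        constructor <;> linarith
      · rw [if_neg hl] at h1
        exact (dd_le_add p1 p2).trans (by linarith)

theorem tok_mono {x y : ℝ} (h : x ≤ y) : I.tok x ≤ I.tok y := by
  unfold tok; split_ifs <;> linarith

/-- All users together are a cluster of cost at most `big`. -/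
theorem WF.fits_big (hI : I.WF) : I.fits 0 I.big fun _ => True :=
  hI.fits_star (hI.pos_nonneg (I.n - 1)) le_rfl fun u hu _ =>
    Or.inl (tok_mono (hI.pos_mono _ _ (by omega) (by have := hI.one_le_n; omega)))

theorem reach_gathering {σ : ℕ → ℕ} {D : ℝ} (hI : I.WF) (hm : I.mode = false)
    (h : Valid I.toUsers ⟨I.m, I.fl, I.fp⟩ D σ) : I.ReachLe D 0 0 0 := by
  refine (reach_of_valid hI.toWF ⟨hI.fp_nonneg, hI.fp_mono⟩ hI.fl_lt h).mono ?_ ?_ ?_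
  · rintro l a b ⟨j, h1, h2, h3, h4⟩
    exact (g_le hm h1 h2 a b).trans (max_le h3 h4)
  · intro u _ hu
    simpa [star, starDist, hm] using hu
  · intro x hx
    simpa [tok, hm] using hx

/-- Clustering enters the sweep through auxiliary facilities, of which number `0` is the center. Two
users within `D` of a facility are within `D + D` of each other, which turns each radius test into a
diameter test. -/
theorem reach_clustering {F : Facs} {σ : ℕ → ℕ} {D : ℝ} (hI : I.WF) (hm : I.mode = true)
    (hF : F.WF) (hfl : ∀ j < F.m, F.fl j < I.d) (h0 : F.fp 0 = 0)
    (h : Valid I.toUsers F D σ) : I.ReachLe (D + D) 0 0 0 := by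
  refine (reach_of_valid hI.toWF hF hfl h).mono ?_ ?_ ?_
  · rintro l a b ⟨j, h1, h2, h3, h4⟩
    have := hF.fp_nonneg j
    unfold segLe g
    rw [if_pos hm]
    exact max_le (by linarith) (by linarith)
  · intro u _ hu
    unfold starDist at hu
    unfold star
    rw [if_pos hm]
    rw [h0] at hu
    split_ifs at hu <;> linarith
  · intro x hx
    unfold tok
    rw [if_pos hm]
    rw [h0] at hx
    linarith

end Inst
end Gather

namespace RAM

/-! ### Reasoning about programs -/

namespace State

def setN (s : State) (x v : ℕ) : State := { s with natReg := Function.update s.natReg x v }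

def setR (s : State) (x : ℕ) (v : ℝ) : State := { s with realReg := Function.update s.realReg x v }

def wrN (s : State) (a i v : ℕ) : State :=
  { s with natArr := Function.update s.natArr a (Function.update (s.natArr a) i v) }

def wrR (s : State) (a i : ℕ) (v : ℝ) : State :=
  { s with realArr := Function.update s.realArr a (Function.update (s.realArr a) i v) }

variable (s : State) (x y v a b i : ℕ) (w : ℝ)

@[simp] theorem setN_natReg : (s.setN x v).natReg y = if y = x then v else s.natReg y := by
  simp [setN, Function.update_apply]
@[simp] theorem setN_realReg : (s.setN x v).realReg = s.realReg := rfl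
@[simp] theorem setN_natArr : (s.setN x v).natArr = s.natArr := rfl
@[simp] theorem setN_realArr : (s.setN x v).realArr = s.realArr := rfl
@[simp] theorem setR_natReg : (s.setR x w).natReg = s.natReg := rfl
@[simp] theorem setR_realReg : (s.setR x w).realReg y = if y = x then w else s.realReg y := by
  simp [setR, Function.update_apply]
@[simp] theorem setR_natArr : (s.setR x w).natArr = s.natArr := rfl
@[simp] theorem setR_realArr : (s.setR x w).realArr = s.realArr := rfl
@[simp] theorem wrN_natReg : (s.wrN a i v).natReg = s.natReg := rfl
@[simp] theorem wrN_realReg : (s.wrN a i v).realReg = s.realReg := rfl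
@[simp] theorem wrN_natArr :
    (s.wrN a i v).natArr b = if b = a then Function.update (s.natArr a) i v else s.natArr b := by
  simp [wrN, Function.update_apply]
@[simp] theorem wrN_realArr : (s.wrN a i v).realArr = s.realArr := rfl
@[simp] theorem wrR_natReg : (s.wrR a i w).natReg = s.natReg := rfl
@[simp] theorem wrR_realReg : (s.wrR a i w).realReg = s.realReg := rfl
@[simp] theorem wrR_natArr : (s.wrR a i w).natArr = s.natArr := rfl
@[simp] theorem wrR_realArr :
    (s.wrR a i w).realArr b = if b = a then Function.update (s.realArr a) i w else s.realArr b := by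
  simp [wrR, Function.update_apply]

end State

instance (n : ℕ) : OfNat NatExpr n := ⟨.const n⟩
instance : Add NatExpr := ⟨.add⟩
instance : Sub NatExpr := ⟨.sub⟩
instance : Zero RealExpr := ⟨.zero⟩
instance : Add RealExpr := ⟨.add⟩
instance : Sub RealExpr := ⟨.sub⟩

section eval
variable (s : State) (e f : NatExpr) (a x : ℕ) (g h : RealExpr)
@[simp] theorem NatExpr.eval_zero : (0 : NatExpr).eval s = 0 := rfl
@[simp] theorem NatExpr.eval_one : (1 : NatExpr).eval s = 1 := rfl
@[simp] theorem NatExpr.eval_two : (2 : NatExpr).eval s = 2 := rfl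
@[simp] theorem NatExpr.eval_three : (3 : NatExpr).eval s = 3 := rfl
@[simp] theorem NatExpr.eval_reg : (NatExpr.reg x).eval s = s.natReg x := rfl
@[simp] theorem NatExpr.eval_read : (NatExpr.read a e).eval s = s.natArr a (e.eval s) := rfl
@[simp] theorem NatExpr.eval_add : (e + f).eval s = e.eval s + f.eval s := rfl
@[simp] theorem NatExpr.eval_sub : (e - f).eval s = e.eval s - f.eval s := rfl
@[simp] theorem RealExpr.eval_zero : (0 : RealExpr).eval s = 0 := rfl
@[simp] theorem RealExpr.eval_reg : (RealExpr.reg x).eval s = s.realReg x := rfl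
@[simp] theorem RealExpr.eval_read : (RealExpr.read a e).eval s = s.realArr a (e.eval s) := rfl
@[simp] theorem RealExpr.eval_add : (g + h).eval s = g.eval s + h.eval s := rfl
@[simp] theorem RealExpr.eval_sub : (g - h).eval s = g.eval s - h.eval s := rfl
@[simp] theorem NatExpr.cost_zero : (0 : NatExpr).cost = 1 := rfl
@[simp] theorem NatExpr.cost_one : (1 : NatExpr).cost = 1 := rfl
@[simp] theorem NatExpr.cost_two : (2 : NatExpr).cost = 1 := rfl
@[simp] theorem NatExpr.cost_three : (3 : NatExpr).cost = 1 := rfl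
@[simp] theorem NatExpr.cost_reg : (NatExpr.reg x).cost = 1 := rfl
@[simp] theorem NatExpr.cost_read : (NatExpr.read a e).cost = e.cost + 1 := rfl
@[simp] theorem NatExpr.cost_add : (e + f).cost = e.cost + f.cost + 1 := rfl
@[simp] theorem NatExpr.cost_sub : (e - f).cost = e.cost + f.cost + 1 := rfl
@[simp] theorem RealExpr.cost_zero : (0 : RealExpr).cost = 1 := rfl
@[simp] theorem RealExpr.cost_reg : (RealExpr.reg x).cost = 1 := rfl
@[simp] theorem RealExpr.cost_read : (RealExpr.read a e).cost = e.cost + 1 := rfl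
@[simp] theorem RealExpr.cost_add : (g + h).cost = g.cost + h.cost + 1 := rfl
@[simp] theorem RealExpr.cost_sub : (g - h).cost = g.cost + h.cost + 1 := rfl
end eval

attribute [simp] Test.Holds Test.cost

/-- Started in `s`, the program halts, and its running time and final state satisfy `Q`. -/
def wp (c : Program) (Q : ℕ → State → Prop) (s : State) : Prop := ∃ t s', Exec c s t s' ∧ Q t s'

section rules
variable {s : State} {Q Q' : ℕ → State → Prop} {c c₁ c₂ : Program} {b : Test}

@[simp] theorem wp_skip : wp .skip Q s ↔ Q 1 s := by
  constructor
  · rintro ⟨t, s', h, h'⟩; cases h; exact h'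
  · exact fun h => ⟨_, _, .skip s, h⟩

@[simp] theorem wp_setNat (x : ℕ) (e : NatExpr) :
    wp (.setNat x e) Q s ↔ Q (e.cost + 1) (s.setN x (e.eval s)) := by
  constructor
  · rintro ⟨t, s', h, h'⟩; cases h; exact h'
  · exact fun h => ⟨_, _, .setNat s x e, h⟩

@[simp] theorem wp_setReal (x : ℕ) (e : RealExpr) :
    wp (.setReal x e) Q s ↔ Q (e.cost + 1) (s.setR x (e.eval s)) := by
  constructor
  · rintro ⟨t, s', h, h'⟩; cases h; exact h'
  · exact fun h => ⟨_, _, .setReal s x e, h⟩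

@[simp] theorem wp_writeNat (a : ℕ) (i e : NatExpr) :
    wp (.writeNat a i e) Q s ↔ Q (i.cost + e.cost + 1) (s.wrN a (i.eval s) (e.eval s)) := by
  constructor
  · rintro ⟨t, s', h, h'⟩; cases h; exact h'
  · exact fun h => ⟨_, _, .writeNat s a i e, h⟩

@[simp] theorem wp_writeReal (a : ℕ) (i : NatExpr) (e : RealExpr) :
    wp (.writeReal a i e) Q s ↔ Q (i.cost + e.cost + 1) (s.wrR a (i.eval s) (e.eval s)) := by
  constructor
  · rintro ⟨t, s', h, h'⟩; cases h; exact h'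
  · exact fun h => ⟨_, _, .writeReal s a i e, h⟩

@[simp] theorem wp_seq : wp (.seq c₁ c₂) Q s ↔
    wp c₁ (fun t s' => wp c₂ (fun t' s'' => Q (t + t') s'') s') s := by
  constructor
  · rintro ⟨t, s', h, h'⟩; cases h with | seq h1 h2 => exact ⟨_, _, h1, _, _, h2, h'⟩
  · rintro ⟨t, s', h1, t', s'', h2, h⟩; exact ⟨_, _, .seq h1 h2, h⟩

@[simp] theorem wp_ite : wp (.ite b c₁ c₂) Q s ↔
    (b.Holds s → wp c₁ (fun t s' => Q (b.cost + 1 + t) s') s) ∧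
      (¬ b.Holds s → wp c₂ (fun t s' => Q (b.cost + 1 + t) s') s) := by
  constructor
  · rintro ⟨t, s', h, h'⟩
    cases h with
    | iteTrue hb h1 => exact ⟨fun _ => ⟨_, _, h1, h'⟩, fun h => absurd hb h⟩
    | iteFalse hb h1 => exact ⟨fun h => absurd h hb, fun _ => ⟨_, _, h1, h'⟩⟩
  · rintro ⟨h1, h2⟩
    by_cases hb : b.Holds s
    · obtain ⟨t, s', h3, h4⟩ := h1 hb; exact ⟨_, _, .iteTrue hb h3, h4⟩
    · obtain ⟨t, s', h3, h4⟩ := h2 hb; exact ⟨_, _, .iteFalse hb h3, h4⟩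

theorem wp.mono (h : wp c Q s) (h' : ∀ t s', Q t s' → Q' t s') : wp c Q' s := by
  obtain ⟨t, s', h1, h2⟩ := h; exact ⟨t, s', h1, h' _ _ h2⟩

/-! #### What a program leaves unchanged -/

def Program.wNR : Program → ℕ → Bool
  | setNat x _, y => x == y
  | seq a b, y => wNR a y || wNR b y
  | ite _ a b, y => wNR a y || wNR b y
  | loop _ a, y => wNR a y
  | _, _ => false

def Program.wRR : Program → ℕ → Bool
  | setReal x _, y => x == y
  | seq a b, y => wRR a y || wRR b y
  | ite _ a b, y => wRR a y || wRR b y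
  | loop _ a, y => wRR a y
  | _, _ => false

def Program.wNA : Program → ℕ → Bool
  | writeNat x _ _, y => x == y
  | seq a b, y => wNA a y || wNA b y
  | ite _ a b, y => wNA a y || wNA b y
  | loop _ a, y => wNA a y
  | _, _ => false

def Program.wRA : Program → ℕ → Bool
  | writeReal x _ _, y => x == y
  | seq a b, y => wRA a y || wRA b y
  | ite _ a b, y => wRA a y || wRA b y
  | loop _ a, y => wRA a y
  | _, _ => false

/-- `s` and `s'` agree on everything that `c` does not assign to. -/
structure Frame (c : Program) (s s' : State) : Prop where
  nr : ∀ x, c.wNR x = false → s'.natReg x = s.natReg x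
  rr : ∀ x, c.wRR x = false → s'.realReg x = s.realReg x
  na : ∀ x, c.wNA x = false → s'.natArr x = s.natArr x
  ra : ∀ x, c.wRA x = false → s'.realArr x = s.realArr x

theorem Frame.refl (c : Program) (s : State) : Frame c s s :=
  ⟨fun _ _ => rfl, fun _ _ => rfl, fun _ _ => rfl, fun _ _ => rfl⟩

theorem Frame.trans {c : Program} {s s' s'' : State} (h : Frame c s s') (h' : Frame c s' s'') :
    Frame c s s'' :=
  ⟨fun x hx => (h'.nr x hx).trans (h.nr x hx), fun x hx => (h'.rr x hx).trans (h.rr x hx),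
    fun x hx => (h'.na x hx).trans (h.na x hx), fun x hx => (h'.ra x hx).trans (h.ra x hx)⟩

theorem Frame.weaken {c c' : Program} {s s' : State} (h : Frame c s s')
    (h1 : ∀ x, c'.wNR x = false → c.wNR x = false) (h2 : ∀ x, c'.wRR x = false → c.wRR x = false)
    (h3 : ∀ x, c'.wNA x = false → c.wNA x = false) (h4 : ∀ x, c'.wRA x = false → c.wRA x = false) :
    Frame c' s s' :=
  ⟨fun x hx => h.nr x (h1 x hx), fun x hx => h.rr x (h2 x hx), fun x hx => h.na x (h3 x hx),
    fun x hx => h.ra x (h4 x hx)⟩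

theorem Exec.frame {t : ℕ} {s' : State} (h : Exec c s t s') : Frame c s s' := by
  induction h with
  | skip s => exact Frame.refl _ _
  | setNat s x e =>
    refine ⟨fun y hy => ?_, fun _ _ => rfl, fun _ _ => rfl, fun _ _ => rfl⟩
    simp only [Program.wNR, beq_eq_false_iff_ne] at hy
    exact Function.update_of_ne hy.symm _ _
  | setReal s x e =>
    refine ⟨fun _ _ => rfl, fun y hy => ?_, fun _ _ => rfl, fun _ _ => rfl⟩
    simp only [Program.wRR, beq_eq_false_iff_ne] at hy
    exact Function.update_of_ne hy.symm _ _
  | writeNat s a i e =>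
    refine ⟨fun _ _ => rfl, fun _ _ => rfl, fun y hy => ?_, fun _ _ => rfl⟩
    simp only [Program.wNA, beq_eq_false_iff_ne] at hy
    exact Function.update_of_ne hy.symm _ _
  | writeReal s a i e =>
    refine ⟨fun _ _ => rfl, fun _ _ => rfl, fun _ _ => rfl, fun y hy => ?_⟩
    simp only [Program.wRA, beq_eq_false_iff_ne] at hy
    exact Function.update_of_ne hy.symm _ _
  | seq _ _ ih1 ih2 =>
    refine Frame.trans (ih1.weaken ?_ ?_ ?_ ?_) (ih2.weaken ?_ ?_ ?_ ?_) <;> intro x hx <;>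
      simp only [Program.wNR, Program.wRR, Program.wNA, Program.wRA, Bool.or_eq_false_iff] at hx
    all_goals first | exact hx.1 | exact hx.2
  | iteTrue _ _ ih =>
    refine ih.weaken ?_ ?_ ?_ ?_ <;> intro x hx <;>
      simp only [Program.wNR, Program.wRR, Program.wNA, Program.wRA, Bool.or_eq_false_iff] at hx <;>
      exact hx.1
  | iteFalse _ _ ih =>
    refine ih.weaken ?_ ?_ ?_ ?_ <;> intro x hx <;>
      simp only [Program.wNR, Program.wRR, Program.wNA, Program.wRA, Bool.or_eq_false_iff] at hx <;>
      exact hx.2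
  | loopTrue _ _ _ ih1 ih2 => exact Frame.trans (ih1.weaken (fun _ h => h) (fun _ h => h)
      (fun _ h => h) (fun _ h => h)) ih2
  | loopFalse _ => exact Frame.refl _ _

/-- Every specification carries the frame of its program along; this is how facts about registers
and arrays survive the execution of other parts. -/
theorem wp.conseq (h : wp c Q s) (h' : ∀ t s', Frame c s s' → Q t s' → Q' t s') : wp c Q' s := by
  obtain ⟨t, s', h1, h2⟩ := h; exact ⟨t, s', h1, h' _ _ h1.frame h2⟩

/-- Loops with an invariant about the elapsed time and the state, and a measure that decreases. -/
theorem wp_loop (I : ℕ → State → Prop) (μ : State → ℕ) (h0 : I 0 s)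
    (hstep : ∀ t s', Frame (.loop b c) s s' → I t s' → b.Holds s' →
      wp c (fun t' s'' => I (t + (b.cost + 1 + t')) s'' ∧ μ s'' < μ s') s')
    (hend : ∀ t s', Frame (.loop b c) s s' → I t s' → ¬ b.Holds s' → Q (t + (b.cost + 1)) s') :
    wp (.loop b c) Q s := by
  have key : ∀ k t s', μ s' = k → Frame (.loop b c) s s' → I t s' →
      ∃ t' s'', Exec (.loop b c) s' t' s'' ∧ Q (t + t') s'' := by
    intro k
    induction k using Nat.strong_induction_on with
    | _ k ih =>
      intro t s' hk hF hI
      by_cases hb : b.Holds s'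
      · obtain ⟨t1, s1, h1, h2, h3⟩ := hstep t s' hF hI hb
        have hF1 : Frame (.loop b c) s s1 := hF.trans (h1.frame.weaken (fun _ h => h)
          (fun _ h => h) (fun _ h => h) (fun _ h => h))
        obtain ⟨t2, s2, h4, h5⟩ := ih _ (by omega) _ s1 rfl hF1 h2
        exact ⟨_, _, .loopTrue hb h1 h4, by convert h5 using 1; omega⟩
      · exact ⟨_, _, .loopFalse hb, hend t s' hF hI hb⟩
  obtain ⟨t, s', h1, h2⟩ := key _ 0 s rfl (Frame.refl _ _) h0
  exact ⟨t, s', h1, by simpa using h2⟩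

/-- Loops that are run through exactly `N` times. -/
theorem wp_for (N : ℕ) (T : ℕ → ℕ) (I : ℕ → State → Prop) (h0 : I 0 s)
    (hb : ∀ k ≤ N, ∀ s', Frame (.loop b c) s s' → I k s' → (b.Holds s' ↔ k < N))
    (hstep : ∀ k < N, ∀ s', Frame (.loop b c) s s' → I k s' →
      wp c (fun t s'' => t ≤ T k ∧ I (k + 1) s'') s')
    (hend : ∀ t s', Frame (.loop b c) s s' →
      t ≤ ∑ k ∈ Finset.range N, T k + (N + 1) * (b.cost + 1) → I N s' → Q t s') :
    wp (.loop b c) Q s := by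
  have key : ∀ j k, k + j = N → ∀ t s', Frame (.loop b c) s s' →
      t ≤ ∑ i ∈ Finset.range k, T i + k * (b.cost + 1) → I k s' →
      ∃ t' s'', Exec (.loop b c) s' t' s'' ∧ Q (t + t') s'' := by
    intro j
    induction j with
    | zero =>
      intro k hk t s' hF ht hI
      obtain rfl : k = N := by omega
      refine ⟨_, _, .loopFalse ((hb k le_rfl s' hF hI).not.2 (by omega)), hend _ _ hF ?_ hI⟩
      rw [Nat.succ_mul]
      omega
    | succ j ih =>
      intro k hk t s' hF ht hI
      have hb' := (hb k (by omega) s' hF hI).2 (by omega)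
      obtain ⟨t1, s1, h1, h2, h3⟩ := hstep k (by omega) s' hF hI
      have hF1 : Frame (.loop b c) s s1 := hF.trans (h1.frame.weaken (fun _ h => h)
        (fun _ h => h) (fun _ h => h) (fun _ h => h))
      obtain ⟨t2, s2, h4, h5⟩ := ih (k + 1) (by omega) (t + (b.cost + 1 + t1)) s1 hF1
        (by rw [Finset.sum_range_succ, Nat.succ_mul]; omega) h3
      exact ⟨_, _, .loopTrue hb' h1 h4, by convert h5 using 1; omega⟩
  obtain ⟨t, s', h1, h2⟩ := key N 0 (by omega) 0 s (Frame.refl _ _) (by simp) h0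
  exact ⟨t, s', h1, by simpa using h2⟩

end rules
end RAM

/-! ### Counting loops and footprints -/

namespace RAM

infixr:40 " ⨟ " => Program.seq

abbrev nr (x : ℕ) : NatExpr := .reg x
abbrev na (a : ℕ) (e : NatExpr) : NatExpr := .read a e
abbrev rr (x : ℕ) : RealExpr := .reg x
abbrev ra (a : ℕ) (e : NatExpr) : RealExpr := .read a e

abbrev Test.ne (e f : NatExpr) : Test := .neg (.natEq e f)
abbrev Test.lt (e f : NatExpr) : Test := .natLe (e + 1) f

/-- For `x = 0, …, e - 1` do `c`. -/
abbrev forUp (x : ℕ) (e : NatExpr) (c : Program) : Program :=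
  .setNat x 0 ⨟ .loop (.lt (nr x) e) (c ⨟ .setNat x (nr x + 1))

/-- For `x = e - 1, …, 0` do `c`. -/
abbrev forDown (x : ℕ) (e : NatExpr) (c : Program) : Program :=
  .setNat x e ⨟ .loop (.ne (nr x) 0) (.setNat x (nr x - 1) ⨟ c)

variable {s : State} {Q : ℕ → State → Prop} {x : ℕ} {e : NatExpr} {c : Program}

theorem Frame.of_seq {c c₁ : Program} {s s' : State} (h : Frame c s s') : Frame (c₁ ⨟ c) s s' :=
  h.weaken (fun x hx => by simp only [Program.wNR, Bool.or_eq_false_iff] at hx; exact hx.2)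
    (fun x hx => by simp only [Program.wRR, Bool.or_eq_false_iff] at hx; exact hx.2)
    (fun x hx => by simp only [Program.wNA, Bool.or_eq_false_iff] at hx; exact hx.2)
    (fun x hx => by simp only [Program.wRA, Bool.or_eq_false_iff] at hx; exact hx.2)

/-- The bound `e` is evaluated before every round, so it must be stable under everything the loop
may change. The invariant is stated for states whose counter has already been raised, and `e.cost +
10` covers the test, the increment and the initialization. -/
theorem wp_forUp (N : ℕ) (T : ℕ → ℕ) (I : ℕ → State → Prop)
    (hN : ∀ s', Frame (forUp x e c) s s' → e.eval s' = N) (hx : c.wNR x = false)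
    (h0 : I 0 (s.setN x 0))
    (hstep : ∀ k < N, ∀ s', Frame (forUp x e c) s s' → s'.natReg x = k → I k s' →
      wp c (fun t s'' => t ≤ T k ∧ I (k + 1) (s''.setN x (k + 1))) s')
    (hend : ∀ t s', Frame (forUp x e c) s s' →
      t ≤ ∑ k ∈ Finset.range N, T k + (N + 1) * (e.cost + 10) → s'.natReg x = N → I N s' → Q t s') :
    wp (forUp x e c) Q s := by
  have h1 : Frame (forUp x e c) s (s.setN x 0) := by
    refine ⟨fun y hy => ?_, fun _ _ => rfl, fun _ _ => rfl, fun _ _ => rfl⟩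
    simp only [Program.wNR, Bool.or_eq_false_iff, beq_eq_false_iff_ne] at hy
    simp [hy.1.symm]
  rw [wp_seq, wp_setNat]
  refine wp_for N (fun k => T k + 5) (fun k s' => s'.natReg x = k ∧ I k s') ⟨by simp, h0⟩ ?_ ?_ ?_
  · rintro k hk s' hF ⟨h2, h3⟩
    have := hN s' (h1.trans hF.of_seq)
    simp only [Test.Holds, NatExpr.eval_add, NatExpr.eval_reg, h2, this, NatExpr.eval_zero, NatExpr.eval_one]
    omega
  · rintro k hk s' hF ⟨h2, h3⟩
    rw [wp_seq]
    refine (hstep k hk s' (h1.trans hF.of_seq) h2 h3).conseq ?_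
    rintro t s'' hF' ⟨h4, h5⟩
    have h6 := hF'.nr x hx
    simp only [wp_setNat, NatExpr.cost_add, NatExpr.cost_reg, NatExpr.cost_zero, NatExpr.cost_one, NatExpr.eval_add,
      NatExpr.eval_reg, NatExpr.eval_zero, NatExpr.eval_one, State.setN_natReg, if_true, h6, h2]
    exact ⟨by omega, trivial, h5⟩
  · rintro t s' hF ht ⟨h2, h3⟩
    refine hend _ s' (h1.trans hF.of_seq) ?_ h2 h3
    simp only [Test.cost, NatExpr.cost_add, NatExpr.cost_reg, NatExpr.cost_zero, NatExpr.cost_one,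
      Finset.sum_add_distrib, Finset.sum_const, Finset.card_range, smul_eq_mul] at ht ⊢
    nlinarith

/-- The counter is lowered before the body, which thus sees `N - 1` down to `0`; the invariant for
`k + 1` refers to the state before the lowering. -/
theorem wp_forDown (N : ℕ) (T : ℕ → ℕ) (I : ℕ → State → Prop) (hN : e.eval s = N)
    (hx : c.wNR x = false) (h0 : I N (s.setN x N))
    (hstep : ∀ k < N, ∀ s', Frame (forDown x e c) s s' → s'.natReg x = k → I (k + 1) (s'.setN x (k + 1)) →
      wp c (fun t s'' => t ≤ T k ∧ I k s'') s')
    (hend : ∀ t s', Frame (forDown x e c) s s' →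
      t ≤ ∑ k ∈ Finset.range N, T k + (N + 1) * (e.cost + 10) → s'.natReg x = 0 → I 0 s' → Q t s') :
    wp (forDown x e c) Q s := by
  have h1 : ∀ s v, Frame (forDown x e c) s (s.setN x v) := by
    intro s v
    refine ⟨fun y hy => ?_, fun _ _ => rfl, fun _ _ => rfl, fun _ _ => rfl⟩
    simp only [Program.wNR, Bool.or_eq_false_iff, beq_eq_false_iff_ne] at hy
    simp [hy.1.symm]
  have hset : ∀ s' : State, ∀ v w, (s'.setN x v).setN x w = s'.setN x w := by
    intro s' v w; simp [State.setN]
  have hself : ∀ s' : State, ∀ v, s'.natReg x = v → s'.setN x v = s' := by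
    rintro s' v rfl; simp [State.setN]
  rw [wp_seq, wp_setNat, hN]
  refine wp_for N (fun k => T (N - 1 - k) + 5) (fun k s' => s'.natReg x = N - k ∧ I (N - k) s')
    ⟨by simp, h0⟩ ?_ ?_ ?_
  · rintro k hk s' hF ⟨h2, h3⟩
    simp only [Test.Holds, NatExpr.eval_reg, h2, NatExpr.eval_zero, NatExpr.eval_one]
    omega
  · rintro k hk s' hF ⟨h2, h3⟩
    have e1 : N - k - 1 = N - 1 - k := by omega
    have e2 : N - k = N - 1 - k + 1 := by omega
    rw [wp_seq, wp_setNat]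
    simp only [NatExpr.eval_sub, NatExpr.eval_reg, NatExpr.eval_zero, NatExpr.eval_one, h2, e1]
    refine (hstep (N - 1 - k) (by omega) _ (((h1 _ _).trans hF.of_seq).trans (h1 _ _)) (by simp)
      ?_).conseq ?_
    · rw [hset, hself _ _ (by omega), ← e2]; exact h3
    rintro t s'' hF' ⟨h4, h5⟩
    have h6 := hF'.nr x hx
    simp only [State.setN_natReg, if_true] at h6
    simp only [NatExpr.cost_sub, NatExpr.cost_reg, NatExpr.cost_zero, NatExpr.cost_one]
    refine ⟨by omega, by omega, ?_⟩
    rw [show N - (k + 1) = N - 1 - k by omega]; exact h5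
  · rintro t s' hF ht ⟨h2, h3⟩
    refine hend _ s' ((h1 _ _).trans hF.of_seq) ?_ (by omega) (by simpa using h3)
    rw [Finset.sum_add_distrib, Finset.sum_range_reflect] at ht
    simp only [Test.cost, NatExpr.cost_reg, NatExpr.cost_zero, NatExpr.cost_one,
      Finset.sum_const, Finset.card_range, smul_eq_mul] at ht ⊢
    nlinarith

/-- The program does not assign to these registers and arrays. -/
def Program.keeps (c : Program) (n r a b : List ℕ) : Bool :=
  n.all (fun x => !c.wNR x) && r.all (fun x => !c.wRR x) && a.all (fun x => !c.wNA x) &&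
    b.all fun x => !c.wRA x

/-- The states agree on these registers and arrays. -/
structure Agree (n r a b : List ℕ) (s s' : State) : Prop where
  nr : ∀ x ∈ n, s'.natReg x = s.natReg x
  rr : ∀ x ∈ r, s'.realReg x = s.realReg x
  na : ∀ x ∈ a, s'.natArr x = s.natArr x
  ra : ∀ x ∈ b, s'.realArr x = s.realArr x

/-- For a concrete program the footprint is computed, so that `rfl` proves `hc`. -/
theorem Frame.agree {c : Program} {s s' : State} (h : Frame c s s') {n r a b : List ℕ}
    (hc : c.keeps n r a b = true) : Agree n r a b s s' := by
  simp only [Program.keeps, Bool.and_eq_true, List.all_eq_true, Bool.not_eq_true'] at hc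
  obtain ⟨⟨⟨h1, h2⟩, h3⟩, h4⟩ := hc
  exact ⟨fun x hx => h.nr x (h1 x hx), fun x hx => h.rr x (h2 x hx), fun x hx => h.na x (h3 x hx),
    fun x hx => h.ra x (h4 x hx)⟩

end RAM

namespace Gather
open RAM

/-! ### The algorithm: tables -/

theorem addr_inj {N l k l' k' : ℕ} (hk : k < N) (hk' : k' < N) (h : l * N + k = l' * N + k') :
    l = l' ∧ k = k' := by
  have hl : l = l' := by
    rcases Nat.lt_trichotomy l l' with h1 | h1 | h1
    · have := Nat.mul_le_mul_right N (show l + 1 ≤ l' from h1)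
      rw [Nat.succ_mul] at this; omega
    · exact h1
    · have := Nat.mul_le_mul_right N (show l' + 1 ≤ l from h1)
      rw [Nat.succ_mul] at this; omega
  subst hl
  exact ⟨rfl, by omega⟩

/-- Number of table entries per step of the sweep: for each set of closed legs the counts `0` to
`r`, and `r + 1` for the star phase. -/
def Inst.W (I : Inst) : ℕ := 2 ^ I.d * (I.r + 2)

/-- For lack of multiplication, multiples and powers are tabulated by repeated addition: block
addresses in arrays `3` and `5`, powers of two in `4`, address shifts for closing a leg in `10`.
Register `7` accumulates `B`. Register `9` ends with an exponent `E` such that `2 ^ E` exceeds `m`,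
for binary search. -/
def tablesProg : Program :=
  .setReal 1 (ra 0 (nr 2 - 1) + ra 0 (nr 2 - 1)) ⨟
  .ite (.natEq (nr 35) 1) .skip (.setReal 1 (ra 1 0 + ra 0 (nr 2 - 1))) ⨟
  .writeNat 3 0 0 ⨟ .writeNat 5 0 0 ⨟ .writeNat 4 0 1 ⨟ .writeNat 10 0 (nr 1 + 2) ⨟
  .setNat 7 0 ⨟
  forUp 5 (nr 0)
    (.writeNat 3 (nr 5 + 1) (na 3 (nr 5) + (nr 2 + 1)) ⨟
    .writeNat 5 (nr 5 + 1) (na 5 (nr 5) + (nr 3 + 1)) ⨟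
    .writeNat 4 (nr 5 + 1) (na 4 (nr 5) + na 4 (nr 5)) ⨟
    .writeNat 10 (nr 5 + 1) (na 10 (nr 5) + na 10 (nr 5)) ⨟
    .setNat 7 (nr 7 + (nr 1 + nr 1))) ⨟
  .setNat 7 (nr 7 + nr 1) ⨟
  .setNat 9 (nr 0) ⨟
  .loop (.natLe (na 4 (nr 9)) (nr 3))
    (.writeNat 4 (nr 9 + 1) (na 4 (nr 9) + na 4 (nr 9)) ⨟ .setNat 9 (nr 9 + 1)) ⨟
  .setNat 34 (na 4 (nr 0) - 1) ⨟
  .setNat 10 (na 10 (nr 0))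

structure Input (I : Inst) (s : State) : Prop where
  d : s.natReg 0 = I.d
  r : s.natReg 1 = I.r
  n : s.natReg 2 = I.n
  m : s.natReg 3 = I.m
  mode : s.natReg 35 = 1 ↔ I.mode = true
  leg : s.natArr 0 = I.leg
  fl : s.natArr 1 = I.fl
  pos : s.realArr 0 = I.pos
  fp : s.realArr 1 = I.fp

structure Tables (I : Inst) (s : State) : Prop extends Input I s where
  B : s.natReg 7 = I.B
  E : I.m < 2 ^ s.natReg 9
  d_le_E : I.d ≤ s.natReg 9
  E_le : 2 ^ s.natReg 9 ≤ 2 ^ I.d * (2 * I.m + 1)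
  W : s.natReg 10 = I.W
  full : s.natReg 34 = 2 ^ I.d - 1
  bs : ∀ l ≤ I.d, s.natArr 3 l = l * (I.n + 1)
  bm : ∀ l ≤ I.d, s.natArr 5 l = l * (I.m + 1)
  pw : ∀ e ≤ s.natReg 9, s.natArr 4 e = 2 ^ e
  pwW : ∀ l ≤ I.d, s.natArr 10 l = 2 ^ l * (I.r + 2)
  big : s.realReg 1 = I.big

variable {I : Inst} {s s' : State}

theorem Input.agree (h : Input I s) (ha : Agree [0, 1, 2, 3, 35] [] [0, 1] [0, 1] s s') :
    Input I s' where
  d := by rw [ha.nr 0 (by decide), h.d]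
  r := by rw [ha.nr 1 (by decide), h.r]
  n := by rw [ha.nr 2 (by decide), h.n]
  m := by rw [ha.nr 3 (by decide), h.m]
  mode := by rw [ha.nr 35 (by decide), h.mode]
  leg := by rw [ha.na 0 (by decide), h.leg]
  fl := by rw [ha.na 1 (by decide), h.fl]
  pos := by rw [ha.ra 0 (by decide), h.pos]
  fp := by rw [ha.ra 1 (by decide), h.fp]

theorem Tables.agree (h : Tables I s)
    (ha : Agree [0, 1, 2, 3, 35, 7, 9, 10, 34] [1] [0, 1, 3, 4, 5, 10] [0, 1] s s') :
    Tables I s' where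
  toInput := h.toInput.agree ⟨fun x hx => ha.nr x (by simp at hx ⊢; tauto), by simp,
    fun x hx => ha.na x (by simp at hx ⊢; tauto), fun x hx => ha.ra x (by simp at hx ⊢; tauto)⟩
  B := by rw [ha.nr 7 (by decide), h.B]
  E := by rw [ha.nr 9 (by decide)]; exact h.E
  d_le_E := by rw [ha.nr 9 (by decide)]; exact h.d_le_E
  E_le := by rw [ha.nr 9 (by decide)]; exact h.E_le
  W := by rw [ha.nr 10 (by decide), h.W]
  full := by rw [ha.nr 34 (by decide), h.full]
  bs := by rw [ha.na 3 (by decide)]; exact h.bs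
  bm := by rw [ha.na 5 (by decide)]; exact h.bm
  pw := by rw [ha.na 4 (by decide), ha.nr 9 (by decide)]; exact h.pw
  pwW := by rw [ha.na 10 (by decide)]; exact h.pwW
  big := by rw [ha.rr 1 (by decide), h.big]

/-- Limits the doublings beyond `2 ^ d`, and thereby gives termination and linear time of the loop
that finds `E`. -/
theorem two_pow_le_of_sub {d E M : ℕ} (hd : d ≤ E) (h : 2 ^ E ≤ 2 ^ d * M) : E < d + M := by
  obtain ⟨k, rfl⟩ := Nat.exists_eq_add_of_le hd
  rw [pow_add] at h
  have h1 := Nat.le_of_mul_le_mul_left h (by positivity)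
  have : k < 2 ^ k := Nat.lt_two_pow_self
  omega

theorem tables_spec (h : Input I s) :
    wp tablesProg (fun t s' => t ≤ 100 * (I.d + I.m + 1) ∧ Tables I s') s := by
  have hbig : ∀ s', Input I s' → (s'.natReg 35 = 1 → I.pos (I.n - 1) + I.pos (I.n - 1) = I.big) ∧
      (s'.natReg 35 ≠ 1 → I.fp 0 + I.pos (I.n - 1) = I.big) := by
    intro s' h'
    have := h'.mode
    unfold Inst.big Inst.tok
    constructor <;> intro h1 <;> simp_all
  obtain ⟨hb1, hb2⟩ := hbig s h
  unfold tablesProg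
  simp only [wp_seq (c₁ := .setReal _ _), wp_setReal, wp_seq (c₁ := .ite _ _ _), wp_ite, wp_skip]
  have key : ∀ t s₀, t ≤ 25 → Input I s₀ → s₀.realReg 1 = I.big → wp (.writeNat 3 0 0 ⨟
      .writeNat 5 0 0 ⨟ .writeNat 4 0 1 ⨟ .writeNat 10 0 (nr 1 + 2) ⨟ .setNat 7 0 ⨟
      forUp 5 (nr 0)
        (.writeNat 3 (nr 5 + 1) (na 3 (nr 5) + (nr 2 + 1)) ⨟
        .writeNat 5 (nr 5 + 1) (na 5 (nr 5) + (nr 3 + 1)) ⨟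
        .writeNat 4 (nr 5 + 1) (na 4 (nr 5) + na 4 (nr 5)) ⨟
        .writeNat 10 (nr 5 + 1) (na 10 (nr 5) + na 10 (nr 5)) ⨟
        .setNat 7 (nr 7 + (nr 1 + nr 1))) ⨟
      .setNat 7 (nr 7 + nr 1) ⨟
      .setNat 9 (nr 0) ⨟
      .loop (.natLe (na 4 (nr 9)) (nr 3))
        (.writeNat 4 (nr 9 + 1) (na 4 (nr 9) + na 4 (nr 9)) ⨟ .setNat 9 (nr 9 + 1)) ⨟
      .setNat 34 (na 4 (nr 0) - 1) ⨟
      .setNat 10 (na 10 (nr 0))) (fun t' s' => t + t' ≤ 100 * (I.d + I.m + 1) ∧ Tables I s') s₀ := by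
    intro t s₀ ht h hbig
    simp only [wp_seq (c₁ := .writeNat _ _ _), wp_writeNat, wp_seq (c₁ := .setNat _ _), wp_setNat]
    rw [wp_seq]
    refine wp_forUp I.d (fun _ => 60) (fun k s' => (∀ l ≤ k, s'.natArr 3 l = l * (I.n + 1)) ∧
      (∀ l ≤ k, s'.natArr 5 l = l * (I.m + 1)) ∧ (∀ l ≤ k, s'.natArr 4 l = 2 ^ l) ∧
      (∀ l ≤ k, s'.natArr 10 l = 2 ^ l * (I.r + 2)) ∧ s'.natReg 7 = k * (2 * I.r))
      ?_ rfl ?_ ?_ ?_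
    · intro s' hF
      simpa [h.d] using hF.nr 0 rfl
    · simp [h.r]
    · rintro k hk s' hF hx ⟨h1, h2, h3, h4, h5⟩
      have e1 := hF.nr 1 rfl
      have e2 := hF.nr 2 rfl
      have e3 := hF.nr 3 rfl
      simp [h.r, h.n, h.m] at e1 e2 e3
      simp [hx, e1, e2, e3, h1 k le_rfl, h2 k le_rfl, h3 k le_rfl, h4 k le_rfl, h5,
        Function.update_apply]
      refine ⟨?_, ?_, ?_, ?_, by ring⟩
      · intro l hl
        split_ifs with hh
        · subst hh; ring
        · exact h1 l (by omega)
      · intro l hl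
        split_ifs with hh
        · subst hh; ring
        · exact h2 l (by omega)
      · intro l hl
        split_ifs with hh
        · subst hh; ring
        · exact h3 l (by omega)
      · intro l hl
        split_ifs with hh
        · subst hh; ring
        · exact h4 l (by omega)
    rintro t1 s1 hF ht1 hx ⟨h1, h2, h3, h4, h5⟩
    have hd : s1.natReg 0 = I.d := by simpa [h.d] using hF.nr 0 rfl
    have hr : s1.natReg 1 = I.r := by simpa [h.r] using hF.nr 1 rfl
    have hm : s1.natReg 3 = I.m := by simpa [h.m] using hF.nr 3 rfl
    have hI1 : Input I s1 := by
      refine h.agree ?_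
      have := hF.agree (n := [0, 1, 2, 3, 35]) (r := []) (a := [0, 1]) (b := [0, 1]) rfl
      exact ⟨fun x hx => by have := this.nr x hx; simp at hx; rcases hx with rfl | rfl | rfl | rfl | rfl <;> simpa using this, by simp,
        fun x hx => by have := this.na x hx; simp at hx; rcases hx with rfl | rfl  <;> simpa using this,
        fun x hx => by have := this.ra x hx; simp at hx; rcases hx with rfl | rfl  <;> simpa using this⟩
    have hb1 : s1.realReg 1 = I.big := by simpa [hbig] using hF.rr 1 rfl
    simp only [wp_seq (c₁ := .setNat _ _), wp_setNat]
    rw [wp_seq]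
    refine wp_loop (fun t s' => I.d ≤ s'.natReg 9 ∧ 2 ^ s'.natReg 9 ≤ 2 ^ I.d * (2 * I.m + 1) ∧
      (∀ e ≤ s'.natReg 9, s'.natArr 4 e = 2 ^ e) ∧ t + 20 * I.d ≤ 20 * s'.natReg 9)
      (fun s' => I.d + (2 * I.m + 1) - s'.natReg 9) ?_ ?_ ?_
    · simp only [State.setN_natReg, State.setN_natArr, NatExpr.eval_reg, if_true, hd, zero_add]
      simp [hd]
      exact h3
    · rintro t2 s2 hF2 ⟨g1, g2, g3, g4⟩ hb
      have e3 : s2.natReg 3 = I.m := by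
        have := hF2.nr 3 rfl
        simpa [hm] using this
      simp [g3 _ le_rfl, e3] at hb
      have hE : 2 ^ (s2.natReg 9 + 1) ≤ 2 ^ I.d * (2 * I.m + 1) := by
        rw [pow_succ]
        have : 1 ≤ 2 ^ I.d := Nat.one_le_two_pow
        nlinarith
      have := two_pow_le_of_sub (Nat.le_succ_of_le g1) hE
      simp [g3 _ le_rfl, Function.update_apply, Nat.le_add_right_of_le g1]
      refine ⟨⟨hE, ?_, by omega⟩, by omega⟩
      intro e he
      split_ifs with hh
      · subst hh; ring
      · exact g3 e (by omega)
    · rintro t2 s2 hF2 ⟨g1, g2, g3, g4⟩ hb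
      have e3 : s2.natReg 3 = I.m := by
        have := hF2.nr 3 rfl
        simpa [hm] using this
      have e7 : s2.natReg 7 = I.B := by
        have := hF2.nr 7 rfl
        simpa [h5, hr, Users.B] using this
      have e0 : s2.natReg 0 = I.d := by
        have := hF2.nr 0 rfl
        simpa [hd] using this
      simp [g3 _ le_rfl, e3] at hb
      have hA := hF2.na 3 rfl
      have hB := hF2.na 5 rfl
      have hC := hF2.na 10 rfl
      have hD := hF2.rr 1 rfl
      simp at hA hB hC hD
      have hI2 : Input I s2 := by
        refine hI1.agree ?_
        have := hF2.agree (n := [0, 1, 2, 3, 35]) (r := []) (a := [0, 1]) (b := [0, 1]) rfl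
        exact ⟨fun x hx => by have := this.nr x hx; simp at hx; rcases hx with rfl | rfl | rfl | rfl | rfl <;> simpa using this, by simp,
          fun x hx => by have := this.na x hx; simp at hx; rcases hx with rfl | rfl  <;> simpa using this,
          fun x hx => by have := this.ra x hx; simp at hx; rcases hx with rfl | rfl  <;> simpa using this⟩
      have := two_pow_le_of_sub g1 g2
      simp only [wp_seq, wp_setNat]
      refine ⟨?_, ?_⟩
      · simp at ht1 ⊢
        omega
      · exact {
          toInput := by
            refine hI2.agree ⟨?_, by simp, by simp, by simp⟩
            intro x hx; simp at hx; rcases hx with rfl | rfl | rfl | rfl | rfl <;> simp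
          B := by simpa using e7
          E := by simpa using hb
          d_le_E := by simpa using g1
          E_le := by simpa using g2
          W := by simp [hC, h4, e0, Inst.W]
          full := by simp [e0, g3 _ g1]
          bs := by simpa [hA] using h1
          bm := by simpa [hB] using h2
          pw := by simpa using g3
          pwW := by simpa [hC] using h4
          big := by simpa [hD] using hb1 }
  constructor
  · intro hm
    refine (key 17 _ (by norm_num) (h.agree ⟨by simp, by simp, by simp, by simp⟩) ?_).mono ?_
    · simp only [Test.Holds] at hm
      simp [h.pos, h.n]; exact hb1 (by simpa using hm)
    · intro t s' ⟨h1, h2⟩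
      exact ⟨by simp at h1 ⊢; omega, h2⟩
  · intro hm
    refine (key 25 _ (by norm_num) (h.agree ⟨by simp, by simp, by simp, by simp⟩) ?_).mono ?_
    · simp only [Test.Holds] at hm
      simp [h.pos, h.n, h.fp]; exact hb2 (by simpa using hm)
    · intro t s' ⟨h1, h2⟩
      exact ⟨by simp at h1 ⊢; omega, h2⟩

end Gather

/-! ### Users and facilities sorted by legs -/

namespace Gather
open RAM

/-- Lists the indices below register `cr` leg by leg, from the last to the first. -/
def listsProg (cr la ba ca xa oa : ℕ) : Program :=
  forDown 4 (nr cr)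
    (.setNat 5 (na la (nr 4)) ⨟
    .writeNat oa (na ba (nr 5) + na ca (nr 5)) (nr 4) ⨟
    .writeNat ca (nr 5) (na ca (nr 5) + 1) ⨟
    .writeNat xa (nr 5) (na xa (nr 5) + 1))

variable {I : Inst} {s s' : State}

/-- As the indices run downwards, the counter of a leg holds the number of later entries on it,
`fe`, which is the address inside the block of that leg. The second counter array gives a copy; for
the users it becomes the working array of `kap`. -/
theorem lists_spec {cr la ba ca xa oa N d : ℕ} {leg : ℕ → ℕ} (hcr : s.natReg cr = N)
    (hla : s.natArr la = leg) (hleg : ∀ u < N, leg u < d) (hba : ∀ l ≤ d, s.natArr ba l = l * (N + 1))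
    (hca : ∀ l, s.natArr ca l = 0) (hxa : ∀ l, s.natArr xa l = 0)
    (h1 : [la, ba, ca, xa, oa].Nodup) :
    wp (listsProg cr la ba ca xa oa) (fun t s' => t ≤ 60 * (N + 1) ∧
      (∀ l, s'.natArr ca l = cb leg l N) ∧ (∀ l, s'.natArr xa l = cb leg l N) ∧
      ∀ l, l < d → ∀ k < cb leg l N, s'.natArr oa (l * (N + 1) + k) = usr N leg l k) s := by
  simp only [List.nodup_cons, List.mem_cons, not_or, List.not_mem_nil, not_false_eq_true, and_true,
    List.nodup_nil] at h1
  obtain ⟨⟨a1, a2, a3, a4⟩, ⟨a5, a6, a7⟩, ⟨a8, a9⟩, a10⟩ := h1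
  refine wp_forDown N (fun _ => 40) (fun i s' => (∀ l, s'.natArr ca l = cb leg l N - cb leg l i) ∧
    (∀ l, s'.natArr xa l = cb leg l N - cb leg l i) ∧
    ∀ u, i ≤ u → u < N → s'.natArr oa (leg u * (N + 1) + fe N leg u) = u) (by simpa using hcr) rfl ?_ ?_ ?_
  · refine ⟨by simpa using hca, by simpa using hxa, fun u h2 h3 => by omega⟩
  · rintro k hk s' hF hx ⟨h2, h3, h4⟩
    have e1 : s'.natArr la = leg := by
      rw [hF.na la (by simp [listsProg, Program.wNA, Ne.symm a2, Ne.symm a3, Ne.symm a4]), hla]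
    have e2 : s'.natArr ba = s.natArr ba :=
      hF.na ba (by simp [listsProg, Program.wNA, Ne.symm a5, Ne.symm a6, Ne.symm a7])
    have hfe := fe_add (leg := leg) hk
    have hs : cb leg (leg k) (k + 1) = cb leg (leg k) k + 1 := by simp [cb_succ]
    have hmono : ∀ l, cb leg l (k + 1) ≤ cb leg l N := fun l => cb_mono l hk
    have hsl : ∀ l, l ≠ leg k → cb leg l (k + 1) = cb leg l k := fun l hl => by
      simp [cb_succ, Ne.symm hl]
    have h2' : ∀ l, s'.natArr ca l = cb leg l N - cb leg l (k + 1) := by simpa using h2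
    have h3' : ∀ l, s'.natArr xa l = cb leg l N - cb leg l (k + 1) := by simpa using h3
    have h4' : ∀ u, k + 1 ≤ u → u < N → s'.natArr oa (leg u * (N + 1) + fe N leg u) = u := by
      simpa using h4
    have hbak := hba (leg k) (hleg k hk).le
    simp [hx, e1, e2, a1, a2, a3, a4, a5, a6, a7, a8, a9, a10, Ne.symm a1, Ne.symm a2, Ne.symm a3,
      Ne.symm a4, Ne.symm a5, Ne.symm a6, Ne.symm a7, Ne.symm a8, Ne.symm a9, Ne.symm a10, hbak, h2',
      h3', Function.update_apply]
    refine ⟨?_, ?_⟩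
    · intro l
      have := hmono l
      split_ifs with hh
      · subst hh; omega
      · rw [hsl l hh]
    · intro u hu hu'
      have ha : cb leg (leg k) N - cb leg (leg k) (k + 1) = fe N leg k := by omega
      rw [ha]
      rcases hu.eq_or_lt with rfl | hu
      · simp
      · rw [if_neg, h4' u hu hu']
        intro hh
        have f1 := fe_lt_cb (leg := leg) hk
        have f2 := fe_lt_cb (leg := leg) hu'
        have f3 : ∀ l, cb leg l N ≤ N := fun l => Nat.count_le _
        have f4 := f3 (leg k)
        have f5 := f3 (leg u)
        obtain ⟨g1, g2⟩ := addr_inj (N := N + 1) (by omega) (by omega) hh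
        have := fe_lt_fe hu' g1.symm hu
        omega
  · rintro t s' hF ht - ⟨h2, h3, h4⟩
    refine ⟨?_, by simpa using h2, by simpa using h3, ?_⟩
    · simp at ht
      omega
    · intro l hl k hk
      have := h4 _ (Nat.zero_le _) (usr_lt hk)
      rwa [leg_usr hk, fe_usr hk] at this

/-- A user is near if fewer than `B` users were taken from its leg before, that is, if the total is
less than the remaining number plus `B`. Array `16` ends as `kap P`, where the backward computation
of the table begins. -/
def nearProg : Program :=
  .setNat 8 0 ⨟
  forUp 4 (nr 2)
    (.setNat 5 (na 0 (nr 4)) ⨟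
    .ite (.lt (na 6 (nr 5)) (na 16 (nr 5) + nr 7))
      (.writeNat 11 (nr 8) (nr 4) ⨟ .setNat 8 (nr 8 + 1) ⨟
        .writeNat 16 (nr 5) (na 16 (nr 5) - 1)) .skip)

structure Lists (I : Inst) (s : State) : Prop extends Tables I s where
  cnt : ∀ l, s.natArr 6 l = I.cnt l
  ul : ∀ l < I.d, ∀ k < I.cnt l, s.natArr 7 (l * (I.n + 1) + k) = usr I.n I.leg l k
  cntF : ∀ l, s.natArr 8 l = I.cntF l
  fl' : ∀ l < I.d, ∀ k < I.cntF l, s.natArr 9 (l * (I.m + 1) + k) = usr I.m I.fl l k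

/-- All tables that remain unchanged once they are set up. -/
structure Base (I : Inst) (s : State) : Prop extends Lists I s where
  P : s.natReg 8 = I.P
  near : ∀ q < I.P, s.natArr 11 q = I.nu q

theorem Lists.agree (h : Lists I s)
    (ha : Agree [0, 1, 2, 3, 35, 7, 9, 10, 34] [1] [0, 1, 3, 4, 5, 10, 6, 7, 8, 9] [0, 1] s s') :
    Lists I s' where
  toTables := h.toTables.agree ⟨ha.nr, ha.rr, fun x hx => ha.na x (by simp at hx ⊢; tauto), ha.ra⟩
  cnt := by rw [ha.na 6 (by decide)]; exact h.cnt
  ul := by rw [ha.na 7 (by decide)]; exact h.ul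
  cntF := by rw [ha.na 8 (by decide)]; exact h.cntF
  fl' := by rw [ha.na 9 (by decide)]; exact h.fl'

theorem Base.agree (h : Base I s)
    (ha : Agree [0, 1, 2, 3, 35, 7, 9, 10, 34, 8] [1] [0, 1, 3, 4, 5, 10, 6, 7, 8, 9, 11] [0, 1] s s') :
    Base I s' where
  toLists := h.toLists.agree ⟨fun x hx => ha.nr x (by simp at hx ⊢; tauto), ha.rr,
    fun x hx => ha.na x (by simp at hx ⊢; tauto), ha.ra⟩
  P := by rw [ha.nr 8 (by decide)]; exact h.P
  near := by rw [ha.na 11 (by decide)]; exact h.near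

theorem near_spec (hI : I.WF) (h : Lists I s) (hk : ∀ l, s.natArr 16 l = I.cnt l) :
    wp nearProg (fun t s' => t ≤ 60 * (I.n + 1) ∧ Base I s' ∧ ∀ l, s'.natArr 16 l = I.kap I.P l) s := by
  unfold nearProg
  simp only [wp_seq (c₁ := .setNat 8 _), wp_setNat]
  have hU := hI.toWF
  refine wp_forUp I.n (fun _ => 40) (fun i s' => s'.natReg 8 = Nat.count I.near i ∧
    (∀ l, s'.natArr 16 l = I.kap (Nat.count I.near i) l) ∧
    ∀ q < Nat.count I.near i, s'.natArr 11 q = I.nu q) ?_ rfl ?_ ?_ ?_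
  · intro s' hF
    simpa [h.n] using hF.nr 2 rfl
  · simpa [Users.kap] using hk
  · rintro k hk s' hF hx ⟨h1, h2, h3⟩
    have e0 : s'.natArr 0 = I.leg := by simpa [h.leg] using hF.na 0 rfl
    have e6 : ∀ l, s'.natArr 6 l = I.cnt l := by
      intro l; rw [hF.na 6 rfl]; exact h.cnt l
    have e7 : s'.natReg 7 = I.B := by simpa [h.B] using hF.nr 7 rfl
    have hc := Users.count_near_cb (U := I.toUsers) (I.leg k) k hk.le
    have hle : cb I.leg (I.leg k) k < I.cnt (I.leg k) := cb_lt hk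
    have hn : I.cnt (I.leg k) + 1 ≤ I.kap (Nat.count I.near k) (I.leg k) + I.B ↔ I.near k := by
      rw [hc]
      unfold Users.near
      omega
    simp [hx, e0, e6, e7, h1, h2, Nat.count_succ]
    rw [Nat.add_comm] at hn
    constructor
    · intro hh
      have hnk : I.near k := by rw [← hn]; omega
      have hnu : I.nu (Nat.count I.near k) = k := Nat.nth_count hnk
      simp [hnk, Function.update_apply, Users.kap, hnu]
      refine ⟨?_, ?_⟩
      · intro l
        by_cases hl : l = I.leg k
        · subst hl; simp
        · simp [hl, Ne.symm hl, h2]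
      · intro q hq
        split_ifs with hqq
        · subst hqq; exact hnu.symm
        · exact h3 q (by omega)
    · intro hh
      have hnk : ¬ I.near k := by rw [← hn]; omega
      simp [hnk, h2]
      exact h3
  · rintro t s' hF ht - ⟨h1, h2, h3⟩
    refine ⟨by simp at ht ⊢; omega, ?_, h2⟩
    have hL : Lists I s' := (h.agree (s' := s.setN 8 0) ⟨by simp, by simp, by simp, by simp⟩).agree
      (hF.agree rfl)
    exact { toLists := hL, P := h1, near := h3 }

end Gather

namespace RAM

/-- For amortized bounds: the elapsed time is part of the invariant instead of being summed over the
rounds. -/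
theorem wp_forUp_time {s : State} {Q : ℕ → State → Prop} {x : ℕ} {e : NatExpr} {c : Program} (N : ℕ)
    (I : ℕ → ℕ → State → Prop)
    (hN : ∀ s', Frame (forUp x e c) s s' → e.eval s' = N) (hx : c.wNR x = false)
    (h0 : I 0 0 (s.setN x 0))
    (hstep : ∀ k < N, ∀ t s', Frame (forUp x e c) s s' → s'.natReg x = k → I k t s' →
      wp c (fun t' s'' => I (k + 1) (t + t' + (e.cost + 9)) (s''.setN x (k + 1))) s')
    (hend : ∀ t s', Frame (forUp x e c) s s' → s'.natReg x = N → I N t s' → Q (t + (e.cost + 7)) s') :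
    wp (forUp x e c) Q s := by
  have h1 : Frame (forUp x e c) s (s.setN x 0) := by
    refine ⟨fun y hy => ?_, fun _ _ => rfl, fun _ _ => rfl, fun _ _ => rfl⟩
    simp only [Program.wNR, Bool.or_eq_false_iff, beq_eq_false_iff_ne] at hy
    simp [hy.1.symm]
  rw [wp_seq, wp_setNat]
  refine wp_loop (fun t s' => s'.natReg x ≤ N ∧ I (s'.natReg x) t s') (fun s' => N - s'.natReg x)
    ⟨by simp, by simpa using h0⟩ ?_ ?_
  · rintro t s' hF ⟨h2, h3⟩ hb
    have hN' := hN s' (h1.trans hF.of_seq)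
    simp only [Test.Holds, NatExpr.eval_add, NatExpr.eval_reg, NatExpr.eval_one, hN'] at hb
    rw [wp_seq]
    refine (hstep _ (by omega) t s' (h1.trans hF.of_seq) rfl h3).conseq ?_
    intro t' s'' hF' h5
    have h6 := hF'.nr x hx
    simp only [wp_setNat, NatExpr.cost_add, NatExpr.cost_reg, NatExpr.cost_one, NatExpr.eval_add,
      NatExpr.eval_reg, NatExpr.eval_one, State.setN_natReg, if_true, h6, Test.cost]
    refine ⟨⟨by omega, ?_⟩, by omega⟩
    convert h5 using 1
    omega
  · rintro t s' hF ⟨h2, h3⟩ hb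
    have hN' := hN s' (h1.trans hF.of_seq)
    simp only [Test.Holds, NatExpr.eval_add, NatExpr.eval_reg, NatExpr.eval_one, hN'] at hb
    have hx' : s'.natReg x = N := by omega
    have := hend t s' (h1.trans hF.of_seq) hx' (hx' ▸ h3)
    simp only [NatExpr.cost_zero, Test.cost, NatExpr.cost_add, NatExpr.cost_reg, NatExpr.cost_one]
    convert this using 1
    omega

end RAM
namespace Gather
open RAM

/-! ### The cost of a cluster -/

/-- The distance of the facility `e` of the current leg. -/
def facPos (e : NatExpr) : RealExpr := ra 1 (na 9 (nr 16 + e))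

def costProg : Program :=
  .ite (.natEq (nr 35) 1)
    (.setReal 2 (rr 4 - rr 3) ⨟
      .ite (.realLe (rr 2) (0 - rr 3 - rr 3)) (.setReal 2 (0 - rr 3 - rr 3)) .skip)
    (.ite (.natEq (nr 17) 0) (.setReal 2 (rr 1))
      (.setNat 18 (na 9 (nr 16 + nr 15)) ⨟ .setReal 2 (rr 4 - ra 1 (nr 18)) ⨟
        .ite (.realLe (rr 2) (ra 1 (nr 18) - rr 3)) (.setReal 2 (ra 1 (nr 18) - rr 3)) .skip))

/-- The pointer moves to the next facility toward the center as long as this one is no worse, and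
never back. Its moves are therefore paid once per leg. -/
def walkProg : Program :=
  .loop (.and (.lt (nr 15 + 1) (nr 17)) (.realLe (rr 3 + rr 4) (facPos (nr 15) + facPos (nr 15 + 1))))
    (.setNat 15 (nr 15 + 1)) ⨟ costProg

/-- For blocks at the top of a leg there is no amortization, so the facility is found by binary
search with descending powers of two. -/
def searchProg : Program :=
  .setNat 15 0 ⨟ .setNat 33 (nr 9) ⨟
  .loop (.ne (nr 33) 0)
    (.setNat 33 (nr 33 - 1) ⨟ .setNat 32 (nr 15 + na 4 (nr 33)) ⨟
    .ite (.lt (nr 32) (nr 17))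
      (.ite (.realLe (rr 3 + rr 4) (facPos (nr 32 - 1) + facPos (nr 32))) (.setNat 15 (nr 32)) .skip)
      .skip) ⨟
  costProg

/-- The facilities of leg `l` after `pt` are no worse than those before it. -/
def PtOK (I : Inst) (l pt : ℕ) (x : ℝ) : Prop :=
  pt = 0 ∨ pt < I.cntF l ∧ x ≤ I.Y l (pt - 1) + I.Y l pt

structure OnLeg (I : Inst) (l : ℕ) (s : State) : Prop where
  lt : l < I.d
  leg : s.natReg 5 = l
  bf : s.natReg 16 = l * (I.m + 1)
  cf : s.natReg 17 = I.cntF l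

/-- On a leg without facilities the cost is `big` and no facility can be named, hence the
certificate is promised only below `big`. -/
def CostPost (I : Inst) (l : ℕ) (s s' : State) : Prop :=
  s'.realReg 2 = I.g l (s.realReg 3) (s.realReg 4) ∧
    (s'.realReg 2 < I.big → I.cert (s'.natReg 18) l (s.realReg 3) (s.realReg 4) (s'.realReg 2))

variable {I : Inst} {s s' : State} {l : ℕ}

@[simp] theorem facPos_cost (e : NatExpr) : (facPos e).cost = e.cost + 4 := by
  simp [facPos]; omega

theorem facPos_eval (h : Base I s) (hl : OnLeg I l s) {e : NatExpr} (he : e.eval s < I.cntF l) :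
    (facPos e).eval s = I.Y l (e.eval s) := by
  simp [facPos, hl.bf, h.fp, h.fl' l hl.lt _ he, Inst.Y]

theorem OnLeg.agree (hl : OnLeg I l s) (h : Agree [5, 16, 17] [] [] [] s s') : OnLeg I l s' :=
  ⟨hl.lt, (h.nr 5 (by decide)).trans hl.leg, (h.nr 16 (by decide)).trans hl.bf,
    (h.nr 17 (by decide)).trans hl.cf⟩

theorem cost_spec (hI : I.WF) (h : Base I s) (hl : OnLeg I l s)
    (h1 : PtOK I l (s.natReg 15) (s.realReg 3 + s.realReg 4))
    (h2 : I.cntF l ≤ s.natReg 15 + 1 ∨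
      I.Y l (s.natReg 15) + I.Y l (s.natReg 15 + 1) < s.realReg 3 + s.realReg 4) :
    wp costProg (fun t s' => t ≤ 50 ∧ CostPost I l s s') s := by
  unfold costProg CostPost
  by_cases hm : I.mode = true
  · have hc := fun φ => I.cert_mode hm φ l (s.realReg 3) (s.realReg 4)
    have hg : I.g l (s.realReg 3) (s.realReg 4) =
        max (s.realReg 4 - s.realReg 3) (- s.realReg 3 - s.realReg 3) := by unfold Inst.g; simp [hm]
    simp [h.mode.2 hm]
    constructor
    · intro h3
      rw [hg] at hc ⊢
      rw [max_eq_right (by linarith)] at hc ⊢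
      exact ⟨rfl, fun _ => hc _⟩
    · intro h3
      rw [hg] at hc ⊢
      rw [max_eq_left (by linarith)] at hc ⊢
      exact ⟨rfl, fun _ => hc _⟩
  · have hm' : I.mode = false := by simpa using hm
    have h35 : s.natReg 35 ≠ 1 := fun hh => hm (h.mode.1 hh)
    simp [h35, hl.cf, h.fp, hl.bf, h.big]
    constructor
    · intro h0
      rw [Inst.g_eq_big hm' h0]
    · intro h0
      have hpt : s.natReg 15 < I.cntF l := by
        rcases h1 with h1 | h1 <;> omega
      have hY : I.fp (s.natArr 9 (l * (I.m + 1) + s.natReg 15)) = I.Y l (s.natReg 15) := by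
        rw [h.fl' l hl.lt _ hpt]; rfl
      have hc := I.cert_facility hm' hpt (s.realReg 3) (s.realReg 4)
      rw [← h.fl' l hl.lt _ hpt] at hc
      have hg := hI.g_eq hm' hpt (lo := s.realReg 3) (hi := s.realReg 4) (h1.imp id fun hh => hh.2)
        (h2.imp (fun hh => by omega) id)
      rw [hY, hg]
      constructor
      · intro h3
        rw [max_eq_right (by linarith)] at hc ⊢
        exact ⟨rfl, fun _ => hc⟩
      · intro h3
        rw [max_eq_left (by linarith)] at hc ⊢
        exact ⟨rfl, fun _ => hc⟩

/-- The time is charged to the progress of the pointer in register `15`, apart from a constant for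
the final evaluation. -/
theorem walk_spec (hI : I.WF) (h : Base I s) (hl : OnLeg I l s)
    (h1 : PtOK I l (s.natReg 15) (s.realReg 3 + s.realReg 4)) :
    wp walkProg (fun t s' => t + 40 * s.natReg 15 ≤ 40 * s'.natReg 15 + 100 ∧
      PtOK I l (s'.natReg 15) (s.realReg 3 + s.realReg 4) ∧ CostPost I l s s') s := by
  unfold walkProg
  rw [wp_seq]
  refine wp_loop (fun t s' => t + 40 * s.natReg 15 ≤ 40 * s'.natReg 15 ∧
    PtOK I l (s'.natReg 15) (s.realReg 3 + s.realReg 4)) (fun s' => I.cntF l - s'.natReg 15) ?_ ?_ ?_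
  · exact ⟨by omega, h1⟩
  all_goals
    rintro t s' hF ⟨h2, h3⟩ hb
    have e3 := hF.rr 3 rfl
    have e4 := hF.rr 4 rfl
    have hB : Base I s' := h.agree (hF.agree rfl)
    have hl' : OnLeg I l s' := hl.agree (hF.agree rfl)
    simp only [Test.Holds, NatExpr.eval_add, NatExpr.eval_reg, NatExpr.eval_one, RealExpr.eval_add,
      RealExpr.eval_reg, hl'.cf, e3, e4] at hb
  · obtain ⟨hb1, hb2⟩ := hb
    rw [facPos_eval hB hl' (by simp; omega), facPos_eval hB hl' (by simp; omega)] at hb2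
    simp at hb2
    simp
    exact ⟨⟨by omega, Or.inr ⟨by omega, by simpa using hb2⟩⟩, by omega⟩
  · refine (cost_spec hI hB hl' (by rw [e3, e4]; exact h3) ?_).conseq ?_
    · rw [e3, e4]
      by_contra hcon
      push Not at hcon
      refine hb ⟨by omega, ?_⟩
      rw [facPos_eval hB hl' (by simp; omega), facPos_eval hB hl' (by simp; omega)]
      simpa using hcon.2
    · rintro t' s'' hF' ⟨h4, h5⟩
      have e15 := hF'.nr 15 rfl
      unfold CostPost at h5 ⊢
      rw [e15]
      rw [e3, e4] at h5
      exact ⟨by simp; omega, h3, h5⟩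

theorem search_spec (hI : I.WF) (h : Base I s) (hl : OnLeg I l s) :
    wp searchProg (fun t s' => t ≤ 60 * s.natReg 9 + 80 ∧ CostPost I l s s') s := by
  unfold searchProg
  simp only [wp_seq (c₁ := .setNat _ _), wp_setNat]
  rw [wp_seq]
  -- The facility at the pointer passes the comparison with its outer neighbour, the one `2 ^ e`
  -- further does not, or does not exist. At `e = 0` these are adjacent, and `WF.g_eq` asks for no
  -- more.
  refine wp_loop (fun t s' => t + 60 * s'.natReg 33 ≤ 60 * s.natReg 9 ∧ s'.natReg 33 ≤ s.natReg 9 ∧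
    PtOK I l (s'.natReg 15) (s.realReg 3 + s.realReg 4) ∧
    (I.cntF l ≤ s'.natReg 15 + 2 ^ s'.natReg 33 ∨ I.Y l (s'.natReg 15 + 2 ^ s'.natReg 33 - 1) +
      I.Y l (s'.natReg 15 + 2 ^ s'.natReg 33) < s.realReg 3 + s.realReg 4)) (fun s' => s'.natReg 33)
    ?_ ?_ ?_
  · have : I.cntF l ≤ I.m := Nat.count_le _
    have := h.E
    simp [PtOK]
    left; omega
  all_goals
    rintro t s' hF ⟨h2, h3, h4, h5⟩ hb
    have e3 : s'.realReg 3 = s.realReg 3 := hF.rr 3 rfl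
    have e4 : s'.realReg 4 = s.realReg 4 := hF.rr 4 rfl
    have e9 : s'.natReg 9 = s.natReg 9 := hF.nr 9 rfl
    have hB : Base I s' := (h.agree (s' := (s.setN 15 0).setN 33 (s.natReg 9))
      ⟨by simp, by simp, by simp, by simp⟩).agree (hF.agree rfl)
    have hl' : OnLeg I l s' := (hl.agree (s' := (s.setN 15 0).setN 33 (s.natReg 9))
      ⟨by simp, by simp, by simp, by simp⟩).agree (hF.agree rfl)
    simp at hb
  · have hpw := hB.pw (s'.natReg 33 - 1) (by omega)
    obtain ⟨p, hp⟩ : ∃ p, s'.natReg 33 = p + 1 := ⟨s'.natReg 33 - 1, by omega⟩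
    rw [hp] at h2 h3 h5 hpw
    simp only [Nat.add_sub_cancel] at hpw
    have h2p : 2 ^ (p + 1) = 2 ^ p + 2 ^ p := by ring
    have hpos : 1 ≤ 2 ^ p := Nat.one_le_two_pow
    set u := ((s'.setN 33 p).setN 32 (s'.natReg 15 + 2 ^ p)) with hu
    have hBu : Base I u := hB.agree ⟨by simp [hu], by simp [hu], by simp [hu], by simp [hu]⟩
    have hlu : OnLeg I l u := hl'.agree ⟨by simp [hu], by simp [hu], by simp [hu], by simp [hu]⟩
    have hu32 : u.natReg 32 = s'.natReg 15 + 2 ^ p := by simp [hu]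
    have hu33 : u.natReg 33 = p := by simp [hu]
    have hu15 : u.natReg 15 = s'.natReg 15 := by simp [hu]
    have hu3 : u.realReg 3 = s.realReg 3 := by simp [hu, e3]
    have hu4 : u.realReg 4 = s.realReg 4 := by simp [hu, e4]
    simp only [wp_seq, wp_setNat, NatExpr.eval_sub, NatExpr.eval_reg, NatExpr.eval_one, hp,
      Nat.add_sub_cancel, NatExpr.eval_add, NatExpr.eval_read, State.setN_natReg, State.setN_natArr,
      if_true, hpw, show (15 = 33) = False by simp, if_false]
    rw [← hu]
    clear_value u
    simp only [wp_ite, wp_setNat, wp_skip, Test.Holds, NatExpr.eval_add, NatExpr.eval_reg,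
      NatExpr.eval_one, hu32, hlu.cf, RealExpr.eval_add, RealExpr.eval_reg, hu3, hu4]
    refine ⟨fun ha => ⟨fun hc => ?_, fun hc => ?_⟩, fun ha => ?_⟩
    · rw [facPos_eval hBu hlu (by simp [hu32]; omega), facPos_eval hBu hlu (by simp [hu32]; omega)] at hc
      simp [hu33, hu32] at hc ⊢
      refine ⟨by omega, by omega, Or.inr ⟨by omega, by simpa using hc⟩, ?_⟩
      rw [Nat.add_assoc, ← h2p]
      exact h5
    · rw [facPos_eval hBu hlu (by simp [hu32]; omega), facPos_eval hBu hlu (by simp [hu32]; omega)] at hc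
      simp [hu33, hu32, hu15] at hc ⊢
      exact ⟨by omega, by omega, h4, Or.inr hc⟩
    · simp [hu33, hu15]
      exact ⟨by omega, by omega, h4, Or.inl (by omega)⟩
  · refine (cost_spec hI hB hl' (by rw [e3, e4]; exact h4) ?_).conseq ?_
    · rw [e3, e4]
      simpa [hb] using h5
    · rintro t' s'' hF' ⟨h6, h7⟩
      unfold CostPost at h7 ⊢
      rw [e3, e4] at h7
      exact ⟨by simp; omega, h7⟩

end Gather

namespace Gather
open RAM

/-! ### A queue of candidate cuts -/

variable {I : Inst} {l k top lo hi pt : ℕ} {F : ℕ → ℝ} {Q : ℕ → ℕ}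

/-- The cost of a cluster from the `k`-th user to the cut `j` and of the rest beyond the cut. -/
noncomputable def cutCost (I : Inst) (l : ℕ) (F : ℕ → ℝ) (k j : ℕ) : ℝ :=
  max (I.g l (I.X l k) (I.X l j)) (F j)

/-- A smaller index is a cut farther out, which makes the segment dearer. It is worth keeping only
if the remaining stretch costs strictly less, so index and value increase together along the queue.
-/
structure Increasing (F : ℕ → ℝ) (Q : ℕ → ℕ) (lo hi : ℕ) : Prop where
  idx : ∀ i i', lo ≤ i → i < i' → i' < hi → Q i < Q i'
  val : ∀ i i', lo ≤ i → i < i' → i' < hi → F (Q i) < F (Q i')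

/-- The cut `j` is at least as good as `j'` for all users from the `k`-th on. -/
def Beats (I : Inst) (l k : ℕ) (F : ℕ → ℝ) (j j' : ℕ) : Prop :=
  ∀ k', k ≤ k' → k' < I.cnt l → cutCost I l F k' j ≤ cutCost I l F k' j'

def Dominated (I : Inst) (l k : ℕ) (F : ℕ → ℝ) (Q : ℕ → ℕ) (lo hi j : ℕ) : Prop :=
  ∃ i, lo ≤ i ∧ i < hi ∧ Beats I l k F (Q i) j

/-- The queue holds cuts `j` with `j + r ≤ top`, among them the best ones for all users from the
`k`-th on. -/
structure Deque (I : Inst) (l k top : ℕ) (F : ℕ → ℝ) (Q : ℕ → ℕ) (lo hi pt : ℕ) : Prop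
    extends Increasing F Q lo hi where
  bound : ∀ i, lo ≤ i → i < hi → Q i + I.r ≤ top
  dom : ∀ j, j + I.r ≤ top → Dominated I l k F Q lo hi j
  -- The pointer is good for some admissible cut that is not nearer to the center than any queued
  -- one, and for every later user. Later cuts and users lie nearer still, so it remains good.
  ptr : pt = 0 ∨ pt < I.cntF l ∧ ∃ j, j + I.r ≤ top ∧ (∀ i, lo ≤ i → i < hi → j ≤ Q i) ∧
    ∀ k', k ≤ k' → k' < I.cnt l → I.X l k' + I.X l j ≤ I.Y l (pt - 1) + I.Y l pt

theorem Deque.empty (hI : I.WF) : Deque I l 0 0 F Q 0 0 0 := by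
  have := hI.one_le_r
  exact ⟨⟨by omega, by omega⟩, by omega, by omega, Or.inl rfl⟩

theorem Deque.mono {k'' : ℕ} (h : Deque I l k top F Q lo hi pt) (hk : k ≤ k'') :
    Deque I l k'' top F Q lo hi pt where
  toIncreasing := h.toIncreasing
  bound := h.bound
  dom j hj := by
    obtain ⟨i, h1, h2, h3⟩ := h.dom j hj
    exact ⟨i, h1, h2, fun k' hk' => h3 k' (by omega)⟩
  ptr := h.ptr.imp id fun ⟨h1, j, h2, h3, h4⟩ => ⟨h1, j, h2, h3, fun k' hk' => h4 k' (by omega)⟩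

/-- Below `r` users no cut is admissible, so nothing has to be dominated. -/
theorem Deque.raise {top' : ℕ} (h : Deque I l k top F Q lo hi pt) (hk : top ≤ top')
    (h' : top' < I.r) : Deque I l k top' F Q lo hi pt where
  toIncreasing := h.toIncreasing
  bound i h1 h2 := by have := h.bound i h1 h2; omega
  dom j hj := by omega
  ptr := h.ptr.imp id fun ⟨h1, j, h2, h3⟩ => ⟨h1, j, by omega, h3⟩

theorem Deque.congr {F' : ℕ → ℝ} (hI : I.WF) (h : Deque I l k top F Q lo hi pt)
    (hF : ∀ j < top, F' j = F j) : Deque I l k top F' Q lo hi pt := by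
  have hr := hI.one_le_r
  have hQ : ∀ i, lo ≤ i → i < hi → F' (Q i) = F (Q i) := fun i h1 h2 => by
    have := h.bound i h1 h2; exact hF _ (by omega)
  refine ⟨⟨h.idx, fun i i' h1 h2 h3 => ?_⟩, h.bound, fun j hj => ?_, h.ptr⟩
  · rw [hQ i h1 (by omega), hQ i' (by omega) h3]; exact h.val i i' h1 h2 h3
  · obtain ⟨i, h1, h2, h3⟩ := h.dom j hj
    refine ⟨i, h1, h2, fun k' hk' hc => ?_⟩
    have := h3 k' hk' hc
    unfold cutCost at this ⊢
    rwa [hQ i h1 h2, hF j (by omega)]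

/-- The queue while the cut `j` is being inserted. -/
structure Popped (I : Inst) (l k j : ℕ) (F : ℕ → ℝ) (Q : ℕ → ℕ) (lo hi pt : ℕ) : Prop
    extends Increasing F Q lo hi where
  bound : ∀ i, lo ≤ i → i < hi → Q i < j
  dom : ∀ j' < j, Dominated I l k F Q lo hi j' ∨ Beats I l k F j j'
  ptr : pt = 0 ∨ pt < I.cntF l ∧ ∃ j' < j, (∀ i, lo ≤ i → i < hi → j' ≤ Q i) ∧
    ∀ k', k ≤ k' → k' < I.cnt l → I.X l k' + I.X l j' ≤ I.Y l (pt - 1) + I.Y l pt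

theorem Deque.popped {j : ℕ} (h : Deque I l k top F Q lo hi pt) (hj : j + I.r = top + 1) :
    Popped I l k j F Q lo hi pt where
  toIncreasing := h.toIncreasing
  bound i h1 h2 := by have := h.bound i h1 h2; omega
  dom j' hj' := Or.inl (h.dom j' (by omega))
  ptr := h.ptr.imp id fun ⟨h1, j, h2, h3⟩ => ⟨h1, j, by omega, h3⟩

theorem Beats.trans {j j' j'' : ℕ} (h : Beats I l k F j j') (h' : Beats I l k F j' j'') :
    Beats I l k F j j'' := fun k' h1 h2 => (h k' h1 h2).trans (h' k' h1 h2)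

/-- The cut nearer to the center gives the shorter segment, and by hypothesis the stretch beyond it
costs no more. -/
theorem beats_of_le (hI : I.WF) {j j' : ℕ} (hj : j' ≤ j) (hjc : j < I.cnt l) (hF : F j ≤ F j') :
    Beats I l k F j j' := fun _ _ _ =>
  max_le_max (Inst.g_mono le_rfl (hI.toWF.X_anti hjc hj)) hF

theorem Popped.pop (hI : I.WF) {j : ℕ} (h : Popped I l k j F Q lo hi pt) (hlo : lo < hi)
    (hj : j < I.cnt l) (hF : F j ≤ F (Q (hi - 1))) : Popped I l k j F Q lo (hi - 1) pt where
  idx i i' h1 h2 h3 := h.idx i i' h1 h2 (by omega)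
  val i i' h1 h2 h3 := h.val i i' h1 h2 (by omega)
  bound i h1 h2 := h.bound i h1 (by omega)
  dom j' hj' := by
    rcases h.dom j' hj' with ⟨i, h1, h2, h3⟩ | h1
    · by_cases hi' : i < hi - 1
      · exact Or.inl ⟨i, h1, hi', h3⟩
      · obtain rfl : i = hi - 1 := by omega
        exact Or.inr ((beats_of_le hI (h.bound _ h1 h2).le hj hF).trans h3)
    · exact Or.inr h1
  ptr := h.ptr.imp id fun ⟨h1, j, h2, h3, h4⟩ => ⟨h1, j, h2, fun i h5 h6 => h3 i h5 (by omega), h4⟩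

theorem Popped.push {j : ℕ} (h : Popped I l k j F Q lo hi pt) (hlo : lo ≤ hi)
    (hF : lo < hi → F (Q (hi - 1)) < F j) (hj : j + I.r = top) :
    Deque I l k top F (Function.update Q hi j) lo (hi + 1) pt := by
  have hQ : ∀ i, i < hi → Function.update Q hi j i = Q i := fun i hi' =>
    Function.update_of_ne (by omega) _ _
  have hQ' : ∀ i, ¬ i < hi → i < hi + 1 → Function.update Q hi j i = j := fun i h1 h2 => by
    obtain rfl : i = hi := by omega
    exact Function.update_self ..
  refine ⟨⟨fun i i' h1 h2 h3 => ?_, fun i i' h1 h2 h3 => ?_⟩, fun i h1 h2 => ?_, fun j' hj' => ?_, ?_⟩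
  · rw [hQ i (by omega)]
    by_cases hi' : i' < hi
    · rw [hQ i' hi']; exact h.idx i i' h1 h2 hi'
    · rw [hQ' i' hi' h3]; exact h.bound i h1 (by omega)
  · rw [hQ i (by omega)]
    by_cases hi' : i' < hi
    · rw [hQ i' hi']; exact h.val i i' h1 h2 hi'
    · rw [hQ' i' hi' h3]
      refine lt_of_le_of_lt ?_ (hF (by omega))
      by_cases hi'' : i = hi - 1
      · rw [hi'']
      · exact (h.val i (hi - 1) h1 (by omega) (by omega)).le
  · by_cases hi' : i < hi
    · rw [hQ i hi']; have := h.bound i h1 hi'; omega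
    · rw [hQ' i hi' h2]; exact hj.le
  · have hself : Dominated I l k F (Function.update Q hi j) lo (hi + 1) j :=
      ⟨hi, hlo, by omega, by rw [hQ' hi (by omega) (by omega)]; exact fun _ _ _ => le_rfl⟩
    rcases (show j' < j ∨ j' = j by omega) with h1 | rfl
    · rcases h.dom j' h1 with ⟨i, h2, h3, h4⟩ | h2
      · exact ⟨i, h2, by omega, by rw [hQ i h3]; exact h4⟩
      · exact ⟨hi, hlo, by omega, by rw [hQ' hi (by omega) (by omega)]; exact h2⟩
    · exact hself
  · refine h.ptr.imp id fun ⟨h1, j', h2, h3, h4⟩ => ⟨h1, j', by omega, fun i h5 h6 => ?_, h4⟩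
    by_cases hi' : i < hi
    · rw [hQ i hi']; exact h3 i h5 hi'
    · rw [hQ' i hi' h6]; exact h2.le

/-- The pointer may be used for the front of the queue. -/
theorem Deque.ptOK (hI : I.WF) (h : Deque I l k top F Q lo hi pt) (hlo : lo < hi) (hk : k < I.cnt l)
    (ht : top ≤ k + 1) : PtOK I l pt (I.X l k + I.X l (Q lo)) := by
  have hr := hI.one_le_r
  refine h.ptr.imp id fun ⟨h1, j, h2, h3, h4⟩ => ⟨h1, ?_⟩
  have h5 := h.bound lo le_rfl hlo
  have := hI.toWF.X_anti (l := l) (show Q lo < I.cnt l by omega) (h3 lo le_rfl hlo)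
  have := h4 k le_rfl hk
  linarith

theorem Deque.move {pt' : ℕ} (hI : I.WF) (h : Deque I l k top F Q lo hi pt) (hlo : lo < hi)
    (hpt : PtOK I l pt' (I.X l k + I.X l (Q lo))) : Deque I l k top F Q lo hi pt' where
  toIncreasing := h.toIncreasing
  bound := h.bound
  dom := h.dom
  ptr := by
    refine hpt.imp id fun ⟨h1, h2⟩ => ⟨h1, Q lo, h.bound lo le_rfl hlo, fun i h3 h4 => ?_, ?_⟩
    · rcases h3.eq_or_lt with rfl | h3
      · exact le_rfl
      · exact (h.idx lo i le_rfl h3 h4).le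
    · intro k' hk' hc
      have := hI.toWF.X_anti (l := l) hc hk'
      linarith

/-- Segments only get dearer as their near end moves toward the center. Once the front segment costs
at least the `F` of the second cut, neither term of the second cut's cost exceeds it, now or later.
-/
theorem Deque.pop_front (hI : I.WF) (h : Deque I l k top F Q lo hi pt) (hlo : lo + 1 < hi)
    (hF : F (Q (lo + 1)) ≤ I.g l (I.X l k) (I.X l (Q lo))) (ht : top ≤ k + 1) :
    Deque I l k top F Q (lo + 1) hi pt where
  idx i i' h1 h2 h3 := h.idx i i' (by omega) h2 h3
  val i i' h1 h2 h3 := h.val i i' (by omega) h2 h3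
  bound i h1 h2 := h.bound i (by omega) h2
  dom j hj := by
    obtain ⟨i, h1, h2, h3⟩ := h.dom j hj
    rcases h1.eq_or_lt with rfl | h1
    · refine ⟨lo + 1, le_rfl, hlo, Beats.trans ?_ h3⟩
      intro k' hk' hc
      have hr := hI.one_le_r
      have hb := h.bound (lo + 1) (by omega) hlo
      have e1 : I.g l (I.X l k') (I.X l (Q (lo + 1))) ≤ I.g l (I.X l k') (I.X l (Q lo)) :=
        Inst.g_mono le_rfl (hI.toWF.X_anti (by omega) (h.idx lo (lo + 1) le_rfl (by omega) hlo).le)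
      have e2 : I.g l (I.X l k) (I.X l (Q lo)) ≤ I.g l (I.X l k') (I.X l (Q lo)) :=
        Inst.g_mono (hI.toWF.X_anti hc hk') le_rfl
      exact le_max_of_le_left (max_le e1 (hF.trans e2))
    · exact ⟨i, h1, h2, h3⟩
  ptr := h.ptr.imp id fun ⟨h1, j, h2, h3, h4⟩ => ⟨h1, j, h2, fun i h5 h6 => h3 i (by omega) h6, h4⟩

/-- The front of the queue is the best cut. -/
theorem Deque.front_le (h : Deque I l k top F Q lo hi pt) (hk : k < I.cnt l)
    (hF : lo + 1 < hi → I.g l (I.X l k) (I.X l (Q lo)) < F (Q (lo + 1))) {j : ℕ}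
    (hj : j + I.r ≤ top) : cutCost I l F k (Q lo) ≤ cutCost I l F k j := by
  obtain ⟨i, h1, h2, h3⟩ := h.dom j hj
  refine le_trans ?_ (h3 k le_rfl hk)
  -- For an entry behind the front, its `F` alone is at least both terms of the front's cost.
  rcases h1.eq_or_lt with rfl | h1
  · exact le_rfl
  · have e1 := hF (by omega)
    have e2 := h.val lo i le_rfl h1 h2
    have e3 : F (Q (lo + 1)) ≤ F (Q i) := by
      rcases (show lo + 1 = i ∨ lo + 1 < i by omega) with rfl | h4
      · exact le_rfl
      · exact (h.val (lo + 1) i (by omega) h4 h2).le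
    exact le_max_of_le_right (max_le (e1.le.trans e3) e2.le)

end Gather

namespace Gather
open RAM

/-! ### Partitioning the users of a leg -/

/-- The distance of the user `e` of the current leg. -/
def userPos (e : NatExpr) : RealExpr := ra 0 (na 7 (nr 11 + e))

def popBackProg : Program :=
  .loop (.and (.lt (nr 13) (nr 14))
      (.realLe (ra 2 (nr 11 + nr 19)) (ra 2 (nr 11 + na 15 (nr 14 - 1)))))
    (.setNat 14 (nr 14 - 1))

def popFrontProg : Program :=
  .loop (.and (.lt (nr 13 + 1) (nr 14)) (.realLe (ra 2 (nr 11 + na 15 (nr 13 + 1))) (rr 2)))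
    (.setNat 13 (nr 13 + 1) ⨟ .setReal 4 (userPos (na 15 (nr 13))) ⨟ walkProg)

def cutProg : Program :=
  .setNat 19 (nr 6 + 1 - nr 1) ⨟ popBackProg ⨟
  .writeNat 15 (nr 14) (nr 19) ⨟ .setNat 14 (nr 14 + 1) ⨟
  .setReal 3 (userPos (nr 6)) ⨟ .setReal 4 (userPos (na 15 (nr 13))) ⨟ walkProg ⨟ popFrontProg ⨟
  .setReal 5 (ra 2 (nr 11 + na 15 (nr 13))) ⨟
  .ite (.realLe (rr 5) (rr 2)) (.setReal 5 (rr 2)) .skip ⨟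
  .writeReal 2 (nr 11 + nr 6 + 1) (rr 5) ⨟
  .writeNat 12 (nr 11 + nr 6 + 1) (na 15 (nr 13)) ⨟
  .writeNat 13 (nr 11 + nr 6 + 1) (nr 18)

structure OnLine (I : Inst) (l : ℕ) (s : State) : Prop extends OnLeg I l s where
  b : s.natReg 11 = l * (I.n + 1)

variable {I : Inst} {s s' : State} {l : ℕ}

theorem OnLine.agree (hl : OnLine I l s) (h : Agree [5, 16, 17, 11] [] [] [] s s') : OnLine I l s' :=
  ⟨hl.toOnLeg.agree ⟨fun x hx => h.nr x (by simp at hx ⊢; tauto), by simp, by simp, by simp⟩,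
    (h.nr 11 (by decide)).trans hl.b⟩

@[simp] theorem userPos_cost (e : NatExpr) : (userPos e).cost = e.cost + 4 := by
  simp [userPos]; omega

theorem userPos_eval (h : Base I s) (hl : OnLine I l s) {e : NatExpr} (he : e.eval s < I.cnt l) :
    (userPos e).eval s = I.X l (e.eval s) := by
  simp [userPos, hl.b, h.pos, h.ul l hl.lt _ he, Users.X]

/-- The costs of the optimal partitions of the users of leg `l`. -/
def lineCost (I : Inst) (l : ℕ) (s : State) (κ : ℕ) : ℝ := s.realArr 2 (l * (I.n + 1) + κ)

theorem popBack_spec (hI : I.WF) (hb : s.natReg 11 = l * (I.n + 1)) {k : ℕ}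
    (hk : s.natReg 19 < I.cnt l) (hlo : s.natReg 13 ≤ s.natReg 14)
    (h : Popped I l k (s.natReg 19) (lineCost I l s) (s.natArr 15) (s.natReg 13) (s.natReg 14)
      (s.natReg 15)) :
    wp popBackProg (fun t s' => t + 300 * s'.natReg 14 ≤ 300 * s.natReg 14 + 40 ∧
      s.natReg 13 ≤ s'.natReg 14 ∧
      Popped I l k (s.natReg 19) (lineCost I l s) (s.natArr 15) (s.natReg 13) (s'.natReg 14)
        (s.natReg 15) ∧ (s.natReg 13 < s'.natReg 14 →
          lineCost I l s (s.natArr 15 (s'.natReg 14 - 1)) < lineCost I l s (s.natReg 19))) s := by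
  unfold popBackProg
  refine wp_loop (fun t s' => t + 300 * s'.natReg 14 ≤ 300 * s.natReg 14 ∧
      s.natReg 13 ≤ s'.natReg 14 ∧
      Popped I l k (s.natReg 19) (lineCost I l s) (s.natArr 15) (s.natReg 13) (s'.natReg 14)
        (s.natReg 15)) (fun s' => s'.natReg 14) ⟨by omega, hlo, h⟩ ?_ ?_
  all_goals
    rintro t s' hF ⟨h1, h2, h3⟩ hb'
    have e13 : s'.natReg 13 = s.natReg 13 := hF.nr 13 rfl
    have e11 : s'.natReg 11 = l * (I.n + 1) := by rw [hF.nr 11 rfl, hb]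
    have e19 : s'.natReg 19 = s.natReg 19 := hF.nr 19 rfl
    have eQ : s'.natArr 15 = s.natArr 15 := hF.na 15 rfl
    have eF : s'.realArr 2 = s.realArr 2 := hF.ra 2 rfl
    simp [e13, e11, e19, eQ, eF] at hb'
  · simp
    exact ⟨⟨by omega, by omega, h3.pop hI (by omega) hk hb'.2⟩, by omega⟩
  · refine ⟨by simp; omega, h2, h3, fun h4 => ?_⟩
    exact hb' (by omega)

theorem popFront_spec (hI : I.WF) (h : Base I s) (hl : OnLine I l s) {k : ℕ}
    (hk : k < I.cnt l) (h3 : s.realReg 3 = I.X l k)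
    (h4 : s.realReg 4 = I.X l (s.natArr 15 (s.natReg 13)))
    (hD : Deque I l k (k + 1) (lineCost I l s) (s.natArr 15) (s.natReg 13) (s.natReg 14) (s.natReg 15))
    (hlo : s.natReg 13 < s.natReg 14) (hc : CostPost I l s s) :
    wp popFrontProg (fun t s' =>
      t + 40 * s.natReg 15 + 300 * s.natReg 13 ≤ 40 * s'.natReg 15 + 300 * s'.natReg 13 + 60 ∧
      Deque I l k (k + 1) (lineCost I l s) (s.natArr 15) (s'.natReg 13) (s.natReg 14) (s'.natReg 15) ∧
      s'.natReg 13 < s.natReg 14 ∧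
      s'.realReg 2 = I.g l (I.X l k) (I.X l (s.natArr 15 (s'.natReg 13))) ∧
      (s'.realReg 2 < I.big → I.cert (s'.natReg 18) l (I.X l k) (I.X l (s.natArr 15 (s'.natReg 13)))
        (s'.realReg 2)) ∧
      (s'.natReg 13 + 1 < s.natReg 14 → I.g l (I.X l k) (I.X l (s.natArr 15 (s'.natReg 13))) <
        lineCost I l s (s.natArr 15 (s'.natReg 13 + 1)))) s := by
  have hr := hI.one_le_r
  unfold popFrontProg
  unfold CostPost at hc
  rw [h3, h4] at hc
  refine wp_loop (fun t s' =>
      t + 40 * s.natReg 15 + 300 * s.natReg 13 ≤ 40 * s'.natReg 15 + 300 * s'.natReg 13 ∧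
      Deque I l k (k + 1) (lineCost I l s) (s.natArr 15) (s'.natReg 13) (s.natReg 14) (s'.natReg 15) ∧
      s'.natReg 13 < s.natReg 14 ∧
      s'.realReg 2 = I.g l (I.X l k) (I.X l (s.natArr 15 (s'.natReg 13))) ∧
      (s'.realReg 2 < I.big → I.cert (s'.natReg 18) l (I.X l k) (I.X l (s.natArr 15 (s'.natReg 13)))
        (s'.realReg 2))) (fun s' => s.natReg 14 - s'.natReg 13) ⟨by omega, hD, hlo, hc⟩ ?_ ?_
  all_goals
    rintro t s' hF ⟨g1, g2, g3, g4, g5⟩ hb'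
    have e14 : s'.natReg 14 = s.natReg 14 := hF.nr 14 rfl
    have e11 : s'.natReg 11 = l * (I.n + 1) := by rw [hF.nr 11 rfl, hl.b]
    have e3 : s'.realReg 3 = I.X l k := by rw [hF.rr 3 rfl, h3]
    have eQ : s'.natArr 15 = s.natArr 15 := hF.na 15 rfl
    have eF : s'.realArr 2 = s.realArr 2 := hF.ra 2 rfl
    have hB : Base I s' := h.agree (hF.agree rfl)
    have hl' : OnLine I l s' := hl.agree (hF.agree rfl)
    simp [e14, e11, eQ, eF] at hb'
  · have hQ := g2.bound (s'.natReg 13 + 1) (by omega) hb'.1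
    simp only [wp_seq, wp_setNat, wp_setReal]
    rw [userPos_eval (hB.agree ⟨by simp, by simp, by simp, by simp⟩)
      (hl'.agree ⟨by simp, by simp, by simp, by simp⟩) (by simp [eQ]; omega)]
    simp only [NatExpr.eval_add, NatExpr.eval_reg, NatExpr.eval_one, NatExpr.eval_read,
      State.setN_natReg, if_true, State.setN_natArr, eQ]
    have g6 := g2.pop_front hI hb'.1 (by rw [← g4]; exact hb'.2) le_rfl
    set u := (s'.setN 13 (s'.natReg 13 + 1)).setR 4 (I.X l (s.natArr 15 (s'.natReg 13 + 1))) with hu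
    have hBu : Base I u := hB.agree ⟨by simp [hu], by simp [hu], by simp [hu], by simp [hu]⟩
    have hlu : OnLine I l u := hl'.agree ⟨by simp [hu], by simp [hu], by simp [hu], by simp [hu]⟩
    have u3 : u.realReg 3 = I.X l k := by simp [hu, e3]
    have u4 : u.realReg 4 = I.X l (s.natArr 15 (s'.natReg 13 + 1)) := by simp [hu]
    have u15 : u.natReg 15 = s'.natReg 15 := by simp [hu]
    have u13 : u.natReg 13 = s'.natReg 13 + 1 := by simp [hu]
    clear_value u
    refine (walk_spec hI hBu hlu.toOnLeg ?_).conseq ?_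
    · rw [u3, u4, u15]; exact g6.ptOK hI hb'.1 hk le_rfl
    · rintro t' s'' hF' ⟨k1, k2, k3⟩
      have v13 := hF'.nr 13 rfl
      unfold CostPost at k3
      rw [u3, u4] at k2 k3
      simp only [v13, u13]
      refine ⟨⟨by simp; omega, g6.move hI hb'.1 k2, hb'.1, k3⟩, by omega⟩
  · exact ⟨by simp; omega, g2, g3, g4, g5, fun h5 => by rw [← g4]; exact hb' h5⟩

def CutPost (I : Inst) (l k cut fac : ℕ) (v : ℝ) (F : ℕ → ℝ) : Prop :=
  v = cutCost I l F k cut ∧ cut + I.r ≤ k + 1 ∧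
    (∀ j, j + I.r ≤ k + 1 → v ≤ cutCost I l F k j) ∧
    (v < I.big → I.cert fac l (I.X l k) (I.X l cut) v)

theorem cert_of_le {φ : ℕ} {lo hi v w : ℝ} (h : I.cert φ l lo hi v) (hv : v ≤ w) :
    I.cert φ l lo hi w := by
  unfold Inst.cert at *
  split_ifs at * with hm
  · exact ⟨h.1.trans hv, h.2.trans hv⟩
  · exact ⟨h.1, h.2.1, h.2.2.1.trans hv, h.2.2.2.trans hv⟩

/-- Amortization: an insertion pays `300` units in advance for a removal at the back, register `13`
absorbs the removals at the front, and register `15` the walk of the facility pointer at `40` units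
per move. -/
theorem cut_spec (hI : I.WF) (h : Base I s) (hl : OnLine I l s) (hk : s.natReg 6 < I.cnt l)
    (hkr : I.r ≤ s.natReg 6 + 1) (hlo : s.natReg 13 ≤ s.natReg 14)
    (hD : Deque I l (s.natReg 6) (s.natReg 6) (lineCost I l s) (s.natArr 15) (s.natReg 13)
      (s.natReg 14) (s.natReg 15)) :
    wp cutProg (fun t s' =>
      t + 300 * s'.natReg 14 + 40 * s.natReg 15 + 300 * s.natReg 13 ≤
        300 * s.natReg 14 + 40 * s'.natReg 15 + 300 * s'.natReg 13 + 800 ∧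
      s'.natReg 13 ≤ s'.natReg 14 ∧
      Deque I l (s.natReg 6) (s.natReg 6 + 1) (lineCost I l s) (s'.natArr 15) (s'.natReg 13)
        (s'.natReg 14) (s'.natReg 15) ∧
      ∃ v cut fac, CutPost I l (s.natReg 6) cut fac v (lineCost I l s) ∧
        s'.realArr 2 = Function.update (s.realArr 2) (l * (I.n + 1) + (s.natReg 6 + 1)) v ∧
        s'.natArr 12 = Function.update (s.natArr 12) (l * (I.n + 1) + (s.natReg 6 + 1)) cut ∧
        s'.natArr 13 = Function.update (s.natArr 13) (l * (I.n + 1) + (s.natReg 6 + 1)) fac) s := by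
  have hr := hI.one_le_r
  unfold cutProg
  rw [wp_seq, wp_setNat, wp_seq]
  obtain ⟨k, hkk⟩ : ∃ k, s.natReg 6 = k := ⟨_, rfl⟩
  obtain ⟨F, hF0⟩ : ∃ F, lineCost I l s = F := ⟨_, rfl⟩
  simp only [hkk, hF0] at hk hkr hD ⊢
  have hjr : k + 1 - I.r + I.r = k + 1 := by omega
  set j := k + 1 - I.r
  have hev : (nr 6 + 1 - nr 1 : NatExpr).eval s = j := by simp [hkk, h.r, j]
  rw [hev]
  have hF1 : lineCost I l (s.setN 19 j) = F := hF0
  refine (popBack_spec (k := k) (l := l) hI (by simpa using hl.b) (by simp; omega) (by simpa using hlo)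
    ?_).conseq ?_
  · simpa [hF1] using hD.popped hjr
  rintro t1 s1 hFr ⟨p1, p2, p3, p4⟩
  rw [hF1] at p3 p4
  simp at p1 p2 p3 p4
  have hB1 : Base I s1 := (h.agree (s' := s.setN 19 j) ⟨by simp, by simp, by simp, by simp⟩).agree
    (hFr.agree rfl)
  have hl1 : OnLine I l s1 := (hl.agree (s' := s.setN 19 j) ⟨by simp, by simp, by simp, by simp⟩).agree
    (hFr.agree rfl)
  have e6 : s1.natReg 6 = k := by simpa [hkk] using hFr.nr 6 rfl
  have e13 : s1.natReg 13 = s.natReg 13 := by simpa using hFr.nr 13 rfl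
  have e15 : s1.natReg 15 = s.natReg 15 := by simpa using hFr.nr 15 rfl
  have e19 : s1.natReg 19 = j := by simpa using hFr.nr 19 rfl
  have eQ : s1.natArr 15 = s.natArr 15 := by simpa using hFr.na 15 rfl
  have e12 : s1.natArr 12 = s.natArr 12 := by simpa using hFr.na 12 rfl
  have e13' : s1.natArr 13 = s.natArr 13 := by simpa using hFr.na 13 rfl
  have eF : s1.realArr 2 = s.realArr 2 := by simpa using hFr.ra 2 rfl
  have q1 := p3.push p2 p4 hjr
  have hlo1 : s.natReg 13 < s1.natReg 14 + 1 := by omega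
  have hQlo := q1.bound _ le_rfl hlo1
  simp only [wp_seq (c₁ := .writeNat _ _ _), wp_writeNat, wp_seq (c₁ := .setNat _ _), wp_setNat,
    wp_seq (c₁ := .setReal _ _), wp_setReal]
  rw [userPos_eval (l := l) (hB1.agree ⟨by simp, by simp, by simp, by simp⟩)
      (hl1.agree ⟨by simp, by simp, by simp, by simp⟩) (by simp [e6]; omega)]
  rw [userPos_eval (l := l) (hB1.agree ⟨by simp, by simp, by simp, by simp⟩)
      (hl1.agree ⟨by simp, by simp, by simp, by simp⟩) (by simp [eQ, e19, e13]; omega)]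
  rw [wp_seq]
  obtain ⟨Q1, hQ1⟩ : ∃ Q1, Function.update (s.natArr 15) (s1.natReg 14) j = Q1 := ⟨_, rfl⟩
  rw [hQ1] at q1 hQlo
  simp [e19, eQ, e13, e6]
  generalize hu : ((((s1.wrN 15 (s1.natReg 14) j).setN 14 (s1.natReg 14 + 1)).setR 3 (I.X l k)).setR 4
    (I.X l (Function.update (s.natArr 15) (s1.natReg 14) j (s.natReg 13)))) = u
  have hBu : Base I u := hB1.agree ⟨by simp [← hu], by simp [← hu], by simp [← hu], by simp [← hu]⟩
  have hlu : OnLine I l u := hl1.agree ⟨by simp [← hu], by simp [← hu], by simp [← hu], by simp [← hu]⟩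
  have u3 : u.realReg 3 = I.X l k := by simp [← hu]
  have u4 : u.realReg 4 = I.X l (Q1 (s.natReg 13)) := by simp [← hu, hQ1]
  have u15 : u.natReg 15 = s.natReg 15 := by simp [← hu, e15]
  have u13 : u.natReg 13 = s.natReg 13 := by simp [← hu, e13]
  have u14 : u.natReg 14 = s1.natReg 14 + 1 := by simp [← hu]
  have u6 : u.natReg 6 = k := by simp [← hu, e6]
  have uQ : u.natArr 15 = Q1 := by simp [← hu, eQ, hQ1]
  have u12 : u.natArr 12 = s.natArr 12 := by simp [← hu, e12]
  have u13' : u.natArr 13 = s.natArr 13 := by simp [← hu, e13']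
  have uF : u.realArr 2 = s.realArr 2 := by simp [← hu, eF]
  clear hu
  refine (walk_spec hI hBu hlu.toOnLeg ?_).conseq ?_
  · rw [u3, u4, u15]; exact q1.ptOK hI hlo1 hk le_rfl
  rintro t2 s2 hFr2 ⟨k1, k2, k3⟩
  unfold CostPost at k3
  rw [u3, u4] at k2 k3
  have q2 := q1.move hI hlo1 k2
  have hB2 : Base I s2 := hBu.agree (hFr2.agree rfl)
  have hl2 : OnLine I l s2 := hlu.agree (hFr2.agree rfl)
  have v3 := (hFr2.rr 3 rfl).trans u3
  have v4 := (hFr2.rr 4 rfl).trans u4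
  have v13 := (hFr2.nr 13 rfl).trans u13
  have v14 := (hFr2.nr 14 rfl).trans u14
  have v6 := (hFr2.nr 6 rfl).trans u6
  have vQ := (hFr2.na 15 rfl).trans uQ
  have v12 := (hFr2.na 12 rfl).trans u12
  have v13' := (hFr2.na 13 rfl).trans u13'
  have vF := (hFr2.ra 2 rfl).trans uF
  have hF2 : lineCost I l s2 = F := by rw [← hF0]; unfold lineCost; rw [vF]
  refine (popFront_spec (k := k) hI hB2 hl2 hk v3 (by rw [v4, vQ, v13]) (by rw [hF2, vQ, v13, v14]; exact q2)
    (by rw [v13, v14]; exact hlo1) (by unfold CostPost; rw [v3, v4]; exact k3)).conseq ?_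
  rintro t3 s3 hFr3 ⟨m1, m2, m3, m4, m5, m6⟩
  rw [hF2, vQ] at m2 m6
  rw [vQ] at m4 m5
  rw [v14] at m2 m3 m6
  have w14 := (hFr3.nr 14 rfl).trans v14
  have w6 := (hFr3.nr 6 rfl).trans v6
  have wQ := (hFr3.na 15 rfl).trans vQ
  have w12 := (hFr3.na 12 rfl).trans v12
  have w13' := (hFr3.na 13 rfl).trans v13'
  have wF := (hFr3.ra 2 rfl).trans vF
  have hl3 : OnLine I l s3 := hl2.agree (hFr3.agree rfl)
  have hF3 : s3.realArr 2 (l * (I.n + 1) + Q1 (s3.natReg 13)) = F (Q1 (s3.natReg 13)) := by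
    rw [wF, ← hF0]; rfl
  have hcut := m2.bound _ le_rfl m3
  have hmin : ∀ j', j' + I.r ≤ k + 1 → cutCost I l F k (Q1 (s3.natReg 13)) ≤ cutCost I l F k j' :=
    fun j' hj' => m2.front_le hk m6 hj'
  simp [hl3.b, wQ, hF3, w6, w14]
  constructor
  · intro hle
    refine ⟨by omega, by omega, m2, s3.realReg 2, Q1 (s3.natReg 13), s3.natReg 18, ?_, by rw [wF, Nat.add_assoc],
      by rw [w12, Nat.add_assoc], by rw [w13', Nat.add_assoc]⟩
    have hv : s3.realReg 2 = cutCost I l F k (Q1 (s3.natReg 13)) := by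
      unfold cutCost; rw [← m4, max_eq_left hle]
    exact ⟨hv, hcut, fun j' hj' => hv ▸ hmin j' hj', m5⟩
  · intro hle
    refine ⟨by omega, by omega, m2, F (Q1 (s3.natReg 13)), Q1 (s3.natReg 13), s3.natReg 18, ?_, by rw [wF, Nat.add_assoc],
      by rw [w12, Nat.add_assoc], by rw [w13', Nat.add_assoc]⟩
    have hv : F (Q1 (s3.natReg 13)) = cutCost I l F k (Q1 (s3.natReg 13)) := by
      unfold cutCost; rw [← m4, max_eq_right hle.le]
    exact ⟨hv, hcut, fun j' hj' => hv ▸ hmin j' hj', fun hlt =>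
      cert_of_le (m5 (hle.trans hlt)) hle.le⟩

end Gather

/-! ### The star alternative and the tables of all legs -/

namespace Gather
open RAM

/-- Either the nearest user joins the star and the entry for one user less is used, or the entire
stretch is left to clusters of the leg. Array `14` records where the star ends. -/
def starProg : Program :=
  .ite (.natEq (nr 35) 1) (.setReal 5 (userPos (nr 6) + userPos (nr 6)))
    (.ite (.natEq (nr 5) (na 1 0)) (.setReal 5 (userPos (nr 6) - ra 1 0))
      (.setReal 5 (userPos (nr 6) + ra 1 0))) ⨟
  .ite (.realLe (rr 5) (ra 3 (nr 11 + nr 6))) (.setReal 5 (ra 3 (nr 11 + nr 6))) .skip ⨟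
  .ite (.realLe (ra 2 (nr 11 + nr 6 + 1)) (rr 5))
    (.writeReal 3 (nr 11 + nr 6 + 1) (ra 2 (nr 11 + nr 6 + 1)) ⨟
      .writeNat 14 (nr 11 + nr 6 + 1) (nr 6 + 1))
    (.writeReal 3 (nr 11 + nr 6 + 1) (rr 5) ⨟
      .writeNat 14 (nr 11 + nr 6 + 1) (na 14 (nr 11 + nr 6)))

/-- Fewer than `r` users have no partition; `big` stands for infinity. -/
def lineStepProg : Program :=
  .ite (.natLe (nr 1) (nr 6 + 1)) cutProg (.writeReal 2 (nr 11 + nr 6 + 1) (rr 1)) ⨟ starProg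

def lineInitProg : Program :=
  .setNat 11 (na 3 (nr 5)) ⨟ .setNat 12 (na 6 (nr 5)) ⨟ .setNat 16 (na 5 (nr 5)) ⨟
  .setNat 17 (na 8 (nr 5)) ⨟ .setNat 13 0 ⨟ .setNat 14 0 ⨟ .setNat 15 0 ⨟
  .writeReal 2 (nr 11) 0 ⨟ .writeReal 3 (nr 11) 0 ⨟ .writeNat 14 (nr 11) 0

def lineProg : Program := lineInitProg ⨟ forUp 6 (nr 12) lineStepProg

def linesProg : Program := forUp 5 (nr 0) lineProg

variable {I : Inst} {s s' : State} {l : ℕ}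

/-- The cost of the leg `l` when some of its users may join a central star cluster. -/
def starCost (I : Inst) (l : ℕ) (s : State) (κ : ℕ) : ℝ := s.realArr 3 (l * (I.n + 1) + κ)
def lineCut (I : Inst) (l : ℕ) (s : State) (κ : ℕ) : ℕ := s.natArr 12 (l * (I.n + 1) + κ)
def lineFac (I : Inst) (l : ℕ) (s : State) (κ : ℕ) : ℕ := s.natArr 13 (l * (I.n + 1) + κ)
def starTgt (I : Inst) (l : ℕ) (s : State) (κ : ℕ) : ℕ := s.natArr 14 (l * (I.n + 1) + κ)

/-- `line_le` and `star_le` bound the entries by every achievable `D` below `big`. The other fields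
say that the recorded cut and star target attain the stored values, which is needed to read off a
solution. -/
structure LineCell (I : Inst) (s : State) (l κ : ℕ) : Prop where
  line_le : ∀ D, 0 ≤ D → D < I.big → I.LineLe D l κ → lineCost I l s κ ≤ D
  line_cut : κ ≠ 0 → lineCost I l s κ < I.big → lineCut I l s κ + I.r ≤ κ ∧
    I.cert (lineFac I l s κ) l (I.X l (κ - 1)) (I.X l (lineCut I l s κ)) (lineCost I l s κ) ∧
    lineCost I l s (lineCut I l s κ) ≤ lineCost I l s κ
  star_le : ∀ D, 0 ≤ D → D < I.big → I.StarLe D l κ → starCost I l s κ ≤ D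
  tgt_le : starTgt I l s κ ≤ κ
  tgt_cost : lineCost I l s (starTgt I l s κ) ≤ starCost I l s κ
  tgt_star : ∀ k, starTgt I l s κ ≤ k → k < κ → I.star (usr I.n I.leg l k) ≤ starCost I l s κ

/-- The tables of the legs agree at address `a`. -/
structure SameAt (s s' : State) (a : ℕ) : Prop where
  f : s'.realArr 2 a = s.realArr 2 a
  st : s'.realArr 3 a = s.realArr 3 a
  cut : s'.natArr 12 a = s.natArr 12 a
  fac : s'.natArr 13 a = s.natArr 13 a
  tgt : s'.natArr 14 a = s.natArr 14 a

theorem SameAt.trans {s'' : State} {a : ℕ} (h : SameAt s s' a) (h' : SameAt s' s'' a) :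
    SameAt s s'' a :=
  ⟨h'.f.trans h.f, h'.st.trans h.st, h'.cut.trans h.cut, h'.fac.trans h.fac, h'.tgt.trans h.tgt⟩

theorem LineCell.congr {κ : ℕ} (hr : 1 ≤ I.r) (h : LineCell I s l κ)
    (h' : ∀ j ≤ κ, SameAt s s' (l * (I.n + 1) + j)) : LineCell I s' l κ := by
  have e1 : ∀ j ≤ κ, lineCost I l s' j = lineCost I l s j := fun j hj => (h' j hj).f
  have e2 : starCost I l s' κ = starCost I l s κ := (h' κ le_rfl).st
  have e3 : lineCut I l s' κ = lineCut I l s κ := (h' κ le_rfl).cut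
  have e4 : lineFac I l s' κ = lineFac I l s κ := (h' κ le_rfl).fac
  have e5 : starTgt I l s' κ = starTgt I l s κ := (h' κ le_rfl).tgt
  refine ⟨?_, ?_, ?_, ?_, ?_, ?_⟩
  · rw [e1 κ le_rfl]; exact h.line_le
  · intro h0 hlt
    rw [e1 κ le_rfl] at hlt
    have := h.line_cut h0 hlt
    rw [e3, e4, e1 κ le_rfl, e1 _ (by omega)]
    exact this
  · rw [e2]; exact h.star_le
  · rw [e5]; exact h.tgt_le
  · rw [e5, e2, e1 _ h.tgt_le]; exact h.tgt_cost
  · rw [e5, e2]; exact h.tgt_star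

theorem LineCell.zero (h1 : lineCost I l s 0 = 0) (h2 : starCost I l s 0 = 0)
    (h3 : starTgt I l s 0 = 0) : LineCell I s l 0 := by
  refine ⟨fun D hD _ _ => by rw [h1]; exact hD, by simp, fun D hD _ _ => by rw [h2]; exact hD,
    by rw [h3], by rw [h3, h2, h1], by omega⟩

/-- The last step of `Line` is a cut, and `CutPost` minimizes over all admissible cuts. The two
constructors of `StarLine` are the two alternatives that `hs` compares. -/
theorem LineCell.succ {k : ℕ} (hI : I.WF) (hk : k < I.cnt l) (h : ∀ κ ≤ k, LineCell I s l κ)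
    (hf : (k + 1 < I.r ∧ lineCost I l s (k + 1) = I.big) ∨
      CutPost I l k (lineCut I l s (k + 1)) (lineFac I l s (k + 1)) (lineCost I l s (k + 1))
        (lineCost I l s))
    (hs : (starCost I l s (k + 1) = lineCost I l s (k + 1) ∧ starTgt I l s (k + 1) = k + 1 ∧
        lineCost I l s (k + 1) ≤ max (I.star (usr I.n I.leg l k)) (starCost I l s k)) ∨
      (starCost I l s (k + 1) = max (I.star (usr I.n I.leg l k)) (starCost I l s k) ∧
        starTgt I l s (k + 1) = starTgt I l s k ∧
        max (I.star (usr I.n I.leg l k)) (starCost I l s k) ≤ lineCost I l s (k + 1))) :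
    LineCell I s l (k + 1) := by
  have hr := hI.one_le_r
  have hle : ∀ D, 0 ≤ D → D < I.big → I.LineLe D l (k + 1) → lineCost I l s (k + 1) ≤ D := by
    intro D hD0 hD hL
    cases hL with
    | step h1 h2 h3 h4 =>
      rcases hf with ⟨h5, -⟩ | h5
      · omega
      · exact (h5.2.2.1 _ h1).trans (max_le h3 ((h _ (by omega)).line_le D hD0 hD h4))
  refine ⟨hle, fun _ hlt => ?_, fun D hD0 hD hS => ?_, ?_, ?_, ?_⟩
  · rcases hf with ⟨h5, h6⟩ | ⟨h1, h2, h3, h4⟩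
    · rw [h6] at hlt; exact absurd hlt (lt_irrefl _)
    · exact ⟨h2, h4 hlt, by rw [h1]; exact le_max_right _ _⟩
  · generalize hκ : k + 1 = κ at hS
    cases hS with
    | line h1 =>
      subst hκ
      have := hle D hD0 hD h1
      rcases hs with ⟨h2, -⟩ | ⟨h2, -, h3⟩
      · rw [h2]; exact this
      · rw [h2]; exact h3.trans this
    | step h1 h2 h3 =>
      obtain rfl : k = _ := Nat.succ.inj hκ
      have : max (I.star (usr I.n I.leg l k)) (starCost I l s k) ≤ D :=
        max_le h2 ((h k le_rfl).star_le D hD0 hD h3)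
      rcases hs with ⟨h2, -, h3⟩ | ⟨h2, -⟩
      · rw [h2]; exact h3.trans this
      · rw [h2]; exact this
  · have := (h k le_rfl).tgt_le
    rcases hs with ⟨-, h2, -⟩ | ⟨-, h2, -⟩ <;> omega
  · rcases hs with ⟨h1, h2, -⟩ | ⟨h1, h2, -⟩ <;> rw [h1, h2]
    exact (h k le_rfl).tgt_cost.trans (le_max_right _ _)
  · intro k' h3 h4
    rcases hs with ⟨h1, h2, -⟩ | ⟨h1, h2, -⟩
    · omega
    · rw [h1]
      rw [h2] at h3
      rcases (show k' < k ∨ k' = k by omega) with h5 | rfl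
      · exact ((h k le_rfl).tgt_star k' h3 h5).trans (le_max_right _ _)
      · exact le_max_left _ _

theorem star_spec (h : Base I s) (hl : OnLine I l s) (hk : s.natReg 6 < I.cnt l) :
    wp starProg (fun t s' => t ≤ 100 ∧ ∃ v tgt,
      s'.realArr 3 = Function.update (s.realArr 3) (l * (I.n + 1) + (s.natReg 6 + 1)) v ∧
      s'.natArr 14 = Function.update (s.natArr 14) (l * (I.n + 1) + (s.natReg 6 + 1)) tgt ∧
      ((v = lineCost I l s (s.natReg 6 + 1) ∧ tgt = s.natReg 6 + 1 ∧
        lineCost I l s (s.natReg 6 + 1) ≤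
          max (I.star (usr I.n I.leg l (s.natReg 6))) (starCost I l s (s.natReg 6))) ∨
      (v = max (I.star (usr I.n I.leg l (s.natReg 6))) (starCost I l s (s.natReg 6)) ∧
        tgt = starTgt I l s (s.natReg 6) ∧
        max (I.star (usr I.n I.leg l (s.natReg 6))) (starCost I l s (s.natReg 6)) ≤
          lineCost I l s (s.natReg 6 + 1)))) s := by
  have hu : (userPos (nr 6)).eval s = I.pos (usr I.n I.leg l (s.natReg 6)) :=
    userPos_eval h hl hk
  have hleg : I.leg (usr I.n I.leg l (s.natReg 6)) = l := leg_usr hk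
  obtain ⟨x, hx⟩ : ∃ x, I.star (usr I.n I.leg l (s.natReg 6)) = x := ⟨_, rfl⟩
  have key : ∀ t, t ≤ 30 → wp (.ite (.realLe (rr 5) (ra 3 (nr 11 + nr 6)))
        (.setReal 5 (ra 3 (nr 11 + nr 6))) .skip ⨟
      .ite (.realLe (ra 2 (nr 11 + nr 6 + 1)) (rr 5))
        (.writeReal 3 (nr 11 + nr 6 + 1) (ra 2 (nr 11 + nr 6 + 1)) ⨟
          .writeNat 14 (nr 11 + nr 6 + 1) (nr 6 + 1))
        (.writeReal 3 (nr 11 + nr 6 + 1) (rr 5) ⨟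
          .writeNat 14 (nr 11 + nr 6 + 1) (na 14 (nr 11 + nr 6)))) (fun t' s' =>
      t + t' ≤ 100 ∧ ∃ v tgt,
      s'.realArr 3 = Function.update (s.realArr 3) (l * (I.n + 1) + (s.natReg 6 + 1)) v ∧
      s'.natArr 14 = Function.update (s.natArr 14) (l * (I.n + 1) + (s.natReg 6 + 1)) tgt ∧
      ((v = lineCost I l s (s.natReg 6 + 1) ∧ tgt = s.natReg 6 + 1 ∧
        lineCost I l s (s.natReg 6 + 1) ≤ max x (starCost I l s (s.natReg 6))) ∨
      (v = max x (starCost I l s (s.natReg 6)) ∧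
        tgt = starTgt I l s (s.natReg 6) ∧
        max x (starCost I l s (s.natReg 6)) ≤ lineCost I l s (s.natReg 6 + 1)))) (s.setR 5 x) := by
    intro t ht
    unfold lineCost starCost starTgt
    simp [hl.b]
    simp only [Nat.add_assoc]
    refine ⟨fun h1 => ⟨fun h2 => ?_, fun h2 => ?_⟩, fun h1 => ⟨fun h2 => ?_, fun h2 => ?_⟩⟩
    · exact ⟨by omega, _, rfl, _, rfl, Or.inl ⟨rfl, rfl, Or.inr h2⟩⟩
    · exact ⟨by omega, _, rfl, _, rfl, Or.inr ⟨(max_eq_right h1).symm, rfl, h1.trans h2.le, h2.le⟩⟩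
    · exact ⟨by omega, _, rfl, _, rfl, Or.inl ⟨rfl, rfl, Or.inl h2⟩⟩
    · exact ⟨by omega, _, rfl, _, rfl, Or.inr ⟨(max_eq_left h1.le).symm, rfl, h2.le, h1.le.trans h2.le⟩⟩
  rw [hx]
  unfold starProg
  rw [wp_seq]
  simp only [wp_ite, wp_setReal, Test.Holds, RealExpr.eval_add, RealExpr.eval_sub, hu,
    NatExpr.eval_reg, NatExpr.eval_one, RealExpr.eval_read, NatExpr.eval_zero, NatExpr.eval_read,
    h.mode, hl.leg, h.fl, h.fp]
  unfold Inst.star at hx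
  rw [hleg] at hx
  refine ⟨fun h1 => ?_, fun h1 => ⟨fun h2 => ?_, fun h2 => ?_⟩⟩
  · rw [if_pos h1] at hx
    rw [hx]; exact key _ (by simp)
  · rw [if_neg h1, if_pos h2] at hx
    rw [hx]; exact key _ (by simp)
  · rw [if_neg h1, if_neg h2] at hx
    rw [hx]; exact key _ (by simp)

structure LineInv (I : Inst) (l : ℕ) (s s' : State) (k : ℕ) : Prop where
  cell : ∀ κ ≤ k, LineCell I s' l κ
  lo_le : s'.natReg 13 ≤ s'.natReg 14
  deque : Deque I l k k (lineCost I l s') (s'.natArr 15) (s'.natReg 13) (s'.natReg 14) (s'.natReg 15)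
  other : ∀ a, (∀ j ≤ I.n, a ≠ l * (I.n + 1) + j) → SameAt s s' a

theorem lineStep_spec (hI : I.WF) {s₀ : State} (h : Base I s) (hl : OnLine I l s) {k : ℕ}
    (hk : k < I.cnt l) (h6 : s.natReg 6 = k) (hinv : LineInv I l s₀ s k) :
    wp lineStepProg (fun t s' => t + 300 * s'.natReg 14 + 40 * s.natReg 15 + 300 * s.natReg 13 ≤
        300 * s.natReg 14 + 40 * s'.natReg 15 + 300 * s'.natReg 13 + 1000 ∧
      LineInv I l s₀ s' (k + 1)) s := by
  have hkn : k < I.n := lt_of_lt_of_le hk (Nat.count_le _)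
  obtain ⟨b, hb⟩ : ∃ b, l * (I.n + 1) = b := ⟨_, rfl⟩
  have key : ∀ t s1, Frame cutProg s s1 →
      t + 300 * s1.natReg 14 + 40 * s.natReg 15 + 300 * s.natReg 13 ≤
        300 * s.natReg 14 + 40 * s1.natReg 15 + 300 * s1.natReg 13 + 820 →
      s1.natReg 13 ≤ s1.natReg 14 →
      Deque I l k (k + 1) (lineCost I l s) (s1.natArr 15) (s1.natReg 13) (s1.natReg 14)
        (s1.natReg 15) →
      (∀ a, a ≠ b + (k + 1) → SameAt s s1 a) →
      ((k + 1 < I.r ∧ lineCost I l s1 (k + 1) = I.big) ∨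
        CutPost I l k (lineCut I l s1 (k + 1)) (lineFac I l s1 (k + 1)) (lineCost I l s1 (k + 1))
        (lineCost I l s)) →
      wp starProg (fun t' s' => t + t' + 300 * s'.natReg 14 + 40 * s.natReg 15 + 300 * s.natReg 13 ≤
        300 * s.natReg 14 + 40 * s'.natReg 15 + 300 * s'.natReg 13 + 1000 ∧
        LineInv I l s₀ s' (k + 1)) s1 := by
    intro t s1 hF ht hlo hD hsame hcut
    have e6 : s1.natReg 6 = k := (hF.nr 6 rfl).trans h6
    refine (star_spec (h.agree (hF.agree rfl)) (hl.agree (hF.agree rfl)) (by rw [e6]; exact hk)).conseq ?_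
    rintro t' s2 hF2 ⟨ht2, v, tgt, hv, htgt, hs⟩
    rw [e6] at hv htgt hs
    have f13 : s2.natReg 13 = s1.natReg 13 := hF2.nr 13 rfl
    have f14 : s2.natReg 14 = s1.natReg 14 := hF2.nr 14 rfl
    have f15 : s2.natReg 15 = s1.natReg 15 := hF2.nr 15 rfl
    have fQ : s2.natArr 15 = s1.natArr 15 := hF2.na 15 rfl
    have f2 : s2.realArr 2 = s1.realArr 2 := hF2.ra 2 rfl
    have f12 : s2.natArr 12 = s1.natArr 12 := hF2.na 12 rfl
    have f13' : s2.natArr 13 = s1.natArr 13 := hF2.na 13 rfl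
    have hsame2 : ∀ a, a ≠ b + (k + 1) → SameAt s s2 a := fun a ha => (hsame a ha).trans
      ⟨by rw [f2], by rw [hv, hb, Function.update_of_ne ha], by rw [f12], by rw [f13'],
        by rw [htgt, hb, Function.update_of_ne ha]⟩
    have hcell : ∀ κ ≤ k, LineCell I s2 l κ := fun κ hκ => (hinv.cell κ hκ).congr hI.one_le_r fun j hj =>
      hsame2 _ (by omega)
    have hcost1 : ∀ j ≤ k, lineCost I l s2 j = lineCost I l s j := fun j hj => (hsame2 _ (by omega)).f
    have hcost2 : lineCost I l s2 = lineCost I l s1 := by unfold lineCost; rw [f2]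
    have hst : ∀ j ≤ k, starCost I l s2 j = starCost I l s1 j := fun j hj => by
      unfold starCost; rw [hv, Function.update_of_ne (by omega)]
    have htg : starTgt I l s2 k = starTgt I l s1 k := by
      unfold starTgt; rw [htgt, Function.update_of_ne (by omega)]
    have hv' : starCost I l s2 (k + 1) = v := by unfold starCost; rw [hv, Function.update_self]
    have htg' : starTgt I l s2 (k + 1) = tgt := by unfold starTgt; rw [htgt, Function.update_self]
    have hnew : LineCell I s2 l (k + 1) := by
      refine LineCell.succ hI hk hcell ?_ ?_
      · refine hcut.imp (fun h1 => ⟨h1.1, by rw [hcost2]; exact h1.2⟩) ?_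
        rintro ⟨h1, h2, h3, h4⟩
        have hr := hI.one_le_r
        have hcc : ∀ j, j + I.r ≤ k + 1 → cutCost I l (lineCost I l s2) k j =
            cutCost I l (lineCost I l s) k j := fun j hj => by
          unfold cutCost; rw [hcost1 j (by omega)]
        have e1 : lineCut I l s2 (k + 1) = lineCut I l s1 (k + 1) := by unfold lineCut; rw [f12]
        have e2 : lineFac I l s2 (k + 1) = lineFac I l s1 (k + 1) := by unfold lineFac; rw [f13']
        rw [hcost2, e1, e2]
        rw [hcost2] at hcc
        refine ⟨?_, h2, fun j hj => ?_, h4⟩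
        · rw [hcc _ h2]; exact h1
        · rw [hcc _ hj]; exact h3 j hj
      · rw [hv', htg', hst k le_rfl, htg, hcost2]
        exact hs
    refine ⟨by omega, ⟨fun κ hκ => ?_, by omega, ?_, ?_⟩⟩
    · rcases (show κ ≤ k ∨ κ = k + 1 by omega) with h1 | rfl
      · exact hcell κ h1
      · exact hnew
    · rw [fQ, f13, f14, f15]
      exact (hD.mono (Nat.le_succ k)).congr hI fun j hj => hcost1 j (by omega)
    · intro a ha
      refine (hinv.other a ha).trans (hsame2 a ?_)
      rw [← hb]; exact ha (k + 1) hkn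
  unfold lineStepProg
  rw [wp_seq, wp_ite]
  constructor
  · intro hb1
    simp [h.r, h6] at hb1
    refine (cut_spec hI h hl (by rw [h6]; exact hk) (by rw [h6]; exact hb1) hinv.lo_le
      (by rw [h6]; exact hinv.deque)).conseq ?_
    rintro t s1 hF ⟨k1, k2, k3, v, cut, fac, k4, k5, k6, k7⟩
    rw [h6, hb] at k5 k6 k7
    rw [h6] at k3 k4
    refine key _ s1 hF (by simp; omega) k2 k3 ?_ ?_
    · intro a ha
      exact ⟨by rw [k5, Function.update_of_ne ha], by rw [hF.ra 3 rfl], by rw [k6, Function.update_of_ne ha],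
        by rw [k7, Function.update_of_ne ha], by rw [hF.na 14 rfl]⟩
    · right
      have e1 : lineCut I l s1 (k + 1) = cut := by unfold lineCut; rw [k6, hb, Function.update_self]
      have e2 : lineFac I l s1 (k + 1) = fac := by unfold lineFac; rw [k7, hb, Function.update_self]
      have e3 : lineCost I l s1 (k + 1) = v := by unfold lineCost; rw [k5, hb, Function.update_self]
      rw [e1, e2, e3]
      exact k4
  · intro hb1
    simp [h.r, h6] at hb1
    rw [wp_writeReal]
    have he : (nr 11 + nr 6 + 1 : NatExpr).eval s = b + (k + 1) := by simp [hl.b, hb, h6, Nat.add_assoc]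
    have he' : (rr 1).eval s = I.big := h.big
    rw [he, he']
    refine key _ _ ?_ ?_ hinv.lo_le ?_ ?_ ?_
    · exact ⟨fun _ _ => rfl, fun _ _ => rfl, fun _ _ => rfl, fun x hx => by
        rw [State.wrR_realArr, if_neg]; rintro rfl; exact absurd hx (by decide)⟩
    · simp
      omega
    · exact hinv.deque.raise (Nat.le_succ k) hb1
    · intro a ha
      exact ⟨by simp [ha], by simp, by simp, by simp, by simp⟩
    · exact Or.inl ⟨hb1, by simp [lineCost, hb]⟩

theorem lineInit_spec (hI : I.WF) (h : Base I s) (hl : l < I.d) (h5 : s.natReg 5 = l) :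
    wp lineInitProg (fun t u => t ≤ 50 ∧ Base I u ∧ OnLine I l u ∧ u.natReg 12 = I.cnt l ∧
      u.natReg 13 = 0 ∧ u.natReg 14 = 0 ∧ u.natReg 15 = 0 ∧ LineInv I l s u 0) s := by
  generalize hQ : (fun t u => t ≤ 50 ∧ Base I u ∧ OnLine I l u ∧ u.natReg 12 = I.cnt l ∧
      u.natReg 13 = 0 ∧ u.natReg 14 = 0 ∧ u.natReg 15 = 0 ∧ LineInv I l s u 0) = Q
  unfold lineInitProg
  simp [h5, h.bs l hl.le, h.cnt, h.bm l hl.le, h.cntF]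
  generalize hu : ((((((((((s.setN 11 (l * (I.n + 1))).setN 12 (I.cnt l)).setN 16
    (l * (I.m + 1))).setN 17 (I.cntF l)).setN 13 0).setN 14 0).setN 15 0).wrR 2 (l * (I.n + 1)) 0).wrR 3
    (l * (I.n + 1)) 0).wrN 14 (l * (I.n + 1)) 0) = u
  rw [← hQ]
  have u13 : u.natReg 13 = 0 := by simp [← hu]
  have u14 : u.natReg 14 = 0 := by simp [← hu]
  have u15 : u.natReg 15 = 0 := by simp [← hu]
  refine ⟨by norm_num, h.agree ⟨by simp [← hu], by simp [← hu], by simp [← hu], by simp [← hu]⟩,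
    ⟨⟨hl, by simp [← hu, h5], by simp [← hu], by simp [← hu]⟩, by simp [← hu]⟩, by simp [← hu], u13, u14,
    u15, fun κ hκ => ?_, by omega, by rw [u13, u14, u15]; exact Deque.empty hI, fun a ha => ?_⟩
  · obtain rfl : κ = 0 := by omega
    exact LineCell.zero (by simp [← hu, lineCost]) (by simp [← hu, starCost])
      (by simp [← hu, starTgt])
  · have := ha 0 (by omega)
    simp at this
    exact ⟨by simp [← hu, this], by simp [← hu, this], by simp [← hu], by simp [← hu],
      by simp [← hu, this]⟩

/-- The credits telescope: the front of the queue never passes its back, and the pointer stays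
within the facilities of the leg, so linear time remains. -/
theorem line_spec (hI : I.WF) (h : Base I s) (hl : l < I.d) (h5 : s.natReg 5 = l) :
    wp lineProg (fun t s' => t ≤ 1100 * (I.cnt l) + 40 * I.cntF l + 100 ∧
      (∀ κ ≤ I.cnt l, LineCell I s' l κ) ∧
      ∀ a, (∀ j ≤ I.n, a ≠ l * (I.n + 1) + j) → SameAt s s' a) s := by
  unfold lineProg
  rw [wp_seq]
  refine (lineInit_spec hI h hl h5).mono ?_
  rintro t0 u ⟨ht0, hB, hL, u12, u13, u14, u15, hinv⟩
  refine wp_forUp_time (I.cnt l) (fun k t s' => t + 300 * s'.natReg 14 ≤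
    1020 * k + 40 * s'.natReg 15 + 300 * s'.natReg 13 ∧ LineInv I l s s' k) ?_ rfl ?_ ?_ ?_
  · intro s' hF
    simpa [u12] using hF.nr 12 rfl
  · refine ⟨by simp; omega, ?_⟩
    exact ⟨fun κ hκ => (hinv.cell κ hκ).congr hI.one_le_r fun j _ => ⟨rfl, rfl, rfl, rfl, rfl⟩, hinv.lo_le,
      hinv.deque, fun a ha => (hinv.other a ha).trans ⟨rfl, rfl, rfl, rfl, rfl⟩⟩
  · rintro k hk t s' hF h6 ⟨h7, h8⟩
    refine (lineStep_spec hI (hB.agree (hF.agree rfl)) (hL.agree (hF.agree rfl)) hk h6 h8).mono ?_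
    rintro t' s'' ⟨h9, h10⟩
    refine ⟨by simp; omega, ?_⟩
    exact ⟨fun κ hκ => (h10.cell κ hκ).congr hI.one_le_r fun j _ => ⟨rfl, rfl, rfl, rfl, rfl⟩, h10.lo_le,
      h10.deque, fun a ha => (h10.other a ha).trans ⟨rfl, rfl, rfl, rfl, rfl⟩⟩
  · rintro t s' hF h6 ⟨h7, h8⟩
    have hpt : s'.natReg 15 ≤ I.cntF l := by
      rcases h8.deque.ptr with h | h <;> omega
    have := h8.lo_le
    refine ⟨by simp; omega, h8.cell, h8.other⟩

/-- The legs are disjoint, so linear time per leg is linear time in total. -/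
theorem sum_cb_le (leg : ℕ → ℕ) (d n : ℕ) : ∑ l ∈ Finset.range d, cb leg l n ≤ n := by
  simp only [cb_eq_card]
  rw [← Finset.card_biUnion]
  · refine (Finset.card_le_card (t := Finset.range n) ?_).trans (by simp)
    intro x hx
    simp at hx
    simpa using hx.2
  · intro a _ b _ hab
    rw [Function.onFun, Finset.disjoint_left]
    intro x h1 h2
    simp at h1 h2
    omega

theorem lines_spec (hI : I.WF) (h : Base I s) :
    wp linesProg (fun t s' => t ≤ 1200 * (I.n + I.m + I.d + 1) ∧
      ∀ l < I.d, ∀ κ ≤ I.cnt l, LineCell I s' l κ) s := by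
  have hcn : ∀ l, I.cnt l ≤ I.n := fun l => Nat.count_le _
  refine wp_forUp I.d (fun l => 1100 * I.cnt l + 40 * I.cntF l + 100)
    (fun k s' => ∀ l < k, ∀ κ ≤ I.cnt l, LineCell I s' l κ) ?_ rfl (by simp) ?_ ?_
  · intro s' hF
    simpa [h.d] using hF.nr 0 rfl
  · intro l hl s' hF h5 hcell
    refine (line_spec hI (h.agree (hF.agree rfl)) hl h5).mono ?_
    rintro t s'' ⟨h1, h2, h3⟩
    refine ⟨h1, fun l' hl' κ hκ => ?_⟩
    rcases (show l' < l ∨ l' = l by omega) with h4 | rfl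
    · refine (hcell l' h4 κ hκ).congr hI.one_le_r fun j hj => SameAt.trans (h3 _ ?_) ⟨rfl, rfl, rfl, rfl, rfl⟩
      intro j' hj' he
      have := hcn l'
      have := (addr_inj (N := I.n + 1) (by omega) (by omega) he).1
      omega
    · exact (h2 κ hκ).congr hI.one_le_r fun j _ => ⟨rfl, rfl, rfl, rfl, rfl⟩
  · intro t s' hF ht _ hcell
    refine ⟨?_, hcell⟩
    have e1 : ∑ l ∈ Finset.range I.d, I.cnt l ≤ I.n := sum_cb_le ..
    have e2 : ∑ l ∈ Finset.range I.d, I.cntF l ≤ I.m := sum_cb_le ..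
    simp [Finset.sum_add_distrib, ← Finset.mul_sum] at ht
    omega

end Gather

namespace Gather
open RAM

/-! ### The ways to close a leg -/

/-- A way to close leg `leg` if the number of waiting users is between `lo` and `hi`: the users
before the last `tgt` ones join the current cluster, which is completed if `top ≠ 0`. -/
structure Opt where
  leg : ℕ
  lo : ℕ
  hi : ℕ
  top : ℕ
  tgt : ℕ
  fac : ℕ
  val : ℝ

def optAt (s : State) (o : ℕ) : Opt :=
  ⟨s.natArr 18 o, s.natArr 19 o, s.natArr 20 o, s.natArr 21 o, s.natArr 22 o, s.natArr 23 o,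
    s.realArr 4 o⟩

def addOptProg (lo hi top tgt fac : NatExpr) (val : RealExpr) : Program :=
  .writeNat 18 (nr 25) (nr 5) ⨟ .writeNat 19 (nr 25) lo ⨟ .writeNat 20 (nr 25) hi ⨟
  .writeNat 21 (nr 25) top ⨟ .writeNat 22 (nr 25) tgt ⨟ .writeNat 23 (nr 25) fac ⨟
  .writeReal 4 (nr 25) val ⨟ .setNat 25 (nr 25 + 1)

/-- With `k` users of the leg completing the current cluster, at least `r - k` must be waiting;
truncated subtraction gives `0` when the `k` users suffice alone. -/
def topOptsProg : Program :=
  .setNat 6 0 ⨟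
  .loop (.and (.lt (nr 6) (nr 1 + nr 1)) (.lt (nr 6) (nr 12)))
    (.setNat 6 (nr 6 + 1) ⨟ .setReal 3 (0 - rr 7) ⨟ .setReal 4 (userPos (nr 12 - nr 6)) ⨟
    searchProg ⨟
    .ite (.realLe (rr 2) (ra 2 (nr 11 + (nr 12 - nr 6)))) (.setReal 2 (ra 2 (nr 11 + (nr 12 - nr 6))))
      .skip ⨟
    addOptProg (nr 1 - nr 6) (nr 1) 1 (nr 12 - nr 6) (nr 18) (rr 2))

/-- The count `r + 1` is reserved for the star phase. The admissible range of counts thus tells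
whether a way belongs to the sweep or to the star. -/
def legOptsProg : Program :=
  .setNat 11 (na 3 (nr 5)) ⨟ .setNat 12 (na 16 (nr 5)) ⨟ .setNat 16 (na 5 (nr 5)) ⨟
  .setNat 17 (na 8 (nr 5)) ⨟
  addOptProg 0 (nr 1) 0 (nr 12) 0 (ra 2 (nr 11 + nr 12)) ⨟
  addOptProg (nr 1 + 1) (nr 1 + 1) 0 (na 14 (nr 11 + nr 12)) 0 (ra 3 (nr 11 + nr 12)) ⨟
  topOptsProg

def optsProg : Program := .setNat 24 (nr 25) ⨟ forUp 5 (nr 0) legOptsProg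

variable {I : Inst} {s s' : State} {l q : ℕ}

/-- In `kind`, either no user of the leg joins the current cluster, or the nearest ones join the
star, or the nearest ones complete the current cluster, with a certificate for the segment formed by
it. -/
structure Opt.Valid (I : Inst) (s : State) (q : ℕ) (p : Opt) : Prop where
  leg_lt : p.leg < I.d
  tgt_le : p.tgt ≤ I.kap q p.leg
  line : lineCost I p.leg s p.tgt ≤ p.val
  kind : (p.top = 0 ∧ p.hi = I.r ∧ p.tgt = I.kap q p.leg) ∨
    (p.top = 0 ∧ p.lo = I.r + 1 ∧
      ∀ k, p.tgt ≤ k → k < I.kap q p.leg → I.star (usr I.n I.leg p.leg k) ≤ p.val) ∨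
    (p.top = 1 ∧ p.hi = I.r ∧ I.r + p.tgt ≤ p.lo + I.kap q p.leg ∧ p.tgt < I.kap q p.leg ∧
      (p.val < I.big → I.cert p.fac p.leg (- I.prev q) (I.X p.leg p.tgt) p.val))

/-- There is a way of the given kind. -/
def HasOpt (s : State) (ob oe l lo hi top : ℕ) (v : ℝ) : Prop :=
  ∃ o, ob ≤ o ∧ o < oe ∧ (optAt s o).leg = l ∧ (optAt s o).lo = lo ∧ (optAt s o).hi = hi ∧
    (optAt s o).top = top ∧ (optAt s o).val = v

structure LegOpts (I : Inst) (s : State) (q ob oe l : ℕ) : Prop where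
  plain : HasOpt s ob oe l 0 I.r 0 (lineCost I l s (I.kap q l))
  star : HasOpt s ob oe l (I.r + 1) (I.r + 1) 0 (starCost I l s (I.kap q l))
  top : ∀ k, 1 ≤ k → k ≤ 2 * I.r → k ≤ I.kap q l → HasOpt s ob oe l (I.r - k) I.r 1
    (max (I.g l (- I.prev q) (I.X l (I.kap q l - k))) (lineCost I l s (I.kap q l - k)))

def Lines (I : Inst) (s : State) : Prop := ∀ l < I.d, ∀ κ ≤ I.cnt l, LineCell I s l κ

theorem Lines.agree (hI : I.WF) (h : Lines I s) (ha : Agree [] [] [12, 13, 14] [2, 3] s s') :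
    Lines I s' := fun l hl κ hκ => (h l hl κ hκ).congr hI.one_le_r fun j _ =>
  ⟨by rw [ha.ra 2 (by decide)], by rw [ha.ra 3 (by decide)], by rw [ha.na 12 (by decide)],
    by rw [ha.na 13 (by decide)], by rw [ha.na 14 (by decide)]⟩

theorem kap_le (q l : ℕ) : I.kap q l ≤ I.cnt l := by
  induction q with
  | zero => exact le_rfl
  | succ q ih =>
    unfold Users.kap
    split_ifs <;> omega

theorem Opt.Valid.congr {p : Opt} (h : p.Valid I s q) (hf : s'.realArr 2 = s.realArr 2) :
    p.Valid I s' q :=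
  ⟨h.leg_lt, h.tgt_le, by unfold lineCost; rw [hf]; exact h.line, h.kind⟩

theorem HasOpt.congr {ob oe oe' lo hi top : ℕ} {v : ℝ} (h : HasOpt s ob oe l lo hi top v)
    (ho : ∀ o < oe, optAt s' o = optAt s o) (he : oe ≤ oe') : HasOpt s' ob oe' l lo hi top v := by
  obtain ⟨o, h1, h2, h3⟩ := h
  exact ⟨o, h1, by omega, by rw [ho o h2]; exact h3⟩

/-- The states agree except for the lists of ways. -/
structure AgreeButOpts (s s' : State) : Prop where
  nr : s'.natReg = s.natReg
  rr : s'.realReg = s.realReg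
  na : ∀ x, x < 18 → s'.natArr x = s.natArr x
  ra : ∀ x, x < 4 → s'.realArr x = s.realArr x

/-- The arguments are evaluated between the writes, so their values must not depend on the arrays
being written. -/
theorem addOpt_spec {lo hi top tgt fac : NatExpr} {val : RealExpr}
    {Q : ℕ → State → Prop} {vlo vhi vtop vtgt vfac : ℕ} {vval : ℝ}
    (h : ∀ s', AgreeButOpts s s' → lo.eval s' = vlo ∧ hi.eval s' = vhi ∧ top.eval s' = vtop ∧
      tgt.eval s' = vtgt ∧ fac.eval s' = vfac ∧ val.eval s' = vval)
    (hQ : ∀ s', Frame (addOptProg lo hi top tgt fac val) s s' →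
      s'.natReg 25 = s.natReg 25 + 1 →
      (∀ o ≠ s.natReg 25, optAt s' o = optAt s o) →
      optAt s' (s.natReg 25) = ⟨s.natReg 5, vlo, vhi, vtop, vtgt, vfac, vval⟩ →
      Q (lo.cost + hi.cost + top.cost + tgt.cost + fac.cost + val.cost + 19) s') :
    wp (addOptProg lo hi top tgt fac val) Q s := by
  refine wp.conseq (Q := fun t s' => t = lo.cost + hi.cost + top.cost + tgt.cost + fac.cost +
    val.cost + 19 ∧ s'.natReg 25 = s.natReg 25 + 1 ∧ (∀ o ≠ s.natReg 25, optAt s' o = optAt s o) ∧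
    optAt s' (s.natReg 25) = ⟨s.natReg 5, vlo, vhi, vtop, vtgt, vfac, vval⟩) ?_ ?_
  swap
  · rintro t s' hF ⟨rfl, h1, h2, h3⟩
    exact hQ s' hF h1 h2 h3
  unfold addOptProg
  simp only [wp_seq, wp_writeNat, wp_writeReal, wp_setNat, NatExpr.eval_reg, State.wrN_natReg,
    State.wrR_natReg]
  obtain ⟨b, hb⟩ : ∃ b, s.natReg 25 = b := ⟨_, rfl⟩
  obtain ⟨l, hl⟩ : ∃ l, s.natReg 5 = l := ⟨_, rfl⟩
  simp only [hb, hl, NatExpr.eval_add, NatExpr.eval_reg, NatExpr.eval_one, State.wrN_natReg,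
    State.wrR_natReg]
  have e1 := (h (s.wrN 18 b l) ⟨by simp, by simp, fun x hx => by simp; intro; omega, by simp⟩).1
  rw [e1]
  have e2 := (h ((s.wrN 18 b l).wrN 19 b vlo)
    ⟨by simp, by simp, fun x hx => by simp [show x ≠ 18 by omega, show x ≠ 19 by omega], by simp⟩).2.1
  rw [e2]
  have e3 := (h (((s.wrN 18 b l).wrN 19 b vlo).wrN 20 b vhi)
    ⟨by simp, by simp, fun x hx => by
      simp [show x ≠ 18 by omega, show x ≠ 19 by omega, show x ≠ 20 by omega], by simp⟩).2.2.1
  rw [e3]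
  have e4 := (h ((((s.wrN 18 b l).wrN 19 b vlo).wrN 20 b vhi).wrN 21 b vtop)
    ⟨by simp, by simp, fun x hx => by
      simp [show x ≠ 18 by omega, show x ≠ 19 by omega, show x ≠ 20 by omega,
        show x ≠ 21 by omega], by simp⟩).2.2.2.1
  rw [e4]
  have e5 := (h (((((s.wrN 18 b l).wrN 19 b vlo).wrN 20 b vhi).wrN 21 b vtop).wrN 22 b vtgt)
    ⟨by simp, by simp, fun x hx => by
      simp [show x ≠ 18 by omega, show x ≠ 19 by omega, show x ≠ 20 by omega,
        show x ≠ 21 by omega, show x ≠ 22 by omega], by simp⟩).2.2.2.2.1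
  rw [e5]
  have e6 := (h ((((((s.wrN 18 b l).wrN 19 b vlo).wrN 20 b vhi).wrN 21 b vtop).wrN 22 b vtgt).wrN 23 b
      vfac)
    ⟨by simp, by simp, fun x hx => by
      simp [show x ≠ 18 by omega, show x ≠ 19 by omega, show x ≠ 20 by omega,
        show x ≠ 21 by omega, show x ≠ 22 by omega, show x ≠ 23 by omega], by simp⟩).2.2.2.2.2
  rw [e6]
  refine ⟨by simp; omega, by simp, fun o ho => ?_, ?_⟩
  · simp [optAt, ho]
  · simp [optAt]

/-- The state while the ways to close the legs at step `q` are listed. -/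
structure OptsState (I : Inst) (q : ℕ) (s : State) : Prop extends Base I s where
  lines : Lines I s
  kap : ∀ l, s.natArr 16 l = I.kap q l
  prev : s.realReg 7 = I.prev q

theorem OptsState.agree (hI : I.WF) (h : OptsState I q s)
    (ha : Agree [0, 1, 2, 3, 35, 7, 9, 10, 34, 8] [1, 7]
      [0, 1, 3, 4, 5, 10, 6, 7, 8, 9, 11, 12, 13, 14, 16] [0, 1, 2, 3] s s') : OptsState I q s' where
  toBase := h.toBase.agree ⟨ha.nr, fun x hx => ha.rr x (by simp at hx ⊢; tauto),
    fun x hx => ha.na x (by simp at hx ⊢; tauto), fun x hx => ha.ra x (by simp at hx ⊢; tauto)⟩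
  lines := h.lines.agree hI ⟨by simp, by simp, fun x hx => ha.na x (by simp at hx ⊢; tauto),
    fun x hx => ha.ra x (by simp at hx ⊢; tauto)⟩
  kap := by rw [ha.na 16 (by decide)]; exact h.kap
  prev := by rw [ha.rr 7 (by decide)]; exact h.prev

/-- At most `2 * r` blocks are tried, each at the price of one binary search; the logarithm of `m`
enters the running time only here. -/
theorem topOpts_spec (hI : I.WF) (h : OptsState I q s) (hl : OnLine I l s)
    (h12 : s.natReg 12 = I.kap q l) :
    wp topOptsProg (fun t s' => t ≤ (2 * I.r) * (60 * s.natReg 9 + 200) + 20 ∧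
      s.natReg 25 ≤ s'.natReg 25 ∧ s'.natReg 25 ≤ s.natReg 25 + 2 * I.r ∧
      (∀ o < s.natReg 25, optAt s' o = optAt s o) ∧
      (∀ o, s.natReg 25 ≤ o → o < s'.natReg 25 → (optAt s' o).Valid I s' q) ∧
      ∀ k, 1 ≤ k → k ≤ 2 * I.r → k ≤ I.kap q l →
        HasOpt s' (s.natReg 25) (s'.natReg 25) l (I.r - k) I.r 1
        (max (I.g l (- I.prev q) (I.X l (I.kap q l - k))) (lineCost I l s' (I.kap q l - k)))) s := by
  have hkc : I.kap q l ≤ I.cnt l := kap_le q l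
  obtain ⟨E, hE⟩ : ∃ E, s.natReg 9 = E := ⟨_, rfl⟩
  obtain ⟨b, hb⟩ : ∃ b, s.natReg 25 = b := ⟨_, rfl⟩
  unfold topOptsProg
  simp only [wp_seq (c₁ := .setNat 6 _), wp_setNat, hE, hb]
  refine wp_loop (fun t s' => t ≤ s'.natReg 6 * (60 * E + 200) ∧ s'.natReg 6 ≤ 2 * I.r ∧
      b ≤ s'.natReg 25 ∧ s'.natReg 25 ≤ b + s'.natReg 6 ∧
      (∀ o < b, optAt s' o = optAt s o) ∧
      (∀ o, b ≤ o → o < s'.natReg 25 → (optAt s' o).Valid I s' q) ∧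
      ∀ k, 1 ≤ k → k ≤ s'.natReg 6 → k ≤ I.kap q l →
        HasOpt s' b (s'.natReg 25) l (I.r - k) I.r 1
        (max (I.g l (- I.prev q) (I.X l (I.kap q l - k))) (lineCost I l s' (I.kap q l - k))))
      (fun s' => 2 * I.r - s'.natReg 6) ?_ ?_ ?_
  · simp [hb]
    refine ⟨fun o _ => rfl, fun o h1 h2 => by omega, fun k h1 h2 => by omega⟩
  · rintro t s' hF ⟨g1, g2, g3, g4, g5, g6, g7⟩ hb'
    have hS : OptsState I q s' := (h.agree hI (s' := s.setN 6 0)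
      ⟨by simp, by simp, by simp, by simp⟩).agree hI (hF.agree rfl)
    have hL : OnLine I l s' := (hl.agree (s' := s.setN 6 0)
      ⟨by simp, by simp, by simp, by simp⟩).agree (hF.agree rfl)
    have e12 : s'.natReg 12 = I.kap q l := by simpa [h12] using hF.nr 12 rfl
    have e9 : s'.natReg 9 = E := by simpa [hE] using hF.nr 9 rfl
    simp [hS.r, e12] at hb'
    obtain ⟨k, hk⟩ : ∃ k, s'.natReg 6 + 1 = k := ⟨_, rfl⟩
    obtain ⟨κ, hκ⟩ : ∃ κ, I.kap q l = κ := ⟨_, rfl⟩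
    rw [hκ] at hkc e12 hb'
    simp only [wp_seq (c₁ := .setNat _ _), wp_setNat, wp_seq (c₁ := .setReal _ _), wp_setReal]
    rw [userPos_eval (l := l) (hS.toBase.agree ⟨by simp, by simp, by simp, by simp⟩)
      (hL.agree ⟨by simp, by simp, by simp, by simp⟩) (by simp [e12]; omega), wp_seq]
    simp only [NatExpr.eval_add, NatExpr.eval_sub, NatExpr.eval_reg, NatExpr.eval_one,
      State.setN_natReg, if_true, State.setR_natReg, hk, e12, show (12 = 6) = False by simp, if_false,
      RealExpr.eval_sub, RealExpr.eval_zero, RealExpr.eval_reg, State.setN_realReg, hS.prev, zero_sub]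
    generalize hu : ((s'.setN 6 k).setR 3 (- I.prev q)).setR 4 (I.X l (κ - k)) = u
    have hSu : OptsState I q u := hS.agree hI
      ⟨by simp [← hu], by simp [← hu], by simp [← hu], by simp [← hu]⟩
    have hLu : OnLine I l u := hL.agree ⟨by simp [← hu], by simp [← hu], by simp [← hu], by simp [← hu]⟩
    have u3 : u.realReg 3 = - I.prev q := by simp [← hu]
    have u4 : u.realReg 4 = I.X l (κ - k) := by simp [← hu]
    have u6 : u.natReg 6 = k := by simp [← hu]
    have u25 : u.natReg 25 = s'.natReg 25 := by simp [← hu]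
    have u12 : u.natReg 12 = κ := by simp [← hu, e12]
    have u9 : u.natReg 9 = E := by simp [← hu, e9]
    have uo : ∀ o, optAt u o = optAt s' o := fun o => by simp [← hu, optAt]
    have uf : u.realArr 2 = s'.realArr 2 := by simp [← hu]
    clear hu
    refine (search_spec hI hSu.toBase hLu.toOnLeg).conseq ?_
    rintro t1 s1 hF1 ⟨ht1, hc1, hc2⟩
    rw [u3, u4] at hc1 hc2
    rw [u9] at ht1
    have hS1 : OptsState I q s1 := hSu.agree hI (hF1.agree rfl)
    have hL1 : OnLine I l s1 := hLu.agree (hF1.agree rfl)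
    have v6 : s1.natReg 6 = k := (hF1.nr 6 rfl).trans u6
    have v25 : s1.natReg 25 = s'.natReg 25 := (hF1.nr 25 rfl).trans u25
    have v12 : s1.natReg 12 = κ := (hF1.nr 12 rfl).trans u12
    have vf : s1.realArr 2 = s'.realArr 2 := (hF1.ra 2 rfl).trans uf
    have vo : ∀ o, optAt s1 o = optAt s' o := fun o => by
      rw [← uo]
      unfold optAt
      rw [hF1.na 18 rfl, hF1.na 19 rfl, hF1.na 20 rfl, hF1.na 21 rfl, hF1.na 22 rfl, hF1.na 23 rfl,
        hF1.ra 4 rfl]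
    rw [wp_seq]
    obtain ⟨v, hv⟩ : ∃ v, max (I.g l (- I.prev q) (I.X l (κ - k))) (lineCost I l s' (κ - k)) = v :=
      ⟨_, rfl⟩
    have hvf : s1.realArr 2 (l * (I.n + 1) + (κ - k)) = lineCost I l s' (κ - k) := by
      rw [vf]; rfl
    have key : ∀ s2 t2, t2 ≤ 30 → (∀ x, s2.natReg x = s1.natReg x) →
        Agree [0, 1, 2, 3, 35, 7, 9, 10, 34, 8] [1, 7]
          [0, 1, 3, 4, 5, 10, 6, 7, 8, 9, 11, 12, 13, 14, 16] [0, 1, 2, 3] s1 s2 →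
        (∀ o, optAt s2 o = optAt s1 o) → s2.realReg 2 = v →
        wp (addOptProg (nr 1 - nr 6) (nr 1) 1 (nr 12 - nr 6) (nr 18) (rr 2)) (fun t'' s'' =>
          (t + (Test.cost (.and (.lt (nr 6) (nr 1 + nr 1)) (.lt (nr 6) (nr 12))) + 1 +
            (16 + (t1 + (t2 + t'')))) ≤ s''.natReg 6 * (60 * E + 200) ∧ s''.natReg 6 ≤ 2 * I.r ∧
      b ≤ s''.natReg 25 ∧ s''.natReg 25 ≤ b + s''.natReg 6 ∧
      (∀ o < b, optAt s'' o = optAt s o) ∧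
      (∀ o, b ≤ o → o < s''.natReg 25 → (optAt s'' o).Valid I s'' q) ∧
      ∀ k, 1 ≤ k → k ≤ s''.natReg 6 → k ≤ κ →
        HasOpt s'' b (s''.natReg 25) l (I.r - k) I.r 1
        (max (I.g l (- I.prev q) (I.X l (κ - k))) (lineCost I l s'' (κ - k)))) ∧
        2 * I.r - s''.natReg 6 < 2 * I.r - s'.natReg 6) s2 := by
      intro s2 t2 ht2 hreg ha ho h2
      have hS2 := hS1.agree hI ha
      refine addOpt_spec (vlo := I.r - k) (vhi := I.r) (vtop := 1) (vtgt := κ - k) (vfac := s1.natReg 18)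
        (vval := v) ?_ ?_
      · intro s3 h3
        simp [h3.nr, h3.rr, h2, hreg, v6, v12, hS1.r]
      · intro s3 hF3 h25 ho3 hnew
        rw [hreg 25, v25] at h25 ho3 hnew
        have w6 : s3.natReg 6 = k := by rw [hF3.nr 6 rfl, hreg, v6]
        have w5 : s2.natReg 5 = l := by rw [hreg, hL1.leg]
        rw [w5] at hnew
        have hf3 : s3.realArr 2 = s'.realArr 2 := by
          rw [hF3.ra 2 rfl, ha.ra 2 (by decide), vf]
        have hlc : ∀ κ', lineCost I l s3 κ' = lineCost I l s' κ' := fun κ' => by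
          unfold lineCost; rw [hf3]
        have hold : ∀ o < s'.natReg 25, optAt s3 o = optAt s' o := fun o ho' => by
          rw [ho3 o (by omega), ho, vo]
        rw [w6, h25]
        refine ⟨⟨?_, by omega, by omega, by omega, fun o ho' => ?_, fun o h1 h2 => ?_,
          fun k' h1 h2 h3 => ?_⟩, by omega⟩
        · rw [← hk, Nat.add_mul]
          simp
          omega
        · rw [hold o (by omega), g5 o ho']
        · rcases (show o < s'.natReg 25 ∨ o = s'.natReg 25 by omega) with h3 | rfl
          · rw [hold o h3]
            exact (g6 o h1 h3).congr hf3
          · rw [hnew]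
            refine ⟨hl.lt, by simp; omega, ?_, Or.inr (Or.inr ⟨rfl, rfl, by simp; omega, by simp; omega,
              fun hlt => ?_⟩)⟩
            · rw [hlc, ← hv]; exact le_max_right _ _
            · have h1 : I.g l (- I.prev q) (I.X l (κ - k)) ≤ v := hv ▸ le_max_left _ _
              exact cert_of_le (hc2 (by rw [hc1]; exact lt_of_le_of_lt h1 hlt)) (by rw [hc1]; exact h1)
        · rcases (show k' ≤ s'.natReg 6 ∨ k' = k by omega) with h4 | rfl
          · rw [hlc]
            rw [hκ] at g7
            exact (g7 k' h1 h4 h3).congr hold (by omega)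
          · exact ⟨s'.natReg 25, g3, by omega, by rw [hnew], by rw [hnew], by rw [hnew], by rw [hnew],
              by rw [hnew, hlc, hv]⟩
    rw [wp_ite, wp_setReal, wp_skip]
    simp only [Test.Holds, RealExpr.eval_reg, RealExpr.eval_read, NatExpr.eval_add, NatExpr.eval_sub,
      NatExpr.eval_reg, hL1.b, v12, v6, hvf, hc1]
    constructor
    · intro hle
      refine (key _ 20 (by norm_num) (by simp) ⟨by simp, by simp, by simp, by simp⟩ (by simp [optAt])
        (by simp [← hv, hle])).mono ?_
      rintro t'' s'' ⟨⟨a1, a2⟩, a3⟩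
      rw [hκ]
      refine ⟨⟨?_, a2⟩, a3⟩
      simp at a1 ⊢
      omega
    · intro hle
      refine (key _ 20 (by norm_num) (by simp) ⟨by simp, by simp, by simp, by simp⟩ (by simp)
        (by rw [hc1, ← hv, max_eq_left (not_le.1 hle).le])).mono ?_
      rintro t'' s'' ⟨⟨a1, a2⟩, a3⟩
      rw [hκ]
      refine ⟨⟨?_, a2⟩, a3⟩
      simp at a1 ⊢
      omega
  · rintro t s' hF ⟨g1, g2, g3, g4, g5, g6, g7⟩ hb'
    have hS : OptsState I q s' := (h.agree hI (s' := s.setN 6 0)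
      ⟨by simp, by simp, by simp, by simp⟩).agree hI (hF.agree rfl)
    have e12 : s'.natReg 12 = I.kap q l := by simpa [h12] using hF.nr 12 rfl
    simp [hS.r, e12] at hb'
    have : s'.natReg 6 * (60 * E + 200) ≤ 2 * I.r * (60 * E + 200) := Nat.mul_le_mul_right _ g2
    refine ⟨by simp; omega, by omega, by omega, g5, g6, fun k h1 h2 h3 => g7 k h1 ?_ h3⟩
    by_contra hcon
    have := hb' (by omega)
    omega

end Gather

namespace Gather
open RAM

variable {I : Inst} {s s' : State} {l q : ℕ}

theorem legOpts_spec (hI : I.WF) (h : OptsState I q s) (hl : l < I.d) (h5 : s.natReg 5 = l) :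
    wp legOptsProg (fun t s' => t ≤ (2 * I.r) * (60 * s.natReg 9 + 200) + 150 ∧
      s.natReg 25 ≤ s'.natReg 25 ∧ s'.natReg 25 ≤ s.natReg 25 + (2 * I.r + 2) ∧
      (∀ o < s.natReg 25, optAt s' o = optAt s o) ∧
      (∀ o, s.natReg 25 ≤ o → o < s'.natReg 25 → (optAt s' o).Valid I s' q) ∧
      LegOpts I s' q (s.natReg 25) (s'.natReg 25) l) s := by
  obtain ⟨E, hE⟩ : ∃ E, s.natReg 9 = E := ⟨_, rfl⟩
  obtain ⟨b, hb⟩ : ∃ b, s.natReg 25 = b := ⟨_, rfl⟩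
  obtain ⟨κ, hκ⟩ : ∃ κ, I.kap q l = κ := ⟨_, rfl⟩
  have hκc : κ ≤ I.cnt l := hκ ▸ kap_le q l
  have hcell := h.lines l hl κ hκc
  unfold legOptsProg
  simp only [wp_seq (c₁ := .setNat _ _), wp_setNat, NatExpr.eval_reg, NatExpr.eval_read,
    State.setN_natReg, State.setN_natArr, h5, show (5 = 11) = False by simp,
    show (5 = 12) = False by simp, show (5 = 16) = False by simp, if_false, h.bs l hl.le, h.kap,
    h.bm l hl.le, h.cntF, hκ, hE, hb]
  generalize hu : (((s.setN 11 (l * (I.n + 1))).setN 12 κ).setN 16 (l * (I.m + 1))).setN 17 (I.cntF l) = u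
  have hS : OptsState I q u := h.agree hI
    ⟨by simp [← hu], by simp [← hu], by simp [← hu], by simp [← hu]⟩
  have hL : OnLine I l u := ⟨⟨hl, by simp [← hu, h5], by simp [← hu], by simp [← hu]⟩, by simp [← hu]⟩
  have u25 : u.natReg 25 = b := by simp [← hu, hb]
  have u12 : u.natReg 12 = κ := by simp [← hu]
  have u9 : u.natReg 9 = E := by simp [← hu, hE]
  have uo : ∀ o, optAt u o = optAt s o := fun o => by simp [← hu, optAt]
  have uf : u.realArr 2 = s.realArr 2 := by simp [← hu]
  have us : u.realArr 3 = s.realArr 3 := by simp [← hu]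
  have ut : u.natArr 14 = s.natArr 14 := by simp [← hu]
  clear hu
  rw [wp_seq]
  refine addOpt_spec (vlo := 0) (vhi := I.r) (vtop := 0) (vtgt := κ) (vfac := 0)
    (vval := lineCost I l s κ) ?_ ?_
  · intro s1 h1
    simp [h1.nr, h1.ra 2 (by norm_num), hS.r, u12, hL.b, uf, lineCost]
  intro s1 hF1 h25 ho1 hn1
  rw [u25] at h25 ho1 hn1
  rw [hL.leg] at hn1
  have hS1 : OptsState I q s1 := hS.agree hI (hF1.agree rfl)
  have hL1 : OnLine I l s1 := hL.agree (hF1.agree rfl)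
  have v12 : s1.natReg 12 = κ := (hF1.nr 12 rfl).trans u12
  have v9 : s1.natReg 9 = E := (hF1.nr 9 rfl).trans u9
  have vf : s1.realArr 2 = s.realArr 2 := (hF1.ra 2 rfl).trans uf
  have vs : s1.realArr 3 = s.realArr 3 := (hF1.ra 3 rfl).trans us
  have vt : s1.natArr 14 = s.natArr 14 := (hF1.na 14 rfl).trans ut
  rw [wp_seq]
  refine addOpt_spec (vlo := I.r + 1) (vhi := I.r + 1) (vtop := 0) (vtgt := starTgt I l s κ) (vfac := 0)
    (vval := starCost I l s κ) ?_ ?_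
  · intro s2 h2
    simp [h2.nr, h2.ra 3 (by norm_num), h2.na 14 (by norm_num), hS1.r, v12, hL1.b, vs, vt, starCost,
      starTgt]
  intro s2 hF2 h25' ho2 hn2
  rw [h25] at h25' ho2 hn2
  rw [hL1.leg] at hn2
  have hS2 : OptsState I q s2 := hS1.agree hI (hF2.agree rfl)
  have hL2 : OnLine I l s2 := hL1.agree (hF2.agree rfl)
  have w12 : s2.natReg 12 = κ := (hF2.nr 12 rfl).trans v12
  have w9 : s2.natReg 9 = E := (hF2.nr 9 rfl).trans v9
  have wf : s2.realArr 2 = s.realArr 2 := (hF2.ra 2 rfl).trans vf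
  have ws : s2.realArr 3 = s.realArr 3 := (hF2.ra 3 rfl).trans vs
  refine (topOpts_spec hI hS2 hL2 (by rw [w12, hκ])).conseq ?_
  rintro t3 s3 hF3 ⟨k1, k2, k3, k4, k5, k6⟩
  rw [w9] at k1
  rw [h25'] at k2 k3 k4 k5 k6
  have xf : s3.realArr 2 = s.realArr 2 := (hF3.ra 2 rfl).trans wf
  have xs : s3.realArr 3 = s.realArr 3 := (hF3.ra 3 rfl).trans ws
  have hlc : ∀ κ', lineCost I l s3 κ' = lineCost I l s κ' := fun κ' => by unfold lineCost; rw [xf]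
  have hsc : starCost I l s3 κ = starCost I l s κ := by unfold starCost; rw [xs]
  have e0 : optAt s3 b = ⟨l, 0, I.r, 0, κ, 0, lineCost I l s κ⟩ := by
    rw [k4 b (by omega), ho2 b (by omega), hn1]
  have e1 : optAt s3 (b + 1) = ⟨l, I.r + 1, I.r + 1, 0, starTgt I l s κ, 0, starCost I l s κ⟩ := by
    rw [k4 (b + 1) (by omega), hn2]
  refine ⟨by simp; omega, by omega, by omega, fun o ho => ?_, fun o h1 h2 => ?_, ?_⟩
  · rw [k4 o (by omega), ho2 o (by omega), ho1 o (by omega), uo]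
  · rcases (show o = b ∨ o = b + 1 ∨ b + 1 + 1 ≤ o by omega) with rfl | rfl | h3
    · rw [e0]
      exact ⟨hl, by simp [hκ], by simp [hlc], Or.inl ⟨rfl, rfl, by simp [hκ]⟩⟩
    · rw [e1]
      refine ⟨hl, by simp only [hκ]; exact hcell.tgt_le, ?_, Or.inr (Or.inl ⟨rfl, rfl, ?_⟩)⟩
      · rw [hlc]; exact hcell.tgt_cost
      · simp only [hκ]; exact hcell.tgt_star
    · exact k5 o h3 h2
  · refine ⟨⟨b, le_rfl, by omega, ?_⟩, ⟨b + 1, by omega, by omega, ?_⟩, fun k h1 h2 h3 => ?_⟩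
    · rw [e0, hκ, hlc]; simp
    · rw [e1, hκ, hsc]; simp
    · obtain ⟨o, h4, h5⟩ := k6 k h1 h2 h3
      exact ⟨o, by omega, h5⟩

theorem LegOpts.congr {ob oe oe' : ℕ} (h : LegOpts I s q ob oe l)
    (ho : ∀ o < oe, optAt s' o = optAt s o) (he : oe ≤ oe') (h2 : s'.realArr 2 = s.realArr 2)
    (h3 : s'.realArr 3 = s.realArr 3) : LegOpts I s' q ob oe' l := by
  have e1 : ∀ κ, lineCost I l s' κ = lineCost I l s κ := fun κ => by unfold lineCost; rw [h2]
  have e2 : ∀ κ, starCost I l s' κ = starCost I l s κ := fun κ => by unfold starCost; rw [h3]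
  refine ⟨?_, ?_, fun k h4 h5 h6 => ?_⟩
  · rw [e1]; exact h.plain.congr ho he
  · rw [e2]; exact h.star.congr ho he
  · rw [e1]; exact (h.top k h4 h5 h6).congr ho he

structure Opts (I : Inst) (s : State) (q ob oe : ℕ) : Prop where
  valid : ∀ o, ob ≤ o → o < oe → (optAt s o).Valid I s q
  leg : ∀ l < I.d, LegOpts I s q ob oe l

theorem opts_spec (hI : I.WF) (h : OptsState I q s) :
    wp optsProg (fun t s' => t ≤ I.d * ((2 * I.r) * (60 * s.natReg 9 + 200) + 200) + 50 ∧
      s'.natReg 24 = s.natReg 25 ∧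
      s.natReg 25 ≤ s'.natReg 25 ∧ s'.natReg 25 ≤ s.natReg 25 + I.d * (2 * I.r + 2) ∧
      (∀ o < s.natReg 25, optAt s' o = optAt s o) ∧
      Opts I s' q (s.natReg 25) (s'.natReg 25)) s := by
  obtain ⟨E, hE⟩ : ∃ E, s.natReg 9 = E := ⟨_, rfl⟩
  obtain ⟨b, hb⟩ : ∃ b, s.natReg 25 = b := ⟨_, rfl⟩
  unfold optsProg
  rw [wp_seq, wp_setNat]
  have hu : OptsState I q (s.setN 24 ((nr 25).eval s)) := h.agree hI
    ⟨by simp, by simp, by simp, by simp⟩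
  rw [hE, hb]
  refine wp_forUp I.d (fun _ => (2 * I.r) * (60 * E + 200) + 150) (fun k s' =>
      b ≤ s'.natReg 25 ∧ s'.natReg 25 ≤ b + k * (2 * I.r + 2) ∧
      (∀ o < b, optAt s' o = optAt s o) ∧
      (∀ o, b ≤ o → o < s'.natReg 25 → (optAt s' o).Valid I s' q) ∧
      ∀ l < k, LegOpts I s' q b (s'.natReg 25) l) ?_ rfl ?_ ?_ ?_
  · intro s' hF
    simpa [h.d] using hF.nr 0 rfl
  · simp [hb]
    exact ⟨fun o _ => rfl, fun o h1 h2 => by omega⟩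
  · rintro l hl s' hF h5 ⟨g1, g2, g3, g4, g5⟩
    have hS : OptsState I q s' := hu.agree hI (hF.agree rfl)
    have e9 : s'.natReg 9 = E := by simpa [hE] using hF.nr 9 rfl
    refine (legOpts_spec hI hS hl h5).conseq ?_
    rintro t s'' hF' ⟨k1, k2, k3, k4, k5, k6⟩
    rw [e9] at k1
    have f2 := hF'.ra 2 rfl
    have f3 := hF'.ra 3 rfl
    refine ⟨k1, ?_⟩
    simp only [State.setN_natReg, show (25 = 5) = False by simp, if_false]
    refine ⟨by omega, by rw [Nat.succ_mul]; omega, fun o ho => (k4 o (by omega)).trans (g3 o ho),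
      fun o h1 h2 => ?_, fun l' hl' => ?_⟩
    · rcases (show o < s'.natReg 25 ∨ s'.natReg 25 ≤ o by omega) with h3 | h3
      · have := (g4 o h1 h3).congr f2
        rw [← k4 o h3] at this
        exact this.congr rfl
      · exact (k5 o h3 h2).congr rfl
    · rcases (show l' < l ∨ l' = l by omega) with h3 | rfl
      · exact (g5 l' h3).congr k4 (by omega) f2 f3
      · refine ⟨?_, ?_, fun k h4 h5 h6 => ?_⟩
        · obtain ⟨o, h7, h8⟩ := k6.plain; exact ⟨o, by omega, h8⟩
        · obtain ⟨o, h7, h8⟩ := k6.star; exact ⟨o, by omega, h8⟩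
        · obtain ⟨o, h7, h8⟩ := k6.top k h4 h5 h6; exact ⟨o, by omega, h8⟩
  · rintro t s' hF ht - ⟨g1, g2, g3, g4, g5⟩
    have e24 : s'.natReg 24 = b := by simpa [hb] using hF.nr 24 rfl
    refine ⟨?_, e24, g1, g2, g3, g4, g5⟩
    simp at ht ⊢
    generalize 2 * I.r * (60 * E + 200) = M at *
    simp only [Nat.mul_add] at ht ⊢
    omega

end Gather

namespace Gather
open RAM

/-! ### One entry of the table -/

def updProg (ch : NatExpr) : Program :=
  .ite (.realLe (rr 5) (rr 6)) .skip (.setReal 5 (rr 6) ⨟ .setNat 27 ch)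

def advanceProg : Program :=
  .ite (.and (.lt (nr 20) (nr 8)) (.natLe (nr 22) (nr 1)))
    (.setNat 28 (nr 23 + nr 10) ⨟
      .ite (.and (.ne (nr 22) (nr 1)) (.natEq (na 17 (na 0 (na 11 (nr 20)))) 0))
        (.setNat 28 (nr 28 + 1)) .skip ⨟
      .setReal 6 (ra 5 (nr 28)) ⨟ updProg 1)
    .skip

def maxProg (e : NatExpr) : Program :=
  .ite (.realLe (ra 5 e) (rr 6)) .skip (.setReal 6 (ra 5 e))

def enterProg : Program :=
  .ite (.natEq (nr 22) (nr 1)) (.setReal 6 (rr 8) ⨟ maxProg (nr 23 + 1) ⨟ updProg 2) .skip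

/-- Closing a leg shifts the address by `2 ^ l * (r + 2)`. If the cluster is completed the count
returns to `0`, hence the subtraction of the count from the address. -/
def closeProg : Program :=
  .ite (.and (.natEq (na 17 (na 18 (nr 26))) 0)
      (.and (.natLe (na 19 (nr 26)) (nr 22)) (.natLe (nr 22) (na 20 (nr 26)))))
    (.setNat 28 (nr 23 + na 10 (na 18 (nr 26))) ⨟
      .ite (.natEq (na 21 (nr 26)) 0) .skip (.setNat 28 (nr 28 - nr 22)) ⨟
      .setReal 6 (ra 4 (nr 26)) ⨟ maxProg (nr 28) ⨟ updProg (nr 26 + 3))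
    .skip

def closeAllProg : Program :=
  .setNat 26 (nr 24) ⨟ .loop (.lt (nr 26) (nr 25)) (closeProg ⨟ .setNat 26 (nr 26 + 1))

/-- Codes of transitions: `0` ends, `1` passes a user, `2` enters the star phase, and `o + 3` closes
a leg in the way `o`. The minimum starts at `big`, so an entry that stays there has no transition.
-/
def cellProg : Program :=
  .setReal 5 (rr 1) ⨟ .setNat 27 0 ⨟
  .ite (.and (.natEq (nr 21) (nr 34))
      (.neg (.and (.ne (nr 22) 0) (.ne (nr 22) (nr 1 + 1)))))
    (.setReal 5 0) (advanceProg ⨟ enterProg ⨟ closeAllProg) ⨟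
  .writeReal 5 (nr 23) (rr 5) ⨟ .writeNat 24 (nr 23) (nr 27)

variable {I : Inst} {s s' : State} {q S c : ℕ}

/-- The value of a transition and its number. -/
inductive Cand (I : Inst) (s : State) (q S c : ℕ) : ℕ → ℝ → Prop
  | skip : q < I.P → c ≤ I.r → (c = I.r ∨ S.testBit (I.leg (I.nu q)) = true) →
      Cand I s q S c 1 (s.realArr 5 (s.natReg 23 + I.W))
  | fill : q < I.P → c < I.r → S.testBit (I.leg (I.nu q)) = false →
      Cand I s q S c 1 (s.realArr 5 (s.natReg 23 + I.W + 1))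
  | star : c = I.r → Cand I s q S c 2 (max (I.tok (I.prev q)) (s.realArr 5 (s.natReg 23 + 1)))
  | close (o : ℕ) : s.natReg 24 ≤ o → o < s.natReg 25 → S.testBit (optAt s o).leg = false →
      (optAt s o).lo ≤ c → c ≤ (optAt s o).hi →
      Cand I s q S c (o + 3) (max (optAt s o).val (s.realArr 5
        (s.natReg 23 + 2 ^ (optAt s o).leg * (I.r + 2) - if (optAt s o).top = 0 then 0 else c)))

/-- The least value not above `B` among those in `C`. -/
structure Best (B : ℝ) (C : ℕ → ℝ → Prop) (best : ℝ) (ch : ℕ) : Prop where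
  le_big : best ≤ B
  le : ∀ h w, C h w → best ≤ w
  mem : best < B → C ch best

theorem Best.congr {B : ℝ} {C C' : ℕ → ℝ → Prop} {best : ℝ} {ch : ℕ} (h : Best B C best ch)
    (hC : ∀ k w, C k w ↔ C' k w) : Best B C' best ch :=
  ⟨h.le_big, fun k w hk => h.le k w ((hC k w).2 hk), fun hb => (hC _ _).1 (h.mem hb)⟩

theorem upd_spec {B : ℝ} {C : ℕ → ℝ → Prop} {ch : NatExpr} {k : ℕ} {v : ℝ} (hk : ch.eval (s.setR 5 v) = k)
    (hv : s.realReg 6 = v) (h : Best B C (s.realReg 5) (s.natReg 27)) :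
    wp (updProg ch) (fun t s' => t ≤ ch.cost + 10 ∧
      Best B (fun k' w => C k' w ∨ k' = k ∧ w = v) (s'.realReg 5) (s'.natReg 27)) s := by
  unfold updProg
  rw [wp_ite, wp_skip, wp_seq, wp_setReal, wp_setNat]
  simp only [Test.Holds, RealExpr.eval_reg, hv, hk]
  constructor
  · intro hle
    refine ⟨by simp, h.le_big, ?_, fun hb => Or.inl (h.mem hb)⟩
    rintro h w (hC | ⟨-, rfl⟩)
    · exact Best.le ‹_› _ _ hC
    · exact hle
  · intro hle
    rw [not_le] at hle
    refine ⟨by simp; omega, by simp; exact hle.le.trans h.le_big, ?_, fun hb => by simp⟩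
    rintro k' w (hC | ⟨-, rfl⟩)
    · simpa using hle.le.trans (h.le _ _ hC)
    · simp

structure CellState (I : Inst) (q S c : ℕ) (s : State) : Prop extends Base I s where
  q_le : q ≤ I.P
  reg_q : s.natReg 20 = q
  reg_S : s.natReg 21 = S
  reg_c : s.natReg 22 = c
  mem : ∀ l < I.d, s.natArr 17 l = if S.testBit l then 1 else 0
  prev : s.realReg 8 = I.tok (I.prev q)
  leg_lt : ∀ o, s.natReg 24 ≤ o → o < s.natReg 25 → (optAt s o).leg < I.d

theorem CellState.agree (h : CellState I q S c s)
    (ha : Agree [0, 1, 2, 3, 35, 7, 9, 10, 34, 8, 20, 21, 22, 24, 25] [1, 8]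
      [0, 1, 3, 4, 5, 10, 6, 7, 8, 9, 11, 17, 18] [0, 1] s s') : CellState I q S c s' where
  toBase := h.toBase.agree ⟨fun x hx => ha.nr x (by simp at hx ⊢; tauto),
    fun x hx => ha.rr x (by simp at hx ⊢; tauto), fun x hx => ha.na x (by simp at hx ⊢; tauto), ha.ra⟩
  q_le := h.q_le
  reg_q := by rw [ha.nr 20 (by decide), h.reg_q]
  reg_S := by rw [ha.nr 21 (by decide), h.reg_S]
  reg_c := by rw [ha.nr 22 (by decide), h.reg_c]
  mem := by rw [ha.na 17 (by decide)]; exact h.mem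
  prev := by rw [ha.rr 8 (by decide), h.prev]
  leg_lt := by
    have : ∀ o, (optAt s' o).leg = (optAt s o).leg := fun o => by
      unfold optAt; rw [ha.na 18 (by decide)]
    simp only [this, ha.nr 24 (by decide), ha.nr 25 (by decide)]
    exact h.leg_lt

/-- `Cand` only depends on the table and the registers that stay fixed. -/
theorem Cand.congr (ha : Agree [23, 24, 25] [] [18, 19, 20, 21, 22, 23] [4, 5] s s') (h : ℕ) (w : ℝ) :
    Cand I s' q S c h w ↔ Cand I s q S c h w := by
  have e : ∀ o, optAt s' o = optAt s o := fun o => by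
    unfold optAt
    rw [ha.na 18 (by decide), ha.na 19 (by decide), ha.na 20 (by decide), ha.na 21 (by decide),
      ha.na 22 (by decide), ha.na 23 (by decide), ha.ra 4 (by decide)]
  have e5 := ha.ra 5 (by decide)
  have n23 := ha.nr 23 (by decide)
  have n24 := ha.nr 24 (by decide)
  have n25 := ha.nr 25 (by decide)
  constructor
  · intro hC
    cases hC with
    | skip h1 h2 h3 => rw [e5, n23]; exact .skip h1 h2 h3
    | fill h1 h2 h3 => rw [e5, n23]; exact .fill h1 h2 h3
    | star h1 => rw [e5, n23]; exact .star h1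
    | close o h1 h2 h3 h4 h5 =>
      rw [e, e5, n23]
      rw [e] at h3 h4 h5
      exact .close o (n24 ▸ h1) (n25 ▸ h2) h3 h4 h5
  · intro hC
    cases hC with
    | skip h1 h2 h3 => rw [← e5, ← n23]; exact .skip h1 h2 h3
    | fill h1 h2 h3 => rw [← e5, ← n23]; exact .fill h1 h2 h3
    | star h1 => rw [← e5, ← n23]; exact .star h1
    | close o h1 h2 h3 h4 h5 =>
      rw [← e, ← e5, ← n23]
      rw [← e] at h3 h4 h5
      exact .close o (n24 ▸ h1) (n25 ▸ h2) h3 h4 h5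

/-- The candidates with numbers below `k`. -/
def CandLt (I : Inst) (s : State) (q S c k : ℕ) (h : ℕ) (w : ℝ) : Prop := h < k ∧ Cand I s q S c h w

theorem advance_spec (hI : I.WF) (hs : CellState I q S c s)
    (h : Best I.big (CandLt I s q S c 1) (s.realReg 5) (s.natReg 27)) :
    wp advanceProg (fun t s' => t ≤ 80 ∧
      Best I.big (CandLt I s q S c 2) (s'.realReg 5) (s'.natReg 27)) s := by
  unfold advanceProg
  have h17 : q < I.P → s.natArr 17 (I.leg (I.nu q)) =
      if S.testBit (I.leg (I.nu q)) then 1 else 0 := fun hq =>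
    hs.mem _ (hI.leg_lt _ (Users.nu_spec hq).1)
  obtain ⟨a, ha⟩ : ∃ a, s.natReg 23 = a := ⟨_, rfl⟩
  simp only [wp_ite, wp_skip, Test.Holds, NatExpr.eval_add, NatExpr.eval_reg, NatExpr.eval_one,
    hs.reg_q, hs.P, hs.reg_c, hs.r, wp_seq, wp_setNat, wp_setReal, ha, hs.W, State.setN_natReg, if_true,
    NatExpr.eval_read, State.setN_natArr, hs.leg, show (22 = 28) = False by simp,
    show (1 = 28) = False by simp, show (20 = 28) = False by simp, if_false, NatExpr.eval_zero]
  refine ⟨fun ⟨h1, h2⟩ => ⟨fun h3 => ?_, fun h3 => ?_⟩, fun h1 => ?_⟩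
  · rw [hs.near q (by omega), h17 (by omega)] at h3
    simp at h3
    refine (upd_spec (k := 1) rfl rfl (by simpa using h)).mono ?_
    rintro t s' ⟨h4, h5⟩
    refine ⟨by simp at h4 ⊢; omega, h5.congr fun k w => ?_⟩
    simp
    constructor
    · rintro (⟨h6, h7⟩ | ⟨rfl, rfl⟩)
      · exact ⟨by omega, h7⟩
      · exact ⟨by omega, by rw [← ha]; exact .fill (by omega) (by omega) h3.2⟩
    · rintro ⟨h6, h7⟩
      cases h7 with
      | skip h8 h9 h10 =>
        rcases h10 with h10 | h10
        · exact absurd h10 h3.1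
        · rw [h3.2] at h10; simp at h10
      | fill h8 h9 h10 => exact Or.inr ⟨rfl, by rw [ha]⟩
      | star => omega
      | close => omega
  · rw [hs.near q (by omega), h17 (by omega)] at h3
    simp at h3
    refine (upd_spec (k := 1) rfl rfl (by simpa using h)).mono ?_
    rintro t s' ⟨h4, h5⟩
    refine ⟨by simp at h4 ⊢; omega, h5.congr fun k w => ?_⟩
    simp
    constructor
    · rintro (⟨h6, h7⟩ | ⟨rfl, rfl⟩)
      · exact ⟨by omega, h7⟩
      · exact ⟨by omega, by rw [← ha]; exact .skip (by omega) (by omega) (by tauto)⟩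
    · rintro ⟨h6, h7⟩
      cases h7 with
      | skip h8 h9 h10 => exact Or.inr ⟨rfl, by rw [ha]⟩
      | fill h8 h9 h10 =>
        rw [h3 (by omega)] at h10; simp at h10
      | star => omega
      | close => omega
  · refine ⟨by simp, h.congr fun k w => ?_⟩
    constructor
    · rintro ⟨h6, h7⟩; exact ⟨by omega, h7⟩
    · rintro ⟨h6, h7⟩
      cases h7 with
      | skip h8 h9 h10 => exact absurd ⟨by omega, by omega⟩ h1
      | fill h8 h9 h10 => exact absurd ⟨by omega, by omega⟩ h1
      | star => omega
      | close => omega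

theorem max_spec {e : NatExpr} {a : ℕ} (he : e.eval s = a) {Q : ℕ → State → Prop}
    (h : ∀ t, t ≤ 2 * e.cost + 10 → Q t (s.setR 6 (max (s.realReg 6) (s.realArr 5 a)))) :
    wp (maxProg e) Q s := by
  unfold maxProg
  rw [wp_ite, wp_skip, wp_setReal]
  simp only [Test.Holds, RealExpr.eval_reg, RealExpr.eval_read, he]
  constructor
  · intro hle
    have := h (Test.cost (.realLe (ra 5 e) (rr 6)) + 1 + 1) (by simp; omega)
    rw [max_eq_left hle] at this
    have e : s.setR 6 (s.realReg 6) = s := by simp [State.setR]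
    rwa [e] at this
  · intro hle
    have := h (Test.cost (.realLe (ra 5 e) (rr 6)) + 1 + ((ra 5 e).cost + 1)) (by simp; omega)
    rwa [max_eq_right (not_le.1 hle).le] at this

theorem enter_spec (hs : CellState I q S c s)
    (h : Best I.big (CandLt I s q S c 2) (s.realReg 5) (s.natReg 27)) :
    wp enterProg (fun t s' => t ≤ 80 ∧
      Best I.big (CandLt I s q S c 3) (s'.realReg 5) (s'.natReg 27)) s := by
  unfold enterProg
  rw [wp_ite, wp_skip]
  simp only [Test.Holds, NatExpr.eval_reg, hs.reg_c, hs.r]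
  constructor
  · intro h1
    rw [wp_seq, wp_setReal, wp_seq]
    refine max_spec (a := s.natReg 23 + 1) rfl ?_
    intro t1 ht1
    refine (upd_spec (k := 2) rfl rfl (by simpa using h)).mono ?_
    rintro t s' ⟨h4, h5⟩
    refine ⟨by simp at h4 ht1 ⊢; omega, h5.congr fun k w => ?_⟩
    simp [hs.prev]
    constructor
    · rintro (⟨h6, h7⟩ | ⟨rfl, rfl⟩)
      · exact ⟨by omega, h7⟩
      · exact ⟨by omega, .star h1⟩
    · rintro ⟨h6, h7⟩
      cases h7 with
      | skip h8 h9 h10 => exact Or.inl ⟨by omega, .skip h8 h9 h10⟩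
      | fill h8 h9 h10 => exact Or.inl ⟨by omega, .fill h8 h9 h10⟩
      | star => exact Or.inr ⟨rfl, rfl⟩
      | close => omega
  · intro h1
    refine ⟨by simp, h.congr fun k w => ?_⟩
    constructor
    · rintro ⟨h6, h7⟩; exact ⟨by omega, h7⟩
    · rintro ⟨h6, h7⟩
      cases h7 with
      | skip h8 h9 h10 => exact ⟨by omega, .skip h8 h9 h10⟩
      | fill h8 h9 h10 => exact ⟨by omega, .fill h8 h9 h10⟩
      | star h8 => exact absurd h8 h1
      | close => omega

theorem close_spec (hs : CellState I q S c s) {o : ℕ} (ho : s.natReg 26 = o) (h1 : s.natReg 24 ≤ o)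
    (h2 : o < s.natReg 25) (h : Best I.big (CandLt I s q S c (o + 3)) (s.realReg 5) (s.natReg 27)) :
    wp closeProg (fun t s' => t ≤ 100 ∧
      Best I.big (CandLt I s q S c (o + 4)) (s'.realReg 5) (s'.natReg 27)) s := by
  have hl : s.natArr 18 o < I.d := hs.leg_lt o h1 h2
  have hcand : (S.testBit (optAt s o).leg = false ∧ (optAt s o).lo ≤ c ∧ c ≤ (optAt s o).hi →
      ∀ k w, (CandLt I s q S c (o + 3) k w ∨ k = o + 3 ∧ w = max (optAt s o).val (s.realArr 5
        (s.natReg 23 + 2 ^ (optAt s o).leg * (I.r + 2) - if (optAt s o).top = 0 then 0 else c))) ↔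
        CandLt I s q S c (o + 4) k w) ∧
      (¬ (S.testBit (optAt s o).leg = false ∧ (optAt s o).lo ≤ c ∧ c ≤ (optAt s o).hi) →
      ∀ k w, CandLt I s q S c (o + 3) k w ↔ CandLt I s q S c (o + 4) k w) := by
    constructor
    · intro h3 k w
      constructor
      · rintro (⟨h6, h7⟩ | ⟨rfl, rfl⟩)
        · exact ⟨by omega, h7⟩
        · exact ⟨by omega, .close o h1 h2 h3.1 h3.2.1 h3.2.2⟩
      · rintro ⟨h6, h7⟩
        by_cases hk : k < o + 3
        · exact Or.inl ⟨hk, h7⟩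
        · obtain rfl : k = o + 3 := by omega
          right
          generalize hk : o + 3 = k at h7
          cases h7 with
          | skip => omega
          | fill => omega
          | star => omega
          | close o' h8 h9 h10 =>
            obtain rfl : o = o' := by omega
            exact ⟨rfl, rfl⟩
    · intro h3 k w
      constructor
      · rintro ⟨h6, h7⟩; exact ⟨by omega, h7⟩
      · rintro ⟨h6, h7⟩
        refine ⟨?_, h7⟩
        by_contra hk
        obtain rfl : k = o + 3 := by omega
        generalize hk : o + 3 = k at h7
        cases h7 with
        | skip => omega
        | fill => omega
        | star => omega
        | close o' h8 h9 h10 h11 h12 =>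
          obtain rfl : o = o' := by omega
          exact h3 ⟨h10, h11, h12⟩
  unfold closeProg
  rw [wp_ite, wp_skip]
  simp only [Test.Holds, NatExpr.eval_reg, NatExpr.eval_read, NatExpr.eval_zero, hs.reg_c, ho,
    hs.mem _ hl]
  constructor
  · rintro ⟨h3, h4, h5⟩
    have h3' : S.testBit (s.natArr 18 o) = false := by simpa using h3
    have hc := hcand.1 ⟨h3', h4, h5⟩
    obtain ⟨a', ha'⟩ : ∃ a', s.natReg 23 + 2 ^ (s.natArr 18 o) * (I.r + 2) -
      (if s.natArr 21 o = 0 then 0 else c) = a' := ⟨_, rfl⟩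
    have key : ∀ s1 t1, t1 ≤ 40 → s1.natReg 28 = a' → s1.natReg 26 = o →
        s1.realReg 5 = s.realReg 5 → s1.natReg 27 = s.natReg 27 → s1.realArr = s.realArr →
        wp (.setReal 6 (ra 4 (nr 26)) ⨟ maxProg (nr 28) ⨟ updProg (nr 26 + 3)) (fun t s' =>
          t1 + t ≤ 99 ∧ Best I.big (CandLt I s q S c (o + 4)) (s'.realReg 5) (s'.natReg 27)) s1 := by
      intro s1 t1 ht1 e28 e26 e5 e27 er
      rw [wp_seq, wp_setReal, wp_seq]
      refine max_spec (a := a') (by simpa using e28) ?_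
      intro t2 ht2
      refine (upd_spec (k := o + 3) (by simp [e26]) rfl (C := CandLt I s q S c (o + 3))
        (by simpa [e5, e27] using h)).mono ?_
      rintro t s' ⟨h6, h7⟩
      refine ⟨by simp at h6 ht2 ⊢; omega, h7.congr fun k w => ?_⟩
      rw [← hc k w]
      have ha2 : (s.natReg 23 + 2 ^ (optAt s o).leg * (I.r + 2) -
        if (optAt s o).top = 0 then 0 else c) = a' := ha'
      rw [ha2]
      simp [er, e26, optAt]
    simp only [wp_seq (c₁ := .setNat _ _), wp_setNat]
    rw [wp_seq, wp_ite, wp_skip, wp_setNat]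
    have hpw := hs.pwW _ hl.le
    simp only [NatExpr.eval_add, NatExpr.eval_reg, NatExpr.eval_read, ho, hpw, Test.Holds,
      State.setN_natArr, State.setN_natReg, NatExpr.eval_zero, NatExpr.eval_sub, if_true,
      show (26 = 28) = False by simp, if_false, show (22 = 28) = False by simp, hs.reg_c]
    constructor
    · intro h6
      rw [if_pos h6] at ha'
      refine (key _ 35 (by norm_num) ?_ ?_ ?_ ?_ ?_).mono ?_
      · simpa using ha'
      · simp [ho]
      · rfl
      · simp
      · rfl
      rintro t s' ⟨h7, h8⟩
      exact ⟨by simp; omega, h8⟩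
    · intro h6
      rw [if_neg h6] at ha'
      refine (key _ 35 (by norm_num) ?_ ?_ ?_ ?_ ?_).mono ?_
      · simpa using ha'
      · simp [ho]
      · rfl
      · simp
      · rfl
      rintro t s' ⟨h7, h8⟩
      exact ⟨by simp; omega, h8⟩
  · intro h3
    refine ⟨by simp, h.congr (hcand.2 ?_)⟩
    simpa [optAt] using h3

theorem closeAll_spec (hs : CellState I q S c s) (h1 : s.natReg 24 ≤ s.natReg 25)
    (h : Best I.big (CandLt I s q S c 3) (s.realReg 5) (s.natReg 27)) :
    wp closeAllProg (fun t s' => t ≤ 120 * (s.natReg 25 - s.natReg 24) + 20 ∧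
      Best I.big (Cand I s q S c) (s'.realReg 5) (s'.natReg 27)) s := by
  unfold closeAllProg
  rw [wp_seq, wp_setNat]
  obtain ⟨ob, hob⟩ : ∃ ob, s.natReg 24 = ob := ⟨_, rfl⟩
  obtain ⟨oe, hoe⟩ : ∃ oe, s.natReg 25 = oe := ⟨_, rfl⟩
  rw [hob, hoe] at h1
  refine wp_loop (fun t s' => t + 120 * ob ≤ 120 * s'.natReg 26 ∧ ob ≤ s'.natReg 26 ∧ s'.natReg 26 ≤ oe ∧
    Best I.big (CandLt I s q S c (s'.natReg 26 + 3)) (s'.realReg 5) (s'.natReg 27))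
    (fun s' => oe - s'.natReg 26) ?_ ?_ ?_
  · simp [hob, h1]
    refine h.congr fun k w => ?_
    constructor
    · rintro ⟨h6, h7⟩; exact ⟨by omega, h7⟩
    · rintro ⟨h6, h7⟩
      refine ⟨?_, h7⟩
      cases h7 with
      | close o h8 => omega
      | _ => omega
  all_goals
    rintro t s' hF ⟨g1, g2, g3, g4⟩ hb
    have hF' : Agree [0, 1, 2, 3, 35, 7, 9, 10, 34, 8, 20, 21, 22, 24, 25] [1, 8]
      [0, 1, 3, 4, 5, 10, 6, 7, 8, 9, 11, 17, 18] [0, 1] (s.setN 26 ((nr 24).eval s)) s' := hF.agree rfl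
    have hs' : CellState I q S c s' := (hs.agree (s' := s.setN 26 ((nr 24).eval s))
      ⟨by simp, by simp, by simp, by simp⟩).agree hF'
    have e24 : s'.natReg 24 = ob := by simpa [hob] using hF.nr 24 rfl
    have e25 : s'.natReg 25 = oe := by simpa [hoe] using hF.nr 25 rfl
    simp [e25] at hb
  · have hc : ∀ k w, Cand I s' q S c k w ↔ Cand I s q S c k w := by
      intro k w
      rw [Cand.congr (hF.agree rfl), Cand.congr (s := s) (s' := s.setN 26 ((nr 24).eval s))
        ⟨by simp, by simp, by simp, by simp⟩]
    rw [wp_seq]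
    refine (close_spec (o := s'.natReg 26) hs' rfl (by omega) (by omega) (g4.congr fun k w => ?_)).conseq ?_
    · unfold CandLt; rw [hc]
    · rintro t' s'' hF'' ⟨h3, h4⟩
      have e26 := hF''.nr 26 rfl
      simp [e26]
      refine ⟨⟨by omega, by omega, by omega, ?_⟩, by omega⟩
      refine h4.congr fun k w => ?_
      unfold CandLt
      rw [hc, show s'.natReg 26 + 1 + 3 = s'.natReg 26 + 4 by omega]
  · refine ⟨by simp; omega, g4.congr fun k w => ⟨fun hk => hk.2, fun hk => ⟨?_, hk⟩⟩⟩
    cases hk with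
    | close o h8 h9 => omega
    | _ => omega

/-- All legs are closed, and no cluster is left incomplete: nobody waits at count `0`, and at `r +
1` the star cluster is full. -/
def Terminal (I : Inst) (S c : ℕ) : Prop := S = 2 ^ I.d - 1 ∧ (c = 0 ∨ c = I.r + 1)

theorem cell_spec (hI : I.WF) (hs : CellState I q S c s) (h1 : s.natReg 24 ≤ s.natReg 25) :
    wp cellProg (fun t s' => t ≤ 120 * (s.natReg 25 - s.natReg 24) + 300 ∧
      ∃ v ch, s'.realArr 5 = Function.update (s.realArr 5) (s.natReg 23) v ∧
        s'.natArr 24 = Function.update (s.natArr 24) (s.natReg 23) ch ∧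
        (Terminal I S c → v = 0 ∧ ch = 0) ∧ (¬ Terminal I S c → Best I.big (Cand I s q S c) v ch)) s := by
  have hT : s.natReg 21 = s.natReg 34 ∧ ¬ (¬ s.natReg 22 = 0 ∧ ¬ s.natReg 22 = s.natReg 1 + 1) ↔
      Terminal I S c := by
    unfold Terminal
    rw [hs.reg_S, hs.full, hs.reg_c, hs.r]
    tauto
  unfold cellProg
  rw [wp_seq, wp_setReal, wp_seq, wp_setNat, wp_seq, wp_ite]
  simp only [Test.Holds, NatExpr.eval_reg, NatExpr.eval_zero, NatExpr.eval_add, NatExpr.eval_one,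
    State.setN_natReg, State.setR_natReg, show (21 = 27) = False by simp,
    show (34 = 27) = False by simp, show (22 = 27) = False by simp,
    show (1 = 27) = False by simp, if_false, hT]
  constructor
  · intro hter
    rw [wp_setReal]
    simp only [wp_seq, wp_writeReal, wp_writeNat]
    refine ⟨by simp, 0, 0, by simp, by simp, fun _ => ⟨rfl, rfl⟩, fun h => absurd hter h⟩
  · intro hter
    set u := (s.setR 5 ((rr 1).eval s)).setN 27 0 with hu
    have hsu : CellState I q S c u := hs.agree ⟨by simp [hu], by simp [hu], by simp [hu], by simp [hu]⟩
    have hcu : ∀ k w, Cand I u q S c k w ↔ Cand I s q S c k w := Cand.congr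
      ⟨by simp [hu], by simp [hu], by simp [hu], by simp [hu]⟩
    have hb : Best I.big (CandLt I u q S c 1) (u.realReg 5) (u.natReg 27) := by
      have : u.realReg 5 = I.big := by simp [hu, hs.big]
      rw [this]
      refine ⟨le_rfl, fun k w hk => ?_, fun hlt => absurd hlt (lt_irrefl _)⟩
      obtain ⟨h2, h3⟩ := hk
      cases h3 <;> omega
    have u23 : u.natReg 23 = s.natReg 23 := by simp [hu]
    have u24 : u.natReg 24 = s.natReg 24 := by simp [hu]
    have u25 : u.natReg 25 = s.natReg 25 := by simp [hu]
    have uV : u.realArr 5 = s.realArr 5 := by simp [hu]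
    have uC : u.natArr 24 = s.natArr 24 := by simp [hu]
    rw [wp_seq]
    refine (advance_spec hI hsu hb).conseq ?_
    rintro t1 s1 hF1 ⟨ht1, hb1⟩
    have hc1 : ∀ k w, Cand I s1 q S c k w ↔ Cand I u q S c k w := Cand.congr (hF1.agree rfl)
    rw [wp_seq]
    refine (enter_spec (hsu.agree (hF1.agree rfl)) (hb1.congr fun k w => by unfold CandLt; rw [hc1])).conseq ?_
    rintro t2 s2 hF2 ⟨ht2, hb2⟩
    have hc2 : ∀ k w, Cand I s2 q S c k w ↔ Cand I s1 q S c k w := Cand.congr (hF2.agree rfl)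
    have v24 : s2.natReg 24 = s.natReg 24 := by rw [hF2.nr 24 rfl, hF1.nr 24 rfl, u24]
    have v25 : s2.natReg 25 = s.natReg 25 := by rw [hF2.nr 25 rfl, hF1.nr 25 rfl, u25]
    refine (closeAll_spec ((hsu.agree (hF1.agree rfl)).agree (hF2.agree rfl)) (by omega)
      (hb2.congr fun k w => by unfold CandLt; rw [hc2])).conseq ?_
    rintro t3 s3 hF3 ⟨ht3, hb3⟩
    have w23 : s3.natReg 23 = s.natReg 23 := by rw [hF3.nr 23 rfl, hF2.nr 23 rfl, hF1.nr 23 rfl, u23]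
    have wV : s3.realArr 5 = s.realArr 5 := by rw [hF3.ra 5 rfl, hF2.ra 5 rfl, hF1.ra 5 rfl, uV]
    have wC : s3.natArr 24 = s.natArr 24 := by rw [hF3.na 24 rfl, hF2.na 24 rfl, hF1.na 24 rfl, uC]
    simp only [wp_seq, wp_writeReal, wp_writeNat]
    refine ⟨by simp; omega, s3.realReg 5, s3.natReg 27, by simp [w23, wV], by simp [w23, wC],
      fun h => absurd h hter, fun _ => hb3.congr fun k w => ?_⟩
    rw [hc2, hc1, hcu]

end Gather

namespace Gather
open RAM

/-! ### The table -/

/-- Steps are the major index, then the sets of closed legs, then the counts. Every transition leads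
to a larger address, even when a completed cluster resets the count, so filling downwards finds all
needed entries. -/
def Inst.addr (I : Inst) (q S c : ℕ) : ℕ := q * I.W + (S * (I.r + 2) + c)

variable {I : Inst} {s s' : State} {q S c : ℕ}

theorem Inst.addr_succ : I.addr (q + 1) S c = I.addr q S c + I.W := by
  unfold Inst.addr; ring

theorem Inst.addr_add (j : ℕ) : I.addr q S (c + j) = I.addr q S c + j := by
  unfold Inst.addr; ring

theorem Inst.addr_bit (j : ℕ) : I.addr q (S + j) c = I.addr q S c + j * (I.r + 2) := by
  unfold Inst.addr; ring

theorem Inst.addr_lt_W (hS : S < 2 ^ I.d) (hc : c ≤ I.r + 1) : S * (I.r + 2) + c < I.W := by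
  have := Nat.mul_le_mul_right (I.r + 2) (show S + 1 ≤ 2 ^ I.d from hS)
  unfold Inst.W
  rw [Nat.succ_mul] at this
  omega

theorem Inst.eq_of_addr {q' S' c' : ℕ} (hS : S < 2 ^ I.d) (hc : c ≤ I.r + 1) (hS' : S' < 2 ^ I.d)
    (hc' : c' ≤ I.r + 1) (h : I.addr q S c = I.addr q' S' c') : q = q' ∧ S = S' ∧ c = c' := by
  obtain ⟨h1, h2⟩ := addr_inj (Inst.addr_lt_W hS hc) (Inst.addr_lt_W hS' hc') h
  exact ⟨h1, addr_inj (by omega) (by omega) h2⟩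

/-- The stored transition number `ch` is a transition that does not increase the stored value. -/
inductive Choice (I : Inst) (s : State) (oe q S c : ℕ) : ℕ → Prop
  | done : Terminal I S c → Choice I s oe q S c 0
  | advance : q < I.P → c ≤ I.r → s.realArr 5 (I.addr (q + 1) S
      (if c = I.r ∨ S.testBit (I.leg (I.nu q)) = true then c else c + 1)) ≤
        s.realArr 5 (I.addr q S c) → Choice I s oe q S c 1
  | star : c = I.r → I.tok (I.prev q) ≤ s.realArr 5 (I.addr q S c) →
      s.realArr 5 (I.addr q S (I.r + 1)) ≤ s.realArr 5 (I.addr q S c) → Choice I s oe q S c 2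
  | close (o : ℕ) : o < oe → (optAt s o).Valid I s q → S.testBit (optAt s o).leg = false →
      (optAt s o).lo ≤ c → c ≤ (optAt s o).hi → (optAt s o).val ≤ s.realArr 5 (I.addr q S c) →
      s.realArr 5 (I.addr q (S + 2 ^ (optAt s o).leg) (if (optAt s o).top = 0 then c else 0)) ≤
        s.realArr 5 (I.addr q S c) → Choice I s oe q S c (o + 3)

/-- `sound` serves to read off a solution, the other two give optimality. The count `r + 1` stands
for the star phase, where only the conditions of `Reach.star` on the open legs are left. -/
structure Cell (I : Inst) (s : State) (oe q S c : ℕ) : Prop where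
  sound : s.realArr 5 (I.addr q S c) < I.big → Choice I s oe q S c (s.natArr 24 (I.addr q S c))
  reach : c ≤ I.r → ∀ D, 0 ≤ D → D < I.big → I.ReachLe D q S c → s.realArr 5 (I.addr q S c) ≤ D
  star : c = I.r + 1 → ∀ D, 0 ≤ D → D < I.big →
    (∀ l < I.d, S.testBit l = false → I.StarLe D l (I.kap q l)) → s.realArr 5 (I.addr q S c) ≤ D

/-- All entries from address `a` on are correct. -/
def Cells (I : Inst) (s : State) (oe a : ℕ) : Prop :=
  ∀ q ≤ I.P, ∀ S < 2 ^ I.d, ∀ c ≤ I.r + 1, a ≤ I.addr q S c → Cell I s oe q S c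

/-- A transition refers to no address below its own entry, so writing smaller addresses does not
affect it. -/
theorem Choice.congr {oe oe' h : ℕ} (hC : Choice I s oe q S c h) (ho : oe ≤ oe')
    (hopt : ∀ o < oe, optAt s' o = optAt s o) (hf : s'.realArr 2 = s.realArr 2)
    (hV : ∀ a, I.addr q S c ≤ a → s'.realArr 5 a = s.realArr 5 a)
    (hS : S < 2 ^ I.d) (hc : c ≤ I.r + 1) : Choice I s' oe' q S c h := by
  have hW := Inst.addr_lt_W hS hc
  cases hC with
  | done h1 => exact .done h1
  | advance h1 h2 h3 =>
    refine .advance h1 h2 ?_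
    rw [hV _ le_rfl, hV]
    · exact h3
    · split_ifs
      · rw [Inst.addr_succ]; omega
      · rw [Inst.addr_succ, Inst.addr_add]; omega
  | star h1 h2 h3 =>
    refine .star h1 ?_ ?_
    · rwa [hV _ le_rfl]
    · rw [hV _ le_rfl, hV]
      · exact h3
      · rw [Inst.addr_add, ← h1]; omega
  | close o h1 h2 h3 h4 h5 h6 h7 =>
    rw [← hopt o h1] at h2 h3 h4 h5 h6 h7
    refine .close o (by omega) (h2.congr hf) h3 h4 h5 ?_ ?_
    · rwa [hV _ le_rfl]
    · rw [hV _ le_rfl, hV]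
      · exact h7
      · rw [Inst.addr_bit]
        have h8 : I.addr q S c = I.addr q S 0 + c := by rw [← Inst.addr_add, Nat.zero_add]
        have h9 : 1 * (I.r + 2) ≤ 2 ^ (optAt s' o).leg * (I.r + 2) :=
          Nat.mul_le_mul_right _ Nat.one_le_two_pow
        split_ifs <;> omega

theorem Cell.congr {oe oe' : ℕ} (h : Cell I s oe q S c) (ho : oe ≤ oe')
    (hopt : ∀ o < oe, optAt s' o = optAt s o) (hf : s'.realArr 2 = s.realArr 2)
    (hV : ∀ a, I.addr q S c ≤ a → s'.realArr 5 a = s.realArr 5 a)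
    (hCh : s'.natArr 24 (I.addr q S c) = s.natArr 24 (I.addr q S c))
    (hS : S < 2 ^ I.d) (hc : c ≤ I.r + 1) : Cell I s' oe' q S c := by
  have e := hV _ le_rfl
  refine ⟨?_, ?_, ?_⟩
  · rw [e, hCh]; exact fun hlt => (h.sound hlt).congr ho hopt hf hV hS hc
  · rw [e]; exact h.reach
  · rw [e]; exact h.star

theorem Cells.congr {oe oe' a : ℕ} (h : Cells I s oe a) (ho : oe ≤ oe')
    (hopt : ∀ o < oe, optAt s' o = optAt s o) (hf : s'.realArr 2 = s.realArr 2)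
    (hV : ∀ b, a ≤ b → s'.realArr 5 b = s.realArr 5 b)
    (hCh : ∀ b, a ≤ b → s'.natArr 24 b = s.natArr 24 b) : Cells I s' oe' a :=
  fun q hq S hS c hc ha => (h q hq S hS c hc ha).congr ho hopt hf (fun b hb => hV b (by omega))
    (hCh _ ha) hS hc

/-- The candidates found in a correct table lead to a correct entry. -/
theorem cell_of_best {ob oe ch : ℕ} {v : ℝ} (hq : q ≤ I.P) (hS : S < 2 ^ I.d)
    (hc : c ≤ I.r + 1) (ha : s.natReg 23 = I.addr q S c) (hob : s.natReg 24 = ob)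
    (hoe : s.natReg 25 = oe) (hO : Opts I s q ob oe) (hL : Lines I s)
    (hcells : Cells I s oe (I.addr q S c + 1))
    (hter : Terminal I S c → v = 0 ∧ ch = 0) (hbest : ¬ Terminal I S c → Best I.big (Cand I s q S c) v ch)
    (hopt : ∀ o < oe, optAt s' o = optAt s o) (hf : s'.realArr 2 = s.realArr 2)
    (hV : s'.realArr 5 = Function.update (s.realArr 5) (I.addr q S c) v)
    (hCh : s'.natArr 24 = Function.update (s.natArr 24) (I.addr q S c) ch) :
    Cell I s' oe q S c := by
  have hW := Inst.addr_lt_W hS hc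
  have hz : I.addr q S c = I.addr q S 0 + c := by rw [← Inst.addr_add, Nat.zero_add]
  have e1 : s'.realArr 5 (I.addr q S c) = v := by rw [hV, Function.update_self]
  have e2 : s'.natArr 24 (I.addr q S c) = ch := by rw [hCh, Function.update_self]
  have e3 : ∀ a, I.addr q S c + 1 ≤ a → s'.realArr 5 a = s.realArr 5 a := fun a ha => by
    rw [hV, Function.update_of_ne (by omega)]
  have hbit : ∀ l, 1 * (I.r + 2) ≤ 2 ^ l * (I.r + 2) := fun l =>
    Nat.mul_le_mul_right _ Nat.one_le_two_pow
  refine ⟨?_, ?_, ?_⟩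
  · rw [e1, e2]
    intro hlt
    by_cases ht : Terminal I S c
    · rw [(hter ht).2]; exact .done ht
    · have hm := (hbest ht).mem hlt
      generalize hv : v = v' at hm
      cases hm with
      | skip h1 h2 h3 =>
        refine .advance h1 h2 ?_
        rw [if_pos h3, e1, e3 _ (by rw [Inst.addr_succ]; omega), Inst.addr_succ, hv, ha]
      | fill h1 h2 h3 =>
        refine .advance h1 h2.le ?_
        rw [if_neg (by rw [h3]; simp; omega), e1, e3 _ (by rw [Inst.addr_succ, Inst.addr_add]; omega),
          Inst.addr_succ, Inst.addr_add, hv, ha, Nat.add_right_comm]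
      | star h1 =>
        refine .star h1 ?_ ?_
        · rw [e1, hv]; exact le_max_left _ _
        · rw [e1, e3 _ (by rw [Inst.addr_add, ← h1]), hv, Inst.addr_add, ← h1, ha]
          exact le_max_right _ _
      | close o h1 h2 h3 h4 h5 =>
        rw [hob] at h1
        rw [hoe] at h2
        have h6 := hO.valid o h1 h2
        have h7 := hbit (optAt s o).leg
        refine .close o h2 ?_ ?_ ?_ ?_ ?_ ?_
        · rw [hopt o h2]; exact h6.congr hf
        · rwa [hopt o h2]
        · rwa [hopt o h2]
        · rwa [hopt o h2]
        · rw [hopt o h2, e1, hv]; exact le_max_left _ _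
        · rw [hopt o h2, e1, e3 _ (by rw [Inst.addr_bit]; split_ifs <;> omega), hv]
          refine le_trans (le_of_eq ?_) (le_max_right _ _)
          congr 1
          rw [Inst.addr_bit, ha]
          split_ifs
          · omega
          · omega
  · rw [e1]
    intro hcr D hD0 hD hR
    by_cases ht : Terminal I S c
    · rw [(hter ht).1]; exact hD0
    have hle := (hbest ht).le
    cases hR with
    | done => exact absurd ⟨rfl, Or.inl rfl⟩ ht
    | skip h1 h2 h3 =>
      refine (hle _ _ (.skip h1 hcr (Or.inr h2))).trans ?_
      rw [ha, ← Inst.addr_succ]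
      exact (hcells _ h1 S hS c hc (by rw [Inst.addr_succ]; omega)).reach hcr D hD0 hD h3
    | fill h1 h2 h3 =>
      -- With a full cluster the saturated count does not change, so the machine treats this like
      -- passing a user of a closed leg.
      by_cases hcr' : c = I.r
      · rw [hcr', min_eq_left (by omega)] at h3
        refine (hle _ _ (.skip h1 hcr (Or.inl hcr'))).trans ?_
        rw [ha, ← Inst.addr_succ]
        exact (hcells _ h1 S hS c hc (by rw [Inst.addr_succ]; omega)).reach hcr D hD0 hD (hcr' ▸ h3)
      · rw [min_eq_right (by omega)] at h3
        refine (hle _ _ (.fill h1 (by omega) h2)).trans ?_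
        rw [ha, ← Inst.addr_succ, ← Inst.addr_add]
        exact (hcells _ h1 S hS (c + 1) (by omega) (by rw [Inst.addr_succ, Inst.addr_add]; omega)).reach
          (by omega) D hD0 hD h3
    | close h1 h2 h3 h4 =>
      rename_i l
      obtain ⟨o, k1, k2, k3, k4, k5, k6, k7⟩ := (hO.leg l h1).plain
      have hcan := Cand.close (I := I) (s := s) (q := q) (S := S) (c := c) o (by omega) (by omega)
        (by rwa [k3]) (by omega) (by omega)
      refine (hle _ _ hcan).trans (max_le ?_ ?_)
      · rw [k7]
        exact (hL l h1 _ (kap_le q l)).line_le D hD0 hD h3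
      · rw [k3, k6, if_pos rfl, ha, Nat.sub_zero, ← Inst.addr_bit]
        have := hbit l
        exact (hcells q hq _ (add_two_pow_lt hS h1 h2) c hc (by rw [Inst.addr_bit]; omega)).reach
          hcr D hD0 hD h4
    | top h1 h2 h3 h4 h5 h6 h7 h8 h9 =>
      rename_i l a
      obtain ⟨o, k1, k2, k3, k4, k5, k6, k7⟩ := (hO.leg l h1).top a h3 h4 h5
      have hcan := Cand.close (I := I) (s := s) (q := q) (S := S) (c := c) o (by omega) (by omega)
        (by rwa [k3]) (by omega) (by omega)
      refine (hle _ _ hcan).trans (max_le ?_ ?_)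
      · rw [k7]
        exact max_le h7 ((hL l h1 _ ((Nat.sub_le _ _).trans (kap_le q l))).line_le D hD0 hD h8)
      · have := hbit l
        -- The current address contains the count `c`; subtracting it lands on the entry with count
        -- `0`.
        have e : s.natReg 23 + 2 ^ (optAt s o).leg * (I.r + 2) - (if (optAt s o).top = 0 then 0 else c) =
            I.addr q (S + 2 ^ l) 0 := by
          rw [k3, k6, if_neg (by simp), ha, Inst.addr_bit]
          omega
        rw [e]
        exact (hcells q hq _ (add_two_pow_lt hS h1 h2) 0 (by omega) (by rw [Inst.addr_bit]; omega)).reach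
          (by omega) D hD0 hD h9
    | star h1 h2 =>
      refine (hle _ _ (.star rfl)).trans (max_le h1 ?_)
      rw [ha, ← Inst.addr_add]
      exact (hcells q hq S hS _ le_rfl (by rw [Inst.addr_add])).star rfl D hD0 hD h2
  · rw [e1]
    intro hcr D hD0 hD hR
    by_cases ht : Terminal I S c
    · rw [(hter ht).1]; exact hD0
    -- In the star phase the open legs do not interact, so any of them may be closed next.
    obtain ⟨l, hl, hSl⟩ := exists_testBit_false hS fun h => ht ⟨h, Or.inr hcr⟩
    obtain ⟨o, k1, k2, k3, k4, k5, k6, k7⟩ := (hO.leg l hl).star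
    have hcan := Cand.close (I := I) (s := s) (q := q) (S := S) (c := c) o (by omega) (by omega)
      (by rwa [k3]) (by omega) (by omega)
    refine ((hbest ht).le _ _ hcan).trans (max_le ?_ ?_)
    · rw [k7]
      exact (hL l hl _ (kap_le q l)).star_le D hD0 hD (hR l hl hSl)
    · rw [k3, k6, if_pos rfl, ha, Nat.sub_zero, ← Inst.addr_bit]
      have := hbit l
      refine (hcells q hq _ (add_two_pow_lt hS hl hSl) c hc (by rw [Inst.addr_bit]; omega)).star
        hcr D hD0 hD fun l' hl' hS' => hR l' hl' ?_
      rw [testBit_add_two_pow hSl] at hS'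
      simp at hS'
      exact hS'.1

end Gather

/-! ### Filling the table backwards -/

namespace Gather
open RAM

/-- Greedy subtraction of powers of two, the largest first, yields the bits of the set of closed
legs. -/
def decodeProg : Program :=
  .setNat 29 (nr 21) ⨟
  forDown 26 (nr 0)
    (.ite (.natLe (na 4 (nr 26)) (nr 29))
      (.writeNat 17 (nr 26) 1 ⨟ .setNat 29 (nr 29 - na 4 (nr 26))) (.writeNat 17 (nr 26) 0))

def stepDownProg : Program := .setNat 23 (nr 23 - 1) ⨟ cellProg

def columnProg : Program := forDown 22 (nr 1 + 2) stepDownProg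

def rowProg : Program := decodeProg ⨟ columnProg

def rowsProg : Program := forDown 21 (nr 34 + 1) rowProg

/-- Going from step `q + 1` back to `q`, the swept user is given back to its leg. At `q = P`, where
the computation begins, there is none to give back. -/
def sweepBackProg : Program :=
  .ite (.lt (nr 20) (nr 8))
    (.writeNat 16 (na 0 (na 11 (nr 20))) (na 16 (na 0 (na 11 (nr 20))) + 1)) .skip ⨟
  .ite (.natEq (nr 20) 0) (.setReal 7 0) (.setReal 7 (ra 0 (na 11 (nr 20 - 1)))) ⨟
  .ite (.natEq (nr 35) 1) (.setReal 8 (rr 7 + rr 7)) (.setReal 8 (ra 1 0 + rr 7))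

def stageProg : Program := sweepBackProg ⨟ optsProg ⨟ rowsProg

/-- The address just past the table is formed by repeated addition; each entry lowers it by one. -/
def tableProg : Program :=
  .setNat 23 0 ⨟ .setNat 25 0 ⨟ forUp 20 (nr 8 + 1) (.setNat 23 (nr 23 + nr 10)) ⨟
  forDown 20 (nr 8 + 1) stageProg

variable {I : Inst} {s s' : State} {q S c : ℕ}

theorem decode_spec (h : Base I s) (hS : s.natReg 21 = S) (hSd : S < 2 ^ I.d) :
    wp decodeProg (fun t s' => t ≤ 50 * (I.d + 1) ∧
      ∀ l < I.d, s'.natArr 17 l = if S.testBit l then 1 else 0) s := by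
  unfold decodeProg
  rw [wp_seq, wp_setNat]
  refine wp_forDown I.d (fun _ => 30) (fun k s' => s'.natReg 29 = S % 2 ^ k ∧
    ∀ l, k ≤ l → l < I.d → s'.natArr 17 l = if S.testBit l then 1 else 0) (by simp [h.d]) rfl ?_ ?_ ?_
  · simp [hS, Nat.mod_eq_of_lt hSd]
    intro l h1 h2; omega
  · rintro k hk s' hF h26 ⟨h1, h2⟩
    have e4 : s'.natArr 4 k = 2 ^ k := by
      rw [hF.na 4 rfl]; exact h.pw k (hk.le.trans h.d_le_E)
    simp only [State.setN_natReg, State.setN_natArr, show (29 = 26) = False by simp, if_false] at h1 h2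
    have hm := Nat.mod_pow_succ (b := 2) (x := S) (k := k)
    have hb := Nat.testBit_eq_decide_div_mod_eq (x := S) (i := k)
    have h3 : S % 2 ^ k < 2 ^ k := Nat.mod_lt _ (by positivity)
    simp only [wp_ite, wp_seq, wp_writeNat, wp_setNat, Test.Holds, NatExpr.eval_read, NatExpr.eval_reg,
      h26, e4, h1]
    rcases Nat.mod_two_eq_zero_or_one (S / 2 ^ k) with h4 | h4
    · rw [h4] at hm hb
      simp at hm hb
      constructor
      · intro h5; omega
      · intro h5
        refine ⟨by simp, by simp [h1, hm], fun l h6 h7 => ?_⟩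
        by_cases hl : l = k
        · simp [hl, h26, hb]
        · simp [hl, h26]
          exact h2 l (by omega) h7
    · rw [h4] at hm hb
      simp at hm hb
      constructor
      · intro h5
        refine ⟨by simp, by simp [h1, hm, e4, h26], fun l h6 h7 => ?_⟩
        by_cases hl : l = k
        · simp [hl, h26, hb]
        · simp [hl, h26]
          exact h2 l (by omega) h7
      · intro h5; omega
  · rintro t s' hF ht - ⟨h1, h2⟩
    refine ⟨by simp at ht ⊢; omega, fun l hl => h2 l (Nat.zero_le _) hl⟩

/-- The state while the table is being filled: the entries from address `a` on are correct. -/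
structure TableState (I : Inst) (q oe a : ℕ) (s : State) : Prop extends Base I s where
  lines : Lines I s
  kap : ∀ l, s.natArr 16 l = I.kap q l
  cells : Cells I s oe a
  reg_a : s.natReg 23 = a
  reg_o : s.natReg 25 = oe

/-- The state while the entries for step `q` of the sweep are being computed. -/
structure StageState (I : Inst) (q ob oe a : ℕ) (s : State) : Prop extends TableState I q oe a s where
  reg_q : s.natReg 20 = q
  reg_b : s.natReg 24 = ob
  le : ob ≤ oe
  tok : s.realReg 8 = I.tok (I.prev q)
  opts : Opts I s q ob oe

theorem TableState.agree (hI : I.WF) {oe a : ℕ} (h : TableState I q oe a s)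
    (ha : Agree [0, 1, 2, 3, 35, 7, 9, 10, 34, 8, 23, 25] [1]
      [0, 1, 3, 4, 5, 10, 6, 7, 8, 9, 11, 12, 13, 14, 16, 18, 19, 20, 21, 22, 23, 24] [0, 1, 2, 3, 4, 5]
      s s') : TableState I q oe a s' where
  toBase := h.toBase.agree ⟨fun x hx => ha.nr x (by simp at hx ⊢; tauto), ha.rr,
    fun x hx => ha.na x (by simp at hx ⊢; tauto), fun x hx => ha.ra x (by simp at hx ⊢; tauto)⟩
  lines := h.lines.agree hI ⟨by simp, by simp, fun x hx => ha.na x (by simp at hx ⊢; tauto),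
    fun x hx => ha.ra x (by simp at hx ⊢; tauto)⟩
  kap := by rw [ha.na 16 (by decide)]; exact h.kap
  cells := by
    refine h.cells.congr le_rfl (fun o _ => ?_) (ha.ra 2 (by decide)) ?_ ?_
    · unfold optAt
      rw [ha.na 18 (by decide), ha.na 19 (by decide), ha.na 20 (by decide), ha.na 21 (by decide),
        ha.na 22 (by decide), ha.na 23 (by decide), ha.ra 4 (by decide)]
    · rw [ha.ra 5 (by decide)]; exact fun _ _ => rfl
    · rw [ha.na 24 (by decide)]; exact fun _ _ => rfl
  reg_a := by rw [ha.nr 23 (by decide), h.reg_a]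
  reg_o := by rw [ha.nr 25 (by decide), h.reg_o]

theorem Opts.congr {ob oe : ℕ} (h : Opts I s q ob oe) (ho : ∀ o < oe, optAt s' o = optAt s o)
    (h2 : s'.realArr 2 = s.realArr 2) (h3 : s'.realArr 3 = s.realArr 3) : Opts I s' q ob oe :=
  ⟨fun o h4 h5 => by rw [ho o h5]; exact (h.valid o h4 h5).congr h2,
    fun l hl => (h.leg l hl).congr ho le_rfl h2 h3⟩

theorem StageState.agree (hI : I.WF) {ob oe a : ℕ} (h : StageState I q ob oe a s)
    (ha : Agree [0, 1, 2, 3, 35, 7, 9, 10, 34, 8, 23, 25, 20, 24] [1, 8]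
      [0, 1, 3, 4, 5, 10, 6, 7, 8, 9, 11, 12, 13, 14, 16, 18, 19, 20, 21, 22, 23, 24] [0, 1, 2, 3, 4, 5]
      s s') : StageState I q ob oe a s' where
  toTableState := h.toTableState.agree hI ⟨fun x hx => ha.nr x (by simp at hx ⊢; tauto),
    fun x hx => ha.rr x (by simp at hx ⊢; tauto), ha.na, ha.ra⟩
  reg_q := by rw [ha.nr 20 (by decide), h.reg_q]
  reg_b := by rw [ha.nr 24 (by decide), h.reg_b]
  le := h.le
  tok := by rw [ha.rr 8 (by decide), h.tok]
  opts := by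
    refine h.opts.congr (fun o _ => ?_) (ha.ra 2 (by decide)) (ha.ra 3 (by decide))
    unfold optAt
    rw [ha.na 18 (by decide), ha.na 19 (by decide), ha.na 20 (by decide), ha.na 21 (by decide),
      ha.na 22 (by decide), ha.na 23 (by decide), ha.ra 4 (by decide)]

theorem stepDown_spec (hI : I.WF) {ob oe : ℕ} (hq : q ≤ I.P) (hS : S < 2 ^ I.d) (hc : c ≤ I.r + 1)
    (h : StageState I q ob oe (I.addr q S c + 1) s) (h21 : s.natReg 21 = S) (h22 : s.natReg 22 = c)
    (h17 : ∀ l < I.d, s.natArr 17 l = if S.testBit l then 1 else 0) :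
    wp stepDownProg (fun t s' => t ≤ 120 * (oe - ob) + 310 ∧
      StageState I q ob oe (I.addr q S c) s') s := by
  unfold stepDownProg
  rw [wp_seq, wp_setNat]
  simp only [NatExpr.eval_sub, NatExpr.eval_reg, NatExpr.eval_one, h.reg_a, Nat.add_sub_cancel]
  generalize hu : s.setN 23 (I.addr q S c) = u
  have hB : Base I u := h.toBase.agree ⟨by simp [← hu], by simp [← hu], by simp [← hu], by simp [← hu]⟩
  have hL : Lines I u := h.lines.agree hI ⟨by simp [← hu], by simp [← hu], by simp [← hu], by simp [← hu]⟩
  have uo : ∀ o, optAt u o = optAt s o := fun o => by simp [← hu, optAt]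
  have hO : Opts I u q ob oe := h.opts.congr (fun o _ => uo o) (by simp [← hu]) (by simp [← hu])
  have hC : Cells I u oe (I.addr q S c + 1) := h.cells.congr le_rfl (fun o _ => uo o) (by simp [← hu])
    (by simp [← hu]) (by simp [← hu])
  have u20 : u.natReg 20 = q := by simp [← hu, h.reg_q]
  have u21 : u.natReg 21 = S := by simp [← hu, h21]
  have u22 : u.natReg 22 = c := by simp [← hu, h22]
  have u23 : u.natReg 23 = I.addr q S c := by simp [← hu]
  have u24 : u.natReg 24 = ob := by simp [← hu, h.reg_b]
  have u25 : u.natReg 25 = oe := by simp [← hu, h.reg_o]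
  have u8 : u.realReg 8 = I.tok (I.prev q) := by simp [← hu, h.tok]
  have u17 : u.natArr 17 = s.natArr 17 := by simp [← hu]
  have u16 : u.natArr 16 = s.natArr 16 := by simp [← hu]
  clear hu
  have hcs : CellState I q S c u := ⟨hB, hq, u20, u21, u22, by rw [u17]; exact h17, u8, by
    intro o h1 h2; rw [u24] at h1; rw [u25] at h2; exact (hO.valid o h1 h2).leg_lt⟩
  refine (cell_spec hI hcs (by rw [u24, u25]; exact h.le)).conseq ?_
  rintro t s' hF ⟨ht, v, ch, h1, h2, h3, h4⟩
  rw [u23] at h1 h2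
  rw [u24, u25] at ht
  have so : ∀ o, optAt s' o = optAt u o := fun o => by
    unfold optAt
    rw [hF.na 18 rfl, hF.na 19 rfl, hF.na 20 rfl, hF.na 21 rfl, hF.na 22 rfl, hF.na 23 rfl, hF.ra 4 rfl]
  have hcell := cell_of_best (s' := s') hq hS hc u23 u24 u25 hO hL hC h3 h4 (fun o _ => so o) (hF.ra 2 rfl) h1 h2
  refine ⟨by simp; omega, ⟨⟨hB.agree (hF.agree rfl), hL.agree hI (hF.agree rfl), ?_, ?_, ?_, ?_⟩,
    ?_, ?_, h.le, ?_, ?_⟩⟩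
  · rw [hF.na 16 rfl, u16]; exact h.kap
  · intro q' hq' S' hS' c' hc' ha
    rcases ha.eq_or_lt with ha | ha
    · obtain ⟨rfl, rfl, rfl⟩ := Inst.eq_of_addr hS hc hS' hc' ha
      exact hcell
    · refine (hC q' hq' S' hS' c' hc' ha).congr le_rfl (fun o _ => so o) (hF.ra 2 rfl) ?_ ?_ hS' hc'
      · intro b hb; rw [h1, Function.update_of_ne (by omega)]
      · rw [h2, Function.update_of_ne (by omega)]
  · rw [hF.nr 23 rfl, u23]
  · rw [hF.nr 25 rfl, u25]
  · rw [hF.nr 20 rfl, u20]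
  · rw [hF.nr 24 rfl, u24]
  · rw [hF.rr 8 rfl, u8]
  · exact hO.congr (fun o _ => so o) (hF.ra 2 rfl) (hF.ra 3 rfl)

theorem row_spec (hI : I.WF) {ob oe : ℕ} (hq : q ≤ I.P) (hS : S < 2 ^ I.d)
    (h : StageState I q ob oe (I.addr q (S + 1) 0) s) (h21 : s.natReg 21 = S) :
    wp rowProg (fun t s' => t ≤ (I.r + 2) * (120 * (oe - ob) + 340) + 50 * (I.d + 1) + 50 ∧
      StageState I q ob oe (I.addr q S 0) s') s := by
  unfold rowProg columnProg
  rw [wp_seq]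
  refine (decode_spec h.toBase h21 hS).conseq ?_
  rintro t1 s1 hF1 ⟨ht1, h17⟩
  have h' := h.agree hI (hF1.agree rfl)
  have v21 : s1.natReg 21 = S := (hF1.nr 21 rfl).trans h21
  refine wp_forDown (I.r + 2) (fun _ => 120 * (oe - ob) + 310)
    (fun c s' => StageState I q ob oe (I.addr q S c) s') (by simp [h'.r]) rfl ?_ ?_ ?_
  · have : I.addr q S (I.r + 2) = I.addr q (S + 1) 0 := by unfold Inst.addr; ring
    rw [this]
    exact h'.agree hI ⟨by simp, by simp, by simp, by simp⟩
  · intro c hc s' hF h22 hst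
    rw [Inst.addr_add] at hst
    have hst' : StageState I q ob oe (I.addr q S c + 1) s' := hst.agree hI
      ⟨by simp, by simp, by simp, by simp⟩
    exact stepDown_spec hI hq hS (by omega) hst' ((hF.nr 21 rfl).trans v21) h22
      (by rw [hF.na 17 rfl]; exact h17)
  · intro t s' hF ht _ hst
    refine ⟨?_, hst⟩
    simp at ht
    generalize 120 * (oe - ob) = M at *
    simp only [Nat.mul_add, Nat.add_mul] at ht ⊢
    omega

theorem rows_spec (hI : I.WF) {ob oe : ℕ} (hq : q ≤ I.P)
    (h : StageState I q ob oe (I.addr (q + 1) 0 0) s) :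
    wp rowsProg (fun t s' => t ≤ 2 ^ I.d * ((I.r + 2) * (120 * (oe - ob) + 340) + 50 * (I.d + 1) + 65) + 20 ∧
      StageState I q ob oe (I.addr q 0 0) s') s := by
  unfold rowsProg
  have h2 : 1 ≤ 2 ^ I.d := Nat.one_le_two_pow
  refine wp_forDown (2 ^ I.d) (fun _ => (I.r + 2) * (120 * (oe - ob) + 340) + 50 * (I.d + 1) + 50)
    (fun S s' => StageState I q ob oe (I.addr q S 0) s') (by simp [h.full]; omega) rfl ?_ ?_ ?_
  · have : I.addr q (2 ^ I.d) 0 = I.addr (q + 1) 0 0 := by unfold Inst.addr Inst.W; ring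
    rw [this]
    exact h.agree hI ⟨by simp, by simp, by simp, by simp⟩
  · intro S hS s' hF h21 hst
    exact row_spec hI hq hS (hst.agree hI ⟨by simp, by simp, by simp, by simp⟩) h21
  · intro t s' hF ht _ hst
    refine ⟨?_, hst⟩
    simp only [Finset.sum_const, Finset.card_range, smul_eq_mul, NatExpr.cost_add, NatExpr.cost_reg, NatExpr.cost_one] at ht
    nlinarith [h2]

end Gather

/-! ### One step of the sweep, traversed backwards -/

namespace Gather
open RAM

variable {I : Inst} {s s' : State} {q oe a : ℕ}

theorem Users.kap_succ_add {U : Users} {q : ℕ} (hq : q < U.P) (l : ℕ) :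
    U.kap q l = U.kap (q + 1) l + if U.leg (U.nu q) = l then 1 else 0 := by
  have := Users.fe_nu hq
  rw [Users.kap]
  split_ifs with h
  · subst h; omega
  · rfl

theorem sweepBack_spec (hI : I.WF) (hq : q ≤ I.P) (h20 : s.natReg 20 = q)
    (h : TableState I (min (q + 1) I.P) oe a s) :
    wp sweepBackProg (fun t s' => t ≤ 60 ∧ TableState I q oe a s' ∧ s'.realReg 7 = I.prev q ∧
      s'.realReg 8 = I.tok (I.prev q)) s := by
  unfold sweepBackProg
  have key : ∀ u t, t ≤ 22 → TableState I q oe a u → u.natReg 20 = q →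
      wp (.ite (.natEq (nr 20) 0) (.setReal 7 0) (.setReal 7 (ra 0 (na 11 (nr 20 - 1)))) ⨟
        .ite (.natEq (nr 35) 1) (.setReal 8 (rr 7 + rr 7)) (.setReal 8 (ra 1 0 + rr 7)))
      (fun t' s' => t + t' ≤ 60 ∧ TableState I q oe a s' ∧ s'.realReg 7 = I.prev q ∧
        s'.realReg 8 = I.tok (I.prev q)) u := by
    intro u t ht hu h20
    have hag : ∀ v w, TableState I q oe a ((u.setR 7 v).setR 8 w) := fun v w => hu.agree hI
      ⟨by simp, by simp, by simp, by simp⟩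
    simp only [wp_seq, wp_ite, wp_setReal, Test.Holds, NatExpr.eval_reg, NatExpr.eval_zero,
      RealExpr.eval_zero, RealExpr.eval_read, NatExpr.eval_read, NatExpr.eval_sub, NatExpr.eval_one,
      h20, State.setR_natReg, hu.mode, RealExpr.eval_add, RealExpr.eval_reg, State.setR_realReg, if_true,
      hu.pos, State.setR_realArr, hu.fp]
    have hp : (q = 0 → I.prev q = 0) ∧ (q ≠ 0 → I.prev q = I.pos (u.natArr 11 (q - 1))) := by
      cases q with
      | zero => exact ⟨fun _ => rfl, fun h => absurd rfl h⟩
      | succ k => exact ⟨fun h => by omega, fun _ => by rw [Nat.add_sub_cancel, hu.near k hq]; rfl⟩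
    constructor
    · intro h1
      rw [hp.1 h1]
      constructor
      · intro h2; exact ⟨by simp; omega, hag _ _, by simp, by simp [Inst.tok, h2]⟩
      · intro h2; exact ⟨by simp; omega, hag _ _, by simp, by simp [Inst.tok, h2]⟩
    · intro h1
      rw [hp.2 h1]
      constructor
      · intro h2; exact ⟨by simp; omega, hag _ _, by simp, by simp [Inst.tok, h2]⟩
      · intro h2; exact ⟨by simp; omega, hag _ _, by simp, by simp [Inst.tok, h2]⟩
  rw [wp_seq, wp_ite]
  simp only [Test.Holds, NatExpr.eval_add, NatExpr.eval_reg, NatExpr.eval_one, h20, h.P]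
  constructor
  · intro hlt
    have hlt' : q < I.P := hlt
    rw [wp_writeNat]
    simp only [NatExpr.eval_read, NatExpr.eval_reg, h20, h.near q hlt', h.leg, NatExpr.eval_add,
      NatExpr.eval_one]
    refine key _ _ (by simp) ?_ (by simp [h20])
    have h' := h.kap
    rw [min_eq_left hlt] at h'
    have e : ∀ x, x ≠ 16 → (s.wrN 16 (I.leg (I.nu q)) (s.natArr 16 (I.leg (I.nu q)) + 1)).natArr x =
        s.natArr x := fun x hx => by simp [hx]
    generalize hu : s.wrN 16 (I.leg (I.nu q)) (s.natArr 16 (I.leg (I.nu q)) + 1) = u at e ⊢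
    refine ⟨h.toBase.agree ⟨by simp [← hu], by simp [← hu], by simp [← hu], by simp [← hu]⟩,
      h.lines.agree hI ⟨by simp, by simp, by simp [← hu], by simp [← hu]⟩, fun l => ?_,
      h.cells.congr le_rfl (fun o _ => by simp [← hu, optAt]) (by simp [← hu]) (by simp [← hu]) ?_,
      by simp [← hu, h.reg_a], by simp [← hu, h.reg_o]⟩
    · rw [Users.kap_succ_add hlt' l, ← h' l]
      by_cases hl : I.leg (I.nu q) = l
      · simp [← hu, hl]
      · simp [← hu, hl, Ne.symm hl]
    · rw [e 24 (by norm_num)]; exact fun _ _ => rfl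
  · intro hge
    rw [wp_skip]
    rw [min_eq_right (by omega)] at h
    have : q = I.P := by omega
    subst this
    exact key _ _ (by simp) h h20

theorem stage_spec (hI : I.WF) (hq : q ≤ I.P) (h20 : s.natReg 20 = q)
    (h : TableState I (min (q + 1) I.P) oe (I.addr (q + 1) 0 0) s) :
    wp stageProg (fun t s' => t ≤ I.d * ((2 * I.r) * (60 * s.natReg 9 + 200) + 200) +
      2 ^ I.d * ((I.r + 2) * (120 * (I.d * (2 * I.r + 2)) + 340) + 50 * (I.d + 1) + 65) + 130 ∧
      ∃ oe', TableState I q oe' (I.addr q 0 0) s') s := by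
  unfold stageProg
  rw [wp_seq]
  refine (sweepBack_spec hI hq h20 h).conseq ?_
  rintro t1 s1 hF1 ⟨ht1, h1, h7, h8⟩
  have v20 : s1.natReg 20 = q := (hF1.nr 20 rfl).trans h20
  have v9 : s1.natReg 9 = s.natReg 9 := hF1.nr 9 rfl
  rw [wp_seq]
  refine (opts_spec hI ⟨h1.toBase, h1.lines, h1.kap, h7⟩).conseq ?_
  rintro t2 s2 hF2 ⟨ht2, k1, k2, k3, k4, k5⟩
  rw [h1.reg_o] at k1 k2 k3 k4 k5
  rw [v9] at ht2
  obtain ⟨oe', hoe'⟩ : ∃ oe', s2.natReg 25 = oe' := ⟨_, rfl⟩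
  rw [hoe'] at k2 k3 k5
  have hst : StageState I q oe oe' (I.addr (q + 1) 0 0) s2 := by
    refine ⟨⟨h1.toBase.agree (hF2.agree rfl), h1.lines.agree hI (hF2.agree rfl), ?_, ?_, ?_, hoe'⟩,
      ?_, k1, k2, ?_, k5⟩
    · rw [hF2.na 16 rfl]; exact h1.kap
    · refine h1.cells.congr k2 k4 (hF2.ra 2 rfl) ?_ ?_
      · rw [hF2.ra 5 rfl]; exact fun _ _ => rfl
      · rw [hF2.na 24 rfl]; exact fun _ _ => rfl
    · rw [hF2.nr 23 rfl, h1.reg_a]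
    · rw [hF2.nr 20 rfl, v20]
    · rw [hF2.rr 8 rfl, h8]
  refine (rows_spec hI hq hst).mono ?_
  rintro t3 s3 ⟨ht3, h3⟩
  refine ⟨?_, oe', h3.toTableState⟩
  have hle : oe' - oe ≤ I.d * (2 * I.r + 2) := by omega
  have : 2 ^ I.d * ((I.r + 2) * (120 * (oe' - oe) + 340) + 50 * (I.d + 1) + 65) ≤
    2 ^ I.d * ((I.r + 2) * (120 * (I.d * (2 * I.r + 2)) + 340) + 50 * (I.d + 1) + 65) := by gcongr
  linarith

/-- The time to compute the entries for one step of the sweep. -/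
def Inst.stageTime (I : Inst) (E : ℕ) : ℕ := I.d * ((2 * I.r) * (60 * E + 200) + 200) +
      2 ^ I.d * ((I.r + 2) * (120 * (I.d * (2 * I.r + 2)) + 340) + 50 * (I.d + 1) + 65) + 130

theorem table_spec (hI : I.WF) (h : Base I s) (hL : Lines I s)
    (hk : ∀ l, s.natArr 16 l = I.kap I.P l) :
    wp tableProg (fun t s' => t ≤ (I.P + 1) * (I.stageTime (s.natReg 9) + 40) + 60 ∧
      ∃ oe, TableState I 0 oe 0 s') s := by
  obtain ⟨E, hE⟩ : ∃ E, s.natReg 9 = E := ⟨_, rfl⟩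
  rw [hE]
  unfold tableProg
  rw [wp_seq, wp_setNat, wp_seq, wp_setNat, wp_seq]
  generalize hu : ((s.setN 23 ((0 : NatExpr).eval s)).setN 25
    ((0 : NatExpr).eval (s.setN 23 ((0 : NatExpr).eval s)))) = u
  have hBu : Base I u := h.agree ⟨by simp [← hu], by simp [← hu], by simp [← hu], by simp [← hu]⟩
  have hLu : Lines I u := hL.agree hI ⟨by simp [← hu], by simp [← hu], by simp [← hu], by simp [← hu]⟩
  have u23 : u.natReg 23 = 0 := by simp [← hu]
  have u25 : u.natReg 25 = 0 := by simp [← hu]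
  have u16 : u.natArr 16 = s.natArr 16 := by simp [← hu]
  have u9 : u.natReg 9 = E := by simp [← hu, hE]
  clear hu
  refine wp_forUp (I.P + 1) (fun _ => 10) (fun k s' => s'.natReg 23 = k * I.W) ?_ rfl ?_ ?_ ?_
  · intro s' hF
    simp [hF.nr 8 rfl, hBu.P]
  · simpa using u23
  · rintro k hk s' hF h20 h1
    have e10 : s'.natReg 10 = I.W := by rw [hF.nr 10 rfl, hBu.W]
    simp [h1, e10, Nat.succ_mul]
  · rintro t s' hF ht - h1
    have hst : TableState I (min (I.P + 1) I.P) 0 (I.addr (I.P + 1) 0 0) s' := by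
      refine ⟨hBu.agree (hF.agree rfl), hLu.agree hI (hF.agree rfl), ?_, ?_, ?_, ?_⟩
      · rw [hF.na 16 rfl, u16, min_eq_right (by omega)]; exact hk
      -- Every entry lies before the end of the table, so nothing has to be correct yet.
      · intro q hq S hS c hc ha
        have h2 := Inst.addr_lt_W hS hc
        have h3 := Nat.mul_le_mul_right I.W hq
        unfold Inst.addr at ha
        rw [Nat.succ_mul] at ha
        omega
      · rw [h1]; unfold Inst.addr; ring
      · rw [hF.nr 25 rfl, u25]
    have e9 : s'.natReg 9 = E := (hF.nr 9 rfl).trans u9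
    refine wp_forDown (I.P + 1) (fun _ => I.stageTime E) (fun q s' => s'.natReg 9 = E ∧
      ∃ oe, TableState I (min q I.P) oe (I.addr q 0 0) s') (by simp [hst.P]) rfl ?_ ?_ ?_
    · exact ⟨by simpa using e9, 0, hst.agree hI ⟨by simp, by simp, by simp, by simp⟩⟩
    · rintro q hq s'' hF' h20 ⟨e9', oe, h2⟩
      have h2' : TableState I (min (q + 1) I.P) oe (I.addr (q + 1) 0 0) s'' :=
        h2.agree hI ⟨by simp, by simp, by simp, by simp⟩
      simp only [State.setN_natReg, show (9 = 20) = False by simp, if_false] at e9'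
      refine (stage_spec hI (by omega) h20 h2').conseq ?_
      rintro t' s3 hF3 ⟨ht', oe', h3⟩
      rw [e9'] at ht'
      refine ⟨ht', (hF3.nr 9 rfl).trans e9', oe', ?_⟩
      rwa [min_eq_left (by omega)]
    · rintro t' s'' hF' ht' - ⟨-, oe, h2⟩
      refine ⟨?_, oe, ?_⟩
      · simp only [Finset.sum_const, Finset.card_range, smul_eq_mul, NatExpr.cost_add, NatExpr.cost_reg, NatExpr.cost_one,
          NatExpr.cost_zero] at ht ht' ⊢
        linarith
      · have : I.addr 0 0 0 = 0 := by simp [Inst.addr]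
        rw [this, min_eq_left (Nat.zero_le _)] at h2
        exact h2

end Gather

namespace Gather
open RAM

/-! ### Partial solutions -/

open Classical in
/-- The users in `A` with label `i`. -/
noncomputable def cls (I : Inst) (lab : ℕ → ℕ) (A : ℕ → Prop) (i : ℕ) : Finset ℕ :=
  (Finset.range I.n).filter fun v => A v ∧ lab v = i

/-- The users with label `i` form a cluster of cost at most `D`. -/
def Finished (I : Inst) (D : ℝ) (lab fac : ℕ → ℕ) (A : ℕ → Prop) (i : ℕ) : Prop :=
  I.r ≤ (cls I lab A i).card ∧ I.fits (fac i) D fun v => A v ∧ lab v = i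

/-- A solution for the users in `A`, the users labelled `cur` being still to be dealt with. -/
structure Part (I : Inst) (D : ℝ) (lab fac : ℕ → ℕ) (cur nid : ℕ) (A : ℕ → Prop) : Prop where
  cur_lt : cur < nid
  lt : ∀ u, A u → u < I.n ∧ lab u < nid
  fin : ∀ u, A u → lab u ≠ cur → Finished I D lab fac A (lab u)

variable {I : Inst} {D : ℝ} {lab fac lab' fac' : ℕ → ℕ} {cur nid : ℕ} {A A' T : ℕ → Prop}

theorem mem_cls {i u : ℕ} : u ∈ cls I lab A i ↔ u < I.n ∧ A u ∧ lab u = i := by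
  simp [cls]

theorem Finished.congr {i : ℕ} (h : Finished I D lab fac A i)
    (hA : ∀ v < I.n, (A' v ∧ lab' v = i) ↔ (A v ∧ lab v = i)) (hf : fac' i = fac i) :
    Finished I D lab' fac' A' i := by
  have e : cls I lab' A' i = cls I lab A i := by
    ext u; rw [mem_cls, mem_cls]
    exact and_congr_right fun hu => hA u hu
  refine ⟨by rw [e]; exact h.1, ?_⟩
  have h2 := h.2
  unfold Inst.fits at h2 ⊢
  split_ifs at h2 ⊢
  · exact fun u hu v hv hu' hv' => h2 u hu v hv ((hA u hu).1 hu') ((hA v hv).1 hv')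
  · rw [hf]
    exact ⟨h2.1, fun u hu hu' => h2.2 u hu ((hA u hu).1 hu')⟩

theorem fits_congr {C C' : ℕ → Prop} {φ : ℕ} (h : I.fits φ D C) (hC : ∀ v < I.n, C' v → C v) :
    I.fits φ D C' := by
  unfold Inst.fits at h ⊢
  split_ifs at h ⊢
  · exact fun u hu v hv hu' hv' => h u hu v hv (hC u hu hu') (hC v hv hv')
  · exact ⟨h.1, fun u hu hu' => h.2 u hu (hC u hu hu')⟩

theorem Part.congr (h : Part I D lab fac cur nid A) (hA : ∀ u, A' u ↔ A u) :
    Part I D lab fac cur nid A' := by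
  have : A' = A := by ext u; exact hA u
  rwa [this]

/-- The label `nid` is fresh, so no existing cluster changes. -/
theorem Part.add_class (h : Part I D lab fac cur nid A) (hT : ∀ u, T u → u < I.n ∧ ¬ A u)
    (hA : ∀ u, A' u ↔ A u ∨ T u) (hl : ∀ u, T u → lab' u = nid) (hl' : ∀ u, ¬ T u → lab' u = lab u)
    (hf : ∀ i < nid, fac' i = fac i) (hr : I.r ≤ (cls I lab' T nid).card)
    (hfit : I.fits (fac' nid) D T) : Part I D lab' fac' cur (nid + 1) A' := by
  have hnew : ∀ i < nid, ∀ v, (A' v ∧ lab' v = i) ↔ (A v ∧ lab v = i) := by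
    intro i hi v
    rw [hA]
    by_cases hv : T v
    · have := hl v hv
      have := (hT v hv).2
      constructor
      · rintro ⟨-, rfl⟩; omega
      · rintro ⟨h1, -⟩; exact absurd h1 this
    · rw [hl' v hv]; tauto
  refine ⟨by have := h.cur_lt; omega, fun u hu => ?_, fun u hu hne => ?_⟩
  · rcases (hA u).1 hu with h1 | h1
    · have h2 := h.lt u h1
      rw [hl' u fun hT' => (hT u hT').2 h1]
      exact ⟨h2.1, by omega⟩
    · rw [hl u h1]; exact ⟨(hT u h1).1, by omega⟩
  · rcases (hA u).1 hu with h1 | h1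
    · have h2 := h.lt u h1
      have e := hl' u fun hT' => (hT u hT').2 h1
      rw [e] at hne ⊢
      exact (h.fin u h1 hne).congr (fun v _ => hnew _ h2.2 v) (hf _ h2.2)
    · rw [hl u h1]
      have hs : ∀ v, A' v ∧ lab' v = nid → T v := by
        rintro v ⟨h3, h4⟩
        by_contra hv
        rw [hl' v hv] at h4
        have := (h.lt v (((hA v).1 h3).resolve_right hv)).2
        omega
      refine ⟨hr.trans (Finset.card_le_card fun v hv => ?_), fits_congr hfit fun v _ hv => hs v hv⟩
      rw [mem_cls] at hv ⊢
      exact ⟨hv.1, (hA v).2 (Or.inr hv.2.1), hv.2.2⟩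

theorem Part.add_cur (h : Part I D lab fac cur nid A) (hT : ∀ u, T u → u < I.n ∧ ¬ A u)
    (hA : ∀ u, A' u ↔ A u ∨ T u) (hl : ∀ u, T u → lab' u = cur) (hl' : ∀ u, ¬ T u → lab' u = lab u) :
    Part I D lab' fac cur nid A' := by
  refine ⟨h.cur_lt, fun u hu => ?_, fun u hu hne => ?_⟩
  · rcases (hA u).1 hu with h1 | h1
    · rw [hl' u fun hT' => (hT u hT').2 h1]
      exact h.lt u h1
    · rw [hl u h1]; exact ⟨(hT u h1).1, h.cur_lt⟩
  · have hu' : ¬ T u := fun hT' => hne (hl u hT')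
    have h1 := ((hA u).1 hu).resolve_right hu'
    rw [hl' u hu'] at hne ⊢
    refine (h.fin u h1 hne).congr (fun v _ => ?_) rfl
    rw [hA]
    by_cases hv : T v
    · have := hl v hv
      have := (hT v hv).2
      constructor
      · rintro ⟨-, h2⟩; omega
      · rintro ⟨h1, -⟩; exact absurd h1 this
    · rw [hl' v hv]; tauto

theorem card_cls_add_cur [DecidablePred T] (hT : ∀ u, T u → u < I.n ∧ ¬ A u)
    (hA : ∀ u, A' u ↔ A u ∨ T u) (hl : ∀ u, T u → lab' u = cur) (hl' : ∀ u, ¬ T u → lab' u = lab u) :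
    (cls I lab' A' cur).card = (cls I lab A cur).card + ((Finset.range I.n).filter T).card := by
  rw [← Finset.card_union_of_disjoint]
  · congr 1
    ext u
    rw [Finset.mem_union, mem_cls, mem_cls, Finset.mem_filter, Finset.mem_range, hA]
    by_cases hu : T u
    · have := hl u hu
      tauto
    · rw [hl' u hu]; tauto
  · rw [Finset.disjoint_left]
    intro u hu hu'
    rw [mem_cls] at hu
    rw [Finset.mem_filter] at hu'
    exact (hT u hu'.2).2 hu.2.1

/-- The completed cluster keeps its label, and the fresh label `nid` denotes the next current
cluster, still empty. -/
theorem Part.finish (h : Part I D lab fac cur nid A) (hf : ∀ i ≠ cur, fac' i = fac i)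
    (hr : I.r ≤ (cls I lab A cur).card) (hfit : I.fits (fac' cur) D fun v => A v ∧ lab v = cur) :
    Part I D lab fac' nid (nid + 1) A := by
  refine ⟨by omega, fun u hu => ⟨(h.lt u hu).1, by have := (h.lt u hu).2; omega⟩, fun u hu _ => ?_⟩
  by_cases hc : lab u = cur
  · rw [hc]; exact ⟨hr, hfit⟩
  · exact (h.fin u hu hc).congr (fun v _ => Iff.rfl) (hf _ hc)

theorem card_range_leg {l a b : ℕ} (hb : b ≤ I.cnt l) :
    ((Finset.range I.n).filter fun u => I.leg u = l ∧ a ≤ fe I.n I.leg u ∧ fe I.n I.leg u < b).card =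
      b - a := by
  rw [← Nat.card_Ico, eq_comm]
  refine Finset.card_bij (fun k _ => usr I.n I.leg l k) ?_ ?_ ?_
  · intro k hk
    rw [Finset.mem_Ico] at hk
    have hk' : k < cb I.leg l I.n := lt_of_lt_of_le hk.2 hb
    simp [usr_lt hk', leg_usr hk', fe_usr hk', hk]
  · intro j hj k hk he
    rw [Finset.mem_Ico] at hj hk
    rw [← fe_usr (lt_of_lt_of_le hj.2 hb), he, fe_usr (lt_of_lt_of_le hk.2 hb)]
  · intro u hu
    simp only [Finset.mem_filter, Finset.mem_range] at hu
    obtain ⟨h1, h2, h3, h4⟩ := hu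
    exact ⟨fe I.n I.leg u, by simp [h3, h4], by rw [← h2, usr_fe h1]⟩

/-- The users that are dealt with when the legs in `S` are closed and `q` steps are done. -/
def Dealt (I : Inst) (q S u : ℕ) : Prop :=
  u < I.n ∧ (S.testBit (I.leg u) = true ∨ I.kap q (I.leg u) ≤ fe I.n I.leg u)

/-- The state of the current cluster. -/
structure Current (I : Inst) (D : ℝ) (lab : ℕ → ℕ) (cur q c : ℕ) (A : ℕ → Prop) : Prop where
  lt : c < I.r → (cls I lab A cur).card = c
  ge : I.r ≤ c → I.r ≤ (cls I lab A cur).card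
  pos : c ≤ I.r → ∀ u, A u → lab u = cur → I.pos u ≤ I.prev q
  star : c = I.r + 1 → (∃ x, 0 ≤ x ∧ I.tok x ≤ D) ∧
    ∀ u, A u → lab u = cur → I.tok (I.pos u) ≤ D ∨ I.star u ≤ D

/-- The labels describe a solution of cost at most `D`. -/
def Solution (I : Inst) (D : ℝ) (lab fac : ℕ → ℕ) : Prop :=
  ∀ u < I.n, Finished I D lab fac (fun v => v < I.n) (lab u)

/-- With all legs closed every user is dealt with. At count `0` nobody carries the current label; at
`r + 1` the current cluster is the star around the center. -/
theorem Solution.of_terminal (hI : I.WF) {q S c : ℕ} (h : Part I D lab fac cur nid (Dealt I q S))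
    (hC : Current I D lab cur q c (Dealt I q S)) (ht : Terminal I S c)
    (hf : c = I.r + 1 → fac cur = 0) : Solution I D lab fac := by
  have hall : ∀ u < I.n, Dealt I q S u := by
    intro u hu
    refine ⟨hu, Or.inl ?_⟩
    rw [ht.1, Nat.testBit_two_pow_sub_one]
    simpa using hI.leg_lt u hu
  intro u hu
  have hF : Finished I D lab fac (Dealt I q S) (lab u) := by
    by_cases hc : lab u = cur
    · rcases ht.2 with h0 | h1
      · have h2 := hC.lt (by have := hI.one_le_r; omega)
        rw [h0, Finset.card_eq_zero] at h2
        have : u ∈ cls I lab (Dealt I q S) cur := mem_cls.2 ⟨hu, hall u hu, hc⟩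
        rw [h2] at this
        simp at this
      · rw [hc]
        obtain ⟨⟨x, hx0, hx⟩, hs⟩ := hC.star h1
        refine ⟨hC.ge (by omega), ?_⟩
        rw [hf h1]
        exact hI.fits_star hx0 hx fun v _ hv => hs v hv.1 hv.2
    · exact h.fin u (hall u hu) hc
  refine hF.congr (fun v hv => ?_) rfl
  have := hall v hv
  tauto

/-- The label arrays as they are before any labelling, all zero, describe this solution. -/
theorem Solution.trivial (hI : I.WF) (h : I.r ≤ I.n) : Solution I I.big (fun _ => 0) fun _ => 0 := by
  intro u hu
  refine ⟨?_, fits_congr hI.fits_big fun _ _ _ => True.intro⟩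
  have : cls I (fun _ => 0) (fun v => v < I.n) 0 = Finset.range I.n := by
    ext v; rw [mem_cls]; simp
  rw [this, Finset.card_range]
  exact h

end Gather

namespace Gather
open RAM

/-! ### Reading off a solution -/

def labelProg (x : ℕ) : Program :=
  .loop (.lt (nr 13) (nr 14)) (.writeNat 2 (na 7 (nr 11 + nr 13)) (nr x) ⨟ .setNat 13 (nr 13 + 1))

def chainStepProg : Program :=
  .setNat 13 (na 12 (nr 11 + nr 12)) ⨟ .setNat 14 (nr 12) ⨟
  .writeNat 25 (nr 30) (na 13 (nr 11 + nr 12)) ⨟ .setNat 12 (nr 13) ⨟ labelProg 30 ⨟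
  .setNat 30 (nr 30 + 1)

def chainProg : Program := .loop (.ne (nr 12) 0) chainStepProg

variable {I : Inst} {s s' : State} {l : ℕ}

/-- User `u` is among the users of leg `l` with `a` to `b - 1` users behind. -/
def Between (I : Inst) (l a b u : ℕ) : Prop :=
  u < I.n ∧ I.leg u = l ∧ a ≤ fe I.n I.leg u ∧ fe I.n I.leg u < b

instance (l a b : ℕ) : DecidablePred (Between I l a b) := fun u => by unfold Between; infer_instance

theorem label_spec (h : Lists I s) (hl : l < I.d) (h11 : s.natReg 11 = l * (I.n + 1)) {x a b i : ℕ}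
    (h13 : s.natReg 13 = a) (h14 : s.natReg 14 = b) (hab : a ≤ b) (hb : b ≤ I.cnt l)
    (hx : x ≠ 13) (hi : s.natReg x = i) :
    wp (labelProg x) (fun t s' => t ≤ 20 * (b - a) + 10 ∧
      s'.natArr 2 = fun u => if Between I l a b u then i else s.natArr 2 u) s := by
  unfold labelProg
  refine wp_loop (fun t s' => t + 20 * a ≤ 20 * s'.natReg 13 ∧ a ≤ s'.natReg 13 ∧ s'.natReg 13 ≤ b ∧
      s'.natArr 2 = fun u => if Between I l a (s'.natReg 13) u then i else s.natArr 2 u)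
    (fun s' => b - s'.natReg 13) ?_ ?_ ?_
  · refine ⟨by rw [h13]; omega, by omega, by omega, ?_⟩
    funext u
    rw [h13, if_neg]
    rintro ⟨-, -, h1, h2⟩
    omega
  · rintro t s' hF ⟨g1, g2, g3, g4⟩ hb'
    have e14 : s'.natReg 14 = b := (hF.nr 14 rfl).trans h14
    have e11 : s'.natReg 11 = l * (I.n + 1) := (hF.nr 11 rfl).trans h11
    have ex : s'.natReg x = i := (hF.nr x (by simp [Program.wNR, hx.symm])).trans hi
    have e7 : s'.natArr 7 = s.natArr 7 := hF.na 7 rfl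
    obtain ⟨k, hk⟩ : ∃ k, s'.natReg 13 = k := ⟨_, rfl⟩
    simp [e14, hk] at hb'
    rw [hk] at g1 g2 g3 g4
    have hu := h.ul l hl k (by omega)
    have hkc : k < cb I.leg l I.n := lt_of_lt_of_le (show k < b by omega) hb
    simp [e11, hk, e7, hu, ex]
    refine ⟨⟨by omega, by omega, by omega, ?_⟩, by omega⟩
    funext u
    rw [g4]
    by_cases huk : u = usr I.n I.leg l k
    · have : Between I l a (k + 1) u := by
        rw [huk]
        exact ⟨usr_lt hkc, leg_usr hkc, by rw [fe_usr hkc]; exact g2, by rw [fe_usr hkc]; omega⟩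
      simp [huk]
      rw [← huk]
      exact fun hn => absurd this hn
    · rw [Function.update_of_ne huk]
      have : Between I l a (k + 1) u ↔ Between I l a k u := by
        unfold Between
        constructor
        · rintro ⟨h1, h2, h3, h4⟩
          refine ⟨h1, h2, h3, ?_⟩
          by_contra hne
          have : fe I.n I.leg u = k := by omega
          exact huk (by rw [← this, ← h2, usr_fe h1])
        · rintro ⟨h1, h2, h3, h4⟩
          exact ⟨h1, h2, h3, by omega⟩
      simp only [this]
  · rintro t s' hF ⟨g1, g2, g3, g4⟩ hb'
    have e14 : s'.natReg 14 = b := (hF.nr 14 rfl).trans h14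
    simp [e14] at hb'
    have e13 : s'.natReg 13 = b := by omega
    rw [e13] at g4 g1
    exact ⟨by simp; omega, g4⟩

theorem Inst.WF.pos_le_X (hI : I.WF) {u l κ : ℕ} (hu : Between I l κ (I.cnt l) u) : I.pos u ≤ I.X l κ := by
  obtain ⟨h1, rfl, h3, -⟩ := hu
  have h4 := hI.X_anti (fe_lt_cb h1) h3
  unfold Users.X at h4 ⊢
  rwa [usr_fe h1] at h4

theorem Inst.WF.X_le_pos (hI : I.WF) {u l a κ : ℕ} (hκ : κ ≤ I.cnt l) (hu : Between I l a κ u) :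
    I.X l (κ - 1) ≤ I.pos u := by
  obtain ⟨h1, rfl, h3, h4⟩ := hu
  have h5 := hI.X_anti (show κ - 1 < I.cnt (I.leg u) by omega) (show fe I.n I.leg u ≤ κ - 1 by omega)
  unfold Users.X at h5 ⊢
  rwa [usr_fe h1] at h5

/-- The recorded cuts are followed outward. Each yields a certified interval of at least `r` users,
which gets a fresh label, and by `line_cut` the stretch beyond it costs no more. -/
theorem chain_spec (hI : I.WF) (h : Lists I s) (hL : Lines I s) (hl : l < I.d)
    (h11 : s.natReg 11 = l * (I.n + 1)) {k : ℕ} (h12 : s.natReg 12 = k) (hk : k ≤ I.cnt l) {D : ℝ}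
    (hD : D < I.big) (hcost : lineCost I l s k ≤ D) {cur : ℕ} {A : ℕ → Prop}
    (hP : Part I D (s.natArr 2) (s.natArr 25) cur (s.natReg 30) A)
    (hA : ∀ u, Between I l 0 k u → ¬ A u) :
    wp chainProg (fun t s' => t ≤ 100 * k + 10 ∧
      Part I D (s'.natArr 2) (s'.natArr 25) cur (s'.natReg 30) (fun u => A u ∨ Between I l 0 k u) ∧
      (∀ u, ¬ Between I l 0 k u → s'.natArr 2 u = s.natArr 2 u) ∧
      (∀ u, Between I l 0 k u → s'.natArr 2 u ≠ cur) ∧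
      ∀ i < s.natReg 30, s'.natArr 25 i = s.natArr 25 i) s := by
  have hr := hI.one_le_r
  unfold chainProg
  refine wp_loop (fun t s' => t + 100 * s'.natReg 12 ≤ 100 * k ∧ s'.natReg 12 ≤ k ∧
      lineCost I l s (s'.natReg 12) ≤ D ∧ s.natReg 30 ≤ s'.natReg 30 ∧
      Part I D (s'.natArr 2) (s'.natArr 25) cur (s'.natReg 30)
        (fun u => A u ∨ Between I l (s'.natReg 12) k u) ∧
      (∀ u, ¬ Between I l (s'.natReg 12) k u → s'.natArr 2 u = s.natArr 2 u) ∧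
      (∀ u, Between I l (s'.natReg 12) k u → s'.natArr 2 u ≠ cur) ∧
      ∀ i < s.natReg 30, s'.natArr 25 i = s.natArr 25 i) (fun s' => s'.natReg 12) ?_ ?_ ?_
  · rw [h12]
    have hn : ∀ u, ¬ Between I l k k u := by rintro u ⟨-, -, h1, h2⟩; omega
    exact ⟨by omega, le_rfl, hcost, le_rfl, hP.congr fun u => by simp [hn], fun _ _ => rfl,
      fun u hu => absurd hu (hn u), fun _ _ => rfl⟩
  · rintro t s' hF ⟨g1, g2, g3, g4, g5, g6, g7, g8⟩ hb
    have hLi : Lists I s' := h.agree (hF.agree rfl)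
    have e11 : s'.natReg 11 = l * (I.n + 1) := (hF.nr 11 rfl).trans h11
    have e12 : s'.natArr 12 = s.natArr 12 := hF.na 12 rfl
    have e13 : s'.natArr 13 = s.natArr 13 := hF.na 13 rfl
    obtain ⟨κ, hκ⟩ : ∃ κ, s'.natReg 12 = κ := ⟨_, rfl⟩
    obtain ⟨nid, hnid⟩ : ∃ nid, s'.natReg 30 = nid := ⟨_, rfl⟩
    simp [hκ] at hb
    rw [hκ] at g1 g2 g3 g5 g6 g7
    rw [hnid] at g4 g5
    obtain ⟨k1, k2, k3⟩ := (hL l hl κ (g2.trans hk)).line_cut hb (lt_of_le_of_lt g3 hD)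
    obtain ⟨cut, hcut⟩ : ∃ cut, lineCut I l s κ = cut := ⟨_, rfl⟩
    obtain ⟨f, hf⟩ : ∃ f, lineFac I l s κ = f := ⟨_, rfl⟩
    rw [hcut] at k1 k2 k3
    rw [hf] at k2
    unfold lineCut at hcut
    unfold lineFac at hf
    unfold chainStepProg
    simp only [wp_seq (c₁ := .setNat _ _), wp_setNat, wp_seq (c₁ := .writeNat _ _ _), wp_writeNat]
    simp only [NatExpr.eval_read, NatExpr.eval_add, NatExpr.eval_reg, e11, hκ, e12, hcut,
      State.setN_natReg, State.setN_natArr, show (12 = 13) = False by simp, if_false, if_true,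
      show (30 = 14) = False by simp, show (30 = 13) = False by simp, show (11 = 14) = False by simp,
      show (11 = 13) = False by simp, show (12 = 14) = False by simp, show (13 = 14) = False by simp,
      e13, hf, hnid, State.wrN_natReg]
    generalize hu : (((s'.setN 13 cut).setN 14 κ).wrN 25 nid f).setN 12 cut = u
    have u2 : u.natArr 2 = s'.natArr 2 := by simp [← hu]
    have u25 : u.natArr 25 = Function.update (s'.natArr 25) nid f := by simp [← hu]
    have u30 : u.natReg 30 = nid := by simp [← hu, hnid]
    have u12 : u.natReg 12 = cut := by simp [← hu]
    have hLu : Lists I u := hLi.agree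
      ⟨by simp [← hu], by simp [← hu], by simp [← hu], by simp [← hu]⟩
    rw [wp_seq]
    refine (label_spec hLu hl (by simp [← hu, e11]) (a := cut) (b := κ) (i := nid) (by simp [← hu])
      (by simp [← hu]) (by omega) (by omega) (by norm_num) u30).conseq ?_
    rintro t1 s1 hF1 ⟨ht1, h2⟩
    have v25 : s1.natArr 25 = Function.update (s'.natArr 25) nid f := (hF1.na 25 rfl).trans u25
    have v30 : s1.natReg 30 = nid := (hF1.nr 30 rfl).trans u30
    have v12 : s1.natReg 12 = cut := (hF1.nr 12 rfl).trans u12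
    rw [u2] at h2
    clear hu
    simp [v25, v30, v12, h2]
    have hsplit : ∀ u, Between I l cut k u ↔ Between I l κ k u ∨ Between I l cut κ u := by
      intro u; unfold Between; constructor
      · rintro ⟨h1, h2, h3, h4⟩
        rcases Nat.lt_or_ge (fe I.n I.leg u) κ with h5 | h5
        · exact Or.inr ⟨h1, h2, h3, h5⟩
        · exact Or.inl ⟨h1, h2, h5, h4⟩
      · rintro (⟨h1, h2, h3, h4⟩ | ⟨h1, h2, h3, h4⟩)
        · exact ⟨h1, h2, by omega, h4⟩
        · exact ⟨h1, h2, h3, by omega⟩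
    have hcurlt := hP.cur_lt
    refine ⟨⟨by omega, by omega, k3.trans g3, by omega, ?_, ?_, ?_, ?_⟩, by omega⟩
    · refine g5.add_class (T := Between I l cut κ) ?_ ?_ ?_ ?_ ?_ ?_ ?_
      · rintro v ⟨h3, h4, h5, h6⟩
        refine ⟨h3, ?_⟩
        rintro (h7 | ⟨-, -, h7, -⟩)
        · exact hA v ⟨h3, h4, Nat.zero_le _, by omega⟩ h7
        · omega
      · intro v; rw [hsplit]; tauto
      · intro v hv; rw [if_pos hv]
      · intro v hv; rw [if_neg hv]
      · intro i hi; rw [Function.update_of_ne (by omega)]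
      · have e : cls I (fun u => if Between I l cut κ u then nid else s'.natArr 2 u)
            (Between I l cut κ) nid = (Finset.range I.n).filter
            fun u => I.leg u = l ∧ cut ≤ fe I.n I.leg u ∧ fe I.n I.leg u < κ := by
          ext v
          rw [mem_cls, Finset.mem_filter, Finset.mem_range]
          constructor
          · rintro ⟨h3, h4, -⟩; exact ⟨h3, h4.2⟩
          · rintro ⟨h3, h4⟩
            have : Between I l cut κ v := ⟨h3, h4⟩
            exact ⟨h3, this, if_pos this⟩
        rw [e, card_range_leg (by omega)]
        omega
      · rw [Function.update_self]
        refine hI.fits_seg k2 g3 fun v _ hv => Or.inr ⟨hv.2.1, hI.X_le_pos (by omega) hv, ?_⟩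
        exact hI.pos_le_X ⟨hv.1, hv.2.1, hv.2.2.1, by have := hv.2.2.2; omega⟩
    · intro v hv
      rw [hsplit] at hv
      rw [if_neg fun h => hv (Or.inr h)]
      exact g6 v fun h => hv (Or.inl h)
    · intro v hv
      split_ifs with h3
      · omega
      · exact g7 v (((hsplit v).1 hv).resolve_right h3)
    · intro i hi
      rw [Function.update_of_ne (by omega)]
      exact g8 i hi
  · rintro t s' hF ⟨g1, g2, g3, g4, g5, g6, g7, g8⟩ hb
    simp at hb
    rw [hb] at g1 g5 g6 g7
    exact ⟨by simp; omega, g5, g6, g7, g8⟩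

end Gather

/-! ### Effect of the transitions on the partial solution -/

namespace Gather
open RAM

variable {I : Inst} {s s' : State} {D : ℝ} {q S c l u oe cur : ℕ} {lab lab' fac : ℕ → ℕ}

theorem dealt_skip (hS : S.testBit (I.leg (I.nu q)) = true) : Dealt I (q + 1) S u ↔ Dealt I q S u := by
  unfold Dealt
  rw [Users.kap]
  split_ifs with h
  · rw [← h]; tauto
  · rfl

theorem not_dealt_nu (hq : q < I.P) (hS : S.testBit (I.leg (I.nu q)) = false) : ¬ Dealt I q S (I.nu q) := by
  have := Users.fe_nu hq
  rintro ⟨-, h | h⟩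
  · rw [hS] at h; simp at h
  · omega

theorem dealt_fill (hq : q < I.P) :
    Dealt I (q + 1) S u ↔ Dealt I q S u ∨ u = I.nu q := by
  have h1 := Users.fe_nu hq
  have h2 := (Users.nu_spec hq).1
  unfold Dealt
  rw [Users.kap]
  by_cases hu : u = I.nu q
  · subst hu
    rw [if_pos rfl]
    exact ⟨fun _ => Or.inr rfl, fun _ => ⟨h2, Or.inr (by omega)⟩⟩
  · split_ifs with h
    · constructor
      · rintro ⟨h3, h4 | h4⟩
        · exact Or.inl ⟨h3, Or.inl h4⟩
        · refine Or.inl ⟨h3, Or.inr ?_⟩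
          by_contra h5
          apply hu
          rw [← usr_fe (leg := I.leg) h3, ← usr_fe (leg := I.leg) h2, ← h]
          congr 1
          rw [← h] at h4 h5
          omega
      · rintro (⟨h3, h4⟩ | h3)
        · exact ⟨h3, h4.imp_right fun h5 => by omega⟩
        · exact absurd h3 hu
    · tauto

theorem dealt_close (hS : S.testBit l = false) :
    Dealt I q (S + 2 ^ l) u ↔ Dealt I q S u ∨ Between I l 0 (I.kap q l) u := by
  unfold Dealt Between
  rw [testBit_add_two_pow hS]
  by_cases hl : I.leg u = l
  · subst hl
    simp
    constructor
    · intro h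
      refine (Nat.lt_or_ge (fe I.n I.leg u) (I.kap q (I.leg u))).elim (fun h1 => Or.inr ⟨h, h1⟩)
        fun h1 => Or.inl ⟨h, Or.inr h1⟩
    · rintro (h | h) <;> exact h.1
  · simp [hl, Ne.symm hl]

theorem not_dealt_between (hS : S.testBit l = false) (h : Between I l 0 (I.kap q l) u) : ¬ Dealt I q S u := by
  obtain ⟨h1, rfl, h3, h4⟩ := h
  rintro ⟨-, h | h⟩
  · rw [hS] at h; simp at h
  · omega

theorem prev_le_succ (hI : I.WF) (hq : q < I.P) : I.prev q ≤ I.prev (q + 1) := by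
  have h := Users.nu_spec hq
  have := prev_count_le hI.toWF (p := I.nu q) (w := I.nu q) (by omega) h.1
  rwa [h.2.2] at this

/-- A bound for the remaining work. -/
noncomputable def work (I : Inst) (q S c : ℕ) : ℕ :=
  -- One unit for each step ahead, one for entering the star phase, and for each open leg enough to
  -- pay for labelling its users.
  (I.P - q) + (if c ≤ I.r then 1 else 0) +
    ∑ l ∈ Finset.range I.d, if S.testBit l then 0 else I.kap q l + 1

theorem work_advance {c' : ℕ} (hq : q < I.P) (hc : c ≤ I.r) : work I (q + 1) S c' + 1 ≤ work I q S c := by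
  unfold work
  have : ∑ l ∈ Finset.range I.d, (if S.testBit l then 0 else I.kap (q + 1) l + 1) ≤
      ∑ l ∈ Finset.range I.d, if S.testBit l then 0 else I.kap q l + 1 := by
    refine Finset.sum_le_sum fun l _ => ?_
    rw [Users.kap]
    split_ifs <;> omega
  rw [if_pos hc]
  split_ifs <;> omega

theorem work_star : work I q S (I.r + 1) + 1 ≤ work I q S I.r := by
  unfold work
  rw [if_pos le_rfl, if_neg (by omega)]
  omega

theorem work_close {c' : ℕ} (hl : l < I.d) (hS : S.testBit l = false) (hc : c' ≤ I.r → c ≤ I.r) :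
    work I q (S + 2 ^ l) c' + (I.kap q l + 1) ≤ work I q S c := by
  unfold work
  have hm : l ∈ Finset.range I.d := Finset.mem_range.2 hl
  rw [← Finset.add_sum_erase _ _ hm, ← Finset.add_sum_erase (Finset.range I.d)
    (fun l => if S.testBit l then 0 else I.kap q l + 1) hm]
  have : ∑ x ∈ (Finset.range I.d).erase l, (if (S + 2 ^ l).testBit x then 0 else I.kap q x + 1) =
      ∑ x ∈ (Finset.range I.d).erase l, if S.testBit x then 0 else I.kap q x + 1 := by
    refine Finset.sum_congr rfl fun x hx => ?_
    rw [testBit_add_two_pow hS]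
    have := Finset.ne_of_mem_erase hx
    simp [this, Ne.symm this]
  rw [this, testBit_add_two_pow hS]
  simp [hS]
  split_ifs <;> omega

theorem Current.skip (hI : I.WF) (hq : q < I.P) (hS : S.testBit (I.leg (I.nu q)) = true)
    (hc : c ≤ I.r) (h : Current I D lab cur q c (Dealt I q S)) :
    Current I D lab cur (q + 1) c (Dealt I (q + 1) S) := by
  have e : Dealt I (q + 1) S = Dealt I q S := by ext u; exact dealt_skip hS
  rw [e]
  exact ⟨h.lt, h.ge, fun h1 u h2 h3 => (h.pos h1 u h2 h3).trans (prev_le_succ hI hq), fun h1 => by omega⟩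

theorem Current.fill (hI : I.WF) (hq : q < I.P) (hS : S.testBit (I.leg (I.nu q)) = false)
    (hc : c ≤ I.r) (h : Current I D lab cur q c (Dealt I q S)) :
    Current I D (Function.update lab (I.nu q) cur) cur (q + 1) (if c = I.r then c else c + 1)
      (Dealt I (q + 1) S) := by
  have hcard := card_cls_add_cur (I := I) (lab := lab) (lab' := Function.update lab (I.nu q) cur)
    (A := Dealt I q S) (A' := Dealt I (q + 1) S) (T := fun u => u = I.nu q) (cur := cur)
    (by rintro u rfl; exact ⟨(Users.nu_spec hq).1, not_dealt_nu hq hS⟩) (fun u => dealt_fill hq)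
    (by rintro u rfl; simp) (fun u hu => by rw [Function.update_of_ne hu])
  have h1 : ((Finset.range I.n).filter fun u => u = I.nu q).card = 1 := by
    rw [Finset.card_eq_one]
    refine ⟨I.nu q, ?_⟩
    ext u
    rw [Finset.mem_filter, Finset.mem_range, Finset.mem_singleton]
    exact ⟨fun h => h.2, fun h => ⟨h ▸ (Users.nu_spec hq).1, h⟩⟩
  rw [h1] at hcard
  have hlt := h.lt
  have hge := h.ge
  refine ⟨fun h2 => ?_, fun h2 => ?_, fun _ u h2 h3 => ?_, fun h2 => ?_⟩
  · split_ifs at h2 ⊢ <;> omega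
  · rw [hcard]; split_ifs at h2 <;> omega
  · by_cases hu : u = I.nu q
    · subst hu; exact le_rfl
    · rw [Function.update_of_ne hu] at h3
      exact (h.pos hc u (((dealt_fill hq).1 h2).resolve_right hu) h3).trans (prev_le_succ hI hq)
  · split_ifs at h2 <;> omega

theorem Current.enter (hI : I.WF) {A : ℕ → Prop} (h : Current I D lab cur q I.r A)
    (ht : I.tok (I.prev q) ≤ D) : Current I D lab cur q (I.r + 1) A :=
  ⟨fun h1 => by omega, fun _ => h.ge le_rfl, fun h1 => by omega, fun _ =>
    ⟨⟨_, prev_nonneg hI.toWF q, ht⟩, fun u h1 h2 =>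
      Or.inl ((Inst.tok_mono (h.pos le_rfl u h1 h2)).trans ht)⟩⟩

theorem Current.close (hI : I.WF) {p : Opt} (hp : p.Valid I s q) (hlo : p.lo ≤ c) (hhi : c ≤ p.hi)
    (hv : p.val ≤ D) (hD : D < I.big) (hS : S.testBit p.leg = false)
    (h : Current I D lab cur q c (Dealt I q S))
    (hl : ∀ u, Between I p.leg p.tgt (I.kap q p.leg) u → lab' u = cur)
    (hl' : ∀ u, Between I p.leg 0 p.tgt u → lab' u ≠ cur)
    (hl'' : ∀ u, ¬ Between I p.leg 0 (I.kap q p.leg) u → lab' u = lab u) :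
    (p.top = 0 → Current I D lab' cur q c (Dealt I q (S + 2 ^ p.leg))) ∧
    (p.top ≠ 0 → c ≤ I.r ∧ I.r ≤ (cls I lab' (Dealt I q (S + 2 ^ p.leg)) cur).card ∧
      I.fits p.fac D fun u => Dealt I q (S + 2 ^ p.leg) u ∧ lab' u = cur) := by
  have htgt := hp.tgt_le
  have hkap := kap_le (I := I) q p.leg
  have hsplit : ∀ u, Between I p.leg 0 (I.kap q p.leg) u ↔
      Between I p.leg 0 p.tgt u ∨ Between I p.leg p.tgt (I.kap q p.leg) u := by
    intro u; unfold Between; constructor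
    · rintro ⟨h1, h2, h3, h4⟩
      rcases Nat.lt_or_ge (fe I.n I.leg u) p.tgt with h5 | h5
      · exact Or.inl ⟨h1, h2, h3, h5⟩
      · exact Or.inr ⟨h1, h2, h5, h4⟩
    · rintro (⟨h1, h2, h3, h4⟩ | ⟨h1, h2, h3, h4⟩)
      · exact ⟨h1, h2, h3, by omega⟩
      · exact ⟨h1, h2, by omega, h4⟩
  -- The current cluster gains exactly the users with index at least `p.tgt`; those below got labels
  -- other than `cur`.
  have hK : ∀ u, Dealt I q (S + 2 ^ p.leg) u ∧ lab' u = cur ↔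
      (Dealt I q S u ∧ lab u = cur) ∨ Between I p.leg p.tgt (I.kap q p.leg) u := by
    intro u
    rw [dealt_close hS]
    by_cases h1 : Between I p.leg 0 (I.kap q p.leg) u
    · have h2 := not_dealt_between hS h1
      rcases (hsplit u).1 h1 with h3 | h3
      · have h4 := hl' u h3
        have : ¬ Between I p.leg p.tgt (I.kap q p.leg) u := by
          rintro ⟨-, -, h5, -⟩; exact absurd h3.2.2.2 (by omega)
        tauto
      · have := hl u h3
        tauto
    · rw [hl'' u h1]
      have : ¬ Between I p.leg p.tgt (I.kap q p.leg) u := fun h2 => h1 ((hsplit u).2 (Or.inr h2))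
      tauto
  have hN : (cls I lab' (Dealt I q (S + 2 ^ p.leg)) cur).card =
      (cls I lab (Dealt I q S) cur).card + (I.kap q p.leg - p.tgt) := by
    rw [← card_range_leg (I := I) (l := p.leg) (a := p.tgt) hkap, ← Finset.card_union_of_disjoint]
    · congr 1
      ext u
      rw [Finset.mem_union, mem_cls, mem_cls, Finset.mem_filter, Finset.mem_range]
      have := hK u
      unfold Between at this
      tauto
    · rw [Finset.disjoint_left]
      intro u hu hu'
      rw [mem_cls] at hu
      rw [Finset.mem_filter, Finset.mem_range] at hu'
      exact not_dealt_between hS ((hsplit u).2 (Or.inr ⟨hu'.1, hu'.2⟩)) hu.2.1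
  have hlt := h.lt
  have hge := h.ge
  rcases hp.kind with ⟨h1, h2, h3⟩ | ⟨h1, h2, h3⟩ | ⟨h1, h2, h3, h4, h5⟩
  · refine ⟨fun _ => ⟨fun _ => by omega, fun _ => by omega, fun h4 u h5 h6 => ?_, fun h4 => by omega⟩,
      fun h4 => absurd h1 h4⟩
    rcases (hK u).1 ⟨h5, h6⟩ with h7 | h7
    · exact h.pos h4 u h7.1 h7.2
    · have := h7.2.2; omega
  · refine ⟨fun _ => ⟨fun _ => by omega, fun _ => by omega, fun h4 => by omega, fun h4 => ?_⟩,
      fun h4 => absurd h1 h4⟩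
    obtain ⟨h5, h6⟩ := h.star h4
    refine ⟨h5, fun u h7 h8 => ?_⟩
    rcases (hK u).1 ⟨h7, h8⟩ with h9 | ⟨k1, k2, k3, k4⟩
    · exact h6 u h9.1 h9.2
    · have := h3 _ k3 k4
      rw [← k2, usr_fe k1] at this
      exact Or.inr (this.trans hv)
  · refine ⟨fun h6 => by omega, fun _ => ⟨by omega, by omega, ?_⟩⟩
    -- The waiting users are within `I.prev q` of the center and the joining ones reach out to `X
    -- p.tgt`, which is the segment that the option certifies.
    refine hI.fits_seg (h5 (lt_of_le_of_lt hv hD)) hv fun u _ hu => ?_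
    rcases (hK u).1 hu with h9 | h9
    · left
      rw [neg_neg]
      exact h.pos (by omega) u h9.1 h9.2
    · right
      have p1 := hI.pos_nonneg u
      have p2 := prev_nonneg hI.toWF q
      exact ⟨h9.2.1, by linarith,
        hI.pos_le_X ⟨h9.1, h9.2.1, h9.2.2.1, lt_of_lt_of_le h9.2.2.2 hkap⟩⟩

end Gather

/-! ### Following the recorded transitions -/

namespace Gather
open RAM

def passUserProg : Program :=
  .setNat 5 (na 0 (na 11 (nr 20))) ⨟ .setNat 23 (nr 23 + nr 10) ⨟
  .ite (.natEq (na 17 (nr 5)) 0)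
    (.writeNat 2 (na 11 (nr 20)) (nr 29) ⨟
      .ite (.natEq (nr 22) (nr 1)) .skip (.setNat 22 (nr 22 + 1) ⨟ .setNat 23 (nr 23 + 1))) .skip ⨟
  .writeNat 16 (nr 5) (na 16 (nr 5) - 1) ⨟ .setNat 20 (nr 20 + 1)

def passStarProg : Program :=
  .writeNat 25 (nr 29) 0 ⨟ .setNat 22 (nr 22 + 1) ⨟ .setNat 23 (nr 23 + 1)

def optInitProg : Program :=
  .setNat 26 (na 24 (nr 23) - 3) ⨟ .setNat 5 (na 18 (nr 26)) ⨟ .setNat 11 (na 3 (nr 5)) ⨟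
  .setNat 13 (na 22 (nr 26)) ⨟ .setNat 14 (na 16 (nr 5))

def finishProg : Program :=
  .writeNat 17 (nr 5) 1 ⨟ .setNat 21 (nr 21 + na 4 (nr 5)) ⨟ .setNat 23 (nr 23 + na 10 (nr 5)) ⨟
  .ite (.natEq (na 21 (nr 26)) 0) .skip
    (.writeNat 25 (nr 29) (na 23 (nr 26)) ⨟ .setNat 29 (nr 30) ⨟ .setNat 30 (nr 30 + 1) ⨟
      .setNat 23 (nr 23 - nr 22) ⨟ .setNat 22 0)

/-- The users that join the current cluster are labelled before the chain; finishing comes last,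
because it may replace the current label. -/
def passLegProg : Program :=
  optInitProg ⨟ labelProg 29 ⨟ .setNat 12 (na 22 (nr 26)) ⨟ chainProg ⨟ finishProg

def passProg : Program :=
  .ite (.natEq (na 24 (nr 23)) 1) passUserProg (.ite (.natEq (na 24 (nr 23)) 2) passStarProg passLegProg)

/-- The tables that are used to read off a solution. -/
structure Solved (I : Inst) (oe : ℕ) (s : State) : Prop extends Base I s where
  lines : Lines I s
  cells : Cells I s oe 0

/-- The state while a solution is read off. -/
structure Trace (I : Inst) (oe : ℕ) (D : ℝ) (q S c : ℕ) (s : State) : Prop extends Solved I oe s where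
  q_le : q ≤ I.P
  S_lt : S < 2 ^ I.d
  c_le : c ≤ I.r + 1
  reg_q : s.natReg 20 = q
  reg_S : s.natReg 21 = S
  reg_c : s.natReg 22 = c
  reg_a : s.natReg 23 = I.addr q S c
  kap : ∀ l, s.natArr 16 l = I.kap q l
  mem : ∀ l < I.d, s.natArr 17 l = if S.testBit l then 1 else 0
  val : s.realArr 5 (I.addr q S c) ≤ D
  part : Part I D (s.natArr 2) (s.natArr 25) (s.natReg 29) (s.natReg 30) (Dealt I q S)
  current : Current I D (s.natArr 2) (s.natReg 29) q c (Dealt I q S)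
  star_fac : c = I.r + 1 → s.natArr 25 (s.natReg 29) = 0

variable {I : Inst} {s s' : State} {D : ℝ} {q S c oe : ℕ}

theorem Solved.agree (hI : I.WF) (h : Solved I oe s)
    (ha : Agree [0, 1, 2, 3, 35, 7, 9, 10, 34, 8] [1]
      [0, 1, 3, 4, 5, 10, 6, 7, 8, 9, 11, 12, 13, 14, 18, 19, 20, 21, 22, 23, 24] [0, 1, 2, 3, 4, 5]
      s s') : Solved I oe s' where
  toBase := h.toBase.agree ⟨ha.nr, ha.rr, fun x hx => ha.na x (by simp at hx ⊢; tauto),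
    fun x hx => ha.ra x (by simp at hx ⊢; tauto)⟩
  lines := h.lines.agree hI ⟨by simp, by simp, fun x hx => ha.na x (by simp at hx ⊢; tauto),
    fun x hx => ha.ra x (by simp at hx ⊢; tauto)⟩
  cells := by
    refine h.cells.congr le_rfl (fun o _ => ?_) (ha.ra 2 (by decide)) ?_ ?_
    · unfold optAt
      rw [ha.na 18 (by decide), ha.na 19 (by decide), ha.na 20 (by decide), ha.na 21 (by decide),
        ha.na 22 (by decide), ha.na 23 (by decide), ha.ra 4 (by decide)]
    · rw [ha.ra 5 (by decide)]; exact fun _ _ => rfl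
    · rw [ha.na 24 (by decide)]; exact fun _ _ => rfl

theorem passUser_spec (hI : I.WF) (h : Trace I oe D q S c s) (hq : q < I.P) (hc : c ≤ I.r)
    (hval : s.realArr 5 (I.addr (q + 1) S
      (if c = I.r ∨ S.testBit (I.leg (I.nu q)) = true then c else c + 1)) ≤ D) :
    wp passUserProg (fun t s' => t ≤ 70 ∧ ∃ c', Trace I oe D (q + 1) S c' s') s := by
  have hl : I.leg (I.nu q) < I.d := hI.leg_lt _ (Users.nu_spec hq).1
  obtain ⟨v, hv⟩ : ∃ v, I.nu q = v := ⟨_, rfl⟩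
  obtain ⟨l, hlv⟩ : ∃ l, I.leg v = l := ⟨_, rfl⟩
  have key : ∀ u c' t, t ≤ 50 → Solved I oe u → u.natReg 5 = l → u.natReg 20 = q →
      u.natReg 21 = S → u.natReg 22 = c' → u.natReg 23 = I.addr (q + 1) S c' → c' ≤ I.r →
      u.natArr 16 = s.natArr 16 → u.natArr 17 = s.natArr 17 → u.realArr 5 = s.realArr 5 →
      (c' = if c = I.r ∨ S.testBit (I.leg (I.nu q)) = true then c else c + 1) →
      Part I D (u.natArr 2) (u.natArr 25) (u.natReg 29) (u.natReg 30) (Dealt I (q + 1) S) →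
      Current I D (u.natArr 2) (u.natReg 29) (q + 1) c' (Dealt I (q + 1) S) →
      wp (.writeNat 16 (nr 5) (na 16 (nr 5) - 1) ⨟ .setNat 20 (nr 20 + 1))
        (fun t' s' => t + t' ≤ 70 ∧ ∃ c', Trace I oe D (q + 1) S c' s') u := by
    intro u c' t ht hu h5 h20 h21 h22 h23 hc' h16 h17 hra hcc hP hC
    rw [wp_seq, wp_writeNat, wp_setNat]
    refine ⟨by simp; omega, c', hu.agree hI ⟨by simp, by simp, by simp, by simp⟩, hq, h.S_lt, by omega,
      by simp [h20], by simp [h21], by simp [h22], by simp [h23], fun l' => ?_, ?_, ?_, by simpa using hP,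
      by simpa using hC, fun h1 => by omega⟩
    · rw [Users.kap]
      by_cases hl' : l' = l
      · subst hl'
        simp [h5, hv, hlv, h16, h.kap]
      · simp [h5, hv, hlv, hl', Ne.symm hl', h16, h.kap]
    · simp [h17]; exact h.mem
    · simp only [State.setN_realArr, State.wrN_realArr, hra, hcc]
      exact hval
  unfold passUserProg
  have hmem := h.mem _ hl
  rw [hv, hlv] at hmem
  rw [wp_seq, wp_setNat, wp_seq, wp_setNat]
  simp only [NatExpr.eval_read, NatExpr.eval_reg, NatExpr.eval_add, State.setN_natReg, h.reg_q,
    h.near q hq, hv, h.leg, hlv, show (23 = 5) = False by simp, show (10 = 5) = False by simp, if_false,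
    h.W, h.reg_a, ← Inst.addr_succ]
  have hB : Solved I oe ((s.setN 5 l).setN 23 (I.addr (q + 1) S c)) := h.toSolved.agree hI
    ⟨by simp, by simp, by simp, by simp⟩
  rw [wp_seq, wp_ite]
  simp only [wp_seq (c₁ := .writeNat 2 _ _), wp_writeNat 2, wp_ite, wp_skip, wp_seq (c₁ := .setNat 22 _),
    wp_setNat 22, wp_setNat 23]
  simp only [Test.Holds, NatExpr.eval_read, NatExpr.eval_reg, NatExpr.eval_add, NatExpr.eval_one,
    State.setN_natReg, State.setN_natArr, State.wrN_natReg, if_true, hmem, h.reg_q,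
    h.near q hq, hv, show (5 = 23) = False by simp, if_false, h.reg_c, h.r, NatExpr.eval_zero,
    show (20 = 23) = False by simp, show (20 = 5) = False by simp, show (22 = 23) = False by simp,
    show (22 = 5) = False by simp, show (1 = 23) = False by simp, show (1 = 5) = False by simp,
    show (29 = 23) = False by simp, show (29 = 5) = False by simp, show (23 = 22) = False by simp]
  constructor
  · intro h1
    have hS : S.testBit (I.leg (I.nu q)) = false := by rw [hv, hlv]; simpa using h1
    have hP : Part I D (Function.update (s.natArr 2) v (s.natReg 29)) (s.natArr 25) (s.natReg 29)
        (s.natReg 30) (Dealt I (q + 1) S) := by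
      refine h.part.add_cur (T := fun u => u = v) ?_ (fun u => by rw [← hv]; exact dealt_fill hq) ?_ ?_
      · rintro u rfl; exact ⟨hv ▸ (Users.nu_spec hq).1, hv ▸ not_dealt_nu hq hS⟩
      · rintro u rfl; simp
      · intro u hu; rw [Function.update_of_ne hu]
    have hC := Current.fill hI hq hS hc h.current
    rw [hv] at hC
    constructor
    · intro h2
      rw [if_pos h2] at hC
      refine (key _ c 40 (by norm_num) (hB.agree hI ⟨by simp, by simp, by simp, by simp⟩) (by simp)
        (by simp [h.reg_q]) (by simp [h.reg_S]) (by simp [h.reg_c]) (by simp) hc (by simp)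
        (by simp) (by simp) (by rw [if_pos (Or.inl h2)]) (by simpa using hP) (by simpa using hC)).mono ?_
      rintro t s' ⟨h3, h4⟩
      exact ⟨by simp; omega, h4⟩
    · intro h2
      rw [if_neg h2] at hC
      refine (key _ (c + 1) 50 (by norm_num) (hB.agree hI ⟨by simp, by simp, by simp, by simp⟩) (by simp)
        (by simp [h.reg_q]) (by simp [h.reg_S]) (by simp) (by simp [Inst.addr_add]) (by omega)
        (by simp) (by simp) (by simp) (by rw [if_neg (by rw [hS]; simpa using h2)]) (by simpa using hP)
        (by simpa using hC)).mono ?_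
      rintro t s' ⟨h3, h4⟩
      exact ⟨by simp; omega, h4⟩
  · intro h1
    have hS : S.testBit (I.leg (I.nu q)) = true := by rw [hv, hlv]; simpa using h1
    refine (key _ c 40 (by norm_num) hB (by simp)
      (by simp [h.reg_q]) (by simp [h.reg_S]) (by simp [h.reg_c]) (by simp) hc (by simp)
      (by simp) (by simp) (by rw [if_pos (Or.inr hS)])
      (by simpa using h.part.congr fun u => dealt_skip hS)
      (by simpa using Current.skip hI hq hS hc h.current)).mono ?_
    rintro t s' ⟨h3, h4⟩
    exact ⟨by simp; omega, h4⟩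

theorem passStar_spec (hI : I.WF) (h : Trace I oe D q S I.r s) (ht : I.tok (I.prev q) ≤ D)
    (hval : s.realArr 5 (I.addr q S (I.r + 1)) ≤ D) :
    wp passStarProg (fun t s' => t ≤ 20 ∧ Trace I oe D q S (I.r + 1) s') s := by
  unfold passStarProg
  rw [wp_seq, wp_writeNat, wp_seq, wp_setNat, wp_setNat]
  have hP := h.part
  refine ⟨by simp, h.toSolved.agree hI ⟨by simp, by simp, by simp, by simp⟩, h.q_le, h.S_lt, le_rfl,
    by simp [h.reg_q], by simp [h.reg_S], by simp [h.reg_c], by simp [h.reg_a, Inst.addr_add],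
    by simpa using h.kap, by simpa using h.mem, by simpa using hval, ?_, ?_, by simp⟩
  · simp
    refine ⟨hP.cur_lt, hP.lt, fun u hu hne => (hP.fin u hu hne).congr (fun _ _ => Iff.rfl) ?_⟩
    rw [Function.update_of_ne hne]
  · simpa using Current.enter hI h.current ht

end Gather

namespace Gather
open RAM

variable {I : Inst} {s s' : State} {D : ℝ} {q S c oe : ℕ}

theorem between_split {l a b u : ℕ} (hab : a ≤ b) :
    Between I l 0 b u ↔ Between I l a b u ∨ Between I l 0 a u := by
  unfold Between
  constructor
  · rintro ⟨h1, h2, h3, h4⟩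
    rcases Nat.lt_or_ge (fe I.n I.leg u) a with h5 | h5
    · exact Or.inr ⟨h1, h2, h3, h5⟩
    · exact Or.inl ⟨h1, h2, h5, h4⟩
  · rintro (⟨h1, h2, h3, h4⟩ | ⟨h1, h2, h3, h4⟩)
    · exact ⟨h1, h2, by omega, h4⟩
    · exact ⟨h1, h2, h3, by omega⟩

theorem passLeg_spec (hI : I.WF) (hD : D < I.big) (h : Trace I oe D q S c s) {o : ℕ}
    (ho : s.natArr 24 (I.addr q S c) = o + 3) {p : Opt} (hp : optAt s o = p) (hpv : p.Valid I s q)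
    (hS : S.testBit p.leg = false) (hlo : p.lo ≤ c) (hhi : c ≤ p.hi) (hv : p.val ≤ D)
    (hval : s.realArr 5 (I.addr q (S + 2 ^ p.leg) (if p.top = 0 then c else 0)) ≤ D) :
    wp passLegProg (fun t s' => t ≤ 100 * I.kap q p.leg + 150 ∧
      Trace I oe D q (S + 2 ^ p.leg) (if p.top = 0 then c else 0) s') s := by
  have hl := hpv.leg_lt
  have htgt := hpv.tgt_le
  have hkap := kap_le (I := I) q p.leg
  obtain ⟨cur, hcur⟩ : ∃ cur, s.natReg 29 = cur := ⟨_, rfl⟩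
  obtain ⟨κ, hκ⟩ : ∃ κ, I.kap q p.leg = κ := ⟨_, rfl⟩
  have o18 : s.natArr 18 o = p.leg := by rw [← hp]; rfl
  have o21 : s.natArr 21 o = p.top := by rw [← hp]; rfl
  have o22 : s.natArr 22 o = p.tgt := by rw [← hp]; rfl
  have o23 : s.natArr 23 o = p.fac := by rw [← hp]; rfl
  unfold passLegProg
  rw [wp_seq]
  refine wp.conseq (Q := fun t u => t ≤ 30 ∧ u.natReg 26 = o ∧ u.natReg 5 = p.leg ∧
    u.natReg 11 = p.leg * (I.n + 1) ∧ u.natReg 13 = p.tgt ∧ u.natReg 14 = κ) ?_ ?_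
  · unfold optInitProg
    have e3 := h.bs _ hl.le
    have hk := h.kap p.leg
    rw [hκ] at hk
    simp only [wp_seq, wp_setNat, NatExpr.eval_sub, NatExpr.eval_read, NatExpr.eval_reg, h.reg_a, ho,
      NatExpr.eval_three, Nat.add_sub_cancel, State.setN_natReg, State.setN_natArr, if_true, o18,
      show (26 = 5) = False by simp, show (26 = 11) = False by simp, if_false, o22,
      show (5 = 11) = False by simp, show (5 = 13) = False by simp, e3, hk]
    simp
  rintro t0 u hF0 ⟨ht0, u26, u5, u11, u13, u14⟩
  have hu : Solved I oe u := h.toSolved.agree hI (hF0.agree rfl)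
  have u29 : u.natReg 29 = cur := (hF0.nr 29 rfl).trans hcur
  rw [wp_seq]
  refine (label_spec hu.toLists hl u11 u13 u14 (by omega) (by omega) (by norm_num) u29).conseq ?_
  rintro t1 s1 hF1 ⟨ht1, h2⟩
  rw [hF0.na 2 rfl] at h2
  have hs1 : Solved I oe s1 := hu.agree hI (hF1.agree rfl)
  have hP1 : Part I D (s1.natArr 2) (s1.natArr 25) cur (s1.natReg 30)
      (fun v => Dealt I q S v ∨ Between I p.leg p.tgt κ v) := by
    rw [hF1.na 25 rfl, hF0.na 25 rfl, hF1.nr 30 rfl, hF0.nr 30 rfl]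
    have := h.part
    rw [hcur] at this
    refine this.add_cur (T := Between I p.leg p.tgt κ) ?_ (fun v => Iff.rfl) ?_ ?_
    · intro v hv
      refine ⟨hv.1, not_dealt_between (l := p.leg) hS ?_⟩
      rw [between_split htgt, hκ]
      exact Or.inl hv
    · intro v hv; rw [h2]; exact if_pos hv
    · intro v hv; rw [h2]; exact if_neg hv
  rw [wp_seq, wp_setNat, wp_seq]
  simp only [NatExpr.eval_read, NatExpr.eval_reg, hF1.nr 26 rfl, u26, hF1.na 22 rfl, hF0.na 22 rfl, o22]
  generalize hu2 : s1.setN 12 p.tgt = s2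
  have f2 : s2.natArr = s1.natArr := by simp [← hu2]
  have g2 : ∀ x, x ≠ 12 → s2.natReg x = s1.natReg x := fun x hx => by simp [← hu2, hx]
  have hs2 : Solved I oe s2 := hs1.agree hI ⟨by simp [← hu2], by simp [← hu2], by simp [← hu2], by simp [← hu2]⟩
  have r2 : s2.realArr = s1.realArr := by simp [← hu2]
  have s12 : s2.natReg 12 = p.tgt := by simp [← hu2]
  clear hu2
  have hline : lineCost I p.leg s2 p.tgt ≤ D := by
    unfold lineCost
    rw [r2, hF1.ra 2 rfl, hF0.ra 2 rfl]
    exact hpv.line.trans hv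
  refine (chain_spec hI hs2.toLists hs2.lines hl (by rw [g2 11 (by norm_num), hF1.nr 11 rfl, u11]) s12
    (by omega) hD hline (A := fun v => Dealt I q S v ∨ Between I p.leg p.tgt κ v) (cur := cur)
    (by rw [f2, g2 30 (by norm_num)]; exact hP1) ?_).conseq ?_
  · rintro v hv (h3 | h3)
    · refine not_dealt_between (l := p.leg) hS ?_ h3
      rw [between_split htgt]; exact Or.inr hv
    · have := hv.2.2.2; have := h3.2.2.1; omega
  rintro t3 s3 hF3 ⟨ht3, hP3, k1, k2, k3⟩
  have hs3 : Solved I oe s3 := hs2.agree hI (hF3.agree rfl)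
  have hP3' : Part I D (s3.natArr 2) (s3.natArr 25) cur (s3.natReg 30) (Dealt I q (S + 2 ^ p.leg)) := by
    refine hP3.congr fun v => ?_
    rw [dealt_close hS, between_split htgt, hκ]
    tauto
  have hC := h.current
  rw [hcur] at hC
  obtain ⟨c1, c2⟩ := hC.close (lab' := s3.natArr 2) hI hpv hlo hhi hv hD hS (by
      intro v hv
      rw [hκ] at hv
      rw [k1 v fun h3 => by have := h3.2.2.2; have := hv.2.2.1; omega, f2, h2]
      exact if_pos hv)
    k2 (by
      intro v hv
      rw [between_split htgt, not_or, hκ] at hv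
      rw [k1 v hv.2, f2, h2]
      exact if_neg hv.1)
  have w29 : s3.natReg 29 = cur := by rw [hF3.nr 29 rfl, g2 29 (by norm_num), hF1.nr 29 rfl, u29]
  have w5 : s3.natReg 5 = p.leg := by rw [hF3.nr 5 rfl, g2 5 (by norm_num), hF1.nr 5 rfl, u5]
  have w26 : s3.natReg 26 = o := by rw [hF3.nr 26 rfl, g2 26 (by norm_num), hF1.nr 26 rfl, u26]
  have w20 : s3.natReg 20 = q := by
    rw [hF3.nr 20 rfl, g2 20 (by norm_num), hF1.nr 20 rfl, hF0.nr 20 rfl, h.reg_q]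
  have w21 : s3.natReg 21 = S := by
    rw [hF3.nr 21 rfl, g2 21 (by norm_num), hF1.nr 21 rfl, hF0.nr 21 rfl, h.reg_S]
  have w22 : s3.natReg 22 = c := by
    rw [hF3.nr 22 rfl, g2 22 (by norm_num), hF1.nr 22 rfl, hF0.nr 22 rfl, h.reg_c]
  have w23 : s3.natReg 23 = I.addr q S c := by
    rw [hF3.nr 23 rfl, g2 23 (by norm_num), hF1.nr 23 rfl, hF0.nr 23 rfl, h.reg_a]
  have wk : ∀ l, s3.natArr 16 l = I.kap q l := by
    rw [hF3.na 16 rfl, f2, hF1.na 16 rfl, hF0.na 16 rfl]; exact h.kap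
  have wm : ∀ l < I.d, s3.natArr 17 l = if S.testBit l then 1 else 0 := by
    rw [hF3.na 17 rfl, f2, hF1.na 17 rfl, hF0.na 17 rfl]; exact h.mem
  have wV : s3.realArr 5 = s.realArr 5 := by rw [hF3.ra 5 rfl, r2, hF1.ra 5 rfl, hF0.ra 5 rfl]
  have w21' : s3.natArr 21 o = p.top := by rw [hF3.na 21 rfl, f2, hF1.na 21 rfl, hF0.na 21 rfl, o21]
  have w23' : s3.natArr 23 o = p.fac := by rw [hF3.na 23 rfl, f2, hF1.na 23 rfl, hF0.na 23 rfl, o23]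
  have e4 : s3.natArr 4 p.leg = 2 ^ p.leg := hs3.pw _ (hl.le.trans hs3.d_le_E)
  have e10 : s3.natArr 10 p.leg = 2 ^ p.leg * (I.r + 2) := hs3.pwW _ hl.le
  have hlt := add_two_pow_lt h.S_lt hl hS
  have hf25 : c = I.r + 1 → s3.natArr 25 cur = 0 := by
    intro h3
    have h4 := hP1.cur_lt
    rw [k3 cur (by rw [g2 30 (by norm_num)]; exact h4), f2, hF1.na 25 rfl, hF0.na 25 rfl, ← hcur]
    exact h.star_fac h3
  have hmem : ∀ l < I.d, Function.update (s3.natArr 17) p.leg 1 l =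
      if (S + 2 ^ p.leg).testBit l then 1 else 0 := by
    intro l' hl'
    rw [testBit_add_two_pow hS]
    by_cases h3 : l' = p.leg
    · simp [h3]
    · simp [h3, Ne.symm h3, wm l' hl']
  rw [hκ]
  unfold finishProg
  simp only [wp_seq, wp_writeNat, wp_setNat, wp_ite, wp_skip]
  simp only [Test.Holds, NatExpr.eval_read, NatExpr.eval_reg, NatExpr.eval_add, NatExpr.eval_one,
    NatExpr.eval_sub, NatExpr.eval_zero, State.setN_natReg, State.wrN_natReg, State.setN_natArr,
    State.wrN_natArr, show (26 = 23) = False by simp, show (26 = 21) = False by simp,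
    show (5 = 21) = False by simp, show (23 = 21) = False by simp, show (4 = 17) = False by simp,
    show (10 = 17) = False by simp, show (21 = 17) = False by simp, show (23 = 17) = False by simp,
    show (29 = 23) = False by simp, show (29 = 21) = False by simp, show (30 = 29) = False by simp,
    show (30 = 23) = False by simp, show (30 = 21) = False by simp, show (23 = 30) = False by simp,
    show (23 = 29) = False by simp, show (22 = 30) = False by simp, show (22 = 29) = False by simp,
    show (22 = 23) = False by simp, show (22 = 21) = False by simp, if_false, if_true, w5, w26, w21', w23',
    e4, e10, w21, w23, w22, w29]
  have hst : ∀ v, Solved I oe (((s3.wrN 17 p.leg 1).setN 21 (S + 2 ^ p.leg)).setN 23 v) := fun v =>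
    hs3.agree hI ⟨by simp, by simp, by simp, by simp⟩
  constructor
  · intro h3
    rw [if_pos h3] at hval ⊢
    refine ⟨by simp; omega, hst _, h.q_le, hlt, h.c_le, by simp [w20], by simp, by simp [w22],
      by simp [Inst.addr_bit], by simpa using wk, by simpa using hmem, by simpa [wV] using hval,
      by simpa [w29] using hP3', by simpa [w29] using c1 h3, by simpa [w29] using hf25⟩
  · intro h3
    rw [if_neg h3] at hval ⊢
    obtain ⟨c3, c4, c5⟩ := c2 h3
    have hP4 : Part I D (s3.natArr 2) (Function.update (s3.natArr 25) cur p.fac) (s3.natReg 30)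
        (s3.natReg 30 + 1) (Dealt I q (S + 2 ^ p.leg)) := by
      refine hP3'.finish (fun i hi => by rw [Function.update_of_ne hi]) c4 ?_
      rw [Function.update_self]
      exact c5
    have hne : ∀ v, Dealt I q (S + 2 ^ p.leg) v → s3.natArr 2 v ≠ s3.natReg 30 := fun v hv =>
      (hP3'.lt v hv).2.ne
    have hC4 : Current I D (s3.natArr 2) (s3.natReg 30) q 0 (Dealt I q (S + 2 ^ p.leg)) := by
      have hr := hI.one_le_r
      refine ⟨fun _ => ?_, fun h4 => by omega, fun _ v h4 h5 => absurd h5 (hne v h4), fun h4 => by omega⟩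
      rw [Finset.card_eq_zero, Finset.eq_empty_iff_forall_notMem]
      intro v hv
      rw [mem_cls] at hv
      exact hne v hv.2.1 hv.2.2
    have ha : I.addr q S c + 2 ^ p.leg * (I.r + 2) - c = I.addr q (S + 2 ^ p.leg) 0 := by
      rw [Inst.addr_bit, show I.addr q S c = I.addr q S 0 + c by rw [← Inst.addr_add, Nat.zero_add]]
      omega
    refine ⟨by simp; omega, hs3.agree hI ⟨by simp, by simp, by simp, by simp⟩, h.q_le, hlt, by omega,
      by simp [w20], by simp, by simp, by simp [ha], by simpa using wk, by simpa using hmem,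
      by simpa [wV] using hval, by simpa using hP4, by simpa using hC4, fun h4 => by omega⟩

/-- The recorded transition is sound and the entry that it leads to is no larger, so the bound `D`
persists. Each pass uses up `work` at `200` steps per unit; the `10` extra steps pay for the loop
test. -/
theorem pass_spec (hI : I.WF) (hD : D < I.big) (h : Trace I oe D q S c s)
    (hc : s.natArr 24 (I.addr q S c) ≠ 0) :
    wp passProg (fun t s' => ∃ q' S' c', Trace I oe D q' S' c' s' ∧
      t + 10 + 200 * work I q' S' c' ≤ 200 * work I q S c) s := by
  have hcell := (h.cells q h.q_le S h.S_lt c h.c_le (Nat.zero_le _)).sound (lt_of_le_of_lt h.val hD)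
  unfold passProg
  simp only [wp_ite, Test.Holds, NatExpr.eval_read, NatExpr.eval_reg, h.reg_a, NatExpr.eval_one,
    NatExpr.eval_two]
  generalize hch : s.natArr 24 (I.addr q S c) = ch at hcell hc ⊢
  cases hcell with
  | done => exact absurd rfl hc
  | advance h1 h2 h3 =>
    refine ⟨fun _ => ?_, fun h4 => absurd rfl h4⟩
    refine (passUser_spec hI h h1 h2 (h3.trans h.val)).mono ?_
    rintro t s' ⟨ht, c', h4⟩
    refine ⟨_, _, _, h4, ?_⟩
    have := work_advance (S := S) (c' := c') h1 h2
    simp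
    omega
  | star h1 h2 h3 =>
    refine ⟨fun h4 => absurd h4 (by norm_num), fun _ => ⟨fun _ => ?_, fun h4 => absurd rfl h4⟩⟩
    subst h1
    refine (passStar_spec hI h (h2.trans h.val) (h3.trans h.val)).mono ?_
    rintro t s' ⟨ht, h4⟩
    refine ⟨_, _, _, h4, ?_⟩
    have := work_star (I := I) (q := q) (S := S)
    simp
    omega
  | close o h1 h2 h3 h4 h5 h6 h7 =>
    refine ⟨fun h4 => absurd h4 (by omega), fun _ => ⟨fun h4 => absurd h4 (by omega), fun _ => ?_⟩⟩
    refine (passLeg_spec hI hD h hch rfl h2 h3 h4 h5 (h6.trans h.val) (h7.trans h.val)).mono ?_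
    rintro t s' ⟨ht, h8⟩
    refine ⟨_, _, _, h8, ?_⟩
    have := work_close (I := I) (q := q) (c := c) (c' := if (optAt s o).top = 0 then c else 0)
      h2.leg_lt h3 (by
        intro h9
        rcases h2.kind with ⟨k1, k2, k3⟩ | ⟨k1, k2, k3⟩ | ⟨k1, k2, k3, k4⟩
        · omega
        · rwa [if_pos k1] at h9
        · omega)
    simp
    omega

end Gather

/-! ### The complete computation -/

namespace Gather
open RAM

def traceInitProg : Program :=
  .setNat 20 0 ⨟ .setNat 21 0 ⨟ .setNat 22 0 ⨟ .setNat 23 0 ⨟ .setNat 29 0 ⨟ .setNat 30 1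

def traceProg : Program :=
  traceInitProg ⨟ forUp 5 (nr 0) (.writeNat 17 (nr 5) 0) ⨟
  .loop (.ne (na 24 (nr 23)) 0) passProg

/-- An entry not below `big` carries no usable record; the labels, still zero, then give the single
cluster and the value is `big`. -/
def valueProg : Program :=
  .setReal 0 (ra 5 0) ⨟ .ite (.realLe (rr 1) (rr 0)) (.setReal 0 (rr 1)) traceProg

def solveProg : Program :=
  tablesProg ⨟ listsProg 2 0 3 6 16 7 ⨟ listsProg 3 1 5 8 26 9 ⨟ nearProg ⨟ linesProg ⨟ tableProg ⨟
  valueProg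

variable {I : Inst} {s s' : State} {D : ℝ} {q S c oe : ℕ}

theorem work_le : work I 0 0 0 ≤ 2 * I.n + I.d + 1 := by
  have h1 : I.P ≤ I.n := Nat.count_le _
  have h2 : ∑ l ∈ Finset.range I.d, I.cnt l ≤ I.n := sum_cb_le ..
  have h3 : ∀ l, I.kap 0 l = I.cnt l := fun l => rfl
  unfold work
  simp only [Nat.zero_testBit, h3, Bool.false_eq_true, if_false, Finset.sum_add_distrib,
    Finset.sum_const, Finset.card_range, smul_eq_mul, Nat.zero_le, if_true]
  omega

theorem trace_spec (hI : I.WF) (h : TableState I 0 oe 0 s) (hD : s.realArr 5 0 < I.big) :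
    wp traceProg (fun t s' => t ≤ 400 * (I.n + I.d + 1) ∧
      Solution I (s.realArr 5 0) (s'.natArr 2) (s'.natArr 25)) s := by
  obtain ⟨D, hDv⟩ : ∃ D, s.realArr 5 0 = D := ⟨_, rfl⟩
  rw [hDv] at hD ⊢
  have hS : Solved I oe s := ⟨h.toBase, h.lines, h.cells⟩
  unfold traceProg
  rw [wp_seq]
  refine wp.conseq (Q := fun t u => t ≤ 12 ∧ u.natReg 20 = 0 ∧ u.natReg 21 = 0 ∧ u.natReg 22 = 0 ∧
    u.natReg 23 = 0 ∧ u.natReg 29 = 0 ∧ u.natReg 30 = 1) ?_ ?_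
  · unfold traceInitProg
    simp only [wp_seq, wp_setNat]
    simp
  rintro t0 u hF0 ⟨ht0, u20, u21, u22, u23, u29, u30⟩
  have hu : Solved I oe u := hS.agree hI (hF0.agree rfl)
  have huV : u.realArr 5 0 = D := by rw [hF0.ra 5 rfl, hDv]
  have hu16 : u.natArr 16 = s.natArr 16 := hF0.na 16 rfl
  rw [wp_seq]
  refine wp_forUp I.d (fun _ => 10) (fun k s' => ∀ l < k, s'.natArr 17 l = 0) ?_ rfl ?_ ?_ ?_
  · intro s' hF
    simpa [hu.d] using hF.nr 0 rfl
  · simp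
  · intro k hk s' hF h5 h1
    simp [h5]
    intro l hl
    by_cases hlk : l = k
    · simp [hlk]
    · rw [Function.update_of_ne hlk]; exact h1 l (by omega)
  rintro t1 s1 hF1 ht1 - h17
  have ha : I.addr 0 0 0 = 0 := by simp [Inst.addr]
  have hnd : ∀ v, ¬ Dealt I 0 0 v := by
    rintro v ⟨h1, h2 | h2⟩
    · simp at h2
    · have := fe_lt_cb (leg := I.leg) h1
      have h3 : I.kap 0 (I.leg v) = cb I.leg (I.leg v) I.n := rfl
      omega
  have hr := hI.one_le_r
  have hT : Trace I oe D 0 0 0 s1 := by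
    refine ⟨hu.agree hI (hF1.agree rfl), Nat.zero_le _, by positivity, Nat.zero_le _, ?_, ?_, ?_, ?_, ?_,
      ?_, ?_, ?_, ?_, fun h1 => by omega⟩
    · rw [hF1.nr 20 rfl, u20]
    · rw [hF1.nr 21 rfl, u21]
    · rw [hF1.nr 22 rfl, u22]
    · rw [hF1.nr 23 rfl, u23, ha]
    · rw [hF1.na 16 rfl, hu16]; exact h.kap
    · intro l hl; simp [h17 l hl]
    · rw [ha, hF1.ra 5 rfl, huV]
    · rw [hF1.nr 29 rfl, hF1.nr 30 rfl, u29, u30]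
      exact ⟨by norm_num, fun v hv => absurd hv (hnd v), fun v hv => absurd hv (hnd v)⟩
    · refine ⟨fun _ => ?_, fun h1 => by omega, fun _ v hv => absurd hv (hnd v), fun h1 => by omega⟩
      rw [Finset.card_eq_zero, Finset.eq_empty_iff_forall_notMem]
      intro v hv
      exact hnd v (mem_cls.1 hv).2.1
  refine wp_loop (fun t s' => ∃ q S c, Trace I oe D q S c s' ∧
    t + 200 * work I q S c ≤ 200 * work I 0 0 0) (fun s' => work I (s'.natReg 20) (s'.natReg 21) (s'.natReg 22))
    ⟨0, 0, 0, hT, by omega⟩ ?_ ?_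
  · rintro t s' hF ⟨q, S, c, g1, g2⟩ hb
    simp [g1.reg_a] at hb
    refine (pass_spec hI hD g1 hb).mono ?_
    rintro t' s'' ⟨q', S', c', h1, h2⟩
    refine ⟨⟨q', S', c', h1, by simp; omega⟩, ?_⟩
    rw [h1.reg_q, h1.reg_S, h1.reg_c, g1.reg_q, g1.reg_S, g1.reg_c]
    omega
  · rintro t s' hF ⟨q, S, c, g1, g2⟩ hb
    simp [g1.reg_a] at hb
    have hw := work_le (I := I)
    refine ⟨by simp at ht1 ⊢; omega, ?_⟩
    have hcell := (g1.cells q g1.q_le S g1.S_lt c g1.c_le (Nat.zero_le _)).sound (lt_of_le_of_lt g1.val hD)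
    rw [hb] at hcell
    cases hcell with
    | done h1 => exact Solution.of_terminal hI g1.part g1.current h1 g1.star_fac

/-- The time of the main part of the algorithm. -/
def Inst.time (I : Inst) (E : ℕ) : ℕ := 2000 * (I.n + I.m + I.d + 1) + (I.P + 1) * (I.stageTime E + 40)

/-- Separates the machine from the problems: the returned value is attained by the labels, and it is
at most every `D` below `big` for which the sweep succeeds. -/
theorem solve_spec (hI : I.WF) (h : Input I s) (h0 : ∀ a, 2 ≤ a → ∀ i, s.natArr a i = 0) (hr : I.r ≤ I.n) :
    wp solveProg (fun t s' => (∃ E, 2 ^ E ≤ 2 ^ I.d * (2 * I.m + 1) ∧ t ≤ I.time E) ∧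
      Solution I (s'.realReg 0) (s'.natArr 2) (s'.natArr 25) ∧ s'.realReg 0 ≤ I.big ∧
      ∀ D, 0 ≤ D → D < I.big → I.ReachLe D 0 0 0 → s'.realReg 0 ≤ D) s := by
  unfold solveProg
  rw [wp_seq]
  refine (tables_spec h).conseq ?_
  rintro t1 s1 hF1 ⟨ht1, hT1⟩
  rw [wp_seq]
  refine (lists_spec (N := I.n) (d := I.d) hT1.n hT1.leg hI.leg_lt hT1.bs
    (fun l => by rw [hF1.na 6 rfl]; exact h0 6 (by norm_num) l)
    (fun l => by rw [hF1.na 16 rfl]; exact h0 16 (by norm_num) l) (by decide)).conseq ?_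
  rintro t2 s2 hF2 ⟨ht2, h6, h16, h7⟩
  have hT2 : Tables I s2 := hT1.agree (hF2.agree rfl)
  rw [wp_seq]
  refine (lists_spec (N := I.m) (d := I.d) hT2.m hT2.fl hI.fl_lt hT2.bm
    (fun l => by rw [hF2.na 8 rfl, hF1.na 8 rfl]; exact h0 8 (by norm_num) l)
    (fun l => by rw [hF2.na 26 rfl, hF1.na 26 rfl]; exact h0 26 (by norm_num) l) (by decide)).conseq ?_
  rintro t3 s3 hF3 ⟨ht3, h8, -, h9⟩
  have hL3 : Lists I s3 := ⟨hT2.agree (hF3.agree rfl), fun l => by rw [hF3.na 6 rfl]; exact h6 l,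
    by rw [hF3.na 7 rfl]; exact h7, h8, h9⟩
  rw [wp_seq]
  refine (near_spec hI hL3 fun l => by rw [hF3.na 16 rfl]; exact h16 l).conseq ?_
  rintro t4 s4 hF4 ⟨ht4, hB4, hk4⟩
  rw [wp_seq]
  refine (lines_spec hI hB4).conseq ?_
  rintro t5 s5 hF5 ⟨ht5, hL5⟩
  rw [wp_seq]
  refine (table_spec hI (hB4.agree (hF5.agree rfl)) hL5 (by rw [hF5.na 16 rfl]; exact hk4)).conseq ?_
  rintro t6 s6 hF6 ⟨ht6, oe, hT6⟩
  have e9 : s5.natReg 9 = s1.natReg 9 := by rw [hF5.nr 9 rfl, hF4.nr 9 rfl, hF3.nr 9 rfl, hF2.nr 9 rfl]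
  rw [e9] at ht6
  have hz : ∀ a, (a = 2 ∨ a = 25) → ∀ i, s6.natArr a i = 0 := by
    rintro a (rfl | rfl) i
    · rw [hF6.na 2 rfl, hF5.na 2 rfl, hF4.na 2 rfl, hF3.na 2 rfl, hF2.na 2 rfl, hF1.na 2 rfl]
      exact h0 2 (by norm_num) i
    · rw [hF6.na 25 rfl, hF5.na 25 rfl, hF4.na 25 rfl, hF3.na 25 rfl, hF2.na 25 rfl, hF1.na 25 rfl]
      exact h0 25 (by norm_num) i
  have ha : I.addr 0 0 0 = 0 := by simp [Inst.addr]
  have hreach : ∀ D, 0 ≤ D → D < I.big → I.ReachLe D 0 0 0 → s6.realArr 5 0 ≤ D := by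
    have := (hT6.cells 0 (Nat.zero_le _) 0 (by positivity) 0 (Nat.zero_le _) (Nat.zero_le _)).reach
      (Nat.zero_le _)
    rwa [ha] at this
  unfold valueProg
  rw [wp_seq, wp_setReal, wp_ite, wp_setReal]
  simp only [Test.Holds, RealExpr.eval_reg, RealExpr.eval_read, NatExpr.eval_zero, State.setR_realReg,
    show (1 = 0) = False by simp, if_false, if_true, hT6.big]
  have htime : ∀ t, t ≤ 400 * (I.n + I.d + 1) + 30 →
      t1 + (t2 + (t3 + (t4 + (t5 + (t6 + t))))) ≤ I.time (s1.natReg 9) := by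
    intro t ht
    unfold Inst.time
    omega
  constructor
  · intro hle
    refine ⟨⟨_, hT1.E_le, htime _ (by simp)⟩, ?_, by simp, fun D h1 h2 h3 => ?_⟩
    · have e2 : s6.natArr 2 = fun _ => 0 := funext fun i => hz 2 (Or.inl rfl) i
      have e25 : s6.natArr 25 = fun _ => 0 := funext fun i => hz 25 (Or.inr rfl) i
      simp [e2, e25]
      exact Solution.trivial hI hr
    · have := hreach D h1 h2 h3
      linarith
  · intro hlt
    rw [not_le] at hlt
    refine (trace_spec (oe := oe) hI (hT6.agree hI ⟨by simp, by simp, by simp, by simp⟩)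
      (by simpa using hlt)).conseq ?_
    rintro t s' hF ⟨ht, hsol⟩
    have e0 : s'.realReg 0 = s6.realArr 5 0 := by rw [hF.rr 0 rfl]; simp
    refine ⟨⟨_, hT1.E_le, htime _ (by simp; omega)⟩, ?_, ?_, ?_⟩
    · rw [e0]; exact hsol
    · rw [e0]; exact hlt.le
    · rw [e0]; exact hreach

end Gather

namespace Gather
open RAM

/-! ### Correctness -/

/-- The instance with the given users and facilities. -/
noncomputable def instOf (mode : Bool) {d n m : ℕ} (r : ℕ) (U : Fin n → SpiderPoint d)
    (F : Fin m → SpiderPoint d) : Inst where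
  n := n
  d := d
  r := r
  leg i := if h : i < n then ((U ⟨i, h⟩).leg : ℕ) else 0
  pos i := if h : i < n then ((U ⟨i, h⟩).pos : ℝ) else 0
  mode := mode
  m := m
  fl i := if h : i < m then ((F ⟨i, h⟩).leg : ℕ) else 0
  fp i := if h : i < m then ((F ⟨i, h⟩).pos : ℝ) else 0

variable {mode : Bool} {d n m r : ℕ} {U : Fin n → SpiderPoint d} {F : Fin m → SpiderPoint d}

theorem instOf_leg (u : Fin n) : (instOf mode r U F).leg u = (U u).leg := by simp [instOf]

theorem instOf_pos (u : Fin n) : (instOf mode r U F).pos u = (U u).pos := by simp [instOf]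

theorem instOf_fl (j : Fin m) : (instOf mode r U F).fl j = (F j).leg := by simp [instOf]

theorem instOf_fp (j : Fin m) : (instOf mode r U F).fp j = (F j).pos := by simp [instOf]

theorem instOf_wf (hd : 1 ≤ d) (hr : 1 ≤ r) (hn : 1 ≤ n) (hm : mode = false → 1 ≤ m)
    (hU : Monotone fun i => (U i).pos) (hF : Monotone fun i => (F i).pos) : (instOf mode r U F).WF where
  leg_lt u hu := by rw [show u = ((⟨u, hu⟩ : Fin n) : ℕ) from rfl, instOf_leg]; exact (U _).leg.2
  pos_nonneg u := by unfold instOf; dsimp only; split_ifs <;> positivity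
  pos_mono u v huv hv := by
    have hu : u < n := lt_of_le_of_lt huv hv
    rw [show u = ((⟨u, hu⟩ : Fin n) : ℕ) from rfl, show v = ((⟨v, hv⟩ : Fin n) : ℕ) from rfl, instOf_pos,
      instOf_pos]
    exact_mod_cast hU (show (⟨u, hu⟩ : Fin n) ≤ ⟨v, hv⟩ from huv)
  one_le_r := hr
  one_le_d := hd
  fl_lt u hu := by rw [show u = ((⟨u, hu⟩ : Fin m) : ℕ) from rfl, instOf_fl]; exact (F _).leg.2
  fp_nonneg u := by unfold instOf; dsimp only; split_ifs <;> positivity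
  fp_mono u v huv hv := by
    have hu : u < m := lt_of_le_of_lt huv hv
    rw [show u = ((⟨u, hu⟩ : Fin m) : ℕ) from rfl, show v = ((⟨v, hv⟩ : Fin m) : ℕ) from rfl, instOf_fp,
      instOf_fp]
    exact_mod_cast hF (show (⟨u, hu⟩ : Fin m) ≤ ⟨v, hv⟩ from huv)
  one_le_n := hn
  one_le_m := hm

theorem coe_distance (p q : SpiderPoint d) : (p.distance q : ℝ) = dd p.leg p.pos q.leg q.pos := by
  unfold SpiderPoint.distance dd
  by_cases h : p.leg = q.leg
  · rw [if_pos h, if_pos (by rw [h]), coe_nndist, NNReal.dist_eq]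
  · rw [if_neg h, if_neg (fun h' => h (Fin.ext h'))]
    push_cast
    rfl

/-- Cluster sizes in terms of `Fin n`. -/
theorem card_filter_range (p : ℕ → Prop) [DecidablePred p] :
    ((Finset.range n).filter p).card = (Finset.univ.filter fun u : Fin n => p u).card := by
  refine Finset.card_bij (fun u hu => ⟨u, Finset.mem_range.1 (Finset.mem_filter.1 hu).1⟩) ?_ ?_ ?_
  · intro u hu; simpa using (Finset.mem_filter.1 hu).2
  · intro u _ v _ h; simpa using h
  · intro u hu; exact ⟨u, by simpa using hu, rfl⟩

open Classical in
theorem Solution.card_le {v : ℝ} {lab fac : ℕ → ℕ} (h : Solution (instOf mode r U F) v lab fac) (u : Fin n) :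
    r ≤ (Finset.univ.filter fun w : Fin n => lab w = lab u).card := by
  refine (h u u.2).1.trans (le_of_eq ?_)
  rw [← card_filter_range fun w => lab w = lab u]
  congr 1
  ext w
  rw [mem_cls, Finset.mem_filter, Finset.mem_range]
  exact ⟨fun h => ⟨h.1, h.2.2⟩, fun h => ⟨h.1, h.1, h.2⟩⟩

/-- The labels give an assignment of cost at most `v`. Conversely, a gathering cheaper than `big` is
found by the sweep at its own cost, so `v` is a lower bound. -/
theorem gathering_correct (hd : 1 ≤ d) (hr : 1 ≤ r) (hn : 1 ≤ n) (hm : 1 ≤ m)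
    (hU : Monotone fun i => (U i).pos) (hF : Monotone fun i => (F i).pos) {v : ℝ} {lab fac : ℕ → ℕ}
    (h : Solution (instOf false r U F) v lab fac) (hv : v ≤ (instOf false r U F).big)
    (hmin : ∀ D, 0 ≤ D → D < (instOf false r U F).big → (instOf false r U F).ReachLe D 0 0 0 → v ≤ D) :
    ∃ G : RGathering n m r, (∀ H : RGathering n m r, G.cost U F ≤ H.cost U F) ∧
      (∀ u : Fin n, fac (lab u) = (G.assign u : ℕ)) ∧ v = G.cost U F := by
  have hI : (instOf false r U F).WF := instOf_wf hd hr hn (fun _ => hm) hU hF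
  have hfit : ∀ u : Fin n, fac (lab u) < m ∧ dd ((instOf false r U F).leg u) ((instOf false r U F).pos u)
      ((instOf false r U F).fl (fac (lab u))) ((instOf false r U F).fp (fac (lab u))) ≤ v := by
    intro u
    have h1 := (h u u.2).2
    unfold Inst.fits at h1
    rw [if_neg (by simp [instOf])] at h1
    exact ⟨h1.1, h1.2 u u.2 ⟨u.2, rfl⟩⟩
  have hv0 : 0 ≤ v := by
    have h1 := (hfit ⟨0, hn⟩).2
    refine le_trans ?_ h1
    unfold dd
    have p1 := hI.pos_nonneg 0
    have p2 := hI.fp_nonneg (fac (lab 0))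
    split_ifs
    · positivity
    · exact add_nonneg p1 p2
  let G : RGathering n m r :=
    -- Several labels may have the same facility; merging them only enlarges its cluster.
    { opened := Finset.univ.image fun u : Fin n => (⟨fac (lab u), (hfit u).1⟩ : Fin m)
      assign := fun u => ⟨fac (lab u), (hfit u).1⟩
      assign_mem := fun u => Finset.mem_image_of_mem _ (Finset.mem_univ u)
      le_card := by
        intro f hf
        rw [Finset.mem_image] at hf
        obtain ⟨u, -, rfl⟩ := hf
        refine (h.card_le u).trans (Finset.card_le_card fun w hw => ?_)
        simp only [Finset.mem_filter, Finset.mem_univ, true_and] at hw ⊢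
        simp only [hw] }
  have hle : ((G.cost U F : ℝ≥0) : ℝ) ≤ v := by
    rw [← Real.le_toNNReal_iff_coe_le hv0]
    · refine Finset.sup_le fun u _ => ?_
      refine (Real.le_toNNReal_iff_coe_le hv0).2 ?_
      rw [coe_distance]
      have := (hfit u).2
      rw [instOf_leg, instOf_pos] at this
      have e1 := instOf_fl (mode := false) (r := r) (U := U) (F := F) (G.assign u)
      have e2 := instOf_fp (mode := false) (r := r) (U := U) (F := F) (G.assign u)
      rw [← e1, ← e2]
      exact this
  have hge : ∀ H : RGathering n m r, v ≤ (H.cost U F : ℝ≥0) := by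
    intro H
    rcases lt_or_ge ((H.cost U F : ℝ≥0) : ℝ) (instOf false r U F).big with hb | hb
    · refine hmin _ (NNReal.coe_nonneg _) hb (Inst.reach_gathering hI rfl
        (σ := fun u => if hu : u < n then (H.assign ⟨u, hu⟩ : ℕ) else 0) ⟨?_, ?_, ?_⟩)
      · intro u hu
        rw [dif_pos (show u < n from hu)]
        exact (H.assign _).2
      · intro u hu
        have hu : u < n := hu
        rw [dif_pos hu]
        have e1 := instOf_fl (mode := false) (r := r) (U := U) (F := F) (H.assign ⟨u, hu⟩)
        have e2 := instOf_fp (mode := false) (r := r) (U := U) (F := F) (H.assign ⟨u, hu⟩)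
        have e3 := instOf_leg (mode := false) (r := r) (U := U) (F := F) ⟨u, hu⟩
        have e4 := instOf_pos (mode := false) (r := r) (U := U) (F := F) ⟨u, hu⟩
        dsimp only at e1 e2 e3 e4 ⊢
        rw [e1, e2, e3, e4, ← coe_distance, NNReal.coe_le_coe]
        exact Finset.le_sup (f := fun u => (U u).distance (F (H.assign u))) (Finset.mem_univ _)
      · intro u hu
        have hu : u < n := hu
        refine (H.le_card _ (H.assign_mem ⟨u, hu⟩)).trans (le_of_eq ?_)
        have := card_filter_range (n := n) fun w => (if hw : w < n then (H.assign ⟨w, hw⟩ : ℕ) else 0) =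
          if hu : u < n then (H.assign ⟨u, hu⟩ : ℕ) else 0
        refine Eq.trans ?_ this.symm
        congr 1
        ext w
        simp [hu, Fin.ext_iff]
    · exact hv.trans hb
  refine ⟨G, fun H => ?_, fun u => rfl, le_antisymm (hge G) hle⟩
  exact_mod_cast hle.trans (hge H)

end Gather

/-! ### Clustering through half-way facilities -/

namespace Gather
open RAM

variable {d n m r : ℕ} {U : Fin n → SpiderPoint d} {F : Fin m → SpiderPoint d}

theorem distance_le_cost (Q : Finpartition (Finset.univ : Finset (Fin n))) {u v : Fin n}
    (h : v ∈ Q.part u) : (U v).distance (U u) ≤ clusteringCost U Q := by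
  refine le_trans ?_ (Finset.le_sup (f := clusterDiameter U) (Q.part_mem.2 (Finset.mem_univ u)))
  unfold clusterDiameter
  refine le_trans ?_ (Finset.le_sup (f := fun u' => (Q.part u).sup fun v => (U u').distance (U v)) h)
  exact Finset.le_sup (f := fun v' => (U v).distance (U v')) (Q.mem_part (Finset.mem_univ u))

/-- The last user in the cluster of `u`. -/
def lastIn (Q : Finpartition (Finset.univ : Finset (Fin n))) (u : Fin n) : Fin n :=
  (Q.part u).max' ⟨u, Q.mem_part (Finset.mem_univ u)⟩

theorem lastIn_mem (Q : Finpartition (Finset.univ : Finset (Fin n))) (u : Fin n) :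
    lastIn Q u ∈ Q.part u := Finset.max'_mem _ _

theorem le_lastIn (Q : Finpartition (Finset.univ : Finset (Fin n))) (u : Fin n) : u ≤ lastIn Q u :=
  Finset.le_max' _ _ (Q.mem_part (Finset.mem_univ u))

theorem lastIn_eq (Q : Finpartition (Finset.univ : Finset (Fin n))) {u v : Fin n} (h : v ∈ Q.part u) :
    lastIn Q v = lastIn Q u := by
  have : Q.part v = Q.part u := (Q.mem_part_iff_part_eq_part (Finset.mem_univ _) (Finset.mem_univ _)).1 h
  unfold lastIn
  simp only [this]

/-- Half-way points of the longest possible clusters that end at the users, and the center. -/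
noncomputable def midFacs (U : Fin n → SpiderPoint d) (R : ℝ) : Facs where
  m := n + 1
  -- Index `0` is the center and `i + 1` belongs to user `i`, so the distances inherit the order of
  -- the users.
  fl j := if h : 0 < j ∧ j - 1 < n then ((U ⟨j - 1, h.2⟩).leg : ℕ) else 0
  fp j := if h : 0 < j ∧ j - 1 < n then max 0 (((U ⟨j - 1, h.2⟩).pos : ℝ) - R) else 0

theorem midFacs_wf (hU : Monotone fun i => (U i).pos) (R : ℝ) : (midFacs U R).WF := by
  refine ⟨fun j => ?_, fun i j hij hj => ?_⟩
  · unfold midFacs; dsimp only; split_ifs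
    · exact le_max_left _ _
    · exact le_rfl
  · have hj : j < n + 1 := hj
    unfold midFacs
    dsimp only
    by_cases hi : 0 < i
    · rw [dif_pos ⟨hi, by omega⟩, dif_pos ⟨by omega, by omega⟩]
      refine max_le_max le_rfl (sub_le_sub_right ?_ R)
      exact NNReal.coe_le_coe.2 (hU (show (⟨i - 1, by omega⟩ : Fin n) ≤ ⟨j - 1, by omega⟩ from
        Nat.sub_le_sub_right hij 1))
    · rw [dif_neg fun h => hi h.1]
      split_ifs
      · exact le_max_left _ _
      · exact le_rfl

/-- If `a ≤ R`, the center is within `R` of every user not beyond `a`. Otherwise the point at `a -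
R` is on the way from the user at `a` to the center, and halves the bound for users on the same leg
as well as on others. -/
theorem dd_mid {l l' : ℕ} {x a R : ℝ} (hx : 0 ≤ x) (hxa : x ≤ a) (h : dd l x l' a ≤ R + R) :
    dd l x l' (max 0 (a - R)) ≤ R := by
  unfold dd at *
  rcases le_total (a - R) 0 with h1 | h1
  · rw [max_eq_left h1]
    split_ifs
    · rw [abs_le]; constructor <;> linarith
    · linarith
  · rw [max_eq_right h1]
    split_ifs at h ⊢
    · rw [abs_le] at h ⊢; constructor <;> linarith [h.1]
    · linarith

/-- All users of a cluster go to the facility belonging to its last user, which is the farthest one,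
as `dd_mid` requires. -/
theorem valid_midFacs (hU : Monotone fun i => (U i).pos)
    (Q : Finpartition (Finset.univ : Finset (Fin n))) (hQ : IsRGather r Q) {R : ℝ}
    (hR : (clusteringCost U Q : ℝ) = R + R) :
    Valid (instOf true r U F).toUsers (midFacs U R) R
      (fun u => if h : u < n then (lastIn Q ⟨u, h⟩ : ℕ) + 1 else 0) := by
  refine ⟨fun u hu => ?_, fun u hu => ?_, fun u hu => ?_⟩
  · have hu : u < n := hu
    rw [dif_pos hu]
    have := (lastIn Q ⟨u, hu⟩).2
    unfold midFacs
    dsimp only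
    omega
  · have hu : u < n := hu
    rw [dif_pos hu]
    have e3 := instOf_leg (mode := true) (r := r) (U := U) (F := F) ⟨u, hu⟩
    have e4 := instOf_pos (mode := true) (r := r) (U := U) (F := F) ⟨u, hu⟩
    dsimp only at e3 e4
    rw [e3, e4]
    unfold midFacs
    dsimp only
    have hc : 0 < (lastIn Q ⟨u, hu⟩ : ℕ) + 1 ∧ (lastIn Q ⟨u, hu⟩ : ℕ) + 1 - 1 < n :=
      ⟨by omega, by have := (lastIn Q ⟨u, hu⟩).2; omega⟩
    rw [dif_pos hc, dif_pos hc]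
    refine dd_mid (NNReal.coe_nonneg _) (NNReal.coe_le_coe.2 (hU (le_lastIn Q ⟨u, hu⟩))) ?_
    rw [← hR]
    change dd _ _ ((U (lastIn Q ⟨u, hu⟩)).leg : ℕ) ((U (lastIn Q ⟨u, hu⟩)).pos : ℝ) ≤ _
    rw [← coe_distance, NNReal.coe_le_coe]
    refine distance_le_cost Q ?_
    rw [Q.mem_part_iff_part_eq_part (Finset.mem_univ _) (Finset.mem_univ _), eq_comm,
      ← Q.mem_part_iff_part_eq_part (Finset.mem_univ _) (Finset.mem_univ _)]
    exact lastIn_mem Q _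
  · have hu : u < n := hu
    refine (hQ _ (Q.part_mem.2 (Finset.mem_univ ⟨u, hu⟩))).trans ?_
    have := card_filter_range (n := n) fun w => (if hw : w < n then (lastIn Q ⟨w, hw⟩ : ℕ) + 1 else 0) =
      if hu : u < n then (lastIn Q ⟨u, hu⟩ : ℕ) + 1 else 0
    refine le_trans ?_ this.ge
    refine Finset.card_le_card fun w hw => ?_
    have := lastIn_eq Q hw
    simp [hu, this]

theorem clustering_correct (hd : 1 ≤ d) (hr : 1 ≤ r) (hn : 1 ≤ n) {F : Fin 0 → SpiderPoint d}
    (hU : Monotone fun i => (U i).pos) {v : ℝ} {lab fac : ℕ → ℕ}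
    (h : Solution (instOf true r U F) v lab fac) (hv : v ≤ (instOf true r U F).big)
    (hmin : ∀ D, 0 ≤ D → D < (instOf true r U F).big → (instOf true r U F).ReachLe D 0 0 0 → v ≤ D) :
    ∃ P : Finpartition (Finset.univ : Finset (Fin n)), IsRGather r P ∧
      (∀ Q : Finpartition (Finset.univ : Finset (Fin n)),
        IsRGather r Q → clusteringCost U P ≤ clusteringCost U Q) ∧
      (∀ u w : Fin n, P.part u = P.part w ↔ lab u = lab w) ∧ v = clusteringCost U P := by
  classical
  have hI : (instOf true r U F).WF := instOf_wf hd hr hn (by simp) hU fun i => i.elim0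
  have hfit : ∀ u w : Fin n, lab u = lab w → ((U u).distance (U w) : ℝ) ≤ v := by
    intro u w huw
    have h1 := (h u u.2).2
    unfold Inst.fits at h1
    rw [if_pos (by simp [instOf])] at h1
    have := h1 u u.2 w w.2 ⟨u.2, rfl⟩ ⟨w.2, huw.symm⟩
    rwa [instOf_leg, instOf_leg, instOf_pos, instOf_pos, ← coe_distance] at this
  have hv0 : 0 ≤ v := (NNReal.coe_nonneg _).trans (hfit ⟨0, hn⟩ ⟨0, hn⟩ rfl)
  let st : Setoid (Fin n) := Setoid.ker fun u : Fin n => lab u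
  let P : Finpartition (Finset.univ : Finset (Fin n)) := Finpartition.ofSetoid st
  have hP : ∀ u w : Fin n, w ∈ P.part u ↔ lab u = lab w := fun u w =>
    Finpartition.mem_part_ofSetoid_iff_rel
  have hpart : ∀ C ∈ P.parts, ∃ u, C = P.part u := by
    intro C hC
    obtain ⟨u, hu⟩ := P.nonempty_of_mem_parts hC
    exact ⟨u, (P.part_eq_of_mem hC hu).symm⟩
  have hle : (clusteringCost U P : ℝ) ≤ v := by
    rw [← Real.le_toNNReal_iff_coe_le hv0]
    refine Finset.sup_le fun C hC => Finset.sup_le fun u hu => Finset.sup_le fun w hw => ?_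
    refine (Real.le_toNNReal_iff_coe_le hv0).2 (hfit u w ?_)
    obtain ⟨x, rfl⟩ := hpart C hC
    rw [hP] at hu hw
    exact hu.symm.trans hw
  have hgather : IsRGather r P := by
    intro C hC
    obtain ⟨u, rfl⟩ := hpart C hC
    refine (h.card_le u).trans (Finset.card_le_card fun w hw => ?_)
    rw [Finset.mem_filter] at hw
    exact (hP u w).2 hw.2.symm
  have hge : ∀ Q : Finpartition (Finset.univ : Finset (Fin n)), IsRGather r Q →
      v ≤ (clusteringCost U Q : ℝ) := by
    intro Q hQ
    rcases lt_or_ge (clusteringCost U Q : ℝ) (instOf true r U F).big with hb | hb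
    · have hR : (clusteringCost U Q : ℝ) = (clusteringCost U Q : ℝ) / 2 + (clusteringCost U Q : ℝ) / 2 :=
        (add_halves _).symm
      refine hmin _ (NNReal.coe_nonneg _) hb ?_
      have := Inst.reach_clustering hI rfl (midFacs_wf hU _) ?_ (by simp [midFacs])
        (valid_midFacs (F := F) hU Q hQ hR)
      · rwa [← hR] at this
      · intro j _
        unfold midFacs
        dsimp only
        split_ifs with hj
        · exact (U _).leg.2
        · exact hd
    · exact hv.trans hb
  refine ⟨P, hgather, fun Q hQ => ?_, fun u w => ?_, le_antisymm (hge P hgather) hle⟩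
  · exact_mod_cast hle.trans (hge Q hQ)
  · rw [← P.mem_part_iff_part_eq_part (Finset.mem_univ _) (Finset.mem_univ _), hP]
    exact eq_comm

end Gather

namespace Gather
open RAM

/-! ### Running time -/

/-- A near user is determined by its leg and its rank on it, which is below `B`. -/
theorem P_le {I : Inst} (hI : I.WF) : I.P ≤ I.d * I.B := by
  have h : I.P = ((Finset.range I.n).filter I.near).card := Nat.count_eq_card_filter_range _ _
  rw [h, ← Finset.card_range I.d, ← Finset.card_range I.B, ← Finset.card_product]
  refine Finset.card_le_card_of_injOn (fun u => (I.leg u, cb I.leg (I.leg u) u)) ?_ ?_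
  · intro u hu
    simp only [Finset.coe_filter, Finset.mem_range, Set.mem_ofPred_eq] at hu
    simp only [Finset.coe_product, Finset.coe_range, Set.mem_prod, Set.mem_Iio]
    exact ⟨hI.leg_lt _ hu.1, hu.2.2⟩
  · intro u _ v _ h
    simp only [Prod.mk.injEq] at h
    obtain ⟨h1, h2⟩ := h
    rcases Nat.lt_trichotomy u v with h3 | h3 | h3
    · have := cb_lt (leg := I.leg) h3
      rw [← h1] at h2; omega
    · exact h3
    · have := cb_lt (leg := I.leg) h3
      rw [h1] at h2; omega

theorem sq_le_two_pow (L : ℕ) : L ^ 2 + 2 * L + 3 ≤ 4 * 2 ^ L := by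
  induction L with
  | zero => norm_num
  | succ L ih => rw [pow_succ 2 L]; nlinarith

/-- Steps, table rows and transitions multiply to the order of `2 ^ d * d ^ 3 * r ^ 3`. Binary
search adds a term of order `d ^ 3 * r ^ 2 * (d + L)` with `2 ^ L ≤ 2 * m + 1`. To remove the
logarithm it is split into `d ^ 6 * r ^ 4`, which is within the bound since `d ≤ 2 ^ d`, and `L ^
2`, which is linear in `m`. -/
theorem time_le {I : Inst} (hI : I.WF) {E : ℕ} (hE : 2 ^ E ≤ 2 ^ I.d * (2 * I.m + 1)) :
    I.time E ≤ 25000 * (2 ^ I.d * I.r ^ 4 * I.d ^ 5 + I.n + I.m) := by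
  have hd := hI.one_le_d
  have hr := hI.one_le_r
  obtain ⟨L, hEL, hL⟩ : ∃ L, E ≤ I.d + L ∧ 2 ^ L ≤ 2 * I.m + 1 := by
    rcases le_total E I.d with h | h
    · exact ⟨0, by omega, by simp⟩
    · obtain ⟨L, rfl⟩ := Nat.exists_eq_add_of_le h
      rw [pow_add] at hE
      exact ⟨L, le_rfl, Nat.le_of_mul_le_mul_left hE (by positivity)⟩
  have hL2 : L ^ 2 ≤ 8 * I.m + 4 := by have := sq_le_two_pow L; omega
  have hP := P_le hI
  unfold Users.B at hP
  unfold Inst.time Inst.stageTime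
  have hdp : I.d + 1 ≤ 2 ^ I.d := Nat.lt_two_pow_self
  generalize 2 ^ I.d = T at *
  generalize I.d = d at *
  generalize I.r = r at *
  generalize I.P = P at *
  have hT : 1 ≤ T := by omega
  have e1 : P + 1 ≤ 4 * (d ^ 2 * r) := by
    have a1 : d * r ≤ d * (d * r) := Nat.le_mul_of_pos_left _ (by omega)
    have a2 : 1 * 1 ≤ d * r := Nat.mul_le_mul hd hr
    have a3 : d * (d * (2 * r) + r) = 2 * (d * (d * r)) + d * r := by ring
    have a4 : d ^ 2 * r = d * (d * r) := by ring
    omega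
  have b1 : d * r ≤ T * d * r ^ 2 := by
    calc d * r = 1 * d * r ^ 1 := by ring
      _ ≤ T * d * r ^ 2 := by gcongr; omega
  have b2 : 1 ≤ d * r := Nat.mul_le_mul hd hr
  have b3 : d ≤ d * r := Nat.le_mul_of_pos_right _ (by omega)
  have b4 : T * d ≤ T * d * r ^ 2 := Nat.le_mul_of_pos_right _ (by positivity)
  have b5 : T ≤ T * d := Nat.le_mul_of_pos_right _ (by omega)
  have b6 : T * d * r ≤ T * d * r ^ 2 := by gcongr; nlinarith
  have b7 : T * r ≤ T * d * r := Nat.mul_le_mul_right _ b5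
  have e2 : d * (2 * r * (60 * E + 200) + 200) +
      T * ((r + 2) * (120 * (d * (2 * r + 2)) + 340) + 50 * (d + 1) + 65) + 130 + 40 ≤
      120 * (d * r * E) + 4000 * (T * d * r ^ 2) := by
    have c1 : d * (2 * r * (60 * E + 200) + 200) +
      T * ((r + 2) * (120 * (d * (2 * r + 2)) + 340) + 50 * (d + 1) + 65) + 130 + 40 =
      120 * (d * r * E) + 400 * (d * r) + 200 * d + 240 * (T * d * r ^ 2) + 720 * (T * d * r) +
        480 * (T * d) + 340 * (T * r) + 680 * T + 50 * (T * d) + 115 * T + 170 := by ring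
    omega
  -- The product of two numbers is at most the sum of their squares; this separates `L` from `d` and
  -- `r`.
  have f1 : d ^ 3 * r ^ 2 * L ≤ d ^ 6 * r ^ 4 + L ^ 2 := by
    have := sq_nonneg ((d ^ 3 * r ^ 2 : ℤ) - L)
    have h2 : (0 : ℤ) ≤ d ^ 3 * r ^ 2 * L := by positivity
    zify
    nlinarith
  obtain ⟨X, hX⟩ : ∃ X, T * r ^ 4 * d ^ 5 = X := ⟨_, rfl⟩
  have g1 : d ^ 6 * r ^ 4 ≤ X := by
    calc d ^ 6 * r ^ 4 = d * r ^ 4 * d ^ 5 := by ring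
      _ ≤ T * r ^ 4 * d ^ 5 := by gcongr; omega
      _ = X := hX
  have g2 : d ^ 4 * r ^ 2 ≤ X := by
    calc d ^ 4 * r ^ 2 = 1 * r ^ 2 * d ^ 4 := by ring
      _ ≤ T * r ^ 4 * d ^ 5 := by gcongr <;> omega
      _ = X := hX
  have g3 : T * d ^ 3 * r ^ 3 ≤ X := by
    calc T * d ^ 3 * r ^ 3 = T * r ^ 3 * d ^ 3 := by ring
      _ ≤ T * r ^ 4 * d ^ 5 := by gcongr <;> omega
      _ = X := hX
  have g4 : d ≤ X := by
    calc d = 1 * 1 * d ^ 1 := by ring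
      _ ≤ T * r ^ 4 * d ^ 5 := by gcongr <;> first | omega | exact Nat.one_le_pow _ _ hr
      _ = X := hX
  have h1 : (P + 1) * (d * (2 * r * (60 * E + 200) + 200) +
      T * ((r + 2) * (120 * (d * (2 * r + 2)) + 340) + 50 * (d + 1) + 65) + 130 + 40) ≤
      (4 * (d ^ 2 * r)) * (120 * (d * r * (d + L)) + 4000 * (T * d * r ^ 2)) := by
    refine Nat.mul_le_mul e1 (e2.trans ?_)
    gcongr
  have h2 : (4 * (d ^ 2 * r)) * (120 * (d * r * (d + L)) + 4000 * (T * d * r ^ 2)) =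
      480 * (d ^ 4 * r ^ 2) + 480 * (d ^ 3 * r ^ 2 * L) + 16000 * (T * d ^ 3 * r ^ 3) := by ring
  rw [hX]
  omega

end Gather

namespace Gather
open RAM

/-! ### The algorithms -/

/-- Without users the empty solution has value `0`, already in the register; with fewer than `r`
users, but at least one, no solution exists. -/
def clusterProg : Program :=
  .ite (.natEq (nr 2) 0) (.setNat 0 1)
    (.ite (.lt (nr 2) (nr 1)) (.setNat 0 0) (.setNat 35 1 ⨟ solveProg ⨟ .setNat 0 1))

def gatherProg : Program :=
  .ite (.natEq (nr 2) 0) (.setNat 0 1)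
    (.ite (.lt (nr 2) (nr 1)) (.setNat 0 0)
      (.ite (.natEq (nr 3) 0) (.setNat 0 0)
        (solveProg ⨟ forUp 4 (nr 2) (.writeNat 2 (nr 4) (na 25 (na 2 (nr 4)))) ⨟ .setNat 0 1)))

variable {d n m r : ℕ} {U : Fin n → SpiderPoint d} {F : Fin m → SpiderPoint d}

theorem inputState_natArr {a : ℕ} (h : 2 ≤ a) (i : ℕ) : (inputState r U F).natArr a i = 0 := by
  simp [inputState, show a ≠ 0 by omega, show a ≠ 1 by omega]

/-- A bound on the running time on an instance; instances with fewer than `r` users are trivial. -/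
def InTime (d r n m t : ℕ) : Prop :=
  t ≤ 30 ∨ r ≤ n ∧ t ≤ 26000 * (2 ^ d * r ^ 4 * d ^ 5 + n + m)

theorem clusterProg_spec (hd : 1 ≤ d) (hr : 1 ≤ r) {F : Fin 0 → SpiderPoint d}
    (hU : Monotone fun i => (U i).pos) :
    wp clusterProg (fun t s => InTime d r n 0 t ∧ ClusteringAnswer r U s) (inputState r U F) := by
  have e1 : (inputState r U F).natReg 1 = r := by simp [inputState]
  have e2 : (inputState r U F).natReg 2 = n := by simp [inputState]
  have hX : 1 ≤ 2 ^ d * r ^ 4 * d ^ 5 := Nat.one_le_iff_ne_zero.2 (by positivity)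
  unfold clusterProg
  rw [wp_ite, wp_ite]
  simp only [Test.Holds, NatExpr.eval_add, NatExpr.eval_one, NatExpr.eval_reg, NatExpr.eval_zero, e1, e2, wp_setNat]
  refine ⟨fun hn => ⟨Or.inl (by simp), Or.inl ⟨by simp, ?_⟩⟩, fun hn => ⟨fun hlt =>
    ⟨Or.inl (by simp), Or.inr ⟨by simp, ?_⟩⟩, fun hge => ?_⟩⟩
  · subst hn
    have hc : ∀ P : Finpartition (Finset.univ : Finset (Fin 0)), P.parts = ∅ := by
      intro P
      rw [Finset.eq_empty_iff_forall_notMem]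
      intro C hC
      obtain ⟨u, -⟩ := P.nonempty_of_mem_parts hC
      exact u.elim0
    refine ⟨⊥, ?_, ?_, fun u => u.elim0, ?_⟩
    · intro C hC; rw [hc] at hC; simp at hC
    · intro Q _; unfold clusteringCost; rw [hc, hc]
    · unfold clusteringCost; rw [hc]; simp [inputState]
  · rintro ⟨P, hP⟩
    have h1 := hP _ (P.part_mem.2 (Finset.mem_univ (⟨0, by omega⟩ : Fin n)))
    have h2 := Finset.card_le_univ (P.part (⟨0, by omega⟩ : Fin n))
    simp at h2
    omega
  · have hn1 : 1 ≤ n := by omega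
    have hI : (instOf true r U F).WF := instOf_wf hd hr hn1 (by simp) hU fun i => i.elim0
    rw [wp_seq, wp_setNat, wp_seq]
    refine (solve_spec hI (s := (inputState r U F).setN 35 1) ?_ ?_ (show r ≤ n by omega)).conseq ?_
    · constructor <;> simp [inputState, instOf]
    · intro a ha i; simpa using inputState_natArr ha i
    rintro t s hF ⟨⟨E, hE, ht⟩, hsol, hv, hmin⟩
    obtain ⟨P, h1, h2, h3, h4⟩ := clustering_correct hd hr hn1 hU hsol hv hmin
    have ht2 := time_le hI hE
    simp only [wp_setNat]
    refine ⟨Or.inr ⟨by omega, ?_⟩, Or.inl ⟨by simp, P, h1, h2, by simpa using h3, by simpa using h4⟩⟩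
    change _ ≤ 25000 * (2 ^ d * r ^ 4 * d ^ 5 + n + 0) at ht2
    simp
    omega

theorem gatherProg_spec (hd : 1 ≤ d) (hr : 1 ≤ r) (hU : Monotone fun i => (U i).pos)
    (hF : Monotone fun i => (F i).pos) :
    wp gatherProg (fun t s => InTime d r n m t ∧ GatheringAnswer r U F s) (inputState r U F) := by
  have e1 : (inputState r U F).natReg 1 = r := by simp [inputState]
  have e2 : (inputState r U F).natReg 2 = n := by simp [inputState]
  have e3 : (inputState r U F).natReg 3 = m := by simp [inputState]
  have hX : 1 ≤ 2 ^ d * r ^ 4 * d ^ 5 := Nat.one_le_iff_ne_zero.2 (by positivity)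
  unfold gatherProg
  rw [wp_ite, wp_ite, wp_ite]
  simp only [Test.Holds, NatExpr.eval_add, NatExpr.eval_one, NatExpr.eval_reg, NatExpr.eval_zero, e1, e2, e3, wp_setNat]
  refine ⟨fun hn => ⟨Or.inl (by simp), Or.inl ⟨by simp, ?_⟩⟩, fun hn => ⟨fun hlt =>
    ⟨Or.inl (by simp), Or.inr ⟨by simp, ⟨fun G => ?_⟩⟩⟩, fun hge => ⟨fun hm =>
    ⟨Or.inl (by simp), Or.inr ⟨by simp, ⟨fun G => ?_⟩⟩⟩, fun hm => ?_⟩⟩⟩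
  · subst hn
    have hc : ∀ G : RGathering 0 m r, G.cost U F = 0 := fun G => by simp [RGathering.cost]
    refine ⟨⟨∅, fun u => u.elim0, fun u => u.elim0, by simp⟩, fun H => by rw [hc, hc],
      fun u => u.elim0, ?_⟩
    rw [hc]
    simp [inputState]
  · have h1 := G.le_card _ (G.assign_mem ⟨0, by omega⟩)
    have h2 := Finset.card_le_univ (Finset.univ.filter fun u => G.assign u = G.assign ⟨0, by omega⟩)
    simp only [Fintype.card_fin] at h2
    omega
  · have := (G.assign ⟨0, by omega⟩).2
    omega
  · have hn1 : 1 ≤ n := by omega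
    have hm1 : 1 ≤ m := by omega
    have hI : (instOf false r U F).WF := instOf_wf hd hr hn1 (fun _ => hm1) hU hF
    rw [wp_seq]
    refine (solve_spec hI (s := inputState r U F) ?_ (fun a ha i => inputState_natArr ha i)
      (show r ≤ n by omega)).conseq ?_
    · constructor <;> simp [inputState, instOf]
    rintro t s hFr ⟨⟨E, hE, ht⟩, hsol, hv, hmin⟩
    obtain ⟨G, h1, h2, h3⟩ := gathering_correct hd hr hn1 hm1 hU hF hsol hv hmin
    have ht2 := time_le hI hE
    change _ ≤ 25000 * (2 ^ d * r ^ 4 * d ^ 5 + n + m) at ht2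
    have hsn : s.natReg 2 = n := by rw [hFr.nr 2 rfl, e2]
    rw [wp_seq]
    refine wp_forUp n (fun _ => 10) (fun k s' => (∀ u < k, s'.natArr 2 u = s.natArr 25 (s.natArr 2 u)) ∧
      ∀ u, k ≤ u → s'.natArr 2 u = s.natArr 2 u) ?_ rfl ?_ ?_ ?_
    · intro s' hF'
      rw [NatExpr.eval_reg, hF'.nr 2 rfl, hsn]
    · simp
    · rintro k hk s' hF' h4 ⟨g1, g2⟩
      have h25 : s'.natArr 25 = s.natArr 25 := hF'.na 25 rfl
      simp only [wp_writeNat, wp_setNat, State.setN_natArr, State.wrN_natArr, NatExpr.eval_reg, NatExpr.eval_read, h4, h25, if_true]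
      refine ⟨by simp, fun u hu => ?_, fun u hu => ?_⟩
      · rcases eq_or_ne u k with rfl | hne
        · rw [Function.update_self, g2 u le_rfl]
        · rw [Function.update_of_ne hne, g1 u (by omega)]
      · rw [Function.update_of_ne (by omega), g2 u (by omega)]
    · rintro t' s' hF' ht' - ⟨g1, -⟩
      simp only [wp_setNat]
      refine ⟨Or.inr ⟨by omega, ?_⟩, Or.inl ⟨by simp, G, h1, fun u => ?_, ?_⟩⟩
      · simp at ht' ⊢
        omega
      · rw [State.setN_natArr, g1 u u.2, h2]
      · rw [State.setN_realReg, hF'.rr 0 rfl, h3]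

theorem InTime.le {d r n m t : ℕ} (h : InTime d r n m t) (hd : 1 ≤ d) (hr : 1 ≤ r) :
    t ≤ 26000 * (2 ^ d * r ^ 4 * d ^ 5 + n + m) := by
  have hX : 1 ≤ 2 ^ d * r ^ 4 * d ^ 5 := Nat.one_le_iff_ne_zero.2 (by positivity)
  rcases h with h | h
  · omega
  · exact h.2

/-- A running time in terms of the number of legs and the size of the instance. -/
def legTime (d : ℕ) : ℕ := 26000 * (2 ^ d * d ^ 5 + 1)

theorem computable_legTime : Computable legTime := by
  have hp : Primrec₂ ((· ^ ·) : ℕ → ℕ → ℕ) := Primrec₂.unpaired'.1 Nat.Primrec.pow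
  have h : Primrec fun d : ℕ => 26000 * (2 ^ d * d ^ 5 + 1) :=
    Primrec.nat_mul.comp (Primrec.const _) (Primrec.succ.comp (Primrec.nat_mul.comp
      (hp.comp (Primrec.const 2) Primrec.id) (hp.comp Primrec.id (Primrec.const 5))))
  exact h.to_comp

/-- Unless the answer is immediate, `r ≤ n`, so the factor `r ^ 4` is bounded by the size of the
instance and only `d` remains as parameter. -/
theorem InTime.le_legTime {d r n m t : ℕ} (h : InTime d r n m t) :
    t ≤ legTime d * (n + m + 1) ^ 4 := by
  have h1 : 1 ≤ (n + m + 1) ^ 4 := Nat.one_le_pow _ _ (by omega)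
  unfold legTime
  rcases h with h | ⟨hr, h⟩
  · refine h.trans ?_
    calc 30 ≤ 26000 * (0 + 1) * 1 := by norm_num
      _ ≤ _ := by gcongr; exact Nat.zero_le _
  · refine h.trans ?_
    have h2 : r ^ 4 ≤ (n + m + 1) ^ 4 := Nat.pow_le_pow_left (by omega) 4
    have h3 : n + m ≤ (n + m + 1) ^ 4 :=
      (Nat.le_succ _).trans (Nat.le_self_pow (by norm_num) (n + m + 1))
    calc 26000 * (2 ^ d * r ^ 4 * d ^ 5 + n + m) = 26000 * (2 ^ d * d ^ 5 * r ^ 4 + (n + m)) := by ring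
      _ ≤ 26000 * (2 ^ d * d ^ 5 * (n + m + 1) ^ 4 + (n + m + 1) ^ 4) := by gcongr
      _ = 26000 * (2 ^ d * d ^ 5 + 1) * (n + m + 1) ^ 4 := by ring

end Gather

theorem theorem1 :
    (∃ (c : RAM.Program) (K : ℕ),
      SolvesClustering c (fun d r n => K * (2 ^ d * r ^ 4 * d ^ 5 + n))) ∧
    (∃ (c : RAM.Program) (K : ℕ),
      SolvesGathering c (fun d r n m => K * (2 ^ d * r ^ 4 * d ^ 5 + n + m))) ∧
    (∃ (c : RAM.Program) (f : ℕ → ℕ) (k : ℕ), Computable f ∧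
      SolvesClustering c (fun d _ n => f d * (n + 1) ^ k)) ∧
    (∃ (c : RAM.Program) (f : ℕ → ℕ) (k : ℕ), Computable f ∧
      SolvesGathering c (fun d _ n m => f d * (n + m + 1) ^ k)) := by
  refine ⟨⟨Gather.clusterProg, 26000, ?_⟩, ⟨Gather.gatherProg, 26000, ?_⟩,
    ⟨Gather.clusterProg, Gather.legTime, 4, Gather.computable_legTime, ?_⟩,
    ⟨Gather.gatherProg, Gather.legTime, 4, Gather.computable_legTime, ?_⟩⟩
  · intro d r n U hd hr hU
    obtain ⟨t, s, h1, h2, h3⟩ := Gather.clusterProg_spec (F := Fin.elim0) hd hr hU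
    exact ⟨t, s, h1, h2.le hd hr, h3⟩
  · intro d r n m U F hd hr hU hF
    obtain ⟨t, s, h1, h2, h3⟩ := Gather.gatherProg_spec hd hr hU hF
    exact ⟨t, s, h1, h2.le hd hr, h3⟩
  · intro d r n U hd hr hU
    obtain ⟨t, s, h1, h2, h3⟩ := Gather.clusterProg_spec (F := Fin.elim0) hd hr hU
    exact ⟨t, s, h1, h2.le_legTime, h3⟩
  · intro d r n m U F hd hr hU hF
    obtain ⟨t, s, h1, h2, h3⟩ := Gather.gatherProg_spec hd hr hU hF
    exact ⟨t, s, h1, h2.le_legTime, h3⟩
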